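/- Let $r\ge 1$, $\nu(\epsilon)=\left(\frac{\epsilon}{|\ln\epsilon|}\right)^{1/(2(r+2))}$ and $\eta(\epsilon)=\sqrt{-\epsilon\ln\nu(\epsilon)}$, so that $W(\eta(\epsilon);\epsilon)=\nu(\epsilon)$ for the Gaussian barrier function $W(Q;\epsilon)=e^{-Q^2/\epsilon}$. **Setting.** Let $D\subset\mathbb R^d$ be a closed set (a compact domain, or the periodic lift of a domain in $\mathbb T^d$), let $\Gamma^*\subset\partial D$ be closed (the corner set), and let $V(\cdot\,;\epsilon):\mathbb R^d\to\mathbb R$, for small $\epsilon>0$, be $C^{r+1}$ potentials such that: 1. $V(\cdot\,;\epsilon)$ and its derivatives of order $\le r+1$ tend to $0$ as $\epsilon\to0^+$, uniformly on compact subsets of $\mathrm{int}\,D$. 2. There are an open $\tilde D\supset D\setminus\Gamma^*$ and a pattern function $Q(q;\epsilon)$ on $\tilde D$, $\epsilon\ge0$ small, of class $C^{r+2}$ in $q$, with $Q(\cdot\,;\epsilon)\to Q(\cdot\,;0)$ in $C^{r+2}$ on compact subsets of $\tilde D$ as $\epsilon\to0^+$. For $q\in\tilde D$, $Q(q;0)=0$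 iff $q\in\partial D$, and $Q(q;0)>0$ iff $q\in\mathrm{int}\,D$. There is an open $N\subset\tilde D$ with $\partial D\setminus\Gamma^*\subset N$ such that for all small $\epsilon\ge0$, $\nabla Q(\cdot\,;\epsilon)\ne0$ on $N$. 3. For all small $\epsilon>0$, $V(q;\epsilon)=e^{-Q(q;\epsilon)^2/\epsilon}$ whenever $q\in N$ and $Q(q;\epsilon)\ge0$. 4. $V$ is boundary dominated: for every $\delta(\epsilon)\to0^+$ such that $\partial_Q^lW(\delta(\epsilon);\epsilon)\to0$ for $0\le l\le r+1$, and every compact $K\subset\tilde D$, there is a compact $K'\subset N$ such that for all small $\epsilon>0$, every derivative of $V(\cdot\,;\epsilon)$ of order $1,\dots,r+1$ at a point of $K\cap\{Q\ge\delta(\epsilon)\}$ is bounded in norm by some derivative of order $1,\dots,r+1$ at some point of $K'\cap\{Q=\delta(\epsilon)\}$. Let $h^\epsilon_t$ be the flow of $H=\frac{p^2}{2}+V(q;\epsilon)$. The auxiliary billiard is the billiard in $D^\epsilon=\{q\in\tilde D: Q(q;\epsilon)>\eta(\epsilon)\}$ with wall $\{q\in\tilde D:Q(q;\epsilon)=\eta(\epsilon)\}$,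 inward unit normal $n=\nabla Q/|\nabla Q|$ and reflection law $p\mapsto p-2\langle p,n\rangle n$; let $b^\epsilon_t$ be its flow. **Conclusion.** $\eta(\epsilon)=O(\sqrt{\epsilon|\ln\epsilon|})$ as $\epsilon\to0^+$, and: (a) *Flow.* Let $\rho_0=(q_0,p_0)$, $|p_0|=1$, be the initial point of a billiard orbit in $D$ on $[0,T]$, $T>0$, whose two end points are in $\mathrm{int}\,D$ and which has $k<\infty$ collisions, all of them non-tangent, at points of $\partial D\setminus\Gamma^*$, and is in $\mathrm{int}\,D$ otherwise. There are an open neighbourhood $U$ of $\rho_0$ in $\mathbb R^{2d}$ and a constant $C$ such that for all small $\epsilon>0$ and all $\rho\in U$: $h^\epsilon_t\rho$ is defined on $[0,T]$; $b^\epsilon_t\rho$ is defined on $[0,T]$, with exactly $k$ collisions, all non-tangent, at times $t_1<\dots<t_k$ depending on $\rho,\epsilon$; and for every $t\in[0,T]$ outside the impact intervals $[t_j-C\nu(\epsilon),t_j+C\nu(\epsilon)]$, the maps $h^\epsilon_t$ and $b^\epsilon_t$ are $C^r$ at $\rho$, and the derivatives of orders $0,\dots,r$ of $h^\epsilon_t-b^\epsilon_t$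 with respect to the initial conditions, at $\rho$, are bounded by $C\nu(\epsilon)$. In particular the impact intervals have length $O(\nu(\epsilon))$. (b) *Poincaré map.* On $S_\epsilon=\{(q,p): q\in\tilde D,\ Q(q;\epsilon)=\eta(\epsilon),\ \langle p,n(q)\rangle>0\}$ let $B^\epsilon$ be the billiard map of the auxiliary billiard, and $\Phi^\epsilon=R^\epsilon\circ F^\epsilon$ the Poincaré map of the smooth flow ($F^\epsilon$: motion in $Q>\eta$ up to the next transverse outward crossing of $Q=\eta$; $R^\epsilon$: motion in $Q<\eta$ up to the next transverse inward crossing). Let $\rho_0=(q_0,p_0)$, $q_0\in\partial D\setminus\Gamma^*$, $|p_0|=1$, $p_0$ pointing strictly inwards, be such that the straight flight from $\rho_0$ stays in $\mathrm{int}\,D$ until a non-tangent collision at a point of $\partial D\setminus\Gamma^*$. There are an open neighbourhood $U$ of $\rho_0$ in $\mathbb R^{2d}$ and a constant $C$ such that for all small $\epsilon>0$, $\Phi^\epsilon$ and $B^\epsilon$ are defined on $S_\epsilon\cap U$ and extend to $C^r$ maps on $U$ whose difference has derivatives of orders $0,\dots,r$ bounded by $C\nu(\epsilon)$ on $U$.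 -/

import Mathlib

open Set Filter Topology Asymptotics

noncomputable section

/-- Configuration space `ℝ^d`.  (A domain in the torus is treated through its periodic lift,
which is why billiard domains below are closed but not required to be bounded.) -/
abbrev Pos (d : ℕ) : Type := EuclideanSpace ℝ (Fin d)

/-- Phase space: pairs `(q, p)` of a position and a momentum. -/
abbrev Phase (d : ℕ) : Type := Pos d × Pos d

/-! ### Billiards -/

/-- Elastic reflection of the momentum `p` at a wall with unit normal `n`. -/
def reflect {d : ℕ} (n p : Pos d) : Pos d := p - (2 * inner ℝ p n) • n

/-- A billiard table: the open region, the regular part of its boundary, and the inward unit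
normal on the regular part of the boundary. -/
structure Table (d : ℕ) where
  inside : Set (Pos d)
  wall : Set (Pos d)
  normal : Pos d → Pos d

/-- `x : [0, T] → phase space` is a regular billiard orbit with exactly `k` collisions, at the
times `t 0 < t 1 < ⋯` in `(0, T)`: the particle is inside the table at all other times, moves
freely between collisions, and every collision is a non-tangent elastic reflection at a regular
boundary point.  At a collision time `x` takes the value after the reflection. -/
structure IsRegularOrbit {d : ℕ} (B : Table d) (T : ℝ) {k : ℕ} (t : Fin k → ℝ)
    (x : ℝ → Phase d) : Prop where
  times_mono : StrictMono t
  times_mem : ∀ j, t j ∈ Ioo 0 T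
  inside : ∀ s ∈ Icc 0 T, (∀ j, s ≠ t j) → (x s).1 ∈ B.inside
  free : ∀ s s', 0 ≤ s → s ≤ s' → s' ≤ T → (∀ j, t j ∉ Ioc s s') →
    x s' = ((x s).1 + (s' - s) • (x s).2, (x s).2)
  hit : ∀ j, ∀ s, 0 ≤ s → s < t j → (∀ i, t i ∉ Ioo s (t j)) →
    (x (t j)).1 = (x s).1 + (t j - s) • (x s).2 ∧
    (x (t j)).1 ∈ B.wall ∧
    inner ℝ (x s).2 (B.normal (x (t j)).1) < 0 ∧
    (x (t j)).2 = reflect (B.normal (x (t j)).1) (x s).2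

/-- The cross-section: regular boundary points with momentum pointing strictly inwards. -/
def crossSection {d : ℕ} (B : Table d) : Set (Phase d) :=
  {ρ | ρ.1 ∈ B.wall ∧ 0 < inner ℝ ρ.2 (B.normal ρ.1)}

/-- `ρ'` is the image of `ρ` under the billiard map (free flight followed by reflection), the
flight being regular: it starts on the cross-section, stays inside the table, and ends in a
non-tangent collision at a regular boundary point. -/
def IsBilliardImage {d : ℕ} (B : Table d) (ρ ρ' : Phase d) : Prop :=
  ρ ∈ crossSection B ∧
  ∃ τ : ℝ, 0 < τ ∧ (∀ s ∈ Ioo 0 τ, ρ.1 + s • ρ.2 ∈ B.inside) ∧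
    ρ'.1 = ρ.1 + τ • ρ.2 ∧ ρ'.1 ∈ B.wall ∧
    inner ℝ ρ.2 (B.normal ρ'.1) < 0 ∧ ρ'.2 = reflect (B.normal ρ'.1) ρ.2

/-! ### Smooth Hamiltonian motion -/

/-- `x` solves `q' = p`, `p' = -∇V(q)` on `[0, T]`
(the Hamiltonian equations of `H = p² / 2 + V(q)`). -/
def IsHamOrbit {d : ℕ} (V : Pos d → ℝ) (T : ℝ) (x : ℝ → Phase d) : Prop :=
  ∀ s ∈ Icc 0 T, HasDerivWithinAt x ((x s).2, -gradient V (x s).1) (Icc 0 T) s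

/-! ### Steep potentials -/

/-- The data: a domain `D` with corner set `corner`, the neighbourhood `Dt` of `D \ corner` on
which the pattern function `Q(q; ε) = Q ε q` is defined, the neighbourhood `N` of the regular
boundary on which the potential is a function of `Q`, and the potential `V(q; ε) = V ε q`. -/
structure SteepSystem (d : ℕ) where
  D : Set (Pos d)
  corner : Set (Pos d)
  Dt : Set (Pos d)
  N : Set (Pos d)
  Q : ℝ → Pos d → ℝ
  V : ℝ → Pos d → ℝ

/-- The Gaussian barrier function `W(Q; ε) = exp (-Q² / ε)`. -/
def gaussBarrier (ε s : ℝ) : ℝ := Real.exp (-(s ^ 2) / ε)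

/-- The inverse barrier `𝒬(W; ε) = √(-ε ln W)`, inverse to the Gaussian barrier on `Q ≥ 0`. -/
def invBarrier (ε w : ℝ) : ℝ := Real.sqrt (-ε * Real.log w)

/-- `ν(ε) = (ε / |ln ε|) ^ (1 / (2 (r + 2)))`. -/
def nu (r : ℕ) (ε : ℝ) : ℝ := (ε / |Real.log ε|) ^ (1 / (2 * ((r : ℝ) + 2)))

/-- `η(ε) = 𝒬(ν(ε); ε)`, the level of `Q` at which the barrier has the height `ν(ε)`. -/
def eta (r : ℕ) (ε : ℝ) : ℝ := invBarrier ε (nu r ε)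

namespace SteepSystem

variable {d : ℕ}

/-- Inward unit normal to the level sets of the pattern function. -/
def normal (S : SteepSystem d) (ε : ℝ) (q : Pos d) : Pos d :=
  ‖gradient (S.Q ε) q‖⁻¹ • gradient (S.Q ε) q

/-- The original billiard in `D`. -/
def table (S : SteepSystem d) : Table d where
  inside := interior S.D
  wall := frontier S.D \ S.corner
  normal := S.normal 0

/-- The billiard in the domain bounded by the level set `Q(q; ε) = η`. -/
def auxTable (S : SteepSystem d) (ε η : ℝ) : Table d where
  inside := {q | q ∈ S.Dt ∧ η < S.Q ε q}
  wall := {q | q ∈ S.Dt ∧ S.Q ε q = η}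
  normal := S.normal ε

/-- `D` is closed, `corner` is a closed part of its boundary, and `Dt`, `N` are neighbourhoods
of `D \ corner` and of the regular boundary `∂D \ corner`. -/
structure IsDomain (S : SteepSystem d) : Prop where
  closed_D : IsClosed S.D
  closed_corner : IsClosed S.corner
  corner_subset : S.corner ⊆ frontier S.D
  open_Dt : IsOpen S.Dt
  open_N : IsOpen S.N
  D_subset : S.D \ S.corner ⊆ S.Dt
  N_subset : S.N ⊆ S.Dt
  boundary_subset : frontier S.D \ S.corner ⊆ S.N

/-- The conditions on the pattern function.  It is normalised so that the boundary is its zero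
level and the interior is its positive side at `ε = 0`; when the boundary components `Γ_i` lie
on levels `Q_i`, the present `Q` is `±(Q - Q_i)` near `Γ_i`.  Together with `IsDomain` this
makes `∂D \ corner` a hypersurface with `D` on one side of it. -/
structure PatternCondition (S : SteepSystem d) (r : ℕ) : Prop where
  smooth : ∀ᶠ ε in 𝓝[≥] (0 : ℝ), ContDiffOn ℝ (r + 2) (S.Q ε) S.Dt
  limit : ∀ K ⊆ S.Dt, IsCompact K → ∀ l ≤ r + 2,
    TendstoUniformlyOn (fun ε q => iteratedFDeriv ℝ l (S.Q ε) q)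
      (fun q => iteratedFDeriv ℝ l (S.Q 0) q) (𝓝[>] (0 : ℝ)) K
  interior_iff : ∀ q ∈ S.Dt, 0 < S.Q 0 q ↔ q ∈ interior S.D
  boundary_iff : ∀ q ∈ S.Dt, S.Q 0 q = 0 ↔ q ∈ frontier S.D
  gradient_ne : ∀ᶠ ε in 𝓝[≥] (0 : ℝ), ∀ q ∈ S.N, gradient (S.Q ε) q ≠ 0

/-- The potential is `C^{r+1}` and vanishes, with its derivatives up to order `r + 1`, uniformly
on compact subsets of the interior of `D` as `ε → 0+`. -/
structure ConditionI (S : SteepSystem d) (r : ℕ) : Prop where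
  smooth : ∀ᶠ ε in 𝓝[>] (0 : ℝ), ContDiff ℝ (r + 1) (S.V ε)
  limit : ∀ K ⊆ interior S.D, IsCompact K → ∀ l ≤ r + 1,
    TendstoUniformlyOn (fun ε q => iteratedFDeriv ℝ l (S.V ε) q)
      (fun _ => 0) (𝓝[>] (0 : ℝ)) K

/-- Near the regular boundary, on the side `Q ≥ 0` of the barrier, the potential is the Gaussian
barrier function of `Q`.  (The barrier has height `1` at `Q = 0`, above the energy `1/2`.) -/
def GaussianBarrier (S : SteepSystem d) : Prop :=
  ∀ᶠ ε in 𝓝[>] (0 : ℝ), ∀ q ∈ S.N, 0 ≤ S.Q ε q → S.V ε q = gaussBarrier ε (S.Q ε q)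

/-- A choice of boundary layer width `δ(ε) → 0+` so slow that the barrier and its derivatives up
to order `r + 1` tend to zero at `Q = δ(ε)`. -/
def AdmissibleWidth (r : ℕ) (δ : ℝ → ℝ) : Prop :=
  (∀ᶠ ε in 𝓝[>] (0 : ℝ), 0 < δ ε) ∧ Tendsto δ (𝓝[>] (0 : ℝ)) (𝓝 0) ∧
  ∀ l ≤ r + 1, Tendsto (fun ε => iteratedDeriv l (gaussBarrier ε) (δ ε)) (𝓝[>] (0 : ℝ)) (𝓝 0)

/-- The potential is boundary dominated: in the region `Q(q; ε) ≥ δ(ε)` its derivatives of orders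
`1, …, r + 1` do not exceed the largest of them on the surface `Q(q; ε) = δ(ε)`.  As nothing is
assumed at the corners, this is required over compact sets away from the corners. -/
def BoundaryDominated (S : SteepSystem d) (r : ℕ) : Prop :=
  ∀ δ : ℝ → ℝ, AdmissibleWidth r δ → ∀ K ⊆ S.Dt, IsCompact K →
    ∃ K' ⊆ S.N, IsCompact K' ∧ ∀ᶠ ε in 𝓝[>] (0 : ℝ),
      ∀ q ∈ K, δ ε ≤ S.Q ε q → ∀ l ∈ Icc 1 (r + 1),
        ∃ q' ∈ K', S.Q ε q' = δ ε ∧ ∃ l' ∈ Icc 1 (r + 1),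
          ‖iteratedFDeriv ℝ l (S.V ε) q‖ ≤ ‖iteratedFDeriv ℝ l' (S.V ε) q'‖

/-- `ρ'` is the image of `ρ` under the Poincaré map of the smooth flow: the Hamiltonian orbit of
`ρ` starts on the cross-section over `Q = η`, runs in `Q > η` until a time `τ` at which it crosses
`Q = η` outwards, runs in `Q < η` until a time `σ` at which it crosses `Q = η` inwards,
and is then at `ρ'`. -/
def IsPoincareImage (S : SteepSystem d) (ε η : ℝ) (ρ ρ' : Phase d) : Prop :=
  ρ ∈ crossSection (S.auxTable ε η) ∧
  ∃ (τ σ : ℝ) (x : ℝ → Phase d), 0 < τ ∧ τ < σ ∧ IsHamOrbit (S.V ε) σ x ∧ x 0 = ρ ∧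
    (∀ s ∈ Ioo 0 τ, (x s).1 ∈ S.Dt ∧ η < S.Q ε (x s).1) ∧
    ((x τ).1 ∈ (S.auxTable ε η).wall ∧ inner ℝ (x τ).2 (S.normal ε (x τ).1) < 0) ∧
    (∀ s ∈ Ioo τ σ, (x s).1 ∈ S.Dt ∧ S.Q ε (x s).1 < η) ∧
    x σ ∈ crossSection (S.auxTable ε η) ∧ x σ = ρ'

end SteepSystem

end

set_option linter.unusedSectionVars false

/-! ### Families of functions with uniformly bounded derivatives -/

/-! The smooth motion is cut at the levels `eta` and `wid` of Q. In each of the three resulting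
regions it is rewritten, in suitable coordinates and with a suitable independent variable, as the
unit-time flow of a vector field of size O(ν). By `exists_smallFlow` such a flow is O(ν)-close to
the identity together with its derivatives.

Where Q ≥ `wid`, of order √(ε|ln ε|), the Gaussian and the derivatives that matter are O(ε)
(`abs_iteratedDeriv_gaussBarrier_le`). Boundary domination carries this bound into the interior
(`Hyp.cBound_fderiv_V`), so the force is O(ν) in C^r. After the free flight is factored out, the
motion is near the identity (`exists_nearFree`).

Where `eta` ≤ Q ≤ `wid`, the barrier is at most ν, but its derivatives may be large. The quantity Q
- W(Q) still varies only by O(ν). With it as independent variable, Q is a known function of that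
variable, and the barrier enters only through bounded coefficients that do not depend on the phase
point. These coefficients are never differentiated (`Hyp.exists_layer`).

Where Q ≤ `eta`, the force is large and the received impulse becomes the independent variable. The
time elapsed per unit of impulse is governed by the derivative of the inverse barrier at the current
potential energy. The choice of ν makes this function and its derivatives up to order r equal to
O(ν) on the potential energies in [ν, 3/4) (`abs_invBarrierSeq_le`). The total impulse is found from
the condition that the kinetic energy regains its initial value; in the limit it is the impulse of
the elastic reflection (`Hyp.exists_reflection`).

The bookkeeping is a calculus of families with uniform derivative bounds, `CBound`, and of pairs of
close families, `CNear`. In a pair the reference family has one derivative more, because comparing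
compositions with two close inner maps costs a derivative. Hitting times and the impulse come from
an implicit function theorem for such pairs (`CNear.exists_implicit`); the nonvanishing derivative
it needs is non-tangency.

The Poincaré map is the composition layer, flight, layer, reflection (`Hyp.poincare_close`). For the
flow, the orbit is cut between its collisions, and the pieces are joined by `FlowClose.concat`. On a
piece with one collision the two motions cannot be compared only between the arrival of the smooth
one at the layer and its departure; both of these times are O(ν)-close to the collision time of the
auxiliary billiard (`Hyp.exists_flowClose_one`). -/

/-- Eventually in the product filter is an open condition on the point. -/
theorem eventually_eventually_nhds_snd {ι E : Type} [TopologicalSpace E] {l : Filter ι}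
    {K : Set E} {P : ι × E → Prop} (h : ∀ᶠ p in l ×ˢ 𝓝ˢ K, P p) :
    ∀ᶠ p in l ×ˢ 𝓝ˢ K, ∀ᶠ y in 𝓝 p.2, P (p.1, y) := by
  obtain ⟨A, hA, B, hB, hAB⟩ := eventually_prod_iff.1 h
  have hB' : ∀ᶠ y in 𝓝ˢ K, ∀ᶠ z in 𝓝 y, B z := by
    obtain ⟨U, hU, hKU, hUB⟩ := mem_nhdsSet_iff_exists.1 hB
    filter_upwards [hU.mem_nhdsSet.2 hKU] with y hy
    filter_upwards [hU.mem_nhds hy] with z hz using hUB hz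
  refine eventually_prod_iff.2 ⟨A, hA, _, hB', fun {x} hx {y} hy => ?_⟩
  filter_upwards [hy] with z hz using hAB hx hz

section Families

variable {ι κ E F G H : Type} [TopologicalSpace ι] [TopologicalSpace κ]
  [NormedAddCommGroup E] [NormedSpace ℝ E] [NormedAddCommGroup F] [NormedSpace ℝ F]
  [NormedAddCommGroup G] [NormedSpace ℝ G] [NormedAddCommGroup H] [NormedSpace ℝ H]

/-- Auxiliary recursion for `CBound`. -/
def CBoundAux (l : Filter ι) (K : Set E) (μ : ι → ℝ) :
    ℕ → (F : Type) → [NormedAddCommGroup F] → [NormedSpace ℝ F] → (ι → E → F) → Prop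
  | 0, _, _, _, f => (∀ᶠ p in l ×ˢ 𝓝ˢ K, ContinuousAt (Function.uncurry f) p) ∧
      (fun p : ι × E => f p.1 p.2) =O[l ×ˢ 𝓝ˢ K] fun p => μ p.1
  | n + 1, F, _, _, f => ((∀ᶠ p in l ×ˢ 𝓝ˢ K, ContinuousAt (Function.uncurry f) p) ∧
      (fun p : ι × E => f p.1 p.2) =O[l ×ˢ 𝓝ˢ K] fun p => μ p.1) ∧
      ∃ f' : ι → E → E →L[ℝ] F,
        (∀ᶠ p in l ×ˢ 𝓝ˢ K, HasFDerivAt (f p.1) (f' p.1 p.2) p.2) ∧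
        CBoundAux l K μ n (E →L[ℝ] F) f'

/-- The family `f i`, `i → l`, is `C^n` near `K`, and its derivatives of orders `0, …, n` are
`O(μ i)` uniformly near `K`.  The derivatives are jointly continuous in the index and the point. -/
def CBound (l : Filter ι) (K : Set E) (μ : ι → ℝ) (n : ℕ) (f : ι → E → F) : Prop :=
  CBoundAux l K μ n F f

variable {l : Filter ι} {K : Set E} {μ μ₁ μ₂ : ι → ℝ} {n m : ℕ} {f g : ι → E → F}

theorem cBound_zero : CBound l K μ 0 f ↔
    (∀ᶠ p in l ×ˢ 𝓝ˢ K, ContinuousAt (Function.uncurry f) p) ∧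
      (fun p : ι × E => f p.1 p.2) =O[l ×ˢ 𝓝ˢ K] fun p => μ p.1 := Iff.rfl

theorem cBound_succ : CBound l K μ (n + 1) f ↔ CBound l K μ 0 f ∧
    ∃ f' : ι → E → E →L[ℝ] F, (∀ᶠ p in l ×ˢ 𝓝ˢ K, HasFDerivAt (f p.1) (f' p.1 p.2) p.2) ∧
      CBound l K μ n f' := Iff.rfl

namespace CBound

theorem zero (h : CBound l K μ n f) : CBound l K μ 0 f := by
  cases n with
  | zero => exact h
  | succ n => exact h.1

theorem pred (h : CBound l K μ (n + 1) f) : CBound l K μ n f := by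
  induction n generalizing F with
  | zero => exact h.1
  | succ n ih =>
    obtain ⟨h0, f', hf', h1⟩ := h
    exact ⟨h0, f', hf', ih h1⟩

theorem of_le (h : CBound l K μ n f) (hm : m ≤ n) : CBound l K μ m f := by
  induction hm with
  | refl => exact h
  | step _ ih => exact ih h.pred

theorem isBigO (h : CBound l K μ n f) :
    (fun p : ι × E => f p.1 p.2) =O[l ×ˢ 𝓝ˢ K] fun p => μ p.1 := h.zero.2

theorem continuousAt (h : CBound l K μ n f) :
    ∀ᶠ p in l ×ˢ 𝓝ˢ K, ContinuousAt (Function.uncurry f) p := h.zero.1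

theorem trans (h : CBound l K μ₁ n f) (hμ : μ₁ =O[l] μ₂) : CBound l K μ₂ n f := by
  have key : (fun p : ι × E => μ₁ p.1) =O[l ×ˢ 𝓝ˢ K] fun p => μ₂ p.1 :=
    hμ.comp_tendsto tendsto_fst
  induction n generalizing F with
  | zero => exact ⟨h.1, h.2.trans key⟩
  | succ n ih =>
    obtain ⟨h0, f', hf', h1⟩ := h
    exact ⟨⟨h0.1, h0.2.trans key⟩, f', hf', ih h1⟩

theorem mono {l' : Filter ι} {K' : Set E} (h : CBound l K μ n f) (hl : l' ≤ l) (hK : K' ⊆ K) :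
    CBound l' K' μ n f := by
  have key : l' ×ˢ 𝓝ˢ K' ≤ l ×ˢ 𝓝ˢ K := Filter.prod_mono hl (nhdsSet_mono hK)
  induction n generalizing F with
  | zero => exact ⟨h.1.filter_mono key, h.2.mono key⟩
  | succ n ih =>
    obtain ⟨h0, f', hf', h1⟩ := h
    exact ⟨⟨h0.1.filter_mono key, h0.2.mono key⟩, f', hf'.filter_mono key, ih h1⟩

/-- Equality is required near each pair of index and point because joint continuity in the index is
part of the bound. For a discrete index `congr'` needs only eventual equality. -/
theorem congr (h : CBound l K μ n f)
    (hfg : ∀ᶠ p in l ×ˢ 𝓝ˢ K, Function.uncurry f =ᶠ[𝓝 p] Function.uncurry g) :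
    CBound l K μ n g := by
  have h0 : CBound l K μ 0 g := by
    refine ⟨?_, h.isBigO.congr' ?_ EventuallyEq.rfl⟩
    · filter_upwards [h.continuousAt, hfg] with p hp hq using hp.congr hq
    · filter_upwards [hfg] with p hp using hp.self_of_nhds
  cases n with
  | zero => exact h0
  | succ n =>
    obtain ⟨-, f', hf', h1⟩ := h
    refine ⟨h0, f', ?_, h1⟩
    filter_upwards [hf', hfg] with p hp hq
    refine hp.congr_of_eventuallyEq ?_
    have : Tendsto (fun y => (p.1, y)) (𝓝 p.2) (𝓝 p) := by
      have : ContinuousAt (fun y => (p.1, y)) p.2 := by fun_prop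
      exact this
    filter_upwards [this.eventually hq] with y hy using hy.symm

theorem add (hf : CBound l K μ n f) (hg : CBound l K μ n g) :
    CBound l K μ n fun i x => f i x + g i x := by
  induction n generalizing F with
  | zero =>
    refine ⟨?_, hf.2.add hg.2⟩
    filter_upwards [hf.1, hg.1] with p h1 h2 using h1.add h2
  | succ n ih =>
    obtain ⟨h0, f', hf', h1⟩ := hf
    obtain ⟨k0, g', hg', k1⟩ := hg
    refine ⟨⟨?_, h0.2.add k0.2⟩, fun i x => f' i x + g' i x, ?_, ih h1 k1⟩
    · filter_upwards [h0.1, k0.1] with p h1 h2 using h1.add h2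
    · filter_upwards [hf', hg'] with p h1 h2 using h1.add h2

theorem clm (L : F →L[ℝ] G) (hf : CBound l K μ n f) : CBound l K μ n fun i x => L (f i x) := by
  induction n generalizing F G with
  | zero =>
    refine ⟨?_, (L.isBigO_comp _ _).trans hf.2⟩
    filter_upwards [hf.1] with p h1 using L.continuous.continuousAt.comp h1
  | succ n ih =>
    obtain ⟨h0, f', hf', h1⟩ := hf
    refine ⟨⟨?_, (L.isBigO_comp _ _).trans h0.2⟩, fun i x => L.comp (f' i x), ?_,
      ih (ContinuousLinearMap.compL ℝ E F G L) h1⟩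
    · filter_upwards [h0.1] with p h1 using L.continuous.continuousAt.comp h1
    · filter_upwards [hf'] with p h1 using L.hasFDerivAt.comp p.2 h1

theorem neg (hf : CBound l K μ n f) : CBound l K μ n fun i x => -f i x := by
  simpa using hf.clm (-ContinuousLinearMap.id ℝ F)

theorem sub (hf : CBound l K μ n f) (hg : CBound l K μ n g) :
    CBound l K μ n fun i x => f i x - g i x := by
  simpa [sub_eq_add_neg] using hf.add hg.neg

/-- By the Leibniz rule the derivative is a sum of two bilinear expressions, formed with `precompR`
and `precompL`. The induction on the order therefore closes once the spaces and the bilinear map are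
allowed to vary. -/
theorem bilin (B : F →L[ℝ] G →L[ℝ] H) {g : ι → E → G} (hf : CBound l K μ₁ n f)
    (hg : CBound l K μ₂ n g) : CBound l K (fun i => μ₁ i * μ₂ i) n fun i x => B (f i x) (g i x) := by
  have zero : ∀ {F G H : Type} [NormedAddCommGroup F] [NormedSpace ℝ F] [NormedAddCommGroup G]
      [NormedSpace ℝ G] [NormedAddCommGroup H] [NormedSpace ℝ H] (B : F →L[ℝ] G →L[ℝ] H)
      {f : ι → E → F} {g : ι → E → G}, CBound l K μ₁ 0 f → CBound l K μ₂ 0 g →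
      CBound l K (fun i => μ₁ i * μ₂ i) 0 fun i x => B (f i x) (g i x) := by
    intro F G H _ _ _ _ _ _ B f g hf hg
    refine ⟨?_, ?_⟩
    · filter_upwards [hf.1, hg.1] with p h1 h2
      exact (B.continuous.continuousAt.comp h1).clm_apply h2
    · have h1 : (fun p : ι × E => B (f p.1 p.2) (g p.1 p.2)) =O[l ×ˢ 𝓝ˢ K]
          fun p => ‖f p.1 p.2‖ * ‖g p.1 p.2‖ := by
        refine IsBigO.of_bound ‖B‖ (Eventually.of_forall fun p => ?_)
        have := B.le_opNorm₂ (f p.1 p.2) (g p.1 p.2)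
        simpa [mul_assoc] using this
      exact h1.trans (hf.2.norm_left.mul hg.2.norm_left)
  induction n generalizing F G H with
  | zero => exact zero B hf hg
  | succ n ih =>
    obtain ⟨h0, f', hf', h1⟩ := hf
    obtain ⟨k0, g', hg', k1⟩ := hg
    have hf : CBound l K μ₁ (n + 1) f := ⟨h0, f', hf', h1⟩
    have hg : CBound l K μ₂ (n + 1) g := ⟨k0, g', hg', k1⟩
    refine ⟨zero B h0 k0, fun i x => B.precompR E (f i x) (g' i x) + B.precompL E (f' i x) (g i x),
      ?_, (ih (B.precompR E) hf.pred k1).add (ih (B.precompL E) h1 hg.pred)⟩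
    filter_upwards [hf', hg'] with p h1 h2
    exact B.hasFDerivAt_of_bilinear h1 h2

/-- Multiplication by a bounded family. -/
theorem bilin_right (B : F →L[ℝ] G →L[ℝ] H) {g : ι → E → G} (hf : CBound l K (fun _ => 1) n f)
    (hg : CBound l K μ n g) : CBound l K μ n fun i x => B (f i x) (g i x) := by
  simpa using hf.bilin B hg

theorem bilin_left (B : F →L[ℝ] G →L[ℝ] H) {g : ι → E → G} (hf : CBound l K μ n f)
    (hg : CBound l K (fun _ => 1) n g) : CBound l K μ n fun i x => B (f i x) (g i x) := by
  simpa using hf.bilin B hg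

theorem smul_right {a : ι → E → ℝ} (ha : CBound l K (fun _ => 1) n a) (hf : CBound l K μ n f) :
    CBound l K μ n fun i x => a i x • f i x := by
  simpa using ha.bilin_right (ContinuousLinearMap.lsmul ℝ ℝ) hf

theorem smul_left {a : ι → E → ℝ} (ha : CBound l K μ n a) (hf : CBound l K (fun _ => 1) n f) :
    CBound l K μ n fun i x => a i x • f i x := by
  simpa using ha.bilin_left (ContinuousLinearMap.lsmul ℝ ℝ) hf

theorem prodMk {g : ι → E → G} (hf : CBound l K μ n f) (hg : CBound l K μ n g) :
    CBound l K μ n fun i x => (f i x, g i x) := by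
  simpa using (hf.clm (ContinuousLinearMap.inl ℝ F G)).add (hg.clm (ContinuousLinearMap.inr ℝ F G))

theorem fst {f : ι → E → F × G} (hf : CBound l K μ n f) : CBound l K μ n fun i x => (f i x).1 :=
  hf.clm (ContinuousLinearMap.fst ℝ F G)

theorem snd {f : ι → E → F × G} (hf : CBound l K μ n f) : CBound l K μ n fun i x => (f i x).2 :=
  hf.clm (ContinuousLinearMap.snd ℝ F G)

/-- The derivative is bilinear in the outer derivative, evaluated along the inner family, and the
inner derivative. A bounded inner family thus keeps the rate of the outer one. -/
theorem comp {l' : Filter κ} {K' : Set F} {ν : κ → ℝ} {g : κ → F → G} {j : ι → κ}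
    (hg : CBound l' K' ν n g) (hf : CBound l K (fun _ => 1) n f) (hj : Continuous j)
    (ht : Tendsto (fun p : ι × E => (j p.1, f p.1 p.2)) (l ×ˢ 𝓝ˢ K) (l' ×ˢ 𝓝ˢ K')) :
    CBound l K (fun i => ν (j i)) n fun i x => g (j i) (f i x) := by
  have zero : ∀ {G : Type} [NormedAddCommGroup G] [NormedSpace ℝ G] {g : κ → F → G},
      CBound l' K' ν 0 g → CBound l K (fun i => ν (j i)) 0 fun i x => g (j i) (f i x) := by
    intro G _ _ g hg
    refine ⟨?_, hg.2.comp_tendsto ht⟩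
    filter_upwards [ht.eventually hg.1, hf.continuousAt] with p h1 h2
    have h3 : ContinuousAt (fun p : ι × E => (j p.1, f p.1 p.2)) p :=
      (hj.continuousAt.comp continuousAt_fst).prodMk h2
    exact ContinuousAt.comp (g := Function.uncurry g)
      (f := fun p : ι × E => (j p.1, f p.1 p.2)) h1 h3
  induction n generalizing G with
  | zero => exact zero hg
  | succ n ih =>
    obtain ⟨k0, g', hg', k1⟩ := hg
    refine ⟨zero k0, ?_⟩
    have hf2 := hf
    obtain ⟨h0, f', hf', h1⟩ := hf2
    refine ⟨fun i x => (g' (j i) (f i x)).comp (f' i x), ?_, ?_⟩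
    · filter_upwards [ht.eventually hg', hf'] with p h1 h2 using h1.comp p.2 h2
    · exact (ih k1 hf.pred).bilin_left (ContinuousLinearMap.compL ℝ E F G) h1

theorem reindex {f : κ → E → F} {l' : Filter κ} {ν : κ → ℝ} {j : ι → κ} (hf : CBound l' K ν n f)
    (hj : Continuous j) (ht : Tendsto j l l') : CBound l K (fun i => ν (j i)) n fun i => f (j i) := by
  have key : Tendsto (fun p : ι × E => (j p.1, p.2)) (l ×ˢ 𝓝ˢ K) (l' ×ˢ 𝓝ˢ K) :=
    (ht.comp tendsto_fst).prodMk tendsto_snd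
  have zero : ∀ {F : Type} [NormedAddCommGroup F] [NormedSpace ℝ F] {f : κ → E → F},
      CBound l' K ν 0 f → CBound l K (fun i => ν (j i)) 0 fun i => f (j i) := by
    intro F _ _ f hf
    refine ⟨?_, hf.2.comp_tendsto key⟩
    filter_upwards [key.eventually hf.1] with p h1
    exact ContinuousAt.comp (g := Function.uncurry f) (f := fun p : ι × E => (j p.1, p.2)) h1
      (by fun_prop)
  induction n generalizing F with
  | zero => exact zero hf
  | succ n ih =>
    obtain ⟨k0, f', hf', k1⟩ := hf
    exact ⟨zero k0, fun i => f' (j i), key.eventually hf', ih k1⟩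

theorem zero_fun : CBound l K μ n fun _ _ => (0 : F) := by
  have zero : ∀ {F : Type} [NormedAddCommGroup F] [NormedSpace ℝ F],
      CBound l K μ 0 fun _ _ => (0 : F) := by
    intro F _ _
    exact ⟨Eventually.of_forall fun p => continuousAt_const, isBigO_zero _ _⟩
  induction n generalizing F with
  | zero => exact zero
  | succ n ih =>
    exact ⟨zero, fun _ _ => 0, Eventually.of_forall fun p => hasFDerivAt_const _ _, ih⟩

/-- A family of constants. -/
theorem const_family {c : ι → F} (hc : Continuous c) (hb : c =O[l] μ) :
    CBound l K μ n fun i _ => c i := by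
  have h0 : CBound l K μ 0 fun i (_ : E) => c i :=
    ⟨Eventually.of_forall fun p => (hc.comp continuous_fst).continuousAt,
      hb.comp_tendsto tendsto_fst⟩
  cases n with
  | zero => exact h0
  | succ n => exact ⟨h0, fun _ _ => 0, Eventually.of_forall fun p => hasFDerivAt_const _ _, zero_fun⟩

theorem const (c : F) : CBound l K (fun _ => 1) n fun _ _ => c :=
  const_family continuous_const (isBigO_const_const _ one_ne_zero _)

theorem id (hK : IsCompact K) : CBound l K (fun _ => 1) n fun _ x => x := by
  have h0 : CBound l K (fun _ => 1) 0 fun (_ : ι) (x : E) => x := by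
    refine ⟨Eventually.of_forall fun p => continuous_snd.continuousAt, ?_⟩
    obtain ⟨R, hR⟩ := hK.isBounded.subset_ball (0 : E)
    refine IsBigO.of_bound R ?_
    have : Metric.ball (0 : E) R ∈ 𝓝ˢ K := Metric.isOpen_ball.mem_nhdsSet.2 hR
    filter_upwards [tendsto_snd.eventually this] with p hp
    simpa using (mem_ball_zero_iff.1 hp).le
  cases n with
  | zero => exact h0
  | succ n =>
    exact ⟨h0, fun _ _ => ContinuousLinearMap.id ℝ E,
      Eventually.of_forall fun p => hasFDerivAt_id _, const _⟩

theorem clm_id (hK : IsCompact K) (L : E →L[ℝ] F) : CBound l K (fun _ => 1) n fun _ x => L x :=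
  (id hK).clm L

/-- Differences of compositions: if `f - g` is small then so is `G ∘ f - G ∘ g`. -/
theorem comp_sub_comp {l' : Filter κ} {K' : Set F} {u : κ → F → G} {j : ι → κ}
    (hu : CBound l' K' (fun _ => 1) (n + 1) u) (hf : CBound l K (fun _ => 1) n f)
    (hg : CBound l K (fun _ => 1) n g) (hfg : CBound l K μ n fun i x => f i x - g i x)
    (hj : Continuous j)
    (hseg : ∀ s ∈ l' ×ˢ 𝓝ˢ K', ∀ᶠ p in l ×ˢ 𝓝ˢ K,
      ∀ y ∈ segment ℝ (f p.1 p.2) (g p.1 p.2), (j p.1, y) ∈ s) :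
    CBound l K μ n fun i x => u (j i) (f i x) - u (j i) (g i x) := by
  have htf : Tendsto (fun p : ι × E => (j p.1, f p.1 p.2)) (l ×ˢ 𝓝ˢ K) (l' ×ˢ 𝓝ˢ K') := by
    intro s hs
    rw [mem_map]
    filter_upwards [hseg s hs] with p hp using hp _ (left_mem_segment ℝ _ _)
  have htg : Tendsto (fun p : ι × E => (j p.1, g p.1 p.2)) (l ×ˢ 𝓝ˢ K) (l' ×ˢ 𝓝ˢ K') := by
    intro s hs
    rw [mem_map]
    filter_upwards [hseg s hs] with p hp using hp _ (right_mem_segment ℝ _ _)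
  have zero : ∀ {G : Type} [NormedAddCommGroup G] [NormedSpace ℝ G] {u : κ → F → G},
      CBound l' K' (fun _ => 1) 1 u →
      CBound l K μ 0 fun i x => u (j i) (f i x) - u (j i) (g i x) := by
    intro G _ _ u hu
    refine ⟨?_, ?_⟩
    · exact ((hu.zero.comp hf.zero hj htf).sub (hu.zero.comp hg.zero hj htg)).1
    · obtain ⟨-, u', hu', hb⟩ := hu
      obtain ⟨C, hC⟩ := (cBound_zero.1 hb).2.bound
      -- At order zero this is the mean value inequality along the segment from g to f, on which
      -- `hseg` supplies the bound for the derivative of u.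
      refine IsBigO.trans ?_ hfg.isBigO
      refine IsBigO.of_bound C ?_
      filter_upwards [hseg _ (hu'.and hC)] with p hp
      have := (convex_segment (𝕜 := ℝ) (f p.1 p.2) (g p.1 p.2)).norm_image_sub_le_of_norm_hasFDerivWithin_le
        (f := u (j p.1)) (f' := u' (j p.1)) (C := C) (fun y hy => (hp y hy).1.hasFDerivWithinAt)
        (fun y hy => by simpa using (hp y hy).2) (right_mem_segment ℝ _ _)
        (left_mem_segment ℝ _ _)
      exact this
  induction n generalizing G with
  | zero => exact zero hu
  | succ n ih =>
    refine ⟨zero (hu.of_le (by omega)), ?_⟩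
    have hu2 := hu
    have hf2 := hf
    have hg2 := hg
    have hfg2 := hfg
    obtain ⟨-, u', hu', hu1⟩ := hu2
    obtain ⟨-, f', hf', hf1⟩ := hf2
    obtain ⟨-, g', hg', hg1⟩ := hg2
    obtain ⟨-, d', hd', hd1⟩ := hfg2
    -- The derivative of the difference is split as (u'(f) - u'(g)) f' + u'(g) (f' - g'). The first
    -- term is the induction hypothesis for u', which explains the extra derivative asked of u.
    refine ⟨fun i x => (u' (j i) (f i x) - u' (j i) (g i x)).comp (f' i x) +
      (u' (j i) (g i x)).comp (d' i x), ?_, ?_⟩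
    · filter_upwards [htf.eventually hu', htg.eventually hu', hf', hg', hd'] with p a b c d e
      have h1 := (a.comp p.2 c).sub (b.comp p.2 d)
      have h2 : d' p.1 p.2 = f' p.1 p.2 - g' p.1 p.2 := e.unique (c.sub d)
      refine h1.congr_fderiv ?_
      rw [h2]
      ext v
      simp
    · refine CBound.add ?_ ?_
      · exact (ih hu1 hf.pred hg.pred hfg.pred).bilin_left
          (ContinuousLinearMap.compL ℝ E F G) hf1
      · exact ((CBound.pred hu1).comp hg.pred hj htg).bilin_right (ContinuousLinearMap.compL ℝ E F G) hd1

theorem contDiffAt (h : CBound l K μ n f) : ∀ᶠ p in l ×ˢ 𝓝ˢ K, ContDiffAt ℝ n (f p.1) p.2 := by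
  induction n generalizing F with
  | zero =>
    filter_upwards [eventually_eventually_nhds_snd h.continuousAt] with p hp
    rw [Nat.cast_zero, contDiffAt_zero]
    refine ⟨_, hp, fun y hy => ContinuousAt.continuousWithinAt ?_⟩
    exact ContinuousAt.comp (g := Function.uncurry f) (f := fun y => (p.1, y)) hy (by fun_prop)
  | succ n ih =>
    obtain ⟨-, f', hf', h1⟩ := h
    filter_upwards [eventually_eventually_nhds_snd hf', ih h1] with p hp hq
    rw [Nat.cast_succ, contDiffAt_succ_iff_hasFDerivAt]
    exact ⟨f' p.1, ⟨_, hp, fun y hy => hy⟩, hq⟩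

theorem iteratedFDeriv_isBigO (h : CBound l K μ n f) (hm : m ≤ n) :
    (fun p : ι × E => iteratedFDeriv ℝ m (f p.1) p.2) =O[l ×ˢ 𝓝ˢ K] fun p => μ p.1 := by
  induction m generalizing F n with
  | zero =>
    refine IsBigO.of_norm_left ?_
    simpa using h.isBigO.norm_left
  | succ m ih =>
    obtain ⟨n, rfl⟩ : ∃ k, n = k + 1 := ⟨n - 1, by omega⟩
    obtain ⟨-, f', hf', h1⟩ := h
    have := ih h1 (by omega)
    refine (this.norm_left.congr' ?_ EventuallyEq.rfl).of_norm_left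
    filter_upwards [eventually_eventually_nhds_snd hf'] with p hp
    rw [← norm_iteratedFDeriv_fderiv]
    have : fderiv ℝ (f p.1) =ᶠ[𝓝 p.2] f' p.1 := by
      filter_upwards [hp] with y hy using hy.fderiv
    rw [(this.iteratedFDeriv ℝ m).self_of_nhds]

end CBound

end Families

/-! ### Fixed functions and reciprocals as bounded families. -/

section FamiliesTwo

variable {ι κ E F G H : Type} [TopologicalSpace ι] [TopologicalSpace κ]
  [NormedAddCommGroup E] [NormedSpace ℝ E] [NormedAddCommGroup F] [NormedSpace ℝ F]
  [NormedAddCommGroup G] [NormedSpace ℝ G] [NormedAddCommGroup H] [NormedSpace ℝ H]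
  {l : Filter ι} {K : Set E} {μ ν : ι → ℝ} {n m : ℕ} {f g : ι → E → F}

theorem CBound.tendsto_zero (h : CBound l K μ n f) (hμ : Tendsto μ l (𝓝 0)) :
    Tendsto (fun p : ι × E => f p.1 p.2) (l ×ˢ 𝓝ˢ K) (𝓝 0) :=
  h.isBigO.trans_tendsto (hμ.comp tendsto_fst)

/-- If two families converge to a convex compact set, so do the segments joining them. -/
theorem eventually_segment {α : Type} {𝓕 : Filter α} (hK : IsCompact K) (hc : Convex ℝ K)
    {j : α → κ} {f g : α → E} {l' : Filter κ}
    (hf : Tendsto (fun a => (j a, f a)) 𝓕 (l' ×ˢ 𝓝ˢ K))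
    (hg : Tendsto (fun a => (j a, g a)) 𝓕 (l' ×ˢ 𝓝ˢ K)) :
    ∀ s ∈ l' ×ˢ 𝓝ˢ K, ∀ᶠ a in 𝓕, ∀ y ∈ segment ℝ (f a) (g a), (j a, y) ∈ s := by
  intro s hs
  obtain ⟨A, hA, B, hB, hAB⟩ := mem_prod_iff.1 hs
  obtain ⟨d, hd, hdB⟩ := (Metric.hasBasis_nhdsSet_thickening hK).mem_iff.1 hB
  have hmem : A ×ˢ Metric.thickening d K ∈ l' ×ˢ 𝓝ˢ K :=
    prod_mem_prod hA (Metric.isOpen_thickening.mem_nhdsSet.2 (Metric.self_subset_thickening hd K))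
  filter_upwards [hf hmem, hg hmem] with a h1 h2 y hy
  exact hAB ⟨h1.1, hdB ((hc.thickening d).segment_subset h1.2 h2.2 hy)⟩

/-- A fixed `C^n` function is a bounded family. -/
theorem CBound.of_contDiffAt_const {u : E → F} (hK : IsCompact K)
    (hu : ∀ x ∈ K, ContDiffAt ℝ n u x) : CBound l K (fun _ => 1) n fun _ => u := by
  have zero : ∀ {F : Type} [NormedAddCommGroup F] [NormedSpace ℝ F] {u : E → F},
      (∀ᶠ y in 𝓝ˢ K, ContinuousAt u y) → CBound l K (fun _ => 1) 0 fun _ => u := by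
    intro F _ _ u hu
    refine ⟨?_, ?_⟩
    · filter_upwards [tendsto_snd.eventually hu] with p hp
      exact ContinuousAt.comp (g := u) (f := Prod.snd) hp continuousAt_snd
    · have hc : ∀ x ∈ K, ContinuousAt u x := fun x hx => eventually_nhdsSet_iff_forall.1 hu x hx |>.self_of_nhds
      obtain ⟨C, hC⟩ := hK.exists_bound_of_continuousOn (fun x hx => (hc x hx).continuousWithinAt)
      have : ∀ᶠ y in 𝓝ˢ K, ‖u y‖ < C + 1 := by
        refine eventually_nhdsSet_iff_forall.2 fun x hx => ?_
        exact (hc x hx).norm.eventually_lt_const (by linarith [hC x hx])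
      refine IsBigO.of_bound (C + 1) ?_
      filter_upwards [tendsto_snd.eventually this] with p hp
      simpa using hp.le
  have cont : ∀ {F : Type} [NormedAddCommGroup F] [NormedSpace ℝ F] {u : E → F} {n : ℕ},
      (∀ x ∈ K, ContDiffAt ℝ n u x) → ∀ᶠ y in 𝓝ˢ K, ContDiffAt ℝ n u y := by
    intro F _ _ u n hu
    exact eventually_nhdsSet_iff_forall.2 fun x hx => (hu x hx).eventually (by simp)
  induction n generalizing F with
  | zero => exact zero ((cont hu).mono fun y hy => hy.continuousAt)
  | succ n ih =>
    refine ⟨zero ((cont hu).mono fun y hy => hy.continuousAt), fun _ => fderiv ℝ u, ?_, ?_⟩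
    · filter_upwards [tendsto_snd.eventually (cont hu)] with p hp
      exact (hp.differentiableAt (by simp)).hasFDerivAt
    · exact ih fun x hx => (hu x hx).fderiv_right (m := n) (by norm_cast)

theorem CBound.inv {a : ι → E → ℝ} (ha : CBound l K (fun _ => 1) n a) {c : ℝ} (hc : 0 < c)
    (hac : ∀ᶠ p in l ×ˢ 𝓝ˢ K, c ≤ |a p.1 p.2|) :
    CBound l K (fun _ => 1) n fun i x => (a i x)⁻¹ := by
  obtain ⟨C, hC⟩ := ha.isBigO.bound
  -- The values of the family lie in a compact set that avoids zero, and there inversion is one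
  -- fixed smooth function to compose with.
  set K' : Set ℝ := Metric.closedBall 0 C ∩ {y | c ≤ |y|} with hK'
  have hcomp : IsCompact K' :=
    (isCompact_closedBall _ _).inter_right (isClosed_le continuous_const continuous_abs)
  have h1 : CBound l K' (fun _ => 1) n fun _ (y : ℝ) => y⁻¹ := by
    refine CBound.of_contDiffAt_const hcomp fun x hx => contDiffAt_inv ℝ ?_
    rintro rfl
    have : c ≤ |(0 : ℝ)| := hx.2
    simp at this; linarith
  refine h1.comp ha (j := fun i => i) continuous_id ?_
  refine tendsto_fst.prodMk ?_
  refine Tendsto.mono_right ?_ (principal_le_nhdsSet (s := K'))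
  rw [tendsto_principal]
  filter_upwards [hac, hC] with p h1 h2
  exact ⟨by simpa using h2, h1⟩

end FamiliesTwo

/-- Eventually in the product filter for a compact set follows from its points. -/
theorem eventually_prod_nhdsSet {ι E : Type} [TopologicalSpace E] {l : Filter ι} {K : Set E}
    (hK : IsCompact K) {P : ι × E → Prop} (h : ∀ x ∈ K, ∀ᶠ p in l ×ˢ 𝓝ˢ {x}, P p) :
    ∀ᶠ p in l ×ˢ 𝓝ˢ K, P p := by
  rw [hK.prod_nhdsSet_eq_biSup]
  simp only [eventually_iSup]
  intro x hx
  simpa using h x hx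

theorem isBigO_prod_nhdsSet {ι E F : Type} [TopologicalSpace E] [NormedAddCommGroup F]
    {l : Filter ι} {K : Set E} {μ : ι → ℝ}
    (hK : IsCompact K) {u : ι × E → F}
    (h : ∀ x ∈ K, u =O[l ×ˢ 𝓝ˢ {x}] fun p => μ p.1) : u =O[l ×ˢ 𝓝ˢ K] fun p => μ p.1 := by
  refine hK.induction_on (p := fun s => u =O[l ×ˢ 𝓝ˢ s] fun p => μ p.1) ?_ ?_ ?_ ?_
  · simp
  · intro s t hst ht
    exact ht.mono (prod_mono le_rfl (nhdsSet_mono hst))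
  · intro s t hs ht
    rw [nhdsSet_union, prod_sup]
    exact hs.sup ht
  · intro x hx
    obtain ⟨C, hC⟩ := (h x hx).bound
    obtain ⟨A, hA, B, hB, hAB⟩ := eventually_prod_iff.1 hC
    rw [nhdsSet_singleton] at hB
    obtain ⟨U, hUB, hU, hxU⟩ := mem_nhds_iff.1 hB
    refine ⟨U, mem_nhdsWithin_of_mem_nhds (hU.mem_nhds hxU), IsBigO.of_bound C ?_⟩
    refine eventually_prod_iff.2 ⟨A, hA, (· ∈ U), hU.mem_nhdsSet.2 Subset.rfl, ?_⟩
    intro i hi y hy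
    exact hAB hi (hUB hy)

/-! ### Families over a discrete index set. -/

section Discrete

variable {ι E F G : Type} [TopologicalSpace ι] [DiscreteTopology ι]
  [NormedAddCommGroup E] [NormedSpace ℝ E] [NormedAddCommGroup F] [NormedSpace ℝ F]
  [NormedAddCommGroup G] [NormedSpace ℝ G]
  {l : Filter ι} {K : Set E} {μ : ι → ℝ} {n m : ℕ} {f g : ι → E → F}

theorem nhds_prod_of_discrete {ι E : Type} [TopologicalSpace ι] [DiscreteTopology ι]
    [TopologicalSpace E] (p : ι × E) : 𝓝 p = map (Prod.mk p.1) (𝓝 p.2) := by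
  rw [nhds_prod_eq, nhds_discrete, pure_prod]

theorem continuousAt_uncurry_of_discrete {p : ι × E} (h : ContinuousAt (f p.1) p.2) :
    ContinuousAt (Function.uncurry f) p := by
  rw [ContinuousAt, nhds_prod_of_discrete, tendsto_map'_iff]
  exact h

namespace CBound

/-- With a discrete index, joint continuity is continuity in the point alone, so ordinary
differentiability and derivative bounds are enough. -/
theorem of_contDiffAt (hc : ∀ᶠ p in l ×ˢ 𝓝ˢ K, ContDiffAt ℝ n (f p.1) p.2)
    (hb : ∀ m ≤ n, (fun p : ι × E => iteratedFDeriv ℝ m (f p.1) p.2) =O[l ×ˢ 𝓝ˢ K]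
      fun p => μ p.1) : CBound l K μ n f := by
  have h0 : CBound l K μ 0 f := by
    refine ⟨?_, ?_⟩
    · filter_upwards [hc] with p hp using continuousAt_uncurry_of_discrete hp.continuousAt
    · refine IsBigO.of_norm_left ?_
      simpa using (hb 0 (Nat.zero_le _)).norm_left
  induction n generalizing F with
  | zero => exact h0
  | succ n ih =>
    have hc' : ∀ᶠ p in l ×ˢ 𝓝ˢ K, ContDiffAt ℝ n (fderiv ℝ (f p.1)) p.2 := by
      filter_upwards [hc] with p hp using hp.fderiv_right (m := n) (by norm_cast)
    have hb' : ∀ m ≤ n, (fun p : ι × E => iteratedFDeriv ℝ m (fderiv ℝ (f p.1)) p.2)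
        =O[l ×ˢ 𝓝ˢ K] fun p => μ p.1 := by
      intro m hm
      refine IsBigO.of_norm_left ?_
      simpa [norm_iteratedFDeriv_fderiv] using (hb (m + 1) (by omega)).norm_left
    refine ⟨h0, fun i => fderiv ℝ (f i), ?_, ih hc' hb' ⟨?_, ?_⟩⟩
    · filter_upwards [hc] with p hp using (hp.differentiableAt (by simp)).hasFDerivAt
    · filter_upwards [hc'] with p hp using continuousAt_uncurry_of_discrete hp.continuousAt
    · refine IsBigO.of_norm_left ?_
      simpa using (hb' 0 (Nat.zero_le _)).norm_left

theorem congr' (h : CBound l K μ n f) (hfg : ∀ᶠ p in l ×ˢ 𝓝ˢ K, f p.1 p.2 = g p.1 p.2) :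
    CBound l K μ n g := by
  refine h.congr ?_
  filter_upwards [eventually_eventually_nhds_snd hfg] with p hp
  rw [nhds_prod_of_discrete]
  exact eventually_map.2 hp

protected theorem fderiv (h : CBound l K μ (n + 1) f) :
    CBound l K μ n fun i => fderiv ℝ (f i) := by
  refine of_contDiffAt ?_ ?_
  · filter_upwards [h.contDiffAt] with p hp using hp.fderiv_right (m := n) (by norm_cast)
  · intro m hm
    refine IsBigO.of_norm_left ?_
    simpa [norm_iteratedFDeriv_fderiv] using (h.iteratedFDeriv_isBigO (m := m + 1) (by omega)).norm_left

theorem of_singleton (hK : IsCompact K) (h : ∀ x ∈ K, CBound l {x} μ n f) : CBound l K μ n f :=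
  of_contDiffAt (eventually_prod_nhdsSet hK fun x hx => (h x hx).contDiffAt) fun _ hm =>
    isBigO_prod_nhdsSet hK fun x hx => (h x hx).iteratedFDeriv_isBigO hm

theorem differentiableAt (h : CBound l K μ (n + 1) f) :
    ∀ᶠ p in l ×ˢ 𝓝ˢ K, DifferentiableAt ℝ (f p.1) p.2 := by
  filter_upwards [h.contDiffAt] with p hp using hp.differentiableAt (by simp)

/-- This rests on 1/a - 1/b = -(1/a)(1/b)(a - b). -/
theorem inv_sub_inv {a b : ι → E → ℝ} (ha : CBound l K (fun _ => 1) n a)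
    (hb : CBound l K (fun _ => 1) n b) (hab : CBound l K μ n fun i x => a i x - b i x)
    {c : ℝ} (hc : 0 < c) (hac : ∀ᶠ p in l ×ˢ 𝓝ˢ K, c ≤ |a p.1 p.2|)
    (hbc : ∀ᶠ p in l ×ˢ 𝓝ˢ K, c ≤ |b p.1 p.2|) :
    CBound l K μ n fun i x => (a i x)⁻¹ - (b i x)⁻¹ := by
  refine ((ha.inv hc hac).smul_right ((hb.inv hc hbc).smul_right hab)).neg.congr' ?_
  filter_upwards [hac, hbc] with p h1 h2
  have h1 : a p.1 p.2 ≠ 0 := by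
    intro h; rw [h] at h1; simp at h1; linarith
  have h2 : b p.1 p.2 ≠ 0 := by
    intro h; rw [h] at h2; simp at h2; linarith
  simp only [smul_eq_mul]
  field_simp
  ring

end CBound

/-! ### A family version of the implicit function theorem -/

/-- The mean value theorem on a vertical segment, which stays in the ball by convexity. This
monotonicity with a rate independent of the index is the engine of the implicit function theorem
below: it yields roots, their uniqueness and their Lipschitz dependence. -/
theorem mul_abs_sub_le_of_le_fderiv {u : E × ℝ → ℝ} {z : E × ℝ} {r c : ℝ}
    (hd : ∀ y ∈ Metric.ball z r, DifferentiableAt ℝ u y)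
    (hc : ∀ y ∈ Metric.ball z r, c ≤ fderiv ℝ u y (0, 1)) {x : E} {s t : ℝ}
    (hs : (x, s) ∈ Metric.ball z r) (ht : (x, t) ∈ Metric.ball z r) (hst : s ≤ t) :
    c * (t - s) ≤ u (x, t) - u (x, s) := by
  have hmem : ∀ y ∈ Icc s t, (x, y) ∈ Metric.ball z r := by
    intro y hy
    have h := (convex_ball z r).segment_subset hs ht
    apply h
    rw [← Prod.image_mk_segment_right, segment_eq_Icc hst]
    exact ⟨y, hy, rfl⟩
  have hder : ∀ y ∈ Icc s t, HasDerivAt (fun y => u (x, y)) (fderiv ℝ u (x, y) (0, 1)) y := by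
    intro y hy
    have h1 : HasDerivAt (fun y : ℝ => (x, y)) ((0 : E), (1 : ℝ)) y :=
      (hasDerivAt_const y x).prodMk (hasDerivAt_id y)
    exact (hd _ (hmem y hy)).hasFDerivAt.comp_hasDerivAt y h1
  refine (convex_Icc s t).mul_sub_le_image_sub_of_le_deriv (f := fun y => u (x, y))
    (fun y hy => (hder y hy).continuousAt.continuousWithinAt)
    (fun y hy => (hder y (interior_subset hy)).differentiableAt.differentiableWithinAt)
    (fun y hy => ?_) s ⟨le_rfl, hst⟩ t ⟨hst, le_rfl⟩ hst
  rw [(hder y (interior_subset hy)).deriv]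
  exact hc _ (hmem y (interior_subset hy))

theorem mul_abs_sub_le_abs_of_le_fderiv {u : E × ℝ → ℝ} {z : E × ℝ} {r c : ℝ}
    (hd : ∀ y ∈ Metric.ball z r, DifferentiableAt ℝ u y)
    (hc : ∀ y ∈ Metric.ball z r, c ≤ fderiv ℝ u y (0, 1)) {x : E} {s t : ℝ}
    (hs : (x, s) ∈ Metric.ball z r) (ht : (x, t) ∈ Metric.ball z r) :
    c * |t - s| ≤ |u (x, t) - u (x, s)| := by
  rcases le_total s t with h | h
  · rw [abs_of_nonneg (sub_nonneg.2 h)]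
    exact (mul_abs_sub_le_of_le_fderiv hd hc hs ht h).trans (le_abs_self _)
  · rw [abs_sub_comm, abs_of_nonneg (sub_nonneg.2 h), abs_sub_comm]
    exact (mul_abs_sub_le_of_le_fderiv hd hc ht hs h).trans (le_abs_self _)

/-- The a priori Lipschitz bound on τ turns the remainder of u at the graph point into o(‖y - x‖).
The linear equation that is left can then be solved for τ y - τ x. -/
theorem hasFDerivAt_of_implicit {u : E × ℝ → ℝ} {u' : E × ℝ →L[ℝ] ℝ} {τ : E → ℝ} {x : E} {M : ℝ}
    (hu : HasFDerivAt u u' (x, τ x)) (hz : ∀ᶠ y in 𝓝 x, u (y, τ y) = 0)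
    (hM : ∀ᶠ y in 𝓝 x, |τ y - τ x| ≤ M * ‖y - x‖) (h1 : u' (0, 1) ≠ 0) :
    HasFDerivAt τ (-(u' (0, 1))⁻¹ • u'.comp (ContinuousLinearMap.inl ℝ E ℝ)) x := by
  have hbig : (fun y => τ y - τ x) =O[𝓝 x] fun y => y - x :=
    IsBigO.of_bound M (by simpa using hM)
  have hcont : Tendsto (fun y => (y, τ y)) (𝓝 x) (𝓝 (x, τ x)) := by
    refine Tendsto.prodMk_nhds tendsto_id ?_
    have : Tendsto (fun y => τ y - τ x) (𝓝 x) (𝓝 0) := by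
      refine hbig.trans_tendsto ?_
      have : Continuous fun y : E => y - x := by fun_prop
      simpa using this.tendsto x
    simpa using this.add_const (τ x)
  rw [hasFDerivAt_iff_isLittleO] at hu ⊢
  have h2 := hu.comp_tendsto hcont
  have h3 : (fun y => u (y, τ y) - u (x, τ x) - u' ((y, τ y) - (x, τ x))) =o[𝓝 x]
      fun y => y - x := by
    refine h2.trans_isBigO ?_
    exact (isBigO_refl (fun y => y - x) (𝓝 x)).prod_left hbig
  have h4 := h3.const_mul_left (-(u' (0, 1))⁻¹)
  refine h4.congr' ?_ EventuallyEq.rfl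
  filter_upwards [hz] with y hy
  rw [hy, hz.self_of_nhds]
  have : u' ((y, τ y) - (x, τ x)) = u' (y - x, 0) + (τ y - τ x) * u' (0, 1) := by
    rw [← smul_eq_mul, ← map_smul, ← map_add]
    congr 1
    simp
  rw [this]
  simp only [smul_apply, ContinuousLinearMap.comp_apply,
    ContinuousLinearMap.inl_apply, smul_eq_mul]
  field_simp
  ring

variable {x₀ : E} {t₀ c : ℝ} {Γ Γ' : ι → E × ℝ → ℝ} {τ τ' : ι → E → ℝ}

/-- Concrete neighbourhoods for an eventual statement near a point. -/
theorem exists_ball_of_eventually {ι E : Type} [PseudoMetricSpace E] {l : Filter ι} {x : E}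
    {P : ι × E → Prop} (h : ∀ᶠ p in l ×ˢ 𝓝ˢ {x}, P p) :
    ∃ r > 0, ∀ᶠ i in l, ∀ y ∈ Metric.ball x r, P (i, y) := by
  rw [nhdsSet_singleton] at h
  obtain ⟨A, hA, B, hB, hAB⟩ := eventually_prod_iff.1 h
  obtain ⟨r, hr, hrB⟩ := Metric.eventually_nhds_iff_ball.1 hB
  exact ⟨r, hr, hA.mono fun i hi y hy => hAB hi (hrB y hy)⟩

theorem eventually_of_exists_ball {ι E : Type} [PseudoMetricSpace E] {l : Filter ι} {x : E}
    {P : ι × E → Prop} {r : ℝ} (hr : 0 < r) (h : ∀ᶠ i in l, ∀ y ∈ Metric.ball x r, P (i, y)) :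
    ∀ᶠ p in l ×ˢ 𝓝ˢ {x}, P p := by
  rw [nhdsSet_singleton]
  exact eventually_prod_iff.2 ⟨_, h, _, Metric.ball_mem_nhds x hr, fun hi y hy => hi y hy⟩

theorem tendsto_graph (ht : Tendsto (fun p : ι × E => τ p.1 p.2) (l ×ˢ 𝓝ˢ {x₀}) (𝓝 t₀)) :
    Tendsto (fun p : ι × E => (p.1, (p.2, τ p.1 p.2))) (l ×ˢ 𝓝ˢ {x₀}) (l ×ˢ 𝓝ˢ {(x₀, t₀)}) := by
  rw [nhdsSet_singleton, nhdsSet_singleton, nhds_prod_eq] at *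
  exact tendsto_fst.prodMk (tendsto_snd.prodMk ht)

theorem implicit_hasFDerivAt (hG : CBound l {(x₀, t₀)} (fun _ => 1) (n + 1) Γ) (hc : 0 < c)
    (hder : ∀ᶠ p in l ×ˢ 𝓝ˢ {(x₀, t₀)}, c ≤ fderiv ℝ (Γ p.1) p.2 (0, 1))
    (ht : Tendsto (fun p : ι × E => τ p.1 p.2) (l ×ˢ 𝓝ˢ {x₀}) (𝓝 t₀))
    (hz : ∀ᶠ p in l ×ˢ 𝓝ˢ {x₀}, Γ p.1 (p.2, τ p.1 p.2) = 0) :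
    ∀ᶠ p in l ×ˢ 𝓝ˢ {x₀}, HasFDerivAt (τ p.1)
      (-(fderiv ℝ (Γ p.1) (p.2, τ p.1 p.2) (0, 1))⁻¹ •
        (fderiv ℝ (Γ p.1) (p.2, τ p.1 p.2)).comp (ContinuousLinearMap.inl ℝ E ℝ)) p.2 := by
  obtain ⟨C, hC⟩ := hG.fderiv.isBigO.bound
  obtain ⟨r, hr, h⟩ := exists_ball_of_eventually (hG.differentiableAt.and (hder.and hC))
  have hball : ∀ᶠ p in l ×ˢ 𝓝ˢ {x₀}, (p.2, τ p.1 p.2) ∈ Metric.ball (x₀, t₀) r := by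
    have := (tendsto_graph ht)
    have h2 := tendsto_snd.comp this
    refine h2.eventually ?_
    rw [nhdsSet_singleton]
    exact Metric.ball_mem_nhds _ hr
  filter_upwards [tendsto_fst.eventually h, eventually_eventually_nhds_snd hball,
    eventually_eventually_nhds_snd hz] with p hp hb hz'
  have hbx : ∀ᶠ y in 𝓝 p.2, (y, τ p.1 p.2) ∈ Metric.ball (x₀, t₀) r := by
    have : ContinuousAt (fun y : E => (y, τ p.1 p.2)) p.2 := by fun_prop
    exact this.eventually_mem (Metric.isOpen_ball.mem_nhds hb.self_of_nhds)
  have hcp := (hp _ hb.self_of_nhds).2.1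
  -- The Lipschitz constant of the root is the bound C on the derivative of Γ divided by the lower
  -- bound c on its derivative in the last variable.
  refine hasFDerivAt_of_implicit (M := C / c) (hp _ hb.self_of_nhds).1.hasFDerivAt hz' ?_
    (fun h0 => by simp only [h0] at hcp; linarith)
  filter_upwards [hb, hbx, hz'] with y h1 h2 h3
  have e1 := mul_abs_sub_le_abs_of_le_fderiv (fun z hz => (hp z hz).1) (fun z hz => (hp z hz).2.1)
    h2 h1
  have e2 := (convex_ball ((x₀, t₀) : E × ℝ) r).norm_image_sub_le_of_norm_hasFDerivWithin_le
    (f := Γ p.1) (C := C) (fun z hz => ((hp z hz).1).hasFDerivAt.hasFDerivWithinAt)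
    (fun z hz => by simpa using (hp z hz).2.2) hb.self_of_nhds h2
  rw [h3] at e1
  rw [hz'.self_of_nhds] at e2
  have e3 : ‖(y, τ p.1 p.2) - (p.2, τ p.1 p.2)‖ = ‖y - p.2‖ := by simp [Prod.norm_def]
  rw [e3] at e2
  rw [div_mul_eq_mul_div, le_div_iff₀ hc, mul_comm]
  simpa using e1.trans (by simpa using e2)

/-- The derivative of the implicit function, as a function on the graph. -/
theorem implicit_coeff (hG : CBound l {(x₀, t₀)} (fun _ => 1) (n + 1) Γ) (hc : 0 < c)
    (hder : ∀ᶠ p in l ×ˢ 𝓝ˢ {(x₀, t₀)}, c ≤ fderiv ℝ (Γ p.1) p.2 (0, 1)) :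
    CBound l {(x₀, t₀)} (fun _ => 1) n (fun i z => -(fderiv ℝ (Γ i) z (0, 1))⁻¹ •
      (fderiv ℝ (Γ i) z).comp (ContinuousLinearMap.inl ℝ E ℝ)) := by
  have h1 : CBound l {(x₀, t₀)} (fun _ => 1) n fun i z => fderiv ℝ (Γ i) z (0, 1) :=
    hG.fderiv.clm (ContinuousLinearMap.apply ℝ ℝ ((0 : E), (1 : ℝ)))
  have h2 : CBound l {(x₀, t₀)} (fun _ => 1) n fun i z =>
      (fderiv ℝ (Γ i) z).comp (ContinuousLinearMap.inl ℝ E ℝ) :=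
    hG.fderiv.clm ((ContinuousLinearMap.compL ℝ E (E × ℝ) ℝ).flip (ContinuousLinearMap.inl ℝ E ℝ))
  exact (h1.inv hc (hder.mono fun p hp => hp.trans (le_abs_self _))).neg.smul_right h2

/-- A bootstrap: the derivative of τ is a fixed coefficient evaluated on the graph of τ, so k
controlled derivatives of τ give k + 1. -/
theorem implicit_cBound (hG : CBound l {(x₀, t₀)} (fun _ => 1) (n + 1) Γ) (hc : 0 < c)
    (hder : ∀ᶠ p in l ×ˢ 𝓝ˢ {(x₀, t₀)}, c ≤ fderiv ℝ (Γ p.1) p.2 (0, 1))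
    (ht : Tendsto (fun p : ι × E => τ p.1 p.2) (l ×ˢ 𝓝ˢ {x₀}) (𝓝 t₀))
    (hz : ∀ᶠ p in l ×ˢ 𝓝ˢ {x₀}, Γ p.1 (p.2, τ p.1 p.2) = 0) :
    CBound l {x₀} (fun _ => 1) (n + 1) τ := by
  have hd := implicit_hasFDerivAt hG hc hder ht hz
  have h0 : CBound l {x₀} (fun _ => 1) 0 τ := by
    refine ⟨?_, ht.isBigO_one ℝ⟩
    filter_upwards [hd] with p hp using continuousAt_uncurry_of_discrete hp.continuousAt
  have key : ∀ k ≤ n + 1, CBound l {x₀} (fun _ => 1) k τ := by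
    intro k
    induction k with
    | zero => intro _; exact h0
    | succ k ih =>
      intro hk
      refine ⟨h0, fun i x => (fun z : E × ℝ => -(fderiv ℝ (Γ i) z (0, 1))⁻¹ •
        (fderiv ℝ (Γ i) z).comp (ContinuousLinearMap.inl ℝ E ℝ)) (x, τ i x), hd, ?_⟩
      exact ((implicit_coeff hG hc hder).of_le (by omega)).comp
        (f := fun i x => (x, τ i x)) ((CBound.id isCompact_singleton).prodMk (ih (by omega)))
        (j := fun i => i) continuous_id (tendsto_graph ht)
  exact key _ le_rfl

/-- With A and A' the derivative coefficients, the difference of the derivatives is (A - A') on the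
graph of τ, plus A' compared on two close graphs. The second part costs a derivative of A', so Γ' is
one order smoother than Γ. -/
theorem implicit_sub_cBound (hG : CBound l {(x₀, t₀)} (fun _ => 1) (n + 1) Γ)
    (hG' : CBound l {(x₀, t₀)} (fun _ => 1) (n + 2) Γ')
    (hGG : CBound l {(x₀, t₀)} μ (n + 1) fun i z => Γ i z - Γ' i z) (hc : 0 < c)
    (hder : ∀ᶠ p in l ×ˢ 𝓝ˢ {(x₀, t₀)}, c ≤ fderiv ℝ (Γ p.1) p.2 (0, 1))
    (hder' : ∀ᶠ p in l ×ˢ 𝓝ˢ {(x₀, t₀)}, c ≤ fderiv ℝ (Γ' p.1) p.2 (0, 1))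
    (ht : Tendsto (fun p : ι × E => τ p.1 p.2) (l ×ˢ 𝓝ˢ {x₀}) (𝓝 t₀))
    (ht' : Tendsto (fun p : ι × E => τ' p.1 p.2) (l ×ˢ 𝓝ˢ {x₀}) (𝓝 t₀))
    (hz : ∀ᶠ p in l ×ˢ 𝓝ˢ {x₀}, Γ p.1 (p.2, τ p.1 p.2) = 0)
    (hz' : ∀ᶠ p in l ×ˢ 𝓝ˢ {x₀}, Γ' p.1 (p.2, τ' p.1 p.2) = 0) :
    CBound l {x₀} μ (n + 1) fun i x => τ i x - τ' i x := by
  have hd := implicit_hasFDerivAt hG hc hder ht hz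
  have hd' := implicit_hasFDerivAt hG' hc hder' ht' hz'
  have hτ := implicit_cBound hG hc hder ht hz
  have hτ' := (implicit_cBound hG' hc hder' ht' hz').pred
  set A : ι → E × ℝ → E →L[ℝ] ℝ := fun i z => -(fderiv ℝ (Γ i) z (0, 1))⁻¹ •
      (fderiv ℝ (Γ i) z).comp (ContinuousLinearMap.inl ℝ E ℝ) with hA
  set A' : ι → E × ℝ → E →L[ℝ] ℝ := fun i z => -(fderiv ℝ (Γ' i) z (0, 1))⁻¹ •
      (fderiv ℝ (Γ' i) z).comp (ContinuousLinearMap.inl ℝ E ℝ) with hA'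
  have hA'b : CBound l {(x₀, t₀)} (fun _ => 1) (n + 1) A' := implicit_coeff hG' hc hder'
  have hAA : CBound l {(x₀, t₀)} μ n fun i z => A i z - A' i z := by
    have hdd : CBound l {(x₀, t₀)} μ n fun i z => fderiv ℝ (Γ i) z - fderiv ℝ (Γ' i) z := by
      refine hGG.fderiv.congr' ?_
      filter_upwards [hG.differentiableAt, hG'.differentiableAt] with p h1 h2
      exact fderiv_sub h1 h2
    have a1 : CBound l {(x₀, t₀)} (fun _ => 1) n fun i z => fderiv ℝ (Γ i) z (0, 1) :=
      hG.fderiv.clm (ContinuousLinearMap.apply ℝ ℝ ((0 : E), (1 : ℝ)))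
    have a2 : CBound l {(x₀, t₀)} (fun _ => 1) n fun i z => fderiv ℝ (Γ' i) z (0, 1) :=
      hG'.pred.fderiv.clm (ContinuousLinearMap.apply ℝ ℝ ((0 : E), (1 : ℝ)))
    have a3 : CBound l {(x₀, t₀)} μ n fun i z => fderiv ℝ (Γ i) z (0, 1) - fderiv ℝ (Γ' i) z (0, 1) :=
      hdd.clm (ContinuousLinearMap.apply ℝ ℝ ((0 : E), (1 : ℝ)))
    have b1 := hder.mono fun p hp => hp.trans (le_abs_self _)
    have b2 := hder'.mono fun p hp => hp.trans (le_abs_self _)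
    have inv := a1.inv_sub_inv a2 a3 hc b1 b2
    have c1 : CBound l {(x₀, t₀)} μ n fun i z =>
        ((fderiv ℝ (Γ i) z) - (fderiv ℝ (Γ' i) z)).comp (ContinuousLinearMap.inl ℝ E ℝ) :=
      hdd.clm ((ContinuousLinearMap.compL ℝ E (E × ℝ) ℝ).flip (ContinuousLinearMap.inl ℝ E ℝ))
    have c2 : CBound l {(x₀, t₀)} (fun _ => 1) n fun i z =>
        (fderiv ℝ (Γ i) z).comp (ContinuousLinearMap.inl ℝ E ℝ) :=
      hG.fderiv.clm ((ContinuousLinearMap.compL ℝ E (E × ℝ) ℝ).flip (ContinuousLinearMap.inl ℝ E ℝ))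
    refine ((inv.smul_left c2).add ((a2.inv hc b2).smul_right c1)).neg.congr' ?_
    refine Eventually.of_forall fun p => ?_
    ext v
    simp [hA, hA']
    ring
  have h0 : CBound l {x₀} μ 0 fun i x => τ i x - τ' i x := by
    refine ⟨?_, ?_⟩
    · exact ((hτ.zero).sub hτ'.zero).1
    -- Since Γ' vanishes at τ' and Γ at τ, c |τ - τ'| is at most |Γ'(x, τ)| = |Γ'(x, τ) - Γ(x, τ)|.
    · obtain ⟨r, hr, h⟩ := exists_ball_of_eventually (hG'.differentiableAt.and hder')
      have hball : ∀ {τ : ι → E → ℝ}, Tendsto (fun p : ι × E => τ p.1 p.2) (l ×ˢ 𝓝ˢ {x₀}) (𝓝 t₀) →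
          ∀ᶠ p in l ×ˢ 𝓝ˢ {x₀}, (p.2, τ p.1 p.2) ∈ Metric.ball (x₀, t₀) r := by
        intro τ ht
        refine (tendsto_snd.comp (tendsto_graph ht)).eventually ?_
        rw [nhdsSet_singleton]
        exact Metric.ball_mem_nhds _ hr
      have hO := hGG.isBigO.comp_tendsto (tendsto_graph ht)
      refine IsBigO.trans ?_ hO
      refine IsBigO.of_bound c⁻¹ ?_
      filter_upwards [tendsto_fst.eventually h, hball ht, hball ht', hz, hz'] with p hp h1 h2 h3 h4
      have := mul_abs_sub_le_abs_of_le_fderiv (fun z hz => (hp z hz).1) (fun z hz => (hp z hz).2)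
        h2 h1
      simp only [Function.comp, h3, zero_sub, norm_neg, Real.norm_eq_abs]
      simp only [h4, sub_zero] at this
      rw [inv_mul_eq_div, le_div_iff₀ hc, mul_comm]
      exact this
  have key : ∀ k ≤ n + 1, CBound l {x₀} μ k fun i x => τ i x - τ' i x := by
    intro k
    induction k with
    | zero => intro _; exact h0
    | succ k ih =>
      intro hk
      have ihk := ih (by omega)
      refine ⟨h0, fun i x => A i (x, τ i x) - A' i (x, τ' i x), ?_, ?_⟩
      · filter_upwards [hd, hd'] with p h1 h2 using h1.sub h2
      · have i1 : CBound l {x₀} (fun _ => 1) k fun i x => (x, τ i x) :=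
          (CBound.id isCompact_singleton).prodMk (hτ.of_le (by omega))
        have i2 : CBound l {x₀} (fun _ => 1) k fun i x => (x, τ' i x) :=
          (CBound.id isCompact_singleton).prodMk (hτ'.of_le (by omega))
        have e1 := (hAA.of_le (show k ≤ n by omega)).comp i1 (j := fun i => i) continuous_id
          (tendsto_graph ht)
        have e2 : CBound l {x₀} μ k fun i x => (x, τ i x) - (x, τ' i x) := by
          have := ihk.clm (ContinuousLinearMap.inr ℝ E ℝ)
          simpa using this
        have e3 := (hA'b.of_le (show k + 1 ≤ n + 1 by omega)).comp_sub_comp i1 i2 e2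
          (j := fun i => i) continuous_id
          (eventually_segment isCompact_singleton (convex_singleton _) (tendsto_graph ht)
            (tendsto_graph ht'))
        refine (e1.add e3).congr' (Eventually.of_forall fun p => ?_)
        simp
  exact key _ le_rfl

/-- Existence of the implicit function. -/
theorem exists_implicit (hG : CBound l {(x₀, t₀)} (fun _ => 1) (n + 1) Γ) (hc : 0 < c)
    (hder : ∀ᶠ p in l ×ˢ 𝓝ˢ {(x₀, t₀)}, c ≤ fderiv ℝ (Γ p.1) p.2 (0, 1))
    (h0 : Tendsto (fun p : ι × (E × ℝ) => Γ p.1 p.2) (l ×ˢ 𝓝ˢ {(x₀, t₀)}) (𝓝 0)) :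
    ∃ τ : ι → E → ℝ, Tendsto (fun p : ι × E => τ p.1 p.2) (l ×ˢ 𝓝ˢ {x₀}) (𝓝 t₀) ∧
      (∀ᶠ p in l ×ˢ 𝓝ˢ {x₀}, Γ p.1 (p.2, τ p.1 p.2) = 0) ∧
      CBound l {x₀} (fun _ => 1) (n + 1) τ := by
  classical
  obtain ⟨r, hr, h⟩ := exists_ball_of_eventually (hG.differentiableAt.and hder)
  have hconst : Tendsto (fun p : ι × E => (p.1, (p.2, t₀))) (l ×ˢ 𝓝ˢ {x₀})
      (l ×ˢ 𝓝ˢ {(x₀, t₀)}) := tendsto_graph (τ := fun _ _ => t₀) tendsto_const_nhds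
  -- By monotonicity at rate c, as soon as |Γ(x, t₀)| < c d the function changes sign between t₀ - d
  -- and t₀ + d.
  have root : ∀ d, 0 < d → d < r → ∀ᶠ p in l ×ˢ 𝓝ˢ {x₀}, ∃ t, |t - t₀| ≤ d ∧ Γ p.1 (p.2, t) = 0 := by
    intro d hd hdr
    have hsmall : ∀ᶠ p in l ×ˢ 𝓝ˢ {x₀}, |Γ p.1 (p.2, t₀)| < c * d := by
      have := (h0.comp hconst).abs
      simp only [abs_zero] at this
      exact this.eventually_lt_const (by positivity)
    have hx : ∀ᶠ p : ι × E in l ×ˢ 𝓝ˢ {x₀}, p.2 ∈ Metric.ball x₀ r := by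
      refine tendsto_snd.eventually ?_
      rw [nhdsSet_singleton]
      exact Metric.ball_mem_nhds _ hr
    filter_upwards [tendsto_fst.eventually h, hsmall, hx] with p hp hs hx
    have hm : ∀ t, |t - t₀| ≤ d → (p.2, t) ∈ Metric.ball (x₀, t₀) r := by
      intro t ht
      rw [← ball_prod_same]
      refine ⟨hx, ?_⟩
      rw [Metric.mem_ball, Real.dist_eq]
      linarith
    have m0 := hm t₀ (by simp [hd.le])
    have m1 := hm (t₀ + d) (by simp [abs_of_pos hd])
    have m2 := hm (t₀ - d) (by simp [abs_of_pos hd])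
    have e1 := mul_abs_sub_le_of_le_fderiv (fun z hz => (hp z hz).1) (fun z hz => (hp z hz).2) m0 m1
      (by linarith)
    have e2 := mul_abs_sub_le_of_le_fderiv (fun z hz => (hp z hz).1) (fun z hz => (hp z hz).2) m2 m0
      (by linarith)
    have hc1 : ContinuousOn (fun t => Γ p.1 (p.2, t)) (Icc (t₀ - d) (t₀ + d)) := by
      intro t ht
      have : ContinuousAt (fun t => Γ p.1 (p.2, t)) t :=
        ContinuousAt.comp (g := Γ p.1) (f := fun t => (p.2, t))
          (hp _ (hm t (abs_le.2 ⟨by linarith [ht.1], by linarith [ht.2]⟩))).1.continuousAt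
          (by fun_prop)
      exact this.continuousWithinAt
    have hab := abs_lt.1 hs
    obtain ⟨t, ht, hzt⟩ := intermediate_value_Icc (by linarith : t₀ - d ≤ t₀ + d) hc1
      (show (0 : ℝ) ∈ Icc (Γ p.1 (p.2, t₀ - d)) (Γ p.1 (p.2, t₀ + d)) from
        ⟨by nlinarith, by nlinarith⟩)
    exact ⟨t, abs_le.2 ⟨by linarith [ht.1], by linarith [ht.2]⟩, hzt⟩
  let τ : ι → E → ℝ := fun i x =>
    if h : ∃ t, |t - t₀| ≤ r / 2 ∧ Γ i (x, t) = 0 then h.choose else t₀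
  have hτ : ∀ᶠ p in l ×ˢ 𝓝ˢ {x₀}, |τ p.1 p.2 - t₀| ≤ r / 2 ∧ Γ p.1 (p.2, τ p.1 p.2) = 0 := by
    filter_upwards [root (r / 2) (by linarith) (by linarith)] with p hp
    have : τ p.1 p.2 = hp.choose := dif_pos hp
    rw [this]
    exact hp.choose_spec
  -- The root chosen in the window of radius r/2 is unique there. It therefore coincides with the
  -- root found in any smaller window, which forces convergence to t₀.
  have ht : Tendsto (fun p : ι × E => τ p.1 p.2) (l ×ˢ 𝓝ˢ {x₀}) (𝓝 t₀) := by
    rw [Metric.tendsto_nhds]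
    intro d hd
    have hx : ∀ᶠ p : ι × E in l ×ˢ 𝓝ˢ {x₀}, p.2 ∈ Metric.ball x₀ r := by
      refine tendsto_snd.eventually ?_
      rw [nhdsSet_singleton]
      exact Metric.ball_mem_nhds _ hr
    filter_upwards [tendsto_fst.eventually h, hτ, hx,
      root (min (d / 2) (r / 2)) (by positivity) (by
        have := min_le_right (d / 2) (r / 2); linarith)] with p hp h1 hx ⟨t, h2, h3⟩
    have hm : ∀ t, |t - t₀| ≤ r / 2 → (p.2, t) ∈ Metric.ball (x₀, t₀) r := by
      intro t ht
      rw [← ball_prod_same]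
      refine ⟨hx, ?_⟩
      rw [Metric.mem_ball, Real.dist_eq]
      linarith
    have e := mul_abs_sub_le_abs_of_le_fderiv (fun z hz => (hp z hz).1) (fun z hz => (hp z hz).2)
      (hm t (h2.trans (min_le_right _ _))) (hm _ h1.1)
    rw [h1.2, h3, sub_zero, abs_zero] at e
    have : |τ p.1 p.2 - t| = 0 := by
      have := abs_nonneg (τ p.1 p.2 - t)
      nlinarith
    have : τ p.1 p.2 = t := by rw [abs_eq_zero] at this; linarith
    rw [this, Real.dist_eq]
    have := h2.trans (min_le_left _ _)
    linarith
  exact ⟨τ, ht, hτ.mono fun p hp => hp.2, implicit_cBound hG hc hder ht (hτ.mono fun p hp => hp.2)⟩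

end Discrete

/-! ### Flows of small vector fields on the unit time interval -/

section Lines

variable {E : Type} [NormedAddCommGroup E] [NormedSpace ℝ E]

/-- Projection of the line to the unit interval. -/
noncomputable abbrev toUnit (s : ℝ) : unitInterval := projIcc 0 1 zero_le_one s

/-- `γ` is an integral curve of the time dependent field `f` on `[0, 1]`, starting at `x`. -/
structure IsLine (f : unitInterval → E → E) (γ : unitInterval → E) (x : E) : Prop where
  init : γ 0 = x
  deriv : ∀ s ∈ Icc (0 : ℝ) 1,
    HasDerivWithinAt (fun s => γ (toUnit s)) (f (toUnit s) (γ (toUnit s))) (Icc 0 1) s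

theorem toUnit_coe (s : unitInterval) : toUnit (s : ℝ) = s := projIcc_val zero_le_one s

theorem toUnit_zero : toUnit 0 = 0 := projIcc_left zero_le_one

theorem toUnit_one : toUnit 1 = 1 := projIcc_right zero_le_one

theorem coe_toUnit {s : ℝ} (hs : s ∈ Icc (0 : ℝ) 1) : ((toUnit s : unitInterval) : ℝ) = s := by
  simp [toUnit, projIcc_of_mem zero_le_one hs]

theorem continuous_of_hasDerivWithinAt_unit {γ : unitInterval → E} {γ' : ℝ → E}
    (h : ∀ s ∈ Icc (0 : ℝ) 1, HasDerivWithinAt (fun s => γ (toUnit s)) (γ' s) (Icc 0 1) s) :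
    Continuous γ := by
  have h1 : ContinuousOn (fun s => γ (toUnit s)) (Icc 0 1) := fun s hs => (h s hs).continuousWithinAt
  have h2 := h1.comp_continuous continuous_subtype_val fun s : unitInterval => s.2
  simpa only [Function.comp_def, toUnit_coe] using h2

theorem IsLine.continuous {f : unitInterval → E → E} {γ : unitInterval → E} {x : E}
    (h : IsLine f γ x) : Continuous γ := continuous_of_hasDerivWithinAt_unit h.deriv

/-- Grönwall's inequality on the unit interval. -/
theorem norm_le_of_norm_deriv_le_unit {γ : unitInterval → E} {γ' : ℝ → E} {e : ℝ}
    (h : ∀ s ∈ Icc (0 : ℝ) 1, HasDerivWithinAt (fun s => γ (toUnit s)) (γ' s) (Icc 0 1) s)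
    (he : ∀ s ∈ Icc (0 : ℝ) 1, ‖γ' s‖ ≤ ‖γ (toUnit s)‖ + e) (e0 : 0 ≤ e) (s : unitInterval) :
    ‖γ s‖ ≤ 3 * (‖γ 0‖ + e) := by
  have h1 := norm_le_gronwallBound_of_norm_deriv_right_le (f := fun s => γ (toUnit s)) (f' := γ')
    (δ := ‖γ 0‖) (K := 1) (ε := e) (a := 0) (b := 1)
    (fun s hs => (h s hs).continuousWithinAt)
    (fun s hs => (h s (Ico_subset_Icc_self hs)).mono_of_mem_nhdsWithin (Icc_mem_nhdsGE_of_mem hs))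
    (by simp) (fun s hs => by simpa using he s (Ico_subset_Icc_self hs)) s s.2
  rw [toUnit_coe] at h1
  refine h1.trans ?_
  rw [gronwallBound_of_K_ne_0 one_ne_zero]
  -- The factor 3 of the statement is an upper bound for e.
  have h2 : Real.exp (1 * ((s : ℝ) - 0)) ≤ 3 := by
    have : Real.exp (1 * ((s : ℝ) - 0)) ≤ Real.exp 1 := Real.exp_le_exp.2 (by linarith [s.2.2])
    linarith [Real.exp_one_lt_d9]
  have h3 := norm_nonneg (γ 0)
  simp only [div_one]
  nlinarith

/-- The number a bounds the speed and is also the radius of the ball, so a curve cannot leave the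
ball in unit time. The fixed point of the Picard iteration is unpacked directly because this
confinement is wanted together with the equation. -/
theorem exists_isLine [CompleteSpace E] {f : unitInterval → E → E} {x : E} {a : ℝ} (ha : 0 ≤ a)
    {k : NNReal} (hL : ∀ s, LipschitzOnWith k (f s) (Metric.closedBall x a))
    (hc : ∀ y ∈ Metric.closedBall x a, Continuous fun s => f s y)
    (hb : ∀ s, ∀ y ∈ Metric.closedBall x a, ‖f s y‖ ≤ a) :
    ∃ γ : unitInterval → E, IsLine f γ x ∧ ∀ s, ‖γ s - x‖ ≤ a := by
  lift a to NNReal using ha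
  have hP : IsPicardLindelof (fun s => f (toUnit s)) (tmin := 0) (tmax := 1)
      ⟨0, by simp⟩ x a 0 a k := by
    refine ⟨fun s _ => hL _, fun y hy => ?_, fun s _ y hy => hb _ y hy, by simp⟩
    exact ((hc y hy).comp continuous_projIcc).continuousOn
  obtain ⟨α, hα⟩ := ODE.FunSpace.exists_isFixedPt_next hP (Metric.mem_closedBall_self le_rfl)
  have hd : ∀ s ∈ Icc (0 : ℝ) 1,
      HasDerivWithinAt α.compProj (f (toUnit s) (α.compProj s)) (Icc 0 1) s := by
    intro s hs
    apply ODE.hasDerivWithinAt_picard_Icc (t₀ := 0) (f := fun s => f (toUnit s)) (by simp)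
      hP.continuousOn_uncurry α.continuous_compProj.continuousOn
      (fun _ _ => α.compProj_mem_closedBall hP.mul_max_le) x hs |>.congr_of_mem _ hs
    intro t' ht'
    nth_rw 1 [← hα]
    rw [ODE.FunSpace.compProj_of_mem ht', ODE.FunSpace.next_apply]
  refine ⟨fun s => α.compProj s, ⟨?_, fun s hs => ?_⟩, fun s => ?_⟩
  · have := ODE.FunSpace.compProj_val (α := α) (t := ⟨0, by simp⟩)
    change α.compProj ((⟨0, by simp⟩ : Icc (0 : ℝ) 1) : ℝ) = x
    rw [this, ← hα, ODE.FunSpace.next_apply₀]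
  · rw [coe_toUnit hs]
    exact (hd s hs).congr (fun t ht => by rw [coe_toUnit ht]) (by rw [coe_toUnit hs])
  · have := α.compProj_mem_closedBall (t := s) hP.mul_max_le
    simpa [dist_eq_norm] using this

/-- Grönwall's inequality with Lipschitz constant 1. For equal starting points it is the uniqueness
statement. -/
theorem IsLine.norm_sub_le {f : unitInterval → E → E} {γ₁ γ₂ : unitInterval → E} {x y : E}
    {S : Set E} (h₁ : IsLine f γ₁ x) (h₂ : IsLine f γ₂ y) (hL : ∀ s, LipschitzOnWith 1 (f s) S)
    (m₁ : ∀ s, γ₁ s ∈ S) (m₂ : ∀ s, γ₂ s ∈ S) (s : unitInterval) :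
    ‖γ₁ s - γ₂ s‖ ≤ 3 * ‖x - y‖ := by
  have := norm_le_of_norm_deriv_le_unit (γ := fun s => γ₁ s - γ₂ s) (e := 0)
    (fun s hs => (h₁.deriv s hs).sub (h₂.deriv s hs))
    (fun s hs => by
      have := (hL (toUnit s)).norm_sub_le (m₁ (toUnit s)) (m₂ (toUnit s))
      simpa using this) le_rfl s
  simpa [h₁.init, h₂.init] using this

theorem continuousAt_of_forall_unit {X : Type} [TopologicalSpace X] {u : unitInterval → X → E}
    {x : X} (hc : Continuous fun s => u s x)
    (h : ∀ e > 0, ∀ᶠ y in 𝓝 x, ∀ s, ‖u s y - u s x‖ ≤ e) (s : unitInterval) :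
    ContinuousAt (Function.uncurry u) (s, x) := by
  rw [Metric.continuousAt_iff']
  intro e he
  have h1 := h (e / 3) (by positivity)
  have h2 := Metric.continuousAt_iff'.1 (hc.continuousAt (x := s)) (e / 2) (by positivity)
  rw [nhds_prod_eq]
  filter_upwards [h1.prod_inr (𝓝 s), h2.prod_inl (𝓝 x)] with p hp hq
  have h3 := hp p.1
  rw [← dist_eq_norm] at h3
  calc dist (u p.1 p.2) (u s x) ≤ dist (u p.1 p.2) (u p.1 x) + dist (u p.1 x) (u s x) :=
        dist_triangle _ _ _
    _ < e := by linarith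

/-- The flow of one small `C^1` vector field. -/
theorem exists_flow_of_small [CompleteSpace E] {f : unitInterval → E → E}
    {f' : unitInterval → E → E →L[ℝ] E} {U S : Set E} {m d : ℝ} (hU : IsOpen U)
    (hUS : ∀ x ∈ U, Metric.ball x d ⊆ S) (hm0 : 0 ≤ m) (hmd : m ≤ d / 8) (hm1 : m ≤ 1 / 8)
    (hd0 : 0 < d)
    (hder : ∀ s, ∀ x ∈ S, HasFDerivAt (f s) (f' s x) x)
    (hcf : ∀ s, ∀ x ∈ S, ContinuousAt (Function.uncurry f) (s, x))
    (hcf' : ∀ s, ∀ x ∈ S, ContinuousAt (Function.uncurry f') (s, x))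
    (hb : ∀ s, ∀ x ∈ S, ‖f s x‖ ≤ m) (hb' : ∀ s, ∀ x ∈ S, ‖f' s x‖ ≤ m) :
    ∃ (Φ : unitInterval → E → E) (M : unitInterval → E → E →L[ℝ] E), ∀ x ∈ U,
      (IsLine f (fun s => Φ s x) x ∧ ∀ s, ‖Φ s x - x‖ ≤ m) ∧
      (IsLine (fun s A => (f' s (Φ s x)).comp A) (fun s => M s x) (ContinuousLinearMap.id ℝ E) ∧
        ∀ s, ‖M s x - ContinuousLinearMap.id ℝ E‖ ≤ 2 * m) ∧
      (∀ s, HasFDerivAt (Φ s) (M s x) x) ∧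
      (∀ s, ContinuousAt (Function.uncurry Φ) (s, x)) ∧
      ∀ s, ContinuousAt (Function.uncurry M) (s, x) := by
  classical
  have hLip : ∀ x ∈ U, ∀ s, LipschitzOnWith 1 (f s) (Metric.ball x d) := by
    intro x hx s
    refine (convex_ball x d).lipschitzOnWith_of_nnnorm_hasFDerivWithin_le (f' := f' s)
      (fun y hy => (hder s y (hUS x hx hy)).hasFDerivWithinAt) fun y hy => ?_
    have := hb' s y (hUS x hx hy)
    rw [← NNReal.coe_le_coe]
    simpa using this.trans (by linarith)
  have hsub : ∀ x : E, Metric.closedBall x m ⊆ Metric.ball x (d / 2) := fun x =>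
    Metric.closedBall_subset_ball (by linarith)
  have hsub' : ∀ x : E, Metric.closedBall x m ⊆ Metric.ball x d := fun x =>
    Metric.closedBall_subset_ball (by linarith)
  have h1 : ∀ x ∈ U, ∃ γ : unitInterval → E, IsLine f γ x ∧ ∀ s, ‖γ s - x‖ ≤ m := by
    intro x hx
    refine exists_isLine hm0 (fun s => (hLip x hx s).mono (hsub' x)) ?_ ?_
    · intro y hy
      refine continuous_iff_continuousAt.2 fun s => ?_
      exact ContinuousAt.comp (g := Function.uncurry f) (f := fun s => (s, y))
        (hcf s y (hUS x hx (hsub' x hy))) (by fun_prop)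
    · intro s y hy
      exact hb s y (hUS x hx (hsub' x hy))
  choose! γ hγ hγm using h1
  have hγS : ∀ x ∈ U, ∀ s, γ x s ∈ S := fun x hx s =>
    hUS x hx (hsub' x (by simpa [dist_eq_norm] using hγm x hx s))
  have hA : ∀ x ∈ U, Continuous fun s => f' s (γ x s) := by
    intro x hx
    refine continuous_iff_continuousAt.2 fun s => ?_
    exact ContinuousAt.comp (g := Function.uncurry f') (f := fun s => (s, γ x s))
      (hcf' s _ (hγS x hx s)) (by have := (hγ x hx).continuous; fun_prop)
  -- The linearized equation along the trajectory, whose solution will be the derivative of the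
  -- flow. In the ball of radius 2m about the identity ‖A‖ ≤ 2, so the speed is at most 2m and the
  -- solution stays there.
  have h2 : ∀ x ∈ U, ∃ M : unitInterval → E →L[ℝ] E,
      IsLine (fun s A => (f' s (γ x s)).comp A) M (ContinuousLinearMap.id ℝ E) ∧
        ∀ s, ‖M s - ContinuousLinearMap.id ℝ E‖ ≤ 2 * m := by
    intro x hx
    refine exists_isLine (k := 1) (by linarith) (fun s => ?_) (fun A _ => ?_) (fun s A hA' => ?_)
    · refine LipschitzOnWith.of_dist_le_mul fun A _ B _ => ?_
      rw [dist_eq_norm, dist_eq_norm, ← ContinuousLinearMap.comp_sub]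
      refine (ContinuousLinearMap.opNorm_comp_le _ _).trans ?_
      gcongr
      exact (hb' s _ (hγS x hx s)).trans (by simp; linarith)
    · exact (hA x hx).clm_comp continuous_const
    · refine (ContinuousLinearMap.opNorm_comp_le _ _).trans ?_
      have h3 : ‖A‖ ≤ 2 := by
        have h4 : ‖A - ContinuousLinearMap.id ℝ E‖ ≤ 2 * m := by simpa [dist_eq_norm] using hA'
        have h5 : ‖ContinuousLinearMap.id ℝ E‖ ≤ 1 := ContinuousLinearMap.norm_id_le
        have h6 := norm_add_le (A - ContinuousLinearMap.id ℝ E) (ContinuousLinearMap.id ℝ E)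
        rw [sub_add_cancel] at h6
        linarith
      have h7 := hb' s _ (hγS x hx s)
      nlinarith [norm_nonneg A, norm_nonneg (f' s (γ x s))]
  choose! M hM hMm using h2
  -- closeness of nearby trajectories
  have hclose : ∀ x ∈ U, ∀ᶠ y in 𝓝 x, y ∈ U ∧ ∀ s, ‖γ y s - γ x s‖ ≤ 3 * ‖y - x‖ := by
    intro x hx
    filter_upwards [hU.mem_nhds hx, Metric.ball_mem_nhds x (half_pos hd0)] with y hy hyx
    refine ⟨hy, fun s => (hγ y hy).norm_sub_le (hγ x hx) (hLip x hx) (fun s => ?_) (fun s => ?_) s⟩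
    · have h3 : γ y s ∈ Metric.ball y (d / 2) := hsub y (by simpa [dist_eq_norm] using hγm y hy s)
      rw [Metric.mem_ball] at *
      linarith [dist_triangle (γ y s) y x]
    · exact hsub' x (by simpa [dist_eq_norm] using hγm x hx s)
  have hunif : ∀ x ∈ U, ∀ e > 0, ∃ r > 0, ∀ v, ‖v‖ < r → ∀ s,
      ‖f' s (γ x s + v) - f' s (γ x s)‖ ≤ e := by
    intro x hx e he
    have h3 : ∀ᶠ v in 𝓝 (0 : E), ∀ s ∈ (univ : Set unitInterval),
        ‖f' s (γ x s + v) - f' s (γ x s)‖ < e := by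
      refine isCompact_univ.eventually_forall_of_forall_eventually fun s _ => ?_
      have hcγ := (hγ x hx).continuous
      have c1 : ContinuousAt (fun z : E × unitInterval => f' z.2 (γ x z.2 + z.1)) (0, s) :=
        ContinuousAt.comp (g := Function.uncurry f')
          (f := fun z : E × unitInterval => (z.2, γ x z.2 + z.1))
          (by simpa using hcf' s _ (hγS x hx s)) (by fun_prop)
      have c2 : ContinuousAt (fun z : E × unitInterval => f' z.2 (γ x z.2)) (0, s) :=
        ((hA x hx).comp continuous_snd).continuousAt
      have c3 := (c1.sub c2).norm
      refine ContinuousAt.eventually_lt c3 continuousAt_const ?_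
      simpa using he
    obtain ⟨r, hr, h4⟩ := Metric.eventually_nhds_iff_ball.1 h3
    exact ⟨r, hr, fun v hv s => (h4 v (by simpa using hv) s (mem_univ s)).le⟩
  have hunif' : ∀ x ∈ U, ∀ e > 0, ∀ᶠ y in 𝓝 x, (y ∈ U ∧ ∀ s, ‖γ y s - γ x s‖ ≤ 3 * ‖y - x‖) ∧
      ∀ s, ∀ z ∈ segment ℝ (γ x s) (γ y s), z ∈ S ∧ ‖f' s z - f' s (γ x s)‖ ≤ e := by
    intro x hx e he
    obtain ⟨r, hr, h3⟩ := hunif x hx e he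
    filter_upwards [hclose x hx, Metric.ball_mem_nhds x (show 0 < min r (d / 2) / 4 by positivity)]
      with y hy hyx
    refine ⟨hy, fun s z hz => ?_⟩
    rw [mem_ball_iff_norm] at hyx
    have e1 : ‖z - γ x s‖ ≤ 3 * ‖y - x‖ := by
      have := (convex_closedBall (γ x s) (3 * ‖y - x‖)).segment_subset
        (Metric.mem_closedBall_self (by positivity))
        (by simpa [dist_eq_norm] using hy.2 s) hz
      simpa [dist_eq_norm] using this
    have e2 := min_le_left r (d / 2)
    have e3 := min_le_right r (d / 2)
    refine ⟨hUS x hx ?_, ?_⟩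
    · rw [mem_ball_iff_norm]
      have := norm_sub_le_norm_sub_add_norm_sub z (γ x s) x
      have := hγm x hx s
      linarith
    · have := h3 (z - γ x s) (by linarith) s
      simpa using this
  refine ⟨fun s x => γ x s, fun s x => M x s, fun x hx => ⟨⟨hγ x hx, hγm x hx⟩, ⟨hM x hx, hMm x hx⟩,
    fun s => ?_, ?_, ?_⟩⟩
  -- The first-order remainder starts at zero and solves the linearized equation up to an error
  -- (e/9) · 3‖y - x‖. The factor 3 of Grönwall's inequality turns this into e‖y - x‖.
  · rw [hasFDerivAt_iff_isLittleO, isLittleO_iff]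
    intro e he
    filter_upwards [hunif' x hx (e / 9) (by positivity)] with y ⟨⟨hy, hy1⟩, hy2⟩
    have hd1 : ∀ t ∈ Icc (0 : ℝ) 1, HasDerivWithinAt
        (fun t => γ y (toUnit t) - γ x (toUnit t) - M x (toUnit t) (y - x))
        (f (toUnit t) (γ y (toUnit t)) - f (toUnit t) (γ x (toUnit t)) -
          (f' (toUnit t) (γ x (toUnit t))) (M x (toUnit t) (y - x))) (Icc 0 1) t := by
      intro t ht
      refine (((hγ y hy).deriv t ht).sub ((hγ x hx).deriv t ht)).sub ?_
      have := ((hM x hx).deriv t ht).clm_apply (hasDerivWithinAt_const t (Icc 0 1) (y - x))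
      simpa using this
    have := norm_le_of_norm_deriv_le_unit
      (γ := fun s => γ y s - γ x s - M x s (y - x)) (e := e / 3 * ‖y - x‖) hd1
      (fun t ht => ?_) (by positivity) s
    · refine this.trans (le_of_eq ?_)
      simp only [(hγ y hy).init, (hγ x hx).init, (hM x hx).init]
      simp
      ring
    · set σ := toUnit t
      have e1 : ‖f σ (γ y σ) - f σ (γ x σ) - f' σ (γ x σ) (γ y σ - γ x σ)‖ ≤
          e / 9 * ‖γ y σ - γ x σ‖ := by
        refine (convex_segment (𝕜 := ℝ) (γ x σ) (γ y σ)).norm_image_sub_le_of_norm_hasFDerivWithin_le'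
          (f' := f' σ) (fun z hz => (hder σ z (hy2 σ z hz).1).hasFDerivWithinAt)
          (fun z hz => (hy2 σ z hz).2) (left_mem_segment ℝ _ _) (right_mem_segment ℝ _ _)
      have e2 : f σ (γ y σ) - f σ (γ x σ) - (f' σ (γ x σ)) (M x σ (y - x)) =
          f' σ (γ x σ) (γ y σ - γ x σ - M x σ (y - x)) +
          (f σ (γ y σ) - f σ (γ x σ) - f' σ (γ x σ) (γ y σ - γ x σ)) := by
        simp only [map_sub]; abel
      rw [e2]
      refine (norm_add_le _ _).trans (add_le_add ?_ ?_)
      · refine ((f' σ (γ x σ)).le_opNorm _).trans ?_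
        have := hb' σ _ (hγS x hx σ)
        nlinarith [norm_nonneg (γ y σ - γ x σ - M x σ (y - x))]
      · refine e1.trans ?_
        have := hy1 σ
        nlinarith
  · refine continuousAt_of_forall_unit (u := fun s x => γ x s) (hγ x hx).continuous fun e he => ?_
    filter_upwards [hclose x hx, Metric.ball_mem_nhds x (show 0 < e / 3 by positivity)] with y hy hyx s
    rw [mem_ball_iff_norm] at hyx
    linarith [hy.2 s]
  · refine continuousAt_of_forall_unit (u := fun s x => M x s) (hM x hx).continuous fun e he => ?_
    filter_upwards [hunif' x hx (e / 6) (by positivity)] with y ⟨⟨hy, hy1⟩, hy2⟩ s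
    have := norm_le_of_norm_deriv_le_unit (γ := fun s => M y s - M x s) (e := e / 3)
      (fun t ht => ((hM y hy).deriv t ht).sub ((hM x hx).deriv t ht)) (fun t ht => ?_)
      (by positivity) s
    · refine this.trans (le_of_eq ?_)
      simp [(hM x hx).init, (hM y hy).init]
      ring
    · set σ := toUnit t
      have e1 : (f' σ (γ y σ)).comp (M y σ) - (f' σ (γ x σ)).comp (M x σ) =
          (f' σ (γ x σ)).comp (M y σ - M x σ) + (f' σ (γ y σ) - f' σ (γ x σ)).comp (M y σ) := by
        simp only [ContinuousLinearMap.comp_sub, ContinuousLinearMap.sub_comp]; abel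
      rw [e1]
      refine (norm_add_le _ _).trans (add_le_add ?_ ?_)
      · refine (ContinuousLinearMap.opNorm_comp_le _ _).trans ?_
        have := hb' σ _ (hγS x hx σ)
        nlinarith [norm_nonneg (M y σ - M x σ)]
      · refine (ContinuousLinearMap.opNorm_comp_le _ _).trans ?_
        have h3 : ‖M y σ‖ ≤ 2 := by
          have h4 := hMm y hy σ
          have h5 : ‖ContinuousLinearMap.id ℝ E‖ ≤ 1 := ContinuousLinearMap.norm_id_le
          have h6 := norm_add_le (M y σ - ContinuousLinearMap.id ℝ E) (ContinuousLinearMap.id ℝ E)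
          rw [sub_add_cancel] at h6
          linarith
        have h4 := (hy2 σ _ (right_mem_segment ℝ _ _)).2
        nlinarith [norm_nonneg (M y σ), norm_nonneg (f' σ (γ y σ) - f' σ (γ x σ))]

end Lines

section SmallFlow

variable {ι E : Type} [TopologicalSpace ι] [DiscreteTopology ι]
  [NormedAddCommGroup E] [NormedSpace ℝ E] [CompleteSpace E] {l : Filter ι} {K : Set E} {μ : ι → ℝ}

/-- The filter ⊤ on the unit interval makes eventual statements uniform in time. -/
theorem eventually_unit {ι E : Type} [TopologicalSpace E] {l : Filter ι} {K : Set E}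
    {P : (ι × unitInterval) × E → Prop} :
    (∀ᶠ p in (l ×ˢ (⊤ : Filter unitInterval)) ×ˢ 𝓝ˢ K, P p) ↔
      ∀ᶠ p in l ×ˢ 𝓝ˢ K, ∀ s, P ((p.1, s), p.2) := by
  constructor
  · intro h
    obtain ⟨A, hA, B, hB, hAB⟩ := eventually_prod_iff.1 h
    obtain ⟨A1, hA1, A2, hA2, h12⟩ := eventually_prod_iff.1 hA
    refine eventually_prod_iff.2 ⟨A1, hA1, B, hB, fun hx y hy s => hAB (h12 hx ?_) hy⟩
    exact eventually_top.1 hA2 s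
  · intro h
    obtain ⟨A, hA, B, hB, hAB⟩ := eventually_prod_iff.1 h
    refine eventually_prod_iff.2 ⟨fun q => A q.1, hA.prod_inl _, B, hB, ?_⟩
    rintro ⟨i, s⟩ hi y hy
    exact hAB hi hy s

theorem exists_thickening_of_eventually {ι E : Type} [PseudoMetricSpace E] {l : Filter ι}
    {K : Set E} (hK : IsCompact K) {P : ι × E → Prop} (h : ∀ᶠ p in l ×ˢ 𝓝ˢ K, P p) :
    ∃ d > 0, ∀ᶠ i in l, ∀ x ∈ Metric.thickening d K, P (i, x) := by
  obtain ⟨A, hA, B, hB, hAB⟩ := eventually_prod_iff.1 h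
  obtain ⟨d, hd, hdB⟩ := (Metric.hasBasis_nhdsSet_thickening hK).mem_iff.1 hB
  exact ⟨d, hd, hA.mono fun i hi x hx => hAB hi (hdB hx)⟩

theorem eventually_of_exists_thickening {ι E : Type} [PseudoMetricSpace E] {l : Filter ι}
    {K : Set E} {P : ι × E → Prop} {d : ℝ} (hd : 0 < d)
    (h : ∀ᶠ i in l, ∀ x ∈ Metric.thickening d K, P (i, x)) : ∀ᶠ p in l ×ˢ 𝓝ˢ K, P p :=
  eventually_prod_iff.2 ⟨_, h, _, Metric.isOpen_thickening.mem_nhdsSet.2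
    (Metric.self_subset_thickening hd K), fun hi _ hy => hi _ hy⟩

theorem continuousAt_uncurry_unit {F : Type} [TopologicalSpace F] {f : ι × unitInterval → E → F}
    {i : ι} {s : unitInterval} {x : E} :
    ContinuousAt (Function.uncurry f) ((i, s), x) ↔
      ContinuousAt (Function.uncurry fun s => f (i, s)) (s, x) := by
  have h1 : 𝓝 ((i, s), x) = map (fun q : unitInterval × E => ((i, q.1), q.2)) (𝓝 (s, x)) := by
    rw [nhds_prod_eq, nhds_prod_of_discrete, nhds_prod_eq]
    simp only
    rw [← Filter.map_id (f := 𝓝 x), Filter.prod_map_map_eq, Filter.map_id]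
    rfl
  rw [ContinuousAt, h1, tendsto_map'_iff]
  rfl

/-- The C^1 case. The derivative M is returned together with its own equation, since higher orders
are obtained by applying the theory to the pair (Φ, M). -/
theorem exists_smallFlow_one (hK : IsCompact K) (hμ : Tendsto μ l (𝓝 0))
    {g : ι × unitInterval → E → E} {g' : ι × unitInterval → E → E →L[ℝ] E}
    (hg0 : CBound (l ×ˢ ⊤) K (fun j => μ j.1) 0 g) (hg1 : CBound (l ×ˢ ⊤) K (fun j => μ j.1) 0 g')
    (hgg : ∀ᶠ p in (l ×ˢ ⊤) ×ˢ 𝓝ˢ K, HasFDerivAt (g p.1) (g' p.1 p.2) p.2) :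
    ∃ (Φ : ι × unitInterval → E → E) (M : ι × unitInterval → E → E →L[ℝ] E),
      (∀ᶠ p in l ×ˢ 𝓝ˢ K, IsLine (fun s => g (p.1, s)) (fun s => Φ (p.1, s) p.2) p.2 ∧
        IsLine (fun s A => (g' (p.1, s) (Φ (p.1, s) p.2)).comp A) (fun s => M (p.1, s) p.2)
          (ContinuousLinearMap.id ℝ E)) ∧
      (∀ᶠ p in (l ×ˢ ⊤) ×ˢ 𝓝ˢ K, HasFDerivAt (Φ p.1) (M p.1 p.2) p.2) ∧
      CBound (l ×ˢ ⊤) K (fun j => μ j.1) 0 (fun j x => Φ j x - x) ∧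
      CBound (l ×ˢ ⊤) K (fun j => μ j.1) 0 (fun j x => M j x - ContinuousLinearMap.id ℝ E) := by
  classical
  obtain ⟨C, hC0, hC⟩ := hg0.2.exists_pos
  obtain ⟨C', hC0', hC'⟩ := hg1.2.exists_pos
  obtain ⟨d, hd, h⟩ := exists_thickening_of_eventually hK (eventually_unit.1
    (hgg.and (hg0.1.and (hg1.1.and (hC.bound.and hC'.bound)))))
  set D := max C C'
  have hD : 0 < D := lt_max_of_lt_left hC0
  have hsmall : ∀ᶠ i in l, D * |μ i| ≤ min (d / 16) (1 / 8) := by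
    have : Tendsto (fun i => D * |μ i|) l (𝓝 0) := by simpa using hμ.abs.const_mul D
    exact (this.eventually_lt_const (show (0 : ℝ) < min (d / 16) (1 / 8) by positivity)).mono
      fun i hi => hi.le
  let Q : ι → (unitInterval → E → E) → (unitInterval → E → E →L[ℝ] E) → E → Prop := fun i Φ M x =>
    (IsLine (fun s => g (i, s)) (fun s => Φ s x) x ∧ ∀ s, ‖Φ s x - x‖ ≤ D * |μ i|) ∧
      (IsLine (fun s A => (g' (i, s) (Φ s x)).comp A) (fun s => M s x) (ContinuousLinearMap.id ℝ E) ∧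
        ∀ s, ‖M s x - ContinuousLinearMap.id ℝ E‖ ≤ 2 * (D * |μ i|)) ∧
      (∀ s, HasFDerivAt (Φ s) (M s x) x) ∧
      (∀ s, ContinuousAt (Function.uncurry Φ) (s, x)) ∧
      ∀ s, ContinuousAt (Function.uncurry M) (s, x)
  have key : ∀ᶠ i in l, ∃ Φ M, ∀ x ∈ Metric.thickening (d / 2) K, Q i Φ M x := by
    filter_upwards [h, hsmall] with i hi hs
    refine exists_flow_of_small (d := d / 2) (S := Metric.thickening d K) (f := fun s => g (i, s))
      (f' := fun s => g' (i, s)) Metric.isOpen_thickening ?_ (by positivity)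
      (hs.trans (by linarith [min_le_left (d / 16) (1 / 8)])) (hs.trans (min_le_right _ _))
      (by positivity) (fun s x hx => (hi x hx s).1)
      (fun s x hx => continuousAt_uncurry_unit.1 (hi x hx s).2.1)
      (fun s x hx => continuousAt_uncurry_unit.1 (hi x hx s).2.2.1)
      (fun s x hx => (hi x hx s).2.2.2.1.trans ?_) (fun s x hx => (hi x hx s).2.2.2.2.trans ?_)
    · intro x hx y hy
      obtain ⟨z, hz, hxz⟩ := Metric.mem_thickening_iff.1 hx
      rw [Metric.mem_ball] at hy
      refine Metric.mem_thickening_iff.2 ⟨z, hz, ?_⟩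
      linarith [dist_triangle y x z]
    · simp only [Real.norm_eq_abs]
      gcongr
      exact le_max_left _ _
    · simp only [Real.norm_eq_abs]
      gcongr
      exact le_max_right _ _
  -- The flow exists only for indices far along the filter; elsewhere the values are arbitrary.
  let Φ : ι × unitInterval → E → E := fun j x =>
    if h : ∃ Φ M, ∀ x ∈ Metric.thickening (d / 2) K, Q j.1 Φ M x then h.choose j.2 x else x
  let M : ι × unitInterval → E → E →L[ℝ] E := fun j x =>
    if h : ∃ Φ M, ∀ x ∈ Metric.thickening (d / 2) K, Q j.1 Φ M x then h.choose_spec.choose j.2 x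
    else 0
  have main : ∀ᶠ p in l ×ˢ 𝓝ˢ K, Q p.1 (fun s => Φ (p.1, s)) (fun s => M (p.1, s)) p.2 := by
    refine eventually_of_exists_thickening (half_pos hd) ?_
    filter_upwards [key] with i hi
    have e1 : ∀ s, Φ (i, s) = hi.choose s := fun s => by
      funext x; exact dif_pos hi
    have e2 : ∀ s, M (i, s) = hi.choose_spec.choose s := fun s => by
      funext x; exact dif_pos hi
    simp only [e1, e2]
    exact hi.choose_spec.choose_spec
  refine ⟨Φ, M, ?_, ?_, ⟨?_, ?_⟩, ?_, ?_⟩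
  · filter_upwards [main] with p hp using ⟨hp.1.1, hp.2.1.1⟩
  · rw [eventually_unit]
    filter_upwards [main] with p hp s using hp.2.2.1 s
  · rw [eventually_unit]
    filter_upwards [main] with p hp s
    have : ContinuousAt (Function.uncurry Φ) ((p.1, s), p.2) :=
      continuousAt_uncurry_unit.2 (hp.2.2.2.1 s)
    exact this.sub continuousAt_snd
  · refine IsBigO.of_bound D ?_
    rw [eventually_unit]
    filter_upwards [main] with p hp s using hp.1.2 s
  · rw [eventually_unit]
    filter_upwards [main] with p hp s
    have : ContinuousAt (Function.uncurry M) ((p.1, s), p.2) :=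
      continuousAt_uncurry_unit.2 (hp.2.2.2.2 s)
    exact this.sub continuousAt_const
  · refine IsBigO.of_bound (2 * D) ?_
    rw [eventually_unit]
    filter_upwards [main] with p hp s
    have := hp.2.1.2 s
    simpa [mul_assoc] using this

/-- The flow of a family of vector fields which is `O(μ)` in `C^{n+1}`, `μ → 0`, exists on the unit
time interval and is `O(μ)`-close to the identity in `C^{n+1}`. -/
theorem exists_smallFlow (n : ℕ) (hK : IsCompact K) (hμ : Tendsto μ l (𝓝 0))
    {g : ι × unitInterval → E → E} (hg : CBound (l ×ˢ ⊤) K (fun j => μ j.1) (n + 1) g) :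
    ∃ Φ : ι × unitInterval → E → E,
      (∀ᶠ p in l ×ˢ 𝓝ˢ K, IsLine (fun s => g (p.1, s)) (fun s => Φ (p.1, s) p.2) p.2) ∧
      CBound (l ×ˢ ⊤) K (fun j => μ j.1) (n + 1) (fun j x => Φ j x - x) := by
  induction n generalizing E with
  | zero =>
    obtain ⟨h0, g', hg', h1⟩ := hg
    obtain ⟨Φ, M, hl, hd, b1, b2⟩ := exists_smallFlow_one hK hμ h0 h1 hg'
    refine ⟨Φ, hl.mono fun p hp => hp.1, b1, fun j x => M j x - ContinuousLinearMap.id ℝ E, ?_, b2⟩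
    filter_upwards [hd] with p hp using hp.sub (hasFDerivAt_id _)
  | succ n ih =>
    have hg2 := hg
    obtain ⟨h0, g', hg', h1⟩ := hg2
    obtain ⟨Φ, M, hl, hd, b1, b2⟩ := exists_smallFlow_one hK hμ h0 (CBound.zero h1) hg'
    -- The pair of the flow and its derivative is the flow of (x, A) ↦ (g(x), g'(x) A) started at
    -- (x, id). This field is still O(μ), with one order less. The induction hypothesis on the
    -- larger space makes the derivative of the flow regular, which raises the order of the flow by
    -- one.
    set K₂ : Set (E × (E →L[ℝ] E)) := K ×ˢ {ContinuousLinearMap.id ℝ E} with hK₂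
    have hcK₂ : IsCompact K₂ := hK.prod isCompact_singleton
    set G : ι × unitInterval → E × (E →L[ℝ] E) → E × (E →L[ℝ] E) := fun j z =>
      (g j z.1, (g' j z.1).comp z.2) with hG
    have hfst : Tendsto (fun p : (ι × unitInterval) × (E × (E →L[ℝ] E)) => (p.1, p.2.1))
        ((l ×ˢ ⊤) ×ˢ 𝓝ˢ K₂) ((l ×ˢ ⊤) ×ˢ 𝓝ˢ K) := by
      refine tendsto_fst.prodMk (Tendsto.comp ?_ tendsto_snd)
      exact continuous_fst.tendsto_nhdsSet fun z hz => hz.1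
    have hGb : CBound (l ×ˢ ⊤) K₂ (fun j => μ j.1) (n + 1) G := by
      have p1 : CBound (l ×ˢ (⊤ : Filter unitInterval)) K₂ (fun _ : ι × unitInterval => (1 : ℝ)) (n + 1)
          fun _ z => z.1 := CBound.clm_id hcK₂ (ContinuousLinearMap.fst ℝ E (E →L[ℝ] E))
      have p2 : CBound (l ×ˢ (⊤ : Filter unitInterval)) K₂ (fun _ : ι × unitInterval => (1 : ℝ)) (n + 1)
          fun _ z => z.2 := CBound.clm_id hcK₂ (ContinuousLinearMap.snd ℝ E (E →L[ℝ] E))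
      refine CBound.prodMk (hg.pred.comp p1 (j := fun j => j) continuous_id hfst) ?_
      exact (CBound.comp (g := g') h1 p1 (j := fun j => j) continuous_id hfst).bilin_left
        (ContinuousLinearMap.compL ℝ E E E) p2
    obtain ⟨Ψ, hΨl, hΨb⟩ := ih hcK₂ hGb
    have hins : Tendsto (fun p : (ι × unitInterval) × E => (p.1, (p.2, ContinuousLinearMap.id ℝ E)))
        ((l ×ˢ ⊤) ×ˢ 𝓝ˢ K) ((l ×ˢ ⊤) ×ˢ 𝓝ˢ K₂) := by
      have : Continuous fun x : E => (x, ContinuousLinearMap.id ℝ E) := by fun_prop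
      have h2 : Tendsto (fun x : E => (x, ContinuousLinearMap.id ℝ E)) (𝓝ˢ K) (𝓝ˢ K₂) :=
        this.tendsto_nhdsSet fun z hz => ⟨hz, rfl⟩
      exact tendsto_fst.prodMk (h2.comp tendsto_snd)
    have hins' : Tendsto (fun p : ι × E => (p.1, (p.2, ContinuousLinearMap.id ℝ E)))
        (l ×ˢ 𝓝ˢ K) (l ×ˢ 𝓝ˢ K₂) := by
      have : Continuous fun x : E => (x, ContinuousLinearMap.id ℝ E) := by fun_prop
      have h2 : Tendsto (fun x : E => (x, ContinuousLinearMap.id ℝ E)) (𝓝ˢ K) (𝓝ˢ K₂) :=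
        this.tendsto_nhdsSet fun z hz => ⟨hz, rfl⟩
      exact tendsto_fst.prodMk (h2.comp tendsto_snd)
    have hμ' : Tendsto (fun j : ι × unitInterval => μ j.1) (l ×ˢ ⊤) (𝓝 0) := hμ.comp tendsto_fst
    -- the derivative of the flow is the second component of the flow of the extended field
    have hMΨ : ∀ᶠ p in (l ×ˢ ⊤) ×ˢ 𝓝ˢ K, M p.1 p.2 = (Ψ p.1 (p.2, ContinuousLinearMap.id ℝ E)).2 := by
      obtain ⟨-, G', hG', hGb'⟩ := hGb
      have hsm := (CBound.zero hGb').tendsto_zero hμ'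
      have hLs : ∀ᶠ p in (l ×ˢ ⊤) ×ˢ 𝓝ˢ K₂, HasFDerivAt (G p.1) (G' p.1 p.2) p.2 ∧ ‖G' p.1 p.2‖ ≤ 1 := by
        refine hG'.and ?_
        have := hsm.norm
        simp only [norm_zero] at this
        exact (this.eventually_lt_const one_pos).mono fun p hp => hp.le
      obtain ⟨d, hd0, hL⟩ := exists_thickening_of_eventually hcK₂ (eventually_unit.1 hLs)
      have s1 := (b1.tendsto_zero hμ').norm
      have s2 := (b2.tendsto_zero hμ').norm
      have s3 := ((hΨb.tendsto_zero hμ').comp hins).norm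
      simp only [norm_zero] at s1 s2 s3
      have t1 := eventually_unit.1 (s1.eventually_lt_const (half_pos hd0))
      have t2 := eventually_unit.1 (s2.eventually_lt_const (half_pos hd0))
      have t3 := eventually_unit.1 (s3.eventually_lt_const (half_pos hd0))
      have hx : ∀ᶠ p : ι × E in l ×ˢ 𝓝ˢ K, p.2 ∈ Metric.thickening (d / 2) K :=
        tendsto_snd.eventually (Metric.isOpen_thickening.mem_nhdsSet.2
          (Metric.self_subset_thickening (half_pos hd0) K))
      rw [eventually_unit]
      filter_upwards [t1, t2, t3, hl, hins'.eventually hΨl, tendsto_fst.eventually hL, hx]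
        with p q1 q2 q3 ⟨q4, q5⟩ q6 q7 q8 s
      have hball : Metric.ball (p.2, ContinuousLinearMap.id ℝ E) (d / 2) ⊆ Metric.thickening d K₂ := by
        intro z hz
        obtain ⟨y, hy, hxy⟩ := Metric.mem_thickening_iff.1 q8
        refine Metric.mem_thickening_iff.2 ⟨(y, ContinuousLinearMap.id ℝ E), ⟨hy, rfl⟩, ?_⟩
        rw [Metric.mem_ball] at hz
        have e1 : dist (p.2, ContinuousLinearMap.id ℝ E) (y, ContinuousLinearMap.id ℝ E) = dist p.2 y := by
          simp [Prod.dist_eq]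
        linarith [dist_triangle z (p.2, ContinuousLinearMap.id ℝ E) (y, ContinuousLinearMap.id ℝ E)]
      have hLip : ∀ s, LipschitzOnWith 1 (G (p.1, s))
          (Metric.ball (p.2, ContinuousLinearMap.id ℝ E) (d / 2)) := by
        intro s
        refine (convex_ball _ _).lipschitzOnWith_of_nnnorm_hasFDerivWithin_le (f' := G' (p.1, s))
          (fun y hy => (q7 y (hball hy) s).1.hasFDerivWithinAt) fun y hy => ?_
        rw [← NNReal.coe_le_coe]
        simpa using (q7 y (hball hy) s).2
      have hline : IsLine (fun s => G (p.1, s)) (fun s => (Φ (p.1, s) p.2, M (p.1, s) p.2))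
          (p.2, ContinuousLinearMap.id ℝ E) :=
        ⟨by rw [q4.init, q5.init], fun s hs => (q4.deriv s hs).prodMk (q5.deriv s hs)⟩
      have := hline.norm_sub_le q6 hLip (fun s => ?_) (fun s => ?_) s
      · rw [sub_self, norm_zero, mul_zero] at this
        have h2 := norm_le_zero_iff.1 this
        exact (congrArg Prod.snd (sub_eq_zero.1 h2))
      · rw [mem_ball_iff_norm, Prod.norm_def]
        exact max_lt (q1 s) (q2 s)
      · rw [mem_ball_iff_norm]
        exact q3 s
    refine ⟨Φ, hl.mono fun p hp => hp.1, b1,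
      fun j x => (Ψ j (x, ContinuousLinearMap.id ℝ E)).2 - ContinuousLinearMap.id ℝ E, ?_, ?_⟩
    · filter_upwards [hd, hMΨ] with p hp hq
      rw [← hq]
      exact hp.sub (hasFDerivAt_id _)
    · have := CBound.comp (g := fun j z => Ψ j z - z) hΨb
        (f := fun _ x => (x, ContinuousLinearMap.id ℝ E))
        ((CBound.id hK).prodMk (CBound.const _)) (j := fun j => j) continuous_id hins
      exact this.snd

end SmallFlow

/-! ### Inverse functions and changes of time -/

/-- The uniform lower bound on the derivative makes u surjective, so the inverse is global. It
serves to change the time and to invert the barrier gauge. -/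
theorem exists_inverse_of_deriv_pos {u u' : ℝ → ℝ} {c : ℝ} (hc : 0 < c)
    (hu : ∀ s, HasDerivAt u (u' s) s) (hu' : ∀ s, c ≤ u' s) :
    ∃ σ : ℝ → ℝ, (∀ t, u (σ t) = t) ∧ (∀ s, σ (u s) = s) ∧ StrictMono σ ∧
      ∀ t, HasDerivAt σ (u' (σ t))⁻¹ t := by
  have hdiff : Differentiable ℝ u := fun s => (hu s).differentiableAt
  have hmono : StrictMono u := strictMono_of_deriv_pos fun s => by
    rw [(hu s).deriv]; linarith [hu' s]
  have hgrow : ∀ s t, s ≤ t → c * (t - s) ≤ u t - u s :=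
    fun s t hst => mul_sub_le_image_sub_of_le_deriv hdiff
      (fun s => by rw [(hu s).deriv]; exact hu' s) hst
  have htop : Tendsto u atTop atTop := by
    have : Tendsto (fun s => u 0 + c * s) atTop atTop :=
      tendsto_atTop_add_const_left _ _ (tendsto_id.const_mul_atTop hc)
    refine tendsto_atTop_mono' _ ?_ this
    filter_upwards [eventually_ge_atTop 0] with s hs
    linarith [hgrow 0 s hs]
  have hbot : Tendsto u atBot atBot := by
    have : Tendsto (fun s => u 0 + c * s) atBot atBot :=
      tendsto_atBot_add_const_left _ _ (tendsto_id.const_mul_atBot hc)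
    refine tendsto_atBot_mono' _ ?_ this
    filter_upwards [eventually_le_atBot 0] with s hs
    linarith [hgrow s 0 hs]
  have hsurj : Function.Surjective u := hdiff.continuous.surjective htop hbot
  let e := hmono.orderIsoOfSurjective u hsurj
  have h1 : ∀ t, u (e.symm t) = t := fun t => e.apply_symm_apply t
  refine ⟨e.symm, h1, fun s => e.symm_apply_apply s, e.symm.strictMono, fun t => ?_⟩
  exact HasDerivAt.of_local_left_inverse e.symm.continuous.continuousAt (hu _)
    (by have := hu' (e.symm t); exact (hc.trans_le this).ne') (Eventually.of_forall h1)

section Ham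

variable {d : ℕ} {V : Pos d → ℝ} {P P' : Pos d → Prop} {ρ ρ' ρ'' : Phase d} {τ σ : ℝ}

/-- The motion in the potential `V` leads from `ρ` to `ρ'` in time `τ`, through positions
satisfying `P`. -/
def HamSeg (V : Pos d → ℝ) (P : Pos d → Prop) (ρ : Phase d) (τ : ℝ) (ρ' : Phase d) : Prop :=
  0 ≤ τ ∧ ∃ x : ℝ → Phase d, IsHamOrbit V τ x ∧ x 0 = ρ ∧ x τ = ρ' ∧ ∀ s ∈ Ioo 0 τ, P (x s).1

theorem HamSeg.mono (h : HamSeg V P ρ τ ρ') (hP : ∀ q, P q → P' q) : HamSeg V P' ρ τ ρ' := by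
  obtain ⟨h0, x, hx, h1, h2, h3⟩ := h
  exact ⟨h0, x, hx, h1, h2, fun s hs => hP _ (h3 s hs)⟩

theorem IsHamOrbit.mono {x : ℝ → Phase d} (h : IsHamOrbit V τ x) (hσ : σ ≤ τ) : IsHamOrbit V σ x :=
  fun s hs => (h s ⟨hs.1, hs.2.trans hσ⟩).mono (Icc_subset_Icc_right hσ)

theorem IsHamOrbit.concat {x y : ℝ → Phase d} (hx : IsHamOrbit V τ x) (hy : IsHamOrbit V σ y)
    (hτ : 0 ≤ τ) (hσ : 0 ≤ σ) (hxy : y 0 = x τ) :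
    IsHamOrbit V (τ + σ) fun s => if s ≤ τ then x s else y (s - τ) := by
  intro s hs
  have hu : Icc 0 (τ + σ) = Icc 0 τ ∪ Icc τ (τ + σ) :=
    (Icc_union_Icc_eq_Icc hτ (by linarith)).symm
  rw [hu]
  have hval : ∀ t, τ ≤ t → (if t ≤ τ then x t else y (t - τ)) = y (t - τ) := by
    intro t ht
    rcases ht.eq_or_lt with rfl | h
    · simp [hxy]
    · simp [not_le.2 h]
  refine HasDerivWithinAt.union ?_ ?_
  · by_cases h : s ≤ τ
    · simp only [h, if_true]
      exact (hx s ⟨hs.1, h⟩).congr (fun t ht => by simp [ht.2]) (by simp [h])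
    · refine HasFDerivWithinAt.of_notMem_closure ?_
      rw [isClosed_Icc.closure_eq]
      exact fun h' => h h'.2
  · by_cases h : τ ≤ s
    · simp only [hval s h]
      have h1 : HasDerivWithinAt (fun t => y (t - τ)) ((y (s - τ)).2, -gradient V (y (s - τ)).1)
          (Icc τ (τ + σ)) s := by
        have h2 : HasDerivWithinAt (fun t : ℝ => t - τ) 1 (Icc τ (τ + σ)) s :=
          (hasDerivWithinAt_id _ _).sub_const τ
        have h3 : MapsTo (fun t : ℝ => t - τ) (Icc τ (τ + σ)) (Icc 0 σ) :=
          fun t ht => ⟨sub_nonneg.2 ht.1, by linarith [ht.2]⟩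
        have := (hy (s - τ) ⟨by linarith, by linarith [hs.2]⟩).scomp s h2 h3
        rw [one_smul] at this
        exact this
      exact h1.congr (fun t ht => hval t ht.1) (hval s h)
    · refine HasFDerivWithinAt.of_notMem_closure ?_
      rw [isClosed_Icc.closure_eq]
      exact fun h' => h h'.1

theorem HamSeg.trans (h : HamSeg V P ρ τ ρ') (hP : P ρ'.1) (h' : HamSeg V P ρ' σ ρ'') :
    HamSeg V P ρ (τ + σ) ρ'' := by
  obtain ⟨h0, x, hx, h1, h2, h3⟩ := h
  obtain ⟨k0, y, hy, k1, k2, k3⟩ := h'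
  refine ⟨by linarith, _, hx.concat hy h0 k0 (k1.trans h2.symm), by simp [h0, h1], ?_, ?_⟩
  · by_cases hσ : σ = 0
    · subst hσ
      simp [h2, ← k1, ← k2]
    · have : ¬ τ + σ ≤ τ := by
        have := lt_of_le_of_ne k0 (Ne.symm hσ)
        linarith
      simp [this, k2]
  · intro s hs
    rcases lt_trichotomy s τ with h | h | h
    · simpa [h.le] using h3 s ⟨hs.1, h⟩
    · simpa [h, h2] using hP
    · simpa [not_le.2 h] using k3 (s - τ) ⟨by linarith, by linarith [hs.2]⟩

theorem IsHamOrbit.continuousOn {x : ℝ → Phase d} (h : IsHamOrbit V τ x) :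
    ContinuousOn x (Icc 0 τ) := fun s hs => (h s hs).continuousWithinAt

theorem contDiff_gradient {n : WithTop ℕ∞} (hV : ContDiff ℝ (n + 1) V) : ContDiff ℝ n (gradient V) :=
  (InnerProductSpace.toDual ℝ (Pos d)).symm.contDiff.comp (hV.fderiv_right le_rfl)

theorem IsHamOrbit.eqOn {x y : ℝ → Phase d} (hV : ContDiff ℝ 2 V) (hx : IsHamOrbit V τ x)
    (hy : IsHamOrbit V τ y) (h0 : x 0 = y 0) : EqOn x y (Icc 0 τ) := by
  have hc : IsCompact (x '' Icc 0 τ ∪ y '' Icc 0 τ) :=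
    (isCompact_Icc.image_of_continuousOn hx.continuousOn).union
      (isCompact_Icc.image_of_continuousOn hy.continuousOn)
  obtain ⟨R, hR⟩ := hc.isBounded.subset_closedBall (0 : Phase d)
  have hf : ContDiff ℝ 1 fun z : Phase d => (z.2, -gradient V z.1) := by
    have := contDiff_gradient (n := 1) hV
    exact contDiff_snd.prodMk (this.comp contDiff_fst).neg
  obtain ⟨k, hk⟩ := hf.contDiffOn.exists_lipschitzOnWith one_ne_zero (convex_closedBall (0 : Phase d) R)
    (isCompact_closedBall _ _)
  have cast : ∀ {z : ℝ → Phase d}, IsHamOrbit V τ z → ∀ s ∈ Ico 0 τ,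
      HasDerivWithinAt z ((z s).2, -gradient V (z s).1) (Ici s) s := fun hz s hs =>
    (hz s (Ico_subset_Icc_self hs)).mono_of_mem_nhdsWithin (Icc_mem_nhdsGE_of_mem hs)
  refine ODE_solution_unique_of_mem_Icc_right (v := fun _ z => (z.2, -gradient V z.1))
    (s := fun _ => Metric.closedBall 0 R) (K := k) (fun s _ => hk) hx.continuousOn
    (cast hx) (fun s hs => hR (Or.inl ⟨s, Ico_subset_Icc_self hs, rfl⟩)) hy.continuousOn (cast hy)
    (fun s hs => hR (Or.inr ⟨s, Ico_subset_Icc_self hs, rfl⟩)) h0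

theorem HamSeg.unique (hV : ContDiff ℝ 2 V) (h : HamSeg V P ρ τ ρ') (h' : HamSeg V P' ρ τ ρ'') :
    ρ' = ρ'' := by
  obtain ⟨h0, x, hx, h1, h2, -⟩ := h
  obtain ⟨-, y, hy, k1, k2, -⟩ := h'
  rw [← h2, ← k2]
  exact hx.eqOn hV hy (h1.trans k1.symm) ⟨h0, le_rfl⟩

/-- A curve with the right direction can be reparametrized by the physical time. -/
theorem hamSeg_of_gauge {X : unitInterval → Phase d} {T m : unitInterval → ℝ} (hm : Continuous m)
    (hm0 : ∀ s, 0 < m s)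
    (hX : ∀ s ∈ Icc (0 : ℝ) 1, HasDerivWithinAt (fun s => X (toUnit s))
      (m (toUnit s) • ((X (toUnit s)).2, -gradient V (X (toUnit s)).1)) (Icc 0 1) s)
    (hT : ∀ s ∈ Icc (0 : ℝ) 1, HasDerivWithinAt (fun s => T (toUnit s)) (m (toUnit s)) (Icc 0 1) s)
    (hT0 : T 0 = 0) (hP : ∀ s : unitInterval, 0 < s → s < 1 → P (X s).1) :
    0 < T 1 ∧ HamSeg V P (X 0) (T 1) (X 1) := by
  -- The minimum of the clock rate m is a positive lower bound. It persists for the extension of m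
  -- to the real line by constants, whose primitive can then be inverted.
  obtain ⟨s₀, -, hs₀⟩ := isCompact_univ.exists_isMinOn univ_nonempty hm.continuousOn
  have hmin : ∀ s, m s₀ ≤ m s := fun s => hs₀ (mem_univ s)
  have hmc : Continuous fun s : ℝ => m (toUnit s) := hm.comp continuous_projIcc
  have hder : ∀ s, HasDerivAt (fun s => ∫ u in (0 : ℝ)..s, m (toUnit u)) (m (toUnit s)) s :=
    fun s => intervalIntegral.integral_hasDerivAt_right (hmc.intervalIntegrable _ _)
      (hmc.stronglyMeasurableAtFilter _ _) hmc.continuousAt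
  set M : ℝ → ℝ := fun s => ∫ u in (0 : ℝ)..s, m (toUnit u) with hM
  obtain ⟨σ, h1, h2, h3, h4⟩ := exists_inverse_of_deriv_pos (hm0 s₀) hder fun s => hmin _
  have hMT : ∀ s ∈ Icc (0 : ℝ) 1, T (toUnit s) = M s := by
    intro s hs
    have := (convex_Icc (0 : ℝ) 1).norm_image_sub_le_of_norm_hasDerivWithin_le
      (f := fun s => T (toUnit s) - M s) (f' := fun s => m (toUnit s) - m (toUnit s)) (C := 0)
      (fun t ht => (hT t ht).sub (hder t).hasDerivWithinAt) (fun t _ => by simp)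
      (show (0 : ℝ) ∈ Icc (0 : ℝ) 1 by simp) hs
    have h0 : T (toUnit 0) - M 0 = 0 := by simp [hT0, hM]
    rw [h0, sub_zero, zero_mul] at this
    exact sub_eq_zero.1 (norm_le_zero_iff.1 this)
  have hσ0 : σ 0 = 0 := by
    have := h2 0
    simpa [hM] using this
  have hT1 : T 1 = M 1 := by simpa [toUnit_one] using hMT 1 (by simp)
  have hσ1 : σ (T 1) = 1 := by rw [hT1]; exact h2 1
  have hpos : 0 < T 1 := by
    rw [← h3.lt_iff_lt, hσ0, hσ1]; exact one_pos
  have hmaps : MapsTo σ (Icc 0 (T 1)) (Icc 0 1) := fun t ht => by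
    rw [← hσ0, ← hσ1]
    exact ⟨h3.monotone ht.1, h3.monotone ht.2⟩
  refine ⟨hpos, hpos.le, fun t => X (toUnit (σ t)), ?_, by simp [hσ0],
    by simp [hσ1], ?_⟩
  · intro t ht
    have := (hX (σ t) (hmaps ht)).scomp t (h4 t).hasDerivWithinAt hmaps
    rw [smul_smul, inv_mul_cancel₀ (hm0 _).ne', one_smul] at this
    exact this
  · intro t ht
    have e1 : σ t ∈ Ioo (0 : ℝ) 1 := by
      rw [← hσ0, ← hσ1]
      exact ⟨h3 ht.1, h3 ht.2⟩
    have e2 := coe_toUnit (Ioo_subset_Icc_self e1)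
    refine hP _ ?_ ?_
    · rw [← Subtype.coe_lt_coe, e2]; exact e1.1
    · rw [← Subtype.coe_lt_coe, e2]; exact e1.2

end Ham

/-! ### Taylor extension of functions of one variable -/

/-- The Taylor polynomial with derivatives `c k` at `a`. -/
noncomputable def taylorSum (c : ℕ → ℝ) (a : ℝ) (m : ℕ) (x : ℝ) : ℝ :=
  ∑ k ∈ Finset.range m, c k * ((x - a) ^ k / k.factorial)

theorem hasDerivAt_taylorSum (c : ℕ → ℝ) (a : ℝ) (m : ℕ) (x : ℝ) :
    HasDerivAt (taylorSum c a (m + 1)) (taylorSum (fun k => c (k + 1)) a m x) x := by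
  induction m with
  | zero =>
    have : taylorSum c a (0 + 1) = fun _ => c 0 := by
      funext y; simp [taylorSum]
    rw [this]
    simpa [taylorSum] using hasDerivAt_const x (c 0)
  | succ m ih =>
    have h1 : taylorSum c a (m + 1 + 1) = fun y => taylorSum c a (m + 1) y +
        c (m + 1) * ((y - a) ^ (m + 1) / (m + 1).factorial) := by
      funext y; simp only [taylorSum]; rw [Finset.sum_range_succ]
    have h2 : taylorSum (fun k => c (k + 1)) a (m + 1) x =
        taylorSum (fun k => c (k + 1)) a m x + c (m + 1) * ((x - a) ^ m / m.factorial) := by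
      simp only [taylorSum]; rw [Finset.sum_range_succ]
    rw [h1, h2]
    refine ih.add (HasDerivAt.const_mul _ ?_)
    have := (((hasDerivAt_id x).sub_const a).pow (m + 1)).div_const ((m + 1).factorial : ℝ)
    refine this.congr_deriv ?_
    have : (m.factorial : ℝ) ≠ 0 := by positivity
    rw [Nat.factorial_succ]
    push_cast
    simp
    field_simp

theorem taylorSum_self (c : ℕ → ℝ) (a : ℝ) (m : ℕ) : taylorSum c a (m + 1) a = c 0 := by
  simp only [taylorSum, Finset.sum_range_succ']
  simp

theorem abs_taylorSum_le {c : ℕ → ℝ} {a B : ℝ} {m : ℕ} (hc : ∀ k < m, |c k| ≤ B) (x : ℝ)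
    (hB : 0 ≤ B) : |taylorSum c a m x| ≤ B * Real.exp |x - a| := by
  refine (Finset.abs_sum_le_sum_abs _ _).trans ?_
  refine le_trans ?_ (mul_le_mul_of_nonneg_left (Real.sum_le_exp_of_nonneg (abs_nonneg (x - a)) m) hB)
  rw [Finset.mul_sum]
  refine Finset.sum_le_sum fun k hk => ?_
  rw [abs_mul, abs_div, abs_pow, Nat.abs_cast]
  exact mul_le_mul_of_nonneg_right (hc k (Finset.mem_range.1 hk)) (by positivity)

/-- The functions `F 0, …, F n` (each the derivative of the preceding one) on `[a, ∞)`, extended to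
the left of `a` by Taylor polynomials. -/
noncomputable def taylorExt (n : ℕ) (F : ℕ → ℝ → ℝ) (a : ℝ) (i : ℕ) (x : ℝ) : ℝ :=
  if a ≤ x then F i x else taylorSum (fun k => F (i + k) a) a (n + 1 - i) x

/-- The barrier functions are controlled only on one side of a level, whereas `CBound` asks for full
neighbourhoods; this extension bridges the gap. Differentiating a Taylor polynomial of the i-th
function gives that of the next one, and at a both one-sided derivatives agree. -/
theorem hasDerivAt_taylorExt {n : ℕ} {F : ℕ → ℝ → ℝ} {a b : ℝ}
    (hF : ∀ i < n, ∀ x, a ≤ x → x < b → HasDerivAt (F i) (F (i + 1) x) x) {i : ℕ} (hi : i < n)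
    {x : ℝ} (hx : x < b) : HasDerivAt (taylorExt n F a i) (taylorExt n F a (i + 1) x) x := by
  have hn : n + 1 - i = (n - i) + 1 := by omega
  have hn' : n + 1 - (i + 1) = n - i := by omega
  have hT : ∀ x, HasDerivAt (taylorSum (fun k => F (i + k) a) a (n + 1 - i))
      (taylorSum (fun k => F (i + 1 + k) a) a (n + 1 - (i + 1)) x) x := by
    intro x
    rw [hn, hn']
    have := hasDerivAt_taylorSum (fun k => F (i + k) a) a (n - i) x
    simpa only [add_assoc, add_comm 1] using this
  rcases lt_trichotomy x a with h | h | h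
  · have e1 : taylorExt n F a (i + 1) x =
        taylorSum (fun k => F (i + 1 + k) a) a (n + 1 - (i + 1)) x := by
      simp [taylorExt, not_le.2 h]
    rw [e1]
    refine (hT x).congr_of_eventuallyEq ?_
    filter_upwards [Iio_mem_nhds h] with y hy
    have hy : ¬ a ≤ y := not_le.2 hy
    simp [taylorExt, hy]
  · subst h
    have e1 : taylorExt n F x (i + 1) x = F (i + 1) x := by simp [taylorExt]
    have e2 : taylorSum (fun k => F (i + 1 + k) x) x (n + 1 - (i + 1)) x = F (i + 1) x := by
      have : n + 1 - (i + 1) = (n - i - 1) + 1 := by omega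
      rw [this, taylorSum_self]
    rw [e1, ← hasDerivWithinAt_univ, ← Iic_union_Ici (a := x)]
    refine HasDerivWithinAt.union ?_ ?_
    · rw [← e2]
      refine (hT x).hasDerivWithinAt.congr (fun y hy => ?_) ?_
      · rcases (show y ≤ x from hy).eq_or_lt with rfl | h
        · simp only [taylorExt, le_refl, if_true]
          rw [hn, taylorSum_self]; rfl
        · simp [taylorExt, not_le.2 h]
      · simp only [taylorExt, le_refl, if_true]
        rw [hn, taylorSum_self]; rfl
    · refine (hF i hi x le_rfl hx).hasDerivWithinAt.congr (fun y hy => ?_) ?_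
      · have hy : x ≤ y := hy
        simp [taylorExt, hy]
      · simp [taylorExt]
  · have e1 : taylorExt n F a (i + 1) x = F (i + 1) x := by simp [taylorExt, h.le]
    rw [e1]
    refine (hF i hi x h.le hx).congr_of_eventuallyEq ?_
    filter_upwards [Ioi_mem_nhds h] with y hy
    have hy : a ≤ y := le_of_lt hy
    simp [taylorExt, hy]

theorem continuousAt_taylorExt {n : ℕ} {F : ℕ → ℝ → ℝ} {a b : ℝ} (hab : a < b)
    (hF : ∀ x, a ≤ x → x < b → ContinuousAt (F n) x) {x : ℝ} (hx : x < b) :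
    ContinuousAt (taylorExt n F a n) x := by
  have : taylorExt n F a n = fun x => F n (max a x) := by
    funext y
    by_cases h : a ≤ y
    · simp [taylorExt, h]
    · simp [taylorExt, h, taylorSum, max_eq_left (not_le.1 h).le]
  rw [this]
  exact ContinuousAt.comp (g := F n) (hF _ (le_max_left _ _) (max_lt hab hx)) (by fun_prop)

/-- On the left of a the weights |x - a|^k / k! of the Taylor sum add up to at most exp |x - a|,
whatever the degree. -/
theorem abs_taylorExt_le {n : ℕ} {F : ℕ → ℝ → ℝ} {a b B : ℝ} (hab : a < b)
    (hF : ∀ i ≤ n, ∀ x, a ≤ x → x < b → |F i x| ≤ B) {i : ℕ} (hi : i ≤ n) {x : ℝ} (hx : x < b) :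
    |taylorExt n F a i x| ≤ B * Real.exp |x - a| := by
  have hB : 0 ≤ B := (abs_nonneg _).trans (hF i hi a le_rfl hab)
  by_cases h : a ≤ x
  · simp only [taylorExt, h, if_true]
    refine (hF i hi x h hx).trans (le_mul_of_one_le_right hB ?_)
    exact Real.one_le_exp (abs_nonneg _)
  · simp only [taylorExt, h, if_false]
    exact abs_taylorSum_le (fun k hk => hF _ (by omega) a le_rfl hab) x hB

section DerivSeq

variable {ι : Type} [TopologicalSpace ι] [DiscreteTopology ι] {l : Filter ι} {K : Set ℝ} {μ : ι → ℝ}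

theorem CBound.of_derivSeq (n : ℕ) {F : ℕ → ι → ℝ → ℝ}
    (hd : ∀ j < n, ∀ᶠ p in l ×ˢ 𝓝ˢ K, HasDerivAt (F j p.1) (F (j + 1) p.1 p.2) p.2)
    (hc : ∀ᶠ p in l ×ˢ 𝓝ˢ K, ContinuousAt (F n p.1) p.2)
    (hb : ∀ j ≤ n, (fun p : ι × ℝ => F j p.1 p.2) =O[l ×ˢ 𝓝ˢ K] fun p => μ p.1) :
    CBound l K μ n (F 0) := by
  induction n generalizing F with
  | zero =>
    refine ⟨?_, hb 0 le_rfl⟩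
    filter_upwards [hc] with p hp using continuousAt_uncurry_of_discrete hp
  | succ n ih =>
    refine ⟨⟨?_, hb 0 (Nat.zero_le _)⟩, fun i x => (ContinuousLinearMap.mul ℝ ℝ : ℝ →L[ℝ] ℝ →L[ℝ] ℝ) (F 1 i x), ?_, ?_⟩
    · filter_upwards [hd 0 (by omega)] with p hp
      exact continuousAt_uncurry_of_discrete hp.continuousAt
    · filter_upwards [hd 0 (by omega)] with p hp
      refine hp.hasFDerivAt.congr_fderiv ?_
      ext
      simp
    · have := ih (F := fun j => F (j + 1)) (fun j hj => hd (j + 1) (by omega)) hc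
        (fun j hj => hb (j + 1) (by omega))
      exact this.clm (ContinuousLinearMap.mul ℝ ℝ : ℝ →L[ℝ] ℝ →L[ℝ] ℝ)

end DerivSeq

/-! ### The parameter -/

/-- The small parameter, with the discrete topology. -/
def Eps : Type := ℝ

instance : TopologicalSpace Eps := ⊥

instance : DiscreteTopology Eps := ⟨rfl⟩

/-- The parameter tends to `0` from the right. -/
def smallEps : Filter Eps := (𝓝[>] (0 : ℝ) : Filter ℝ)

/-- A boundary layer width, of the size of `√(ε |log ε|)`. -/
noncomputable def wid (r : ℕ) (ε : ℝ) : ℝ := Real.sqrt (8 * (r + 3) * (ε * |Real.log ε|))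

theorem eventually_small {c : ℝ} (hc : 0 < c) : ∀ᶠ ε in 𝓝[>] (0 : ℝ), ε ∈ Ioo 0 c :=
  Ioo_mem_nhdsGT hc

/-! ### Sizes of ν, η and the layer width. -/

section Sizes

variable {r : ℕ} {ε : ℝ}

/-- The threshold `Real.exp (-2)` is a convenient meaning of "small": below it ln ε is negative and
|ln ε| > 2, so that ln |ln ε| ≥ 0. -/
theorem small_log (hε : ε ∈ Ioo 0 (Real.exp (-2))) :
    |Real.log ε| = -Real.log ε ∧ 2 < -Real.log ε ∧ -Real.log ε ≤ ε⁻¹ ∧ ε < 1 := by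
  have h1 : Real.log ε < -2 := by
    rw [← Real.log_exp (-2)]
    exact Real.log_lt_log hε.1 hε.2
  refine ⟨abs_of_neg (by linarith), by linarith, ?_, ?_⟩
  · rw [← Real.log_inv]
    exact Real.log_le_self (inv_nonneg.2 hε.1.le)
  · exact hε.2.trans (by rw [Real.exp_lt_one_iff]; norm_num)

theorem nu_pos (hε : ε ∈ Ioo 0 (Real.exp (-2))) : 0 < nu r ε := by
  obtain ⟨h1, h2, h3, h4⟩ := small_log hε
  refine Real.rpow_pos_of_pos (div_pos hε.1 ?_) _
  rw [h1]; linarith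

/-- Here -ln ν = (|ln ε| + ln |ln ε|) / (2(r + 2)), and ln |ln ε| lies between 0 and |ln ε|. -/
theorem log_nu (hε : ε ∈ Ioo 0 (Real.exp (-2))) :
    |Real.log ε| / (2 * (r + 2)) ≤ -Real.log (nu r ε) ∧
      -Real.log (nu r ε) ≤ |Real.log ε| / (r + 2) := by
  obtain ⟨h1, h2, h3, h4⟩ := small_log hε
  have h5 : 0 < ε / |Real.log ε| := div_pos hε.1 (by rw [h1]; linarith)
  have h6 : (0 : ℝ) < r + 2 := by positivity
  have e : -Real.log (nu r ε) = (-Real.log ε + Real.log (-Real.log ε)) / (2 * (r + 2)) := by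
    rw [nu, Real.log_rpow h5, Real.log_div hε.1.ne' (by rw [h1]; linarith), h1]
    field_simp
    ring
  have h7 : 0 ≤ Real.log (-Real.log ε) := Real.log_nonneg (by linarith)
  have h8 : Real.log (-Real.log ε) ≤ -Real.log ε := Real.log_le_self (by linarith)
  rw [e, h1]
  constructor
  · gcongr
    linarith
  · rw [div_le_div_iff₀ (by positivity) h6]
    nlinarith

theorem nu_lt_one (hε : ε ∈ Ioo 0 (Real.exp (-2))) : nu r ε < 1 := by
  obtain ⟨h1, h2, h3, h4⟩ := small_log hε
  have h := (log_nu (r := r) hε).1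
  have h5 : 0 < |Real.log ε| / (2 * (r + 2)) := by
    rw [h1]; apply div_pos <;> [linarith; positivity]
  exact (Real.log_neg_iff (nu_pos hε)).1 (by linarith)

/-- From |ln ε| ≤ 1/ε one gets ε² ≤ ε/|ln ε|, hence ν ≥ ε^(1/(r + 2)), and r ≥ 1 makes the exponent
at most 1/3. This is what makes a width of order √(ε|ln ε|) negligible against ν. -/
theorem rpow_le_nu (hr : 1 ≤ r) (hε : ε ∈ Ioo 0 (Real.exp (-2))) : ε ^ (1 / 3 : ℝ) ≤ nu r ε := by
  obtain ⟨h1, h2, h3, h4⟩ := small_log hε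
  have hr' : (1 : ℝ) ≤ r := by exact_mod_cast hr
  have h5 : ε ^ 2 ≤ ε / |Real.log ε| := by
    rw [h1, le_div_iff₀ (by linarith)]
    have := mul_le_mul_of_nonneg_left h3 (sq_nonneg ε)
    have e : ε ^ 2 * ε⁻¹ = ε := by field_simp
    linarith
  calc ε ^ (1 / 3 : ℝ) ≤ ε ^ (2 * (1 / (2 * ((r : ℝ) + 2)))) := by
        refine Real.rpow_le_rpow_of_exponent_ge hε.1 h4.le ?_
        rw [show 2 * (1 / (2 * ((r : ℝ) + 2))) = 1 / ((r : ℝ) + 2) by field_simp]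
        exact one_div_le_one_div_of_le (by norm_num) (by linarith)
    _ = (ε ^ 2) ^ (1 / (2 * ((r : ℝ) + 2))) := by
        rw [Real.rpow_mul hε.1.le]; norm_num
    _ ≤ nu r ε := Real.rpow_le_rpow (by positivity) h5 (by positivity)

theorem eps_le_nu (hr : 1 ≤ r) (hε : ε ∈ Ioo 0 (Real.exp (-2))) : ε ≤ nu r ε := by
  obtain ⟨h1, h2, h3, h4⟩ := small_log hε
  refine le_trans ?_ (rpow_le_nu hr hε)
  nth_rewrite 1 [← Real.rpow_one ε]
  exact Real.rpow_le_rpow_of_exponent_ge hε.1 h4.le (by norm_num)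

theorem wid_le (hr : 1 ≤ r) (hε : ε ∈ Ioo 0 (Real.exp (-2))) :
    wid r ε ≤ Real.sqrt (24 * (r + 3)) * nu r ε := by
  obtain ⟨h1, h2, h3, h4⟩ := small_log hε
  refine le_trans ?_ (mul_le_mul_of_nonneg_left (rpow_le_nu hr hε) (Real.sqrt_nonneg _))
  rw [wid, Real.sqrt_le_iff]
  refine ⟨mul_nonneg (Real.sqrt_nonneg _) (Real.rpow_nonneg hε.1.le _), ?_⟩
  rw [mul_pow, Real.sq_sqrt (by positivity), h1, ← Real.log_inv]
  -- The logarithm is at most 3 ε^(-1/3), so ε|ln ε| ≤ 3 ε^(2/3). Its square root is of order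
  -- ε^(1/3), and 24 = 8 · 3.
  have h5 := Real.log_le_rpow_div (inv_nonneg.2 hε.1.le) (show (0 : ℝ) < 1 / 3 by norm_num)
  rw [Real.inv_rpow hε.1.le] at h5
  set t := ε ^ (1 / 3 : ℝ) with ht
  have ht0 : 0 < t := Real.rpow_pos_of_pos hε.1 _
  have ht3 : ε = t ^ 3 := by
    rw [ht, ← Real.rpow_natCast, ← Real.rpow_mul hε.1.le]; norm_num
  have h6 : ε * Real.log ε⁻¹ ≤ 3 * t ^ 2 := by
    calc ε * Real.log ε⁻¹ ≤ ε * (t⁻¹ / (1 / 3)) := mul_le_mul_of_nonneg_left h5 hε.1.le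
      _ = 3 * t ^ 2 := by rw [ht3]; field_simp
  have h7 : (0 : ℝ) ≤ 8 * (r + 3) := by positivity
  nlinarith

theorem wid_pos (hε : ε ∈ Ioo 0 (Real.exp (-2))) : 0 < wid r ε := by
  obtain ⟨h1, h2, h3, h4⟩ := small_log hε
  refine Real.sqrt_pos.2 ?_
  have : 0 < |Real.log ε| := by rw [h1]; linarith
  have := hε.1
  positivity

theorem eta_pos (hε : ε ∈ Ioo 0 (Real.exp (-2))) : 0 < eta r ε := by
  refine Real.sqrt_pos.2 ?_
  have := Real.log_neg (nu_pos (r := r) hε) (nu_lt_one hε)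
  nlinarith [hε.1]

theorem eta_le (hε : ε ∈ Ioo 0 (Real.exp (-2))) : eta r ε ≤ Real.sqrt (ε * |Real.log ε|) := by
  refine Real.sqrt_le_sqrt ?_
  have h := (log_nu (r := r) hε).2
  have h2 : |Real.log ε| / (r + 2) ≤ |Real.log ε| := div_le_self (abs_nonneg _) (by
    have : (0 : ℝ) ≤ r := by positivity
    linarith)
  nlinarith [hε.1]

theorem eta_lt_wid (hε : ε ∈ Ioo 0 (Real.exp (-2))) : eta r ε < wid r ε / 2 := by
  obtain ⟨h1, h2, h3, h4⟩ := small_log hε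
  refine (eta_le hε).trans_lt ?_
  rw [wid, show 8 * ((r : ℝ) + 3) * (ε * |Real.log ε|) = 2 ^ 2 * (2 * (r + 3) * (ε * |Real.log ε|)) by ring,
    Real.sqrt_mul (show (0 : ℝ) ≤ 2 ^ 2 by norm_num), Real.sqrt_sq (show (0 : ℝ) ≤ 2 by norm_num), mul_div_cancel_left₀ _ (by norm_num)]
  refine Real.sqrt_lt_sqrt (mul_nonneg hε.1.le (abs_nonneg _)) ?_
  have h5 : 0 < ε * |Real.log ε| := mul_pos hε.1 (by rw [h1]; linarith)
  have : (0 : ℝ) ≤ r := by positivity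
  nlinarith

theorem tendsto_nu : Tendsto (nu r) (𝓝[>] (0 : ℝ)) (𝓝 0) := by
  have h1 : Tendsto (fun ε : ℝ => ε / |Real.log ε|) (𝓝[>] (0 : ℝ)) (𝓝 0) := by
    refine squeeze_zero' (g := fun ε => ε) ?_ ?_ (tendsto_nhdsWithin_of_tendsto_nhds tendsto_id)
    · filter_upwards [self_mem_nhdsWithin] with ε hε
      exact div_nonneg (le_of_lt hε) (abs_nonneg _)
    · filter_upwards [eventually_small (Real.exp_pos (-2))] with ε hε
      obtain ⟨h1, h2, h3, h4⟩ := small_log hε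
      exact div_le_self hε.1.le (by rw [h1]; linarith)
  have h2 : (0 : ℝ) < 1 / (2 * ((r : ℝ) + 2)) := by positivity
  have := h1.rpow_const (p := 1 / (2 * ((r : ℝ) + 2))) (Or.inr h2.le)
  rwa [Real.zero_rpow h2.ne'] at this

theorem wid_isBigO_nu (hr : 1 ≤ r) : wid r =O[𝓝[>] (0 : ℝ)] nu r := by
  refine IsBigO.of_bound (Real.sqrt (24 * (r + 3))) ?_
  filter_upwards [eventually_small (Real.exp_pos (-2))] with ε hε
  rw [Real.norm_of_nonneg (wid_pos hε).le, Real.norm_of_nonneg (nu_pos hε).le]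
  exact wid_le hr hε

theorem tendsto_wid (hr : 1 ≤ r) : Tendsto (wid r) (𝓝[>] (0 : ℝ)) (𝓝 0) :=
  (wid_isBigO_nu hr).trans_tendsto tendsto_nu

theorem eta_isBigO : eta r =O[𝓝[>] (0 : ℝ)] fun ε => Real.sqrt (ε * |Real.log ε|) := by
  refine IsBigO.of_bound 1 ?_
  filter_upwards [eventually_small (Real.exp_pos (-2))] with ε hε
  rw [Real.norm_of_nonneg (eta_pos hε).le, Real.norm_of_nonneg (Real.sqrt_nonneg _), one_mul]
  exact eta_le hε

theorem eta_isBigO_nu (hr : 1 ≤ r) : eta r =O[𝓝[>] (0 : ℝ)] nu r := by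
  refine IsBigO.trans (IsBigO.of_bound 1 ?_) (wid_isBigO_nu hr)
  filter_upwards [eventually_small (Real.exp_pos (-2))] with ε hε
  rw [Real.norm_of_nonneg (eta_pos hε).le, Real.norm_of_nonneg (wid_pos hε).le]
  linarith [eta_lt_wid (r := r) hε, wid_pos (r := r) hε]

theorem tendsto_eta (hr : 1 ≤ r) : Tendsto (eta r) (𝓝[>] (0 : ℝ)) (𝓝 0) :=
  (eta_isBigO_nu hr).trans_tendsto tendsto_nu

/-- The definition of ν read backwards: ν^(2(r + 2)) = ε/|ln ε|, and |ln ε| is at most 2(r + 2)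
times -ln ν. -/
theorem eps_le_pow (hε : ε ∈ Ioo 0 (Real.exp (-2))) :
    ε ≤ 2 * (r + 2) * (nu r ε ^ (2 * (r + 2)) * -Real.log (nu r ε)) := by
  obtain ⟨h1, h2, h3, h4⟩ := small_log hε
  have hL : 0 < |Real.log ε| := by rw [h1]; linarith
  have e : nu r ε ^ (2 * (r + 2)) = ε / |Real.log ε| := by
    rw [nu, ← Real.rpow_natCast, ← Real.rpow_mul (by have := hε.1; positivity)]
    have : 1 / (2 * ((r : ℝ) + 2)) * ((2 * (r + 2) : ℕ) : ℝ) = 1 := by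
      push_cast; field_simp
    rw [this, Real.rpow_one]
  rw [e]
  have h5 := (log_nu (r := r) hε).1
  have h6 : ε / |Real.log ε| * (|Real.log ε| / (2 * (r + 2))) ≤
      ε / |Real.log ε| * -Real.log (nu r ε) :=
    mul_le_mul_of_nonneg_left h5 (by have := hε.1; positivity)
  have h7 : ε / |Real.log ε| * (|Real.log ε| / (2 * (r + 2))) = ε / (2 * (r + 2)) := by
    field_simp
  rw [h7, div_le_iff₀ (by positivity)] at h6
  linarith

end Sizes

/-! ### The inverse barrier -/

/-- The polynomials in the derivatives of the inverse barrier. -/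
noncomputable def barrierPoly : ℕ → Polynomial ℝ
  | 0 => Polynomial.C (1 / 2)
  | i + 1 => Polynomial.C (-((i : ℝ) + 1)) * barrierPoly i +
      Polynomial.C (1 / 2) * Polynomial.X * barrierPoly i +
      Polynomial.X ^ 2 * Polynomial.derivative (barrierPoly i)

/-- The `i`-th derivative of minus the derivative of the inverse barrier. -/
noncomputable def invBarrierSeq (ε : ℝ) (i : ℕ) (w : ℝ) : ℝ :=
  Real.sqrt ε * (w⁻¹ ^ (i + 1) * ((Real.sqrt (-Real.log w))⁻¹ *
    (barrierPoly i).eval ((-Real.log w)⁻¹)))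

/-- With L = -ln w and y = 1/L, the three terms in the recursion of `barrierPoly` come from
differentiating the power of 1/w, the factor L^(-1/2), and the polynomial in y, where dy/dw = y²/w.
-/
theorem hasDerivAt_invBarrierSeq (ε : ℝ) (i : ℕ) {w : ℝ} (hw : w ∈ Ioo (0 : ℝ) 1) :
    HasDerivAt (invBarrierSeq ε i) (invBarrierSeq ε (i + 1) w) w := by
  have hL : 0 < -Real.log w := by linarith [Real.log_neg hw.1 hw.2]
  have hs := Real.sqrt_pos.2 hL
  have h1 : HasDerivAt (fun w => -Real.log w) (-w⁻¹) w := (Real.hasDerivAt_log hw.1.ne').neg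
  have h2 := (h1.sqrt hL.ne').inv hs.ne'
  have h3 := h1.inv hL.ne'
  have h4 := ((barrierPoly i).hasDerivAt ((-Real.log w)⁻¹)).comp w h3
  have h5 := (hasDerivAt_inv hw.1.ne').pow (i + 1)
  have h6 := (h5.mul (h2.mul h4)).const_mul (Real.sqrt ε)
  refine h6.congr_deriv ?_
  simp only [invBarrierSeq, barrierPoly, Polynomial.eval_add, Polynomial.eval_mul,
    Polynomial.eval_C, Polynomial.eval_X, Polynomial.eval_pow, Pi.pow_apply, Pi.inv_apply,
    Function.comp_apply, Pi.mul_apply, Nat.add_sub_cancel]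
  have hsq : Real.sqrt (-Real.log w) ^ 2 = -Real.log w := Real.sq_sqrt hL.le
  set s := Real.sqrt (-Real.log w) with hsdef
  rw [← hsq]
  have hw0 := hw.1.ne'
  have hs0 := hs.ne'
  clear_value s
  clear hsq hsdef h6 h5 h4 h3 h2 h1 hL
  obtain ⟨v, rfl⟩ : ∃ v, w = v⁻¹ := ⟨w⁻¹, (inv_inv w).symm⟩
  have hv0 : v ≠ 0 := fun h => hw0 (by simp [h])
  simp only [inv_inv, inv_pow]
  push_cast
  field_simp
  ring

theorem hasDerivAt_invBarrier {ε : ℝ} (hε : 0 < ε) {w : ℝ} (hw : w ∈ Ioo (0 : ℝ) 1) :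
    HasDerivAt (invBarrier ε) (-invBarrierSeq ε 0 w) w := by
  have hL : 0 < -Real.log w := by linarith [Real.log_neg hw.1 hw.2]
  have h1 : HasDerivAt (fun w => -ε * Real.log w) (-ε * w⁻¹) w :=
    (Real.hasDerivAt_log hw.1.ne').const_mul _
  have hpos : 0 < -ε * Real.log w := by nlinarith
  refine (h1.sqrt hpos.ne').congr_deriv ?_
  have e : Real.sqrt (-ε * Real.log w) = Real.sqrt ε * Real.sqrt (-Real.log w) := by
    rw [← Real.sqrt_mul hε.le]; congr 1; ring
  rw [e]
  simp only [invBarrierSeq, barrierPoly, Polynomial.eval_C, zero_add, pow_one]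
  have hsq : Real.sqrt ε ^ 2 = ε := Real.sq_sqrt hε.le
  have hs := (Real.sqrt_pos.2 hL).ne'
  have hs' := (Real.sqrt_pos.2 hε).ne'
  have hw0 := hw.1.ne'
  field_simp
  rw [hsq]

theorem invBarrierSeq_zero_pos {ε : ℝ} (hε : 0 < ε) {w : ℝ} (hw : w ∈ Ioo (0 : ℝ) 1) :
    0 < invBarrierSeq ε 0 w := by
  have hL : 0 < -Real.log w := by linarith [Real.log_neg hw.1 hw.2]
  have := Real.sqrt_pos.2 hL
  have := Real.sqrt_pos.2 hε
  have := hw.1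
  simp only [invBarrierSeq, barrierPoly, Polynomial.eval_C]
  positivity

theorem hasDerivAt_gaussBarrier (ε s : ℝ) :
    HasDerivAt (gaussBarrier ε) (-(2 * s / ε) * gaussBarrier ε s) s := by
  have h1 : HasDerivAt (fun s : ℝ => -(s ^ 2) / ε) (-(2 * s) / ε) s := by
    have := ((hasDerivAt_pow 2 s).neg).div_const ε
    simpa using this
  refine h1.exp.congr_deriv ?_
  simp only [gaussBarrier]
  ring

theorem gaussBarrier_invBarrier {ε : ℝ} (hε : 0 < ε) {w : ℝ} (hw : w ∈ Ioo (0 : ℝ) 1) :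
    gaussBarrier ε (invBarrier ε w) = w := by
  have hL : 0 < -Real.log w := by linarith [Real.log_neg hw.1 hw.2]
  have hpos : 0 ≤ -ε * Real.log w := by nlinarith
  rw [gaussBarrier, invBarrier, Real.sq_sqrt hpos]
  rw [show -(-ε * Real.log w) / ε = Real.log w by field_simp]
  exact Real.exp_log hw.1

theorem deriv_gaussBarrier_invBarrier {ε : ℝ} (hε : 0 < ε) {w : ℝ} (hw : w ∈ Ioo (0 : ℝ) 1) :
    deriv (gaussBarrier ε) (invBarrier ε w) = -(invBarrierSeq ε 0 w)⁻¹ := by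
  have hL : 0 < -Real.log w := by linarith [Real.log_neg hw.1 hw.2]
  rw [(hasDerivAt_gaussBarrier ε _).deriv, gaussBarrier_invBarrier hε hw]
  have e : invBarrier ε w = Real.sqrt ε * Real.sqrt (-Real.log w) := by
    rw [invBarrier, ← Real.sqrt_mul hε.le]; congr 1; ring
  rw [e]
  simp only [invBarrierSeq, barrierPoly, Polynomial.eval_C, zero_add, pow_one]
  have hsq : Real.sqrt ε ^ 2 = ε := Real.sq_sqrt hε.le
  have hsq' : Real.sqrt (-Real.log w) ^ 2 = -Real.log w := Real.sq_sqrt hL.le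
  have hs := (Real.sqrt_pos.2 hL).ne'
  have hs' := (Real.sqrt_pos.2 hε).ne'
  have hw0 := hw.1.ne'
  nth_rewrite 2 [← hsq]
  field_simp

/-- The estimate that dictates ν. Up to constants the quantity is √ε / (w^(r + 1) √(-ln w)). On the
given range the denominator is, up to a constant, smallest at w = ν, where √ε is of order ν · ν^(r +
1) √(-ln ν). -/
theorem abs_invBarrierSeq_le (r : ℕ) : ∃ C, 0 ≤ C ∧ ∀ ε ∈ Ioo 0 (Real.exp (-2)), ∀ i ≤ r,
    ∀ w, nu r ε ≤ w → w < 3 / 4 → |invBarrierSeq ε i w| ≤ C * nu r ε := by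
  -- For w < 3/4 one has -ln w ≥ 1 - w > 1/4, so the argument of the polynomials stays in [0, 4].
  have hp : ∀ i, ∃ C, 0 ≤ C ∧ ∀ y ∈ Icc (0 : ℝ) 4, |(barrierPoly i).eval y| ≤ C := by
    intro i
    obtain ⟨C, hC⟩ := (isCompact_Icc (a := (0 : ℝ)) (b := 4)).exists_bound_of_continuousOn
      (barrierPoly i).continuous.continuousOn
    exact ⟨C, (abs_nonneg _).trans (hC 0 (by norm_num)), hC⟩
  choose Cp hCp0 hCp using hp
  set B := ∑ i ∈ Finset.range (r + 1), Cp i with hB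
  have hBi : ∀ i ≤ r, Cp i ≤ B := fun i hi =>
    Finset.single_le_sum (f := Cp) (fun j _ => hCp0 j) (Finset.mem_range.2 (by omega))
  have hB0 : 0 ≤ B := (hCp0 0).trans (hBi 0 (Nat.zero_le _))
  set A := Real.sqrt (8 * (r + 2)) with hA
  refine ⟨A * B, by positivity, fun ε hε i hi w hw hw' => ?_⟩
  obtain ⟨h1, h2, h3, h4⟩ := small_log hε
  have hν := nu_pos (r := r) hε
  have hν1 := nu_lt_one (r := r) hε
  have hw0 : 0 < w := hν.trans_le hw
  have hLw : 1 / 4 ≤ -Real.log w := by linarith [Real.log_le_sub_one_of_pos hw0]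
  set ℓ := -Real.log (nu r ε) with hℓ
  have hℓ0 : 0 < ℓ := by linarith [Real.log_neg hν hν1]
  -- If w² ≤ ν, the logarithms of w and ν are comparable and the powers decide. Otherwise ν < w², so
  -- trading the logarithm for one factor 1/ν leaves ν^(2r + 1) ≤ w^(2(2r + 1)) ≤ w^(2(r + 1)), and
  -- -ln w ≥ 1/4 costs the factor 4.
  have key : nu r ε ^ (2 * (r + 1)) * ℓ ≤ 4 * (w ^ (2 * (r + 1)) * -Real.log w) := by
    by_cases hc : w ^ 2 ≤ nu r ε
    · have h5 : ℓ ≤ 2 * -Real.log w := by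
        have := Real.log_le_log (by positivity) hc
        rw [Real.log_pow] at this
        push_cast at this
        linarith
      have h6 : nu r ε ^ (2 * (r + 1)) ≤ w ^ (2 * (r + 1)) := pow_le_pow_left₀ hν.le hw _
      have h7 : 0 < w ^ (2 * (r + 1)) := by positivity
      calc nu r ε ^ (2 * (r + 1)) * ℓ ≤ w ^ (2 * (r + 1)) * (2 * -Real.log w) :=
            mul_le_mul h6 h5 hℓ0.le h7.le
        _ ≤ 4 * (w ^ (2 * (r + 1)) * -Real.log w) := by nlinarith
    · have hc := not_le.1 hc
      have h5 : ℓ ≤ (nu r ε)⁻¹ := by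
        rw [hℓ, ← Real.log_inv]; exact Real.log_le_self (inv_nonneg.2 hν.le)
      have h6 : nu r ε ^ (2 * (r + 1)) * ℓ ≤ nu r ε ^ (2 * r + 1) := by
        calc nu r ε ^ (2 * (r + 1)) * ℓ ≤ nu r ε ^ (2 * (r + 1)) * (nu r ε)⁻¹ := by gcongr
          _ = nu r ε ^ (2 * r + 1) := by
            rw [show 2 * (r + 1) = 2 * r + 1 + 1 by ring, pow_succ]; field_simp
      have h7 : nu r ε ^ (2 * r + 1) ≤ (w ^ 2) ^ (2 * r + 1) := pow_le_pow_left₀ hν.le hc.le _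
      have h8 : (w ^ 2) ^ (2 * r + 1) ≤ w ^ (2 * (r + 1)) := by
        rw [← pow_mul]
        exact pow_le_pow_of_le_one hw0.le (by linarith) (by omega)
      have h9 : 0 < w ^ (2 * (r + 1)) := by positivity
      nlinarith
  have hsq : Real.sqrt ε ≤ A * nu r ε * (w ^ (r + 1) * Real.sqrt (-Real.log w)) := by
    rw [Real.sqrt_le_iff]
    refine ⟨by positivity, ?_⟩
    rw [mul_pow, mul_pow, mul_pow, hA, Real.sq_sqrt (show 0 ≤ -Real.log w by linarith),
      Real.sq_sqrt (show (0 : ℝ) ≤ 8 * (r + 2) by positivity)]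
    have h5 := eps_le_pow (r := r) hε
    rw [← hℓ] at h5
    have e : nu r ε ^ (2 * (r + 2)) * ℓ = nu r ε ^ 2 * (nu r ε ^ (2 * (r + 1)) * ℓ) := by ring
    rw [e] at h5
    have h6 := mul_le_mul_of_nonneg_left key (sq_nonneg (nu r ε))
    have h7 : (0 : ℝ) ≤ 2 * (r + 2) := by positivity
    have h8 := mul_le_mul_of_nonneg_left h6 h7
    calc ε ≤ _ := h5
      _ ≤ _ := h8
      _ = _ := by ring
  have hs := Real.sqrt_pos.2 (show 0 < -Real.log w by linarith)
  have hev : |(barrierPoly i).eval ((-Real.log w)⁻¹)| ≤ B := by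
    refine (hCp i _ ⟨by positivity, ?_⟩).trans (hBi i hi)
    rw [inv_le_comm₀ (by linarith) (by norm_num)]
    linarith
  have hwi : w⁻¹ ^ (i + 1) ≤ w⁻¹ ^ (r + 1) :=
    pow_le_pow_right₀ ((one_le_inv₀ hw0).2 (by linarith)) (by omega)
  rw [invBarrierSeq, abs_mul, abs_mul, abs_mul, abs_of_nonneg (Real.sqrt_nonneg ε),
    abs_of_pos (show 0 < w⁻¹ ^ (i + 1) by positivity), abs_of_pos (inv_pos.2 hs)]
  calc Real.sqrt ε * (w⁻¹ ^ (i + 1) * ((Real.sqrt (-Real.log w))⁻¹ *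
        |(barrierPoly i).eval ((-Real.log w)⁻¹)|))
      ≤ (A * nu r ε * (w ^ (r + 1) * Real.sqrt (-Real.log w))) *
        (w⁻¹ ^ (r + 1) * ((Real.sqrt (-Real.log w))⁻¹ * B)) := by gcongr
    _ = A * B * nu r ε := by
      rw [inv_pow]; field_simp

/-- Minus the derivative of the inverse barrier, extended below the level `ν`. -/
noncomputable def kap (r : ℕ) (ε : Eps) (w : ℝ) : ℝ := taylorExt r (invBarrierSeq ε) (nu r ε) 0 w

theorem kap_eq {r : ℕ} {ε : Eps} {w : ℝ} (h : nu r ε ≤ w) : kap r ε w = invBarrierSeq ε 0 w := by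
  simp [kap, taylorExt, h]

/-- The extension below ν is needed because the potential energies of the limit reflection fill an
interval that reaches down to 0, and the bound must hold near all of it. -/
theorem cBound_kap (r : ℕ) {K : Set ℝ} (hK : IsCompact K) (hK' : K ⊆ Iio (3 / 4)) :
    CBound smallEps K (fun ε => nu r ε) r (kap r) := by
  obtain ⟨C, hC0, hC⟩ := abs_invBarrierSeq_le r
  obtain ⟨R, hR⟩ := hK.isBounded.subset_ball (0 : ℝ)
  have h1 : ∀ᶠ p : Eps × ℝ in smallEps ×ˢ 𝓝ˢ K, p.2 < 3 / 4 ∧ |p.2| < R := by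
    have : ∀ᶠ x : ℝ in 𝓝ˢ K, x < 3 / 4 ∧ |x| < R := by
      filter_upwards [isOpen_Iio.mem_nhdsSet.2 hK', Metric.isOpen_ball.mem_nhdsSet.2 hR]
        with x hx hx'
      exact ⟨hx, by simpa using hx'⟩
    exact this.prod_inr _
  have h2 : ∀ᶠ p : Eps × ℝ in smallEps ×ˢ 𝓝ˢ K, (p.1 : ℝ) ∈ Ioo 0 (Real.exp (-2)) ∧
      nu r p.1 < 1 / 2 := by
    have : ∀ᶠ ε : Eps in smallEps, (ε : ℝ) ∈ Ioo 0 (Real.exp (-2)) ∧ nu r ε < 1 / 2 :=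
      Filter.Eventually.and (eventually_small (Real.exp_pos (-2)))
        ((tendsto_nu (r := r)).eventually_lt_const (by norm_num))
    exact this.prod_inl _
  have hd : ∀ ε : Eps, (ε : ℝ) ∈ Ioo 0 (Real.exp (-2)) → ∀ (i : ℕ), ∀ x, nu r ε ≤ x → x < 3 / 4 →
      HasDerivAt (invBarrierSeq ε i) (invBarrierSeq ε (i + 1) x) x := fun ε hε i x hx hx' =>
    hasDerivAt_invBarrierSeq ε i ⟨(nu_pos hε).trans_le hx, by linarith⟩
  refine CBound.of_derivSeq (ι := Eps) r (F := fun j ε => taylorExt r (invBarrierSeq ε) (nu r ε) j) ?_ ?_ ?_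
  · intro j hj
    filter_upwards [h1, h2] with p hp hq
    exact hasDerivAt_taylorExt (b := 3 / 4) (fun i _ x hx hx' => hd p.1 hq.1 i x hx hx') hj hp.1
  · filter_upwards [h1, h2] with p hp hq
    exact continuousAt_taylorExt (b := 3 / 4) (by linarith)
      (fun x hx hx' => (hd p.1 hq.1 r x hx hx').continuousAt) hp.1
  · intro j hj
    refine IsBigO.of_bound (C * Real.exp (R + 1)) ?_
    filter_upwards [h1, h2] with p hp hq
    have h3 := abs_taylorExt_le (n := r) (F := invBarrierSeq p.1) (a := nu r p.1) (b := 3 / 4)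
      (by linarith) (fun i hi x hx hx' => hC p.1 hq.1 i hi x hx hx') hj hp.1
    have hν := nu_pos (r := r) hq.1
    have h4 : |p.2 - nu r p.1| ≤ R + 1 := by
      refine (abs_sub _ _).trans ?_
      rw [abs_of_pos hν]
      linarith [hp.2]
    rw [Real.norm_eq_abs, Real.norm_of_nonneg hν.le]
    refine h3.trans ?_
    have := Real.exp_le_exp.2 h4
    have h5 : 0 ≤ C * nu r p.1 := by positivity
    nlinarith

/-! ### The Gaussian barrier outside the layer -/

theorem iteratedDeriv_gauss (l : ℕ) : ∃ p : Polynomial ℝ,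
    iteratedDeriv l (fun u : ℝ => Real.exp (-(u ^ 2))) = fun u => p.eval u * Real.exp (-(u ^ 2)) := by
  induction l with
  | zero => exact ⟨1, by simp⟩
  | succ l ih =>
    obtain ⟨p, hp⟩ := ih
    refine ⟨Polynomial.derivative p - 2 * Polynomial.X * p, ?_⟩
    rw [iteratedDeriv_succ, hp]
    funext u
    have h1 : HasDerivAt (fun u : ℝ => -(u ^ 2)) (-(2 * u)) u :=
      (hasDerivAt_pow 2 u).fun_neg.congr_deriv (by simp)
    rw [((p.hasDerivAt u).fun_mul h1.exp).deriv]
    simp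
    ring

theorem exists_abs_eval_le (p : Polynomial ℝ) : ∃ C, 0 ≤ C ∧ ∀ u : ℝ,
    |p.eval u| ≤ C * Real.exp (u ^ 2 / 2) := by
  induction p using Polynomial.induction_on' with
  | add p q hp hq =>
    obtain ⟨C, hC, h1⟩ := hp
    obtain ⟨C', hC', h2⟩ := hq
    refine ⟨C + C', by positivity, fun u => ?_⟩
    rw [Polynomial.eval_add, add_mul]
    exact (abs_add_le _ _).trans (add_le_add (h1 u) (h2 u))
  | monomial n a =>
    refine ⟨|a| * (n.factorial * Real.exp (1 / 2)), by positivity, fun u => ?_⟩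
    rw [Polynomial.eval_monomial, abs_mul, abs_pow, mul_assoc]
    refine mul_le_mul_of_nonneg_left ?_ (abs_nonneg a)
    have h1 := Real.pow_div_factorial_le_exp |u| (abs_nonneg u) n
    rw [div_le_iff₀ (by positivity)] at h1
    refine h1.trans ?_
    rw [mul_assoc, ← Real.exp_add, mul_comm]
    refine mul_le_mul_of_nonneg_left (Real.exp_le_exp.2 ?_) (by positivity)
    nlinarith [sq_nonneg (|u| - 1), sq_abs u]

theorem iteratedDeriv_gaussBarrier (l : ℕ) {ε : ℝ} (hε : 0 < ε) (s : ℝ) :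
    iteratedDeriv l (gaussBarrier ε) s = (Real.sqrt ε)⁻¹ ^ l *
      iteratedDeriv l (fun u : ℝ => Real.exp (-(u ^ 2))) ((Real.sqrt ε)⁻¹ * s) := by
  have h : gaussBarrier ε = fun s => (fun u : ℝ => Real.exp (-(u ^ 2))) ((Real.sqrt ε)⁻¹ * s) := by
    funext s
    simp only [gaussBarrier, mul_pow, inv_pow, Real.sq_sqrt hε.le]
    congr 1
    field_simp
  have hc : ContDiff ℝ l fun u : ℝ => Real.exp (-(u ^ 2)) := by fun_prop
  rw [h, iteratedDeriv_comp_const_mul hc]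

theorem abs_iteratedDeriv_gaussBarrier_le (r : ℕ) : ∃ C, 0 ≤ C ∧ ∀ ε ∈ Ioo 0 (Real.exp (-2)),
    ∀ l ≤ r + 2, ∀ s, wid r ε / 2 ≤ s → |iteratedDeriv l (gaussBarrier ε) s| ≤ C * ε := by
  choose p hp using iteratedDeriv_gauss
  choose Cp hCp0 hCp using fun l => exists_abs_eval_le (p l)
  set B := ∑ i ∈ Finset.range (r + 3), Cp i with hB
  have hBi : ∀ i ≤ r + 2, Cp i ≤ B := fun i hi =>
    Finset.single_le_sum (f := Cp) (fun j _ => hCp0 j) (Finset.mem_range.2 (by omega))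
  have hB0 : 0 ≤ B := (hCp0 0).trans (hBi 0 (Nat.zero_le _))
  refine ⟨B, hB0, fun ε hε l hl s hs => ?_⟩
  obtain ⟨h1, h2, h3, h4⟩ := small_log hε
  have hw := wid_pos (r := r) hε
  rw [iteratedDeriv_gaussBarrier l hε.1, hp, abs_mul, abs_mul, abs_of_nonneg (by positivity),
    abs_of_pos (Real.exp_pos _)]
  set u := (Real.sqrt ε)⁻¹ * s with hu
  have hu2 : u ^ 2 = s ^ 2 / ε := by
    rw [hu, mul_pow, inv_pow, Real.sq_sqrt hε.1.le]; field_simp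
  -- The constant 8(r + 3) in `wid` is chosen so that u² ≥ 2(r + 3)|ln ε|. Half of the exponent
  -- absorbs the polynomial. The other half gives ε^(r + 3), which beats the scaling factor ε^(-(r +
  -- 2)) and leaves ε.
  have hs2 : 2 * (r + 3) * -Real.log ε ≤ u ^ 2 := by
    rw [hu2, le_div_iff₀ hε.1]
    have e : (wid r ε / 2) ^ 2 = 2 * (r + 3) * (ε * -Real.log ε) := by
      rw [div_pow, wid, Real.sq_sqrt (by have := hε.1; positivity), h1]; ring
    have := pow_le_pow_left₀ (by positivity) hs 2
    rw [e] at this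
    linarith
  have hexp : Real.exp (u ^ 2 / 2) * Real.exp (-(u ^ 2)) ≤ ε ^ (r + 3) := by
    rw [← Real.exp_add]
    have : ε ^ (r + 3) = Real.exp ((r + 3) * Real.log ε) := by
      rw [mul_comm, Real.exp_mul, Real.exp_log hε.1]
      norm_cast
    rw [this]
    exact Real.exp_le_exp.2 (by linarith)
  have hsq : (Real.sqrt ε)⁻¹ ^ l ≤ ε⁻¹ ^ (r + 2) := by
    have a1 : (Real.sqrt ε)⁻¹ ≤ ε⁻¹ := by
      refine inv_anti₀ hε.1 (Real.le_sqrt_of_sq_le ?_)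
      nlinarith [hε.1]
    have a2 : 1 ≤ ε⁻¹ := (one_le_inv₀ hε.1).2 h4.le
    calc (Real.sqrt ε)⁻¹ ^ l ≤ ε⁻¹ ^ l := pow_le_pow_left₀ (by positivity) a1 l
      _ ≤ ε⁻¹ ^ (r + 2) := pow_le_pow_right₀ a2 hl
  calc (Real.sqrt ε)⁻¹ ^ l * (|(p l).eval u| * Real.exp (-(u ^ 2)))
      ≤ ε⁻¹ ^ (r + 2) * ((B * Real.exp (u ^ 2 / 2)) * Real.exp (-(u ^ 2))) := by
        gcongr
        · exact pow_nonneg (inv_nonneg.2 hε.1.le) _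
        · exact (hCp l u).trans (mul_le_mul_of_nonneg_right (hBi l hl) (Real.exp_pos _).le)
    _ = ε⁻¹ ^ (r + 2) * (B * (Real.exp (u ^ 2 / 2) * Real.exp (-(u ^ 2)))) := by ring
    _ ≤ ε⁻¹ ^ (r + 2) * (B * ε ^ (r + 3)) := by
        gcongr
        exact pow_nonneg (inv_nonneg.2 hε.1.le) _
    _ = B * ε := by
        have := hε.1.ne'
        rw [inv_pow, pow_succ ε (r + 2)]
        field_simp

theorem admissibleWidth_wid {r : ℕ} (hr : 1 ≤ r) : SteepSystem.AdmissibleWidth r (wid r) := by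
  obtain ⟨C, hC0, hC⟩ := abs_iteratedDeriv_gaussBarrier_le r
  refine ⟨?_, tendsto_wid hr, fun l hl => ?_⟩
  · filter_upwards [eventually_small (Real.exp_pos (-2))] with ε hε using wid_pos hε
  · refine squeeze_zero_norm' (a := fun ε => C * ε) ?_ ?_
    · filter_upwards [eventually_small (Real.exp_pos (-2))] with ε hε
      exact hC ε hε l (by omega) _ (by linarith [wid_pos (r := r) hε])
    · have : Tendsto (fun ε : ℝ => C * ε) (𝓝 0) (𝓝 0) := by
        have : Continuous fun ε : ℝ => C * ε := by fun_prop
        simpa using this.tendsto 0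
      exact tendsto_nhdsWithin_of_tendsto_nhds this

/-- The derivative of the Gaussian barrier, extended below half the layer width. -/
noncomputable def gaussDer (r : ℕ) (ε : Eps) (s : ℝ) : ℝ :=
  taylorExt r (fun i => iteratedDeriv (i + 1) (gaussBarrier ε)) (wid r ε / 2) 0 s

theorem gaussDer_eq {r : ℕ} {ε : Eps} {s : ℝ} (h : wid r ε / 2 ≤ s) :
    gaussDer r ε s = deriv (gaussBarrier ε) s := by
  simp [gaussDer, taylorExt, h]

theorem contDiff_gaussBarrier (ε : ℝ) {n : WithTop ℕ∞} : ContDiff ℝ n (gaussBarrier ε) := by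
  unfold gaussBarrier
  fun_prop

theorem cBound_gaussDer {r : ℕ} (hr : 1 ≤ r) {K : Set ℝ} (hK : IsCompact K) :
    CBound smallEps K (fun ε => nu r ε) r (gaussDer r) := by
  obtain ⟨C, hC0, hC⟩ := abs_iteratedDeriv_gaussBarrier_le r
  obtain ⟨R, hR⟩ := hK.isBounded.subset_ball (0 : ℝ)
  have h1 : ∀ᶠ p : Eps × ℝ in smallEps ×ˢ 𝓝ˢ K, |p.2| < R := by
    have : ∀ᶠ x : ℝ in 𝓝ˢ K, |x| < R := by
      filter_upwards [Metric.isOpen_ball.mem_nhdsSet.2 hR] with x hx'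
      simpa using hx'
    exact this.prod_inr _
  have h2 : ∀ᶠ p : Eps × ℝ in smallEps ×ˢ 𝓝ˢ K, (p.1 : ℝ) ∈ Ioo 0 (Real.exp (-2)) ∧
      wid r p.1 < 1 := by
    have : ∀ᶠ ε : Eps in smallEps, (ε : ℝ) ∈ Ioo 0 (Real.exp (-2)) ∧ wid r ε < 1 :=
      Filter.Eventually.and (eventually_small (Real.exp_pos (-2)))
        ((tendsto_wid hr).eventually_lt_const (by norm_num))
    exact this.prod_inl _
  have hd : ∀ ε : Eps, ∀ (i : ℕ), ∀ x,
      HasDerivAt (iteratedDeriv (i + 1) (gaussBarrier ε)) (iteratedDeriv (i + 1 + 1) (gaussBarrier ε) x) x := by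
    intro ε i x
    rw [iteratedDeriv_succ (n := i + 1)]
    exact ((contDiff_gaussBarrier ε (n := (i + 2 : ℕ))).differentiable_iteratedDeriv (i + 1)
      (by norm_cast; omega) x).hasDerivAt
  refine CBound.of_derivSeq (ι := Eps) r
    (F := fun j ε => taylorExt r (fun i => iteratedDeriv (i + 1) (gaussBarrier ε)) (wid r ε / 2) j) ?_ ?_ ?_
  · intro j hj
    refine Eventually.of_forall fun p => ?_
    exact hasDerivAt_taylorExt (b := p.2 + 1) (fun i _ x hx hx' => hd p.1 i x) hj (by linarith)
  · refine Eventually.of_forall fun p => ?_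
    exact continuousAt_taylorExt (b := max p.2 (wid r p.1 / 2) + 1)
      (by linarith [le_max_right p.2 (wid r p.1 / 2)])
      (fun x hx hx' => (hd p.1 r x).continuousAt) (by linarith [le_max_left p.2 (wid r p.1 / 2)])
  · intro j hj
    refine IsBigO.of_bound (C * Real.exp (R + 1)) ?_
    filter_upwards [h1, h2] with p hp hq
    have h3 := abs_taylorExt_le (n := r) (F := fun i => iteratedDeriv (i + 1) (gaussBarrier p.1))
      (a := wid r p.1 / 2) (b := max p.2 (wid r p.1 / 2) + 1)
      (by linarith [le_max_right p.2 (wid r p.1 / 2)])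
      (fun i hi x hx hx' => hC p.1 hq.1 (i + 1) (by omega) x hx) hj
      (x := p.2) (by linarith [le_max_left p.2 (wid r p.1 / 2)])
    have hν := nu_pos (r := r) hq.1
    have hw := wid_pos (r := r) hq.1
    have h4 : |p.2 - wid r p.1 / 2| ≤ R + 1 := by
      refine (abs_sub _ _).trans ?_
      rw [abs_of_pos (half_pos hw)]
      linarith [hq.2]
    rw [Real.norm_eq_abs, Real.norm_of_nonneg hν.le]
    refine h3.trans ?_
    have h5 := Real.exp_le_exp.2 h4
    have h6 := mul_le_mul_of_nonneg_left (eps_le_nu hr hq.1) hC0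
    have h7 := mul_le_mul h6 h5 (Real.exp_pos _).le (by positivity)
    linarith

/-! ### Motion in a small force field -/

section Components

variable {E F : Type} [NormedAddCommGroup E] [NormedSpace ℝ E] [NormedAddCommGroup F]
  [NormedSpace ℝ F] {f : ℝ → E × F} {f' : E × F} {s : Set ℝ} {t : ℝ}

theorem HasDerivWithinAt.fst_comp (h : HasDerivWithinAt f f' s t) :
    HasDerivWithinAt (fun t => (f t).1) f'.1 s t :=
  (ContinuousLinearMap.fst ℝ E F).hasFDerivAt.comp_hasDerivWithinAt t h

theorem HasDerivWithinAt.snd_comp (h : HasDerivWithinAt f f' s t) :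
    HasDerivWithinAt (fun t => (f t).2) f'.2 s t :=
  (ContinuousLinearMap.snd ℝ E F).hasFDerivAt.comp_hasDerivWithinAt t h

end Components

section NearFree

variable {ι E : Type} [TopologicalSpace ι] [DiscreteTopology ι] [NormedAddCommGroup E]
  [NormedSpace ℝ E] {l : Filter ι} {μ : ι → ℝ}

/-- Free flight during the time `z.1`, from the position and momentum `z.2`. -/
def freeFlight (z : ℝ × E × E) : E × E := (z.2.1 + z.1 • z.2.2, z.2.2)

theorem contDiff_freeFlight {n : WithTop ℕ∞} : ContDiff ℝ n (freeFlight : ℝ × E × E → E × E) := by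
  unfold freeFlight
  fun_prop

theorem freeFlight_zero (ρ : E × E) : freeFlight (0, ρ) = ρ := by
  simp [freeFlight]

/-- Newton's equation with force `F` on a time interval of length `z.1`, scaled to unit length, in
the coordinates that straighten out the free flight. -/
def interactionField (F : ι → E → E) (j : ι × unitInterval) (z : ℝ × E × E) : ℝ × E × E :=
  (0, (-(z.1 * z.1 * j.2)) • F j.1 (z.2.1 + ((j.2 : ℝ) * z.1) • z.2.2),
    z.1 • F j.1 (z.2.1 + ((j.2 : ℝ) * z.1) • z.2.2))

theorem cBound_interactionField {n : ℕ} {F : ι → E → E} {q p : E} {τ₀ : ℝ}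
    (hF : CBound l ((fun s : ℝ => q + s • p) '' Icc 0 τ₀) μ n F) :
    CBound (l ×ˢ (⊤ : Filter unitInterval)) (Icc 0 τ₀ ×ˢ {(q, p)}) (fun j => μ j.1) n
      (interactionField F) := by
  have hK : IsCompact (Icc 0 τ₀ ×ˢ {(q, p)} : Set (ℝ × E × E)) :=
    isCompact_Icc.prod isCompact_singleton
  set L : Filter (ι × unitInterval) := l ×ˢ ⊤
  set K : Set (ℝ × E × E) := Icc 0 τ₀ ×ˢ {(q, p)}
  have hτ : CBound L K (fun _ => 1) n fun _ z => z.1 :=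
    CBound.clm_id hK (ContinuousLinearMap.fst ℝ ℝ (E × E))
  have ha : CBound L K (fun _ => 1) n fun _ z => z.2.1 :=
    CBound.clm_id hK ((ContinuousLinearMap.fst ℝ E E).comp (ContinuousLinearMap.snd ℝ ℝ (E × E)))
  have hb : CBound L K (fun _ => 1) n fun _ z => z.2.2 :=
    CBound.clm_id hK ((ContinuousLinearMap.snd ℝ E E).comp (ContinuousLinearMap.snd ℝ ℝ (E × E)))
  have hθ : CBound L K (fun _ => 1) n fun j (_ : ℝ × E × E) => (j.2 : ℝ) := by
    refine CBound.const_family (by fun_prop) (IsBigO.of_bound 1 (Eventually.of_forall fun j => ?_))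
    simpa [abs_of_nonneg j.2.2.1] using j.2.2.2
  have harg : CBound L K (fun _ => 1) n fun j z => z.2.1 + ((j.2 : ℝ) * z.1) • z.2.2 :=
    ha.add ((hθ.smul_right hτ).smul_right hb)
  have ht : Tendsto (fun w : (ι × unitInterval) × (ℝ × E × E) =>
      (w.1.1, w.2.2.1 + ((w.1.2 : ℝ) * w.2.1) • w.2.2.2)) (L ×ˢ 𝓝ˢ K)
      (l ×ˢ 𝓝ˢ ((fun s : ℝ => q + s • p) '' Icc 0 τ₀)) := by
    refine (tendsto_fst.comp tendsto_fst).prodMk ?_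
    have h1 : Tendsto (fun w : unitInterval × (ℝ × E × E) =>
        w.2.2.1 + ((w.1 : ℝ) * w.2.1) • w.2.2.2) (𝓝ˢ (univ ×ˢ K))
        (𝓝ˢ ((fun s : ℝ => q + s • p) '' Icc 0 τ₀)) := by
      refine Continuous.tendsto_nhdsSet (by fun_prop) ?_
      rintro ⟨θ, τ, ρ⟩ ⟨-, hτ, hρ⟩
      obtain rfl : ρ = (q, p) := hρ
      refine ⟨θ * τ, ⟨mul_nonneg θ.2.1 hτ.1, ?_⟩, rfl⟩
      exact (mul_le_of_le_one_left hτ.1 θ.2.2).trans hτ.2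
    rw [isCompact_univ.nhdsSet_prod_eq hK, nhdsSet_univ] at h1
    exact h1.comp ((tendsto_snd.comp tendsto_fst).prodMk tendsto_snd)
  have hFc := hF.comp harg continuous_fst ht
  exact CBound.zero_fun.prodMk
    (((((hτ.smul_right hτ).smul_right hθ).neg).smul_right hFc).prodMk (hτ.smul_right hFc))

/-- In the coordinates q - s p, p a free particle is at rest, so only the small force moves the
point. The duration is carried along as a variable with zero velocity, which makes the estimate
uniform in it. By uniqueness, the motion of shorter duration is the initial part of the longer one,
so φ solves Newton's equation in its first variable. -/
theorem exists_nearFree [CompleteSpace E] (n : ℕ) (hμ : Tendsto μ l (𝓝 0)) {F : ι → E → E}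
    {q p : E} {τ₀ : ℝ} (hF : CBound l ((fun s : ℝ => q + s • p) '' Icc 0 τ₀) μ (n + 1) F) :
    ∃ φ : ι → ℝ × E × E → E × E,
      CBound l (Icc 0 τ₀ ×ˢ {(q, p)}) μ (n + 1) (fun i z => φ i z - freeFlight z) ∧
      ∀ᶠ w in l ×ˢ 𝓝ˢ (Icc 0 τ₀ ×ˢ {(q, p)}), φ w.1 (0, w.2.2) = w.2.2 ∧
        ∀ σ ∈ Icc 0 w.2.1, HasDerivWithinAt (fun σ => φ w.1 (σ, w.2.2))
          ((φ w.1 (σ, w.2.2)).2, F w.1 (φ w.1 (σ, w.2.2)).1) (Icc 0 w.2.1) σ := by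
  have hK : IsCompact (Icc 0 τ₀ ×ˢ {(q, p)} : Set (ℝ × E × E)) :=
    isCompact_Icc.prod isCompact_singleton
  have hKc : Convex ℝ (Icc 0 τ₀ ×ˢ {(q, p)} : Set (ℝ × E × E)) :=
    (convex_Icc _ _).prod (convex_singleton _)
  have hg := cBound_interactionField hF
  set K : Set (ℝ × E × E) := Icc 0 τ₀ ×ˢ {(q, p)}
  obtain ⟨Φ, hΦ, hΦC⟩ := exists_smallFlow n hK hμ hg
  have hΦ1 := hΦC.reindex (j := fun i => (i, (1 : unitInterval))) (by fun_prop)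
    (tendsto_id.prodMk tendsto_top)
  refine ⟨fun i z => ((Φ (i, 1) z).2.1 + z.1 • (Φ (i, 1) z).2.2, (Φ (i, 1) z).2.2), ?_, ?_⟩
  · have hτ : CBound l K (fun _ => 1) (n + 1) fun _ z => z.1 :=
      CBound.clm_id hK (ContinuousLinearMap.fst ℝ ℝ (E × E))
    have := (hΦ1.snd.fst.add (hτ.smul_right hΦ1.snd.snd)).prodMk hΦ1.snd.snd
    convert this using 3 with i z
    ext1
    · simp only [freeFlight, Prod.fst_sub, Prod.snd_sub]; module
    · simp [freeFlight]
  -- a convex neighbourhood on which the field is a contraction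
  obtain ⟨-, g', hg', hg'C⟩ := cBound_succ.1 hg
  have hμ' : Tendsto (fun j : ι × unitInterval => μ j.1) (l ×ˢ ⊤) (𝓝 0) := hμ.comp tendsto_fst
  have e1 : ∀ᶠ w in (l ×ˢ (⊤ : Filter unitInterval)) ×ˢ 𝓝ˢ K, ‖g' w.1 w.2‖ < 1 := by
    have := (hg'C.tendsto_zero hμ').norm
    rw [norm_zero] at this
    exact this.eventually_lt_const one_pos
  obtain ⟨d, hd, e2⟩ := exists_thickening_of_eventually hK (eventually_unit.1 (hg'.and e1))
  have e3 : ∀ᶠ w in (l ×ˢ (⊤ : Filter unitInterval)) ×ˢ 𝓝ˢ K, ‖Φ w.1 w.2 - w.2‖ < d / 2 := by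
    have := (hΦC.tendsto_zero hμ').norm
    rw [norm_zero] at this
    exact this.eventually_lt_const (half_pos hd)
  obtain ⟨d₁, hd₁, e4⟩ := exists_thickening_of_eventually hK (hΦ.and (eventually_unit.1 e3))
  set d₂ := min d₁ (d / 2) with hd₂
  have hd₂0 : 0 < d₂ := lt_min hd₁ (half_pos hd)
  refine eventually_of_exists_thickening hd₂0 ?_
  filter_upwards [e2, e4] with i h2 h4
  have hS : Convex ℝ (Metric.thickening d K) := hKc.thickening d
  have hLip : ∀ s, LipschitzOnWith 1 (interactionField F (i, s)) (Metric.thickening d K) := fun s =>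
    hS.lipschitzOnWith_of_nnnorm_hasFDerivWithin_le
      (fun x hx => ((h2 x hx s).1).hasFDerivWithinAt)
      fun x hx => by
        have := (h2 x hx s).2.le
        exact_mod_cast this
  have hsub : ∀ x ∈ Metric.thickening d₂ K, x ∈ Metric.thickening d₁ K := fun x hx =>
    Metric.thickening_mono (min_le_left _ _) _ hx
  have hstay : ∀ x ∈ Metric.thickening d₂ K, ∀ y, ‖y - x‖ < d / 2 → y ∈ Metric.thickening d K := by
    intro x hx y hy
    obtain ⟨k, hk, hxk⟩ := Metric.mem_thickening_iff.1 hx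
    refine Metric.mem_thickening_iff.2 ⟨k, hk, ?_⟩
    rw [← dist_eq_norm] at hy
    linarith [dist_triangle y x k, min_le_right d₁ (d / 2)]
  -- uniqueness
  have huniq : ∀ x ∈ Metric.thickening d₂ K, ∀ γ, IsLine (fun s => interactionField F (i, s)) γ x →
      (∀ s, ‖γ s - x‖ < d / 2) → ∀ s, γ s = Φ (i, s) x := by
    intro x hx γ hγ hγx s
    have := hγ.norm_sub_le (h4 x (hsub x hx)).1 hLip (fun s => hstay x hx _ (hγx s))
      (fun s => hstay x hx _ ((h4 x (hsub x hx)).2 s)) s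
    rw [sub_self, norm_zero, mul_zero] at this
    exact sub_eq_zero.1 (norm_le_zero_iff.1 this)
  have hfst : ∀ x ∈ Metric.thickening d₂ K, ∀ s, (Φ (i, s) x).1 = x.1 := by
    intro x hx s
    have hl := (h4 x (hsub x hx)).1
    have := norm_le_of_norm_deriv_le_unit (γ := fun s => (Φ (i, s) x).1 - x.1) (γ' := fun _ => 0)
      (e := 0) (fun s hs => by
        have := ((hl.deriv s hs).fst_comp).sub_const x.1
        exact this) (by simp) le_rfl s
    have h0 : Φ (i, 0) x = x := hl.init
    rw [h0] at this
    simpa [sub_eq_zero] using this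
  have hfield : ∀ x ∈ Metric.thickening d₂ K, ∀ s, interactionField F (i, s) (Φ (i, s) x) =
      (0, (-(x.1 * x.1 * s)) • F i ((Φ (i, s) x).2.1 + ((s : ℝ) * x.1) • (Φ (i, s) x).2.2),
        x.1 • F i ((Φ (i, s) x).2.1 + ((s : ℝ) * x.1) • (Φ (i, s) x).2.2)) := by
    intro x hx s
    simp only [interactionField, hfst x hx s]
  have hinit : ∀ ρ, (0, ρ) ∈ Metric.thickening d₂ K → Φ (i, 1) (0, ρ) = (0, ρ) := by
    intro ρ hρ
    refine (huniq (0, ρ) hρ (fun _ => (0, ρ)) ⟨rfl, fun s hs => ?_⟩ (fun s => ?_) 1).symm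
    · exact (hasDerivWithinAt_const s (Icc 0 1) ((0 : ℝ), ρ)).congr_deriv (by simp [interactionField, Prod.zero_eq_mk])
    · simpa using half_pos hd
  intro x hx
  obtain ⟨τ, ρ⟩ := x
  have h0mem : ((0 : ℝ), ρ) ∈ Metric.thickening d₂ K := by
    obtain ⟨k, hk, hxk⟩ := Metric.mem_thickening_iff.1 hx
    refine Metric.mem_thickening_iff.2 ⟨(0, k.2), ⟨⟨le_rfl, hk.1.1.trans hk.1.2⟩, hk.2⟩, ?_⟩
    rw [Prod.dist_eq] at hxk ⊢
    simpa [hd₂0] using (le_max_right _ _).trans_lt hxk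
  refine ⟨by simp [hinit ρ h0mem], fun σ hσ => ?_⟩
  dsimp only at hσ ⊢
  rcases (hσ.1.trans hσ.2).eq_or_lt with rfl | hτ
  · have : σ = 0 := le_antisymm hσ.2 hσ.1
    subst this
    rw [Icc_self]
    exact HasFDerivWithinAt.of_subsingleton subsingleton_singleton
  have hmem : ∀ σ ∈ Icc 0 τ, (σ, ρ) ∈ Metric.thickening d₂ K := by
    intro σ hσ
    have hc : Convex ℝ (Metric.thickening d₂ K) := hKc.thickening d₂
    have := hc h0mem hx (sub_nonneg.2 ((div_le_one hτ).2 hσ.2)) (div_nonneg hσ.1 hτ.le) (by ring)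
    convert this using 1
    ext1
    · simp [hτ.ne']
    · simp only [Prod.snd_add, Prod.smul_snd]; module
  have hl := (h4 _ (hsub _ hx)).1
  -- rescaling
  have hscale : ∀ σ ∈ Icc 0 τ, (Φ (i, 1) (σ, ρ)).2 = (Φ (i, toUnit (σ / τ)) (τ, ρ)).2 := by
    intro σ hσ
    have hστ : σ / τ ∈ Icc (0 : ℝ) 1 := ⟨div_nonneg hσ.1 hτ.le, (div_le_one hτ).2 hσ.2⟩
    have hmaps : MapsTo (fun s : ℝ => s * (σ / τ)) (Icc 0 1) (Icc 0 1) := fun s hs =>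
      ⟨mul_nonneg hs.1 hστ.1, mul_le_one₀ hs.2 hστ.1 hστ.2⟩
    have := huniq (σ, ρ) (hmem σ hσ)
      (fun s => (σ, (Φ (i, toUnit ((s : ℝ) * (σ / τ))) (τ, ρ)).2)) ⟨?_, fun s hs => ?_⟩ (fun s => ?_) 1
    · rw [← this]; simp
    · have : Φ (i, 0) (τ, ρ) = (τ, ρ) := hl.init
      simp [this]
    · have h1 := (hl.deriv _ (hmaps hs)).scomp s
        (((hasDerivAt_id s).mul_const (σ / τ)).hasDerivWithinAt) hmaps
      have h2 := (hasDerivWithinAt_const s (Icc 0 1) σ).prodMk h1.snd_comp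
      rw [hfield _ hx] at h2
      have e : ((toUnit (s * (σ / τ)) : unitInterval) : ℝ) = s * (σ / τ) := coe_toUnit (hmaps hs)
      have e' : s * (σ / τ) * τ = s * σ := by field_simp
      refine (h2.congr_deriv ?_).congr (fun y hy => ?_) ?_
      · simp only [interactionField, e, coe_toUnit hs, e']
        ext1
        · rfl
        ext1
        · simp only [Prod.smul_mk, smul_smul]
          congr 1
          field_simp
        · simp only [Prod.smul_mk, smul_smul]
          congr 1
          field_simp
      · simp [coe_toUnit hy]
      · simp [coe_toUnit hs]
    · refine lt_of_le_of_lt ?_ ((h4 _ (hsub _ hx)).2 (toUnit ((s : ℝ) * (σ / τ))))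
      rw [Prod.norm_def]
      simp only [Prod.fst_sub, sub_self, norm_zero, Prod.snd_sub]
      rw [max_eq_right (norm_nonneg _)]
      exact norm_snd_le (Φ (i, toUnit ((s : ℝ) * (σ / τ))) (τ, ρ) - (τ, ρ))
  have hστ : ∀ σ ∈ Icc 0 τ, σ / τ ∈ Icc (0 : ℝ) 1 := fun σ hσ =>
    ⟨div_nonneg hσ.1 hτ.le, (div_le_one hτ).2 hσ.2⟩
  have h1 := ((hl.deriv _ (hστ σ hσ)).scomp σ
    (((hasDerivAt_id σ).div_const τ).hasDerivWithinAt) (fun σ hσ => hστ σ hσ)).snd_comp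
  rw [hfield _ hx, coe_toUnit (hστ σ hσ)] at h1
  have h2 := (h1.fst_comp.add ((hasDerivWithinAt_id σ (Icc 0 τ)).smul h1.snd_comp)).prodMk h1.snd_comp
  refine (h2.congr_deriv ?_).congr (fun y hy => ?_) ?_
  · rw [hscale σ hσ]
    have e : σ / τ * τ = σ := by field_simp
    simp only [e, Function.comp_apply, id, Prod.smul_mk, smul_smul, one_smul]
    ext1
    · have e2 : 1 / τ * -(τ * τ * (σ / τ)) = -σ := by field_simp
      have e3 : 1 / τ * τ = 1 := by field_simp
      simp only [e2, e3]
      module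
    · have e3 : 1 / τ * τ = 1 := by field_simp
      simp only [e3, one_smul]
  · simp [hscale y hy]
  · simp [hscale σ hσ]

end NearFree

/-! ### Pairs of close families -/

section CNear

variable {ι E F G : Type} [TopologicalSpace ι] [NormedAddCommGroup E]
  [NormedSpace ℝ E] [NormedAddCommGroup F] [NormedSpace ℝ F] [NormedAddCommGroup G]
  [NormedSpace ℝ G] {l : Filter ι} {μ : ι → ℝ} {n : ℕ} {x₀ : E} {y₀ : F} {z₀ : G}
  {f g : ι → E → F}

/-- Near `x₀`, the family `f` is `O(μ)`-close in `C^n` to the family `g`, which is bounded in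
`C^{n+1}` and tends to `y₀`. -/
structure CNear (l : Filter ι) (μ : ι → ℝ) (n : ℕ) (x₀ : E) (y₀ : F) (f g : ι → E → F) : Prop where
  smooth : CBound l {x₀} (fun _ => 1) (n + 1) g
  close : CBound l {x₀} μ n fun i x => f i x - g i x
  tendsto : Tendsto (fun p : ι × E => g p.1 p.2) (l ×ˢ 𝓝ˢ {x₀}) (𝓝 y₀)
  small : Tendsto μ l (𝓝 0)

namespace CNear

theorem left (h : CNear l μ n x₀ y₀ f g) : CBound l {x₀} (fun _ => 1) n f := by
  have h1 : μ =O[l] fun _ => (1 : ℝ) := h.small.isBigO_one ℝ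
  simpa using (h.close.trans h1).add h.smooth.pred

theorem tendsto_left (h : CNear l μ n x₀ y₀ f g) :
    Tendsto (fun p : ι × E => f p.1 p.2) (l ×ˢ 𝓝ˢ {x₀}) (𝓝 y₀) := by
  simpa using (h.close.tendsto_zero h.small).add h.tendsto

theorem self (hg : CBound l {x₀} (fun _ => 1) (n + 1) g)
    (ht : Tendsto (fun p : ι × E => g p.1 p.2) (l ×ˢ 𝓝ˢ {x₀}) (𝓝 y₀)) (hμ : Tendsto μ l (𝓝 0)) :
    CNear l μ n x₀ y₀ g g := by
  refine ⟨hg, ?_, ht, hμ⟩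
  simpa using CBound.zero_fun (l := l) (K := {x₀}) (μ := μ) (n := n) (E := E) (F := F)

theorem of_contDiffAt {u : E → F} (hu : ContDiffAt ℝ (n + 1) u x₀) (hμ : Tendsto μ l (𝓝 0)) :
    CNear l μ n x₀ (u x₀) (fun _ => u) fun _ => u := by
  refine self (CBound.of_contDiffAt_const isCompact_singleton ?_) ?_ hμ
  · rintro x rfl
    exact_mod_cast hu
  · rw [nhdsSet_singleton]
    exact hu.continuousAt.tendsto.comp tendsto_snd

theorem prodMk {f' g' : ι → E → G} (h : CNear l μ n x₀ y₀ f g) (h' : CNear l μ n x₀ z₀ f' g') :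
    CNear l μ n x₀ (y₀, z₀) (fun i x => (f i x, f' i x)) fun i x => (g i x, g' i x) :=
  ⟨h.smooth.prodMk h'.smooth, h.close.prodMk h'.close, h.tendsto.prodMk_nhds h'.tendsto, h.small⟩

theorem tendsto_graph (h : CNear l μ n x₀ y₀ f g) :
    Tendsto (fun p : ι × E => (p.1, g p.1 p.2)) (l ×ˢ 𝓝ˢ {x₀}) (l ×ˢ 𝓝ˢ {y₀}) := by
  rw [nhdsSet_singleton (x := y₀)]
  exact tendsto_fst.prodMk h.tendsto

theorem tendsto_graph_left (h : CNear l μ n x₀ y₀ f g) :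
    Tendsto (fun p : ι × E => (p.1, f p.1 p.2)) (l ×ˢ 𝓝ˢ {x₀}) (l ×ˢ 𝓝ˢ {y₀}) := by
  rw [nhdsSet_singleton (x := y₀)]
  exact tendsto_fst.prodMk h.tendsto_left

/-- The difference is (f' - g') evaluated along f, plus g' compared along f and g. The second part
uses the extra derivative of g'. -/
theorem comp {f' g' : ι → F → G} (h' : CNear l μ n y₀ z₀ f' g') (h : CNear l μ n x₀ y₀ f g) :
    CNear l μ n x₀ z₀ (fun i x => f' i (f i x)) fun i x => g' i (g i x) := by
  refine ⟨h'.smooth.comp h.smooth continuous_id h.tendsto_graph, ?_,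
    h'.tendsto.comp h.tendsto_graph, h.small⟩
  have h1 : CBound l {x₀} μ n fun i x => f' i (f i x) - g' i (f i x) :=
    h'.close.comp h.left continuous_id h.tendsto_graph_left
  have h2 : CBound l {x₀} μ n fun i x => g' i (f i x) - g' i (g i x) :=
    h'.smooth.comp_sub_comp h.left h.smooth.pred h.close continuous_id
      (eventually_segment isCompact_singleton (convex_singleton _) h.tendsto_graph_left
        h.tendsto_graph)
  simpa using h1.add h2

theorem map {u : F → G} (hu : ContDiffAt ℝ (n + 1) u y₀) (h : CNear l μ n x₀ y₀ f g) :
    CNear l μ n x₀ (u y₀) (fun i x => u (f i x)) fun i x => u (g i x) :=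
  (of_contDiffAt hu h.small).comp h

theorem fst {y₀ : F × G} {f g : ι → E → F × G} (h : CNear l μ n x₀ y₀ f g) :
    CNear l μ n x₀ y₀.1 (fun i x => (f i x).1) fun i x => (g i x).1 :=
  h.map contDiffAt_fst

theorem snd {y₀ : F × G} {f g : ι → E → F × G} (h : CNear l μ n x₀ y₀ f g) :
    CNear l μ n x₀ y₀.2 (fun i x => (f i x).2) fun i x => (g i x).2 :=
  h.map contDiffAt_snd

theorem add {y₁ : F} {f' g' : ι → E → F} (h : CNear l μ n x₀ y₀ f g)
    (h' : CNear l μ n x₀ y₁ f' g') :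
    CNear l μ n x₀ (y₀ + y₁) (fun i x => f i x + f' i x) fun i x => g i x + g' i x :=
  (h.prodMk h').map (u := fun z : F × F => z.1 + z.2) (by fun_prop)

end CNear

end CNear

/-! ### The pattern function and the force -/

namespace SteepSystem

variable {d : ℕ}

/-- The standing assumptions. -/
structure Hyp (S : SteepSystem d) (r : ℕ) : Prop where
  one_le : 1 ≤ r
  domain : S.IsDomain
  pattern : S.PatternCondition r
  potential : S.ConditionI r
  barrier : S.GaussianBarrier
  dominated : S.BoundaryDominated r

/-- The force, extended smoothly into the boundary layer. -/
noncomputable def force (S : SteepSystem d) (r : ℕ) (ε : Eps) (q : Pos d) : Pos d :=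
  open Classical in
  if q ∈ S.N then -(gaussDer r ε (S.Q ε q) • gradient (S.Q ε) q) else -gradient (S.V ε) q

variable {S : SteepSystem d} {r : ℕ}

theorem Hyp.interior_subset (h : S.Hyp r) : interior S.D ⊆ S.D \ S.corner := fun _ hq =>
  ⟨_root_.interior_subset hq, fun hc => (h.domain.corner_subset hc).2 hq⟩

theorem Hyp.mem_cases (_ : S.Hyp r) {q : Pos d} (hq : q ∈ S.D \ S.corner) :
    q ∈ interior S.D ∨ q ∈ frontier S.D \ S.corner := by
  by_cases hi : q ∈ interior S.D
  · exact Or.inl hi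
  · exact Or.inr ⟨⟨subset_closure hq.1, hi⟩, hq.2⟩

theorem Hyp.wall_subset (h : S.Hyp r) : frontier S.D \ S.corner ⊆ S.D \ S.corner := fun _ hq =>
  ⟨h.domain.closed_D.frontier_subset hq.1, hq.2⟩

theorem eventually_smallEps {P : ℝ → Prop} (h : ∀ᶠ ε in 𝓝[≥] (0 : ℝ), P ε) :
    ∀ᶠ ε : Eps in smallEps, P ε :=
  h.filter_mono (nhdsWithin_mono _ Ioi_subset_Ici_self)

theorem eventually_smallEps_mem (r : ℕ) {c : ℝ} (hc : 0 < c) :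
    ∀ᶠ ε : Eps in smallEps, (ε : ℝ) ∈ Ioo 0 (Real.exp (-2)) ∧ nu r ε < c :=
  Filter.Eventually.and (eventually_small (Real.exp_pos (-2)))
    ((tendsto_nu (r := r)).eventually_lt_const hc)

theorem Hyp.contDiffAt_Q (h : S.Hyp r) :
    ∀ᶠ ε in 𝓝[≥] (0 : ℝ), ∀ q ∈ S.Dt, ContDiffAt ℝ (r + 2) (S.Q ε) q := by
  filter_upwards [h.pattern.smooth] with ε hε q hq
  exact hε.contDiffAt (h.domain.open_Dt.mem_nhds hq)

theorem Hyp.contDiffAt_Q_zero (h : S.Hyp r) {q : Pos d} (hq : q ∈ S.Dt) :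
    ContDiffAt ℝ (r + 2) (S.Q 0) q :=
  h.contDiffAt_Q.self_of_nhdsWithin (by simp) q hq

theorem exists_compact_nhd {U : Set (Pos d)} (hU : IsOpen U) {K : Set (Pos d)} (hK : IsCompact K)
    (hKU : K ⊆ U) : ∃ K', IsCompact K' ∧ K' ⊆ U ∧ K' ∈ 𝓝ˢ K := by
  obtain ⟨K', h1, h2, h3⟩ := exists_compact_between hK hU hKU
  exact ⟨K', h1, h3, mem_nhdsSet_iff_exists.2 ⟨interior K', isOpen_interior, h2, interior_subset⟩⟩

theorem Hyp.cBound_Q (h : S.Hyp r) {K : Set (Pos d)} (hK : IsCompact K) (hKD : K ⊆ S.Dt) :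
    CBound smallEps K (fun _ => 1) (r + 2) (fun ε : Eps => S.Q ε) := by
  obtain ⟨K', hK', hKD', hn⟩ := exists_compact_nhd h.domain.open_Dt hK hKD
  refine CBound.of_contDiffAt ?_ fun m hm => ?_
  · filter_upwards [(eventually_smallEps h.contDiffAt_Q).prod_inl (𝓝ˢ K),
      (show ∀ᶠ q in 𝓝ˢ K, q ∈ K' from hn).prod_inr smallEps] with p h1 h2
    exact_mod_cast h1 p.2 (hKD' h2)
  · have hc : ContinuousOn (iteratedFDeriv ℝ m (S.Q 0)) K' := fun q hq =>
      ((h.contDiffAt_Q_zero (hKD' hq)).continuousAt_iteratedFDeriv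
        (by exact_mod_cast hm)).continuousWithinAt
    obtain ⟨C, hC⟩ := hK'.exists_bound_of_continuousOn hc
    refine IsBigO.of_bound (C + 1) ?_
    have h3 : ∀ᶠ ε : Eps in smallEps, ∀ q ∈ K',
        dist (iteratedFDeriv ℝ m (S.Q 0) q) (iteratedFDeriv ℝ m (S.Q ε) q) < 1 :=
      Metric.tendstoUniformlyOn_iff.1 (h.pattern.limit K' hKD' hK' m hm) 1 one_pos
    filter_upwards [h3.prod_inl (𝓝ˢ K),
      (show ∀ᶠ q in 𝓝ˢ K, q ∈ K' from hn).prod_inr smallEps] with p h1 h2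
    have h4 := hC p.2 h2
    have h5 := h1 p.2 h2
    rw [dist_comm, dist_eq_norm] at h5
    have h6 := norm_add_le (iteratedFDeriv ℝ m (S.Q p.1) p.2 - iteratedFDeriv ℝ m (S.Q 0) p.2)
      (iteratedFDeriv ℝ m (S.Q 0) p.2)
    rw [sub_add_cancel] at h6
    rw [norm_one]
    linarith

theorem Hyp.tendsto_iteratedFDeriv_Q (h : S.Hyp r) {q₀ : Pos d} (hq : q₀ ∈ S.Dt) {m : ℕ}
    (hm : m ≤ r + 2) : Tendsto (fun p : Eps × Pos d => iteratedFDeriv ℝ m (S.Q p.1) p.2)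
      (smallEps ×ˢ 𝓝 q₀) (𝓝 (iteratedFDeriv ℝ m (S.Q 0) q₀)) := by
  obtain ⟨K', hK', hKD', hn⟩ := exists_compact_nhd h.domain.open_Dt isCompact_singleton
    (singleton_subset_iff.2 hq)
  rw [nhdsSet_singleton] at hn
  rw [Metric.tendsto_nhds]
  intro e he
  have h3 : ∀ᶠ ε : Eps in smallEps, ∀ q ∈ K',
      dist (iteratedFDeriv ℝ m (S.Q 0) q) (iteratedFDeriv ℝ m (S.Q ε) q) < e / 2 :=
    Metric.tendstoUniformlyOn_iff.1 (h.pattern.limit K' hKD' hK' m hm) _ (half_pos he)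
  have h4 := Metric.tendsto_nhds.1 ((h.contDiffAt_Q_zero hq).continuousAt_iteratedFDeriv
        (k := m) (by exact_mod_cast hm)).tendsto _ (half_pos he)
  filter_upwards [h3.prod_inl (𝓝 q₀), (h4.and hn).prod_inr smallEps] with p h1 h2
  have h5 := h1 p.2 h2.2
  rw [dist_comm] at h5
  linarith [dist_triangle (iteratedFDeriv ℝ m (S.Q p.1) p.2) (iteratedFDeriv ℝ m (S.Q 0) p.2)
    (iteratedFDeriv ℝ m (S.Q 0) q₀), h2.1]

theorem Hyp.tendsto_Q (h : S.Hyp r) {q₀ : Pos d} (hq : q₀ ∈ S.Dt) :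
    Tendsto (fun p : Eps × Pos d => S.Q p.1 p.2) (smallEps ×ˢ 𝓝 q₀) (𝓝 (S.Q 0 q₀)) := by
  have h1 := h.tendsto_iteratedFDeriv_Q hq (m := 0) (by omega)
  have h2 : Continuous fun A : ContinuousMultilinearMap ℝ (fun _ : Fin 0 => Pos d) ℝ => A 0 := by
    fun_prop
  simpa [Function.comp_def] using (h2.tendsto _).comp h1

/-- The gradient as a linear function of the derivative. -/
noncomputable def gradL (d : ℕ) : (Pos d →L[ℝ] ℝ) →L[ℝ] Pos d :=
  { toFun := fun L => (InnerProductSpace.toDual ℝ (Pos d)).symm L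
    map_add' := fun L L' => map_add _ L L'
    map_smul' := fun c L => by simp
    cont := (InnerProductSpace.toDual ℝ (Pos d)).symm.continuous }

theorem gradL_fderiv (f : Pos d → ℝ) (q : Pos d) : gradL d (fderiv ℝ f q) = gradient f q := rfl

theorem inner_gradient (f : Pos d → ℝ) (q v : Pos d) :
    inner ℝ (gradient f q) v = fderiv ℝ f q v := by
  rw [gradient, InnerProductSpace.toDual_symm_apply]

theorem Hyp.tendsto_fderiv_Q (h : S.Hyp r) {q₀ : Pos d} (hq : q₀ ∈ S.Dt) :
    Tendsto (fun p : Eps × Pos d => fderiv ℝ (S.Q p.1) p.2) (smallEps ×ˢ 𝓝 q₀)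
      (𝓝 (fderiv ℝ (S.Q 0) q₀)) := by
  have h1 := h.tendsto_iteratedFDeriv_Q hq (m := 1) (by omega)
  rw [tendsto_iff_norm_sub_tendsto_zero] at h1 ⊢
  refine squeeze_zero (fun _ => norm_nonneg _) (fun p => ?_) h1
  refine ContinuousLinearMap.opNorm_le_bound _ (norm_nonneg _) fun v => ?_
  have h2 := (iteratedFDeriv ℝ 1 (S.Q p.1) p.2 - iteratedFDeriv ℝ 1 (S.Q 0) q₀).le_opNorm
    (fun _ => v)
  simpa [iteratedFDeriv_one_apply] using h2

theorem Hyp.tendsto_gradient_Q (h : S.Hyp r) {q₀ : Pos d} (hq : q₀ ∈ S.Dt) :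
    Tendsto (fun p : Eps × Pos d => gradient (S.Q p.1) p.2) (smallEps ×ˢ 𝓝 q₀)
      (𝓝 (gradient (S.Q 0) q₀)) :=
  ((gradL d).continuous.tendsto _).comp (h.tendsto_fderiv_Q hq)

theorem Hyp.cBound_fderiv_Q (h : S.Hyp r) {K : Set (Pos d)} (hK : IsCompact K) (hKD : K ⊆ S.Dt) :
    CBound smallEps K (fun _ => 1) (r + 1) (fun (ε : Eps) q => fderiv ℝ (S.Q ε) q) :=
  (h.cBound_Q hK hKD).fderiv

theorem Hyp.cBound_gradient_Q (h : S.Hyp r) {K : Set (Pos d)} (hK : IsCompact K)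
    (hKD : K ⊆ S.Dt) :
    CBound smallEps K (fun _ => 1) (r + 1) (fun (ε : Eps) q => gradient (S.Q ε) q) :=
  (h.cBound_fderiv_Q hK hKD).clm (gradL d)

theorem Hyp.cBound_gaussDer_Q (h : S.Hyp r) {q₀ : Pos d} (hq : q₀ ∈ S.Dt) :
    CBound smallEps {q₀} (fun ε => nu r ε) r (fun (ε : Eps) q => gaussDer r ε (S.Q ε q)) := by
  have hQ := (h.cBound_Q isCompact_singleton (singleton_subset_iff.2 hq)).of_le (show r ≤ r + 2 by omega)
  refine (cBound_gaussDer h.one_le (isCompact_singleton (x := S.Q 0 q₀))).comp hQ continuous_id ?_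
  rw [nhdsSet_singleton, nhdsSet_singleton]
  exact tendsto_fst.prodMk (h.tendsto_Q hq)

/-- Near the regular boundary the potential is a function of `Q`. -/
theorem Hyp.eventually_V (h : S.Hyp r) : ∀ᶠ ε : Eps in smallEps, ∀ q ∈ S.N, 0 < S.Q ε q →
    S.V ε =ᶠ[𝓝 q] fun q => gaussBarrier ε (S.Q ε q) := by
  have h1 : ∀ᶠ ε : Eps in smallEps, ∀ q ∈ S.N, 0 ≤ S.Q ε q → S.V ε q = gaussBarrier ε (S.Q ε q) :=
    h.barrier
  filter_upwards [h1, eventually_smallEps h.contDiffAt_Q] with ε h1 h2 q hq hQ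
  filter_upwards [h.domain.open_N.mem_nhds hq,
    (h2 q (h.domain.N_subset hq)).continuousAt.eventually_const_lt hQ] with y hy hy'
  exact h1 y hy hy'.le

theorem Hyp.eventually_fderiv_V (h : S.Hyp r) : ∀ᶠ ε : Eps in smallEps, ∀ q ∈ S.N, 0 < S.Q ε q →
    fderiv ℝ (S.V ε) q = deriv (gaussBarrier ε) (S.Q ε q) • fderiv ℝ (S.Q ε) q := by
  filter_upwards [h.eventually_V, eventually_smallEps h.contDiffAt_Q] with ε h1 h2 q hq hQ
  rw [(h1 q hq hQ).fderiv_eq]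
  have h3 := ((h2 q (h.domain.N_subset hq)).differentiableAt (by simp)).hasFDerivAt
  have h4 := (hasDerivAt_gaussBarrier ε (S.Q ε q)).differentiableAt.hasDerivAt
  exact (h4.comp_hasFDerivAt q h3).fderiv

theorem Hyp.eventually_gradient_V (h : S.Hyp r) : ∀ᶠ ε : Eps in smallEps, ∀ q ∈ S.N, 0 < S.Q ε q →
    gradient (S.V ε) q = deriv (gaussBarrier ε) (S.Q ε q) • gradient (S.Q ε) q := by
  filter_upwards [h.eventually_fderiv_V] with ε h1 q hq hQ
  rw [← gradL_fderiv, h1 q hq hQ, map_smul, gradL_fderiv]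

theorem Hyp.force_eq (h : S.Hyp r) : ∀ᶠ ε : Eps in smallEps, ∀ q, wid r ε / 2 ≤ S.Q ε q →
    S.force r ε q = -gradient (S.V ε) q := by
  filter_upwards [h.eventually_gradient_V, eventually_smallEps_mem r one_pos] with ε h1 h2 q hq
  have h3 := wid_pos (r := r) h2.1
  by_cases hN : q ∈ S.N
  · rw [force, if_pos hN, h1 q hN (by linarith), gaussDer_eq hq]
  · rw [force, if_neg hN]

theorem Hyp.Q_pos (h : S.Hyp r) {q : Pos d} (hq : q ∈ interior S.D) : 0 < S.Q 0 q :=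
  (h.pattern.interior_iff q (h.domain.D_subset (h.interior_subset hq))).2 hq

theorem Hyp.Q_wall (h : S.Hyp r) {q : Pos d} (hq : q ∈ frontier S.D \ S.corner) : S.Q 0 q = 0 :=
  (h.pattern.boundary_iff q (h.domain.D_subset (h.wall_subset hq))).2 hq.1

theorem Hyp.eventually_lt_Q (h : S.Hyp r) {q₀ : Pos d} (hq : q₀ ∈ interior S.D) {δ : ℝ → ℝ}
    (hδ : Tendsto δ (𝓝[>] (0 : ℝ)) (𝓝 0)) :
    ∀ᶠ p : Eps × Pos d in smallEps ×ˢ 𝓝 q₀, p.2 ∈ S.Dt ∧ δ p.1 < S.Q p.1 p.2 := by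
  have hDt := h.domain.D_subset (h.interior_subset hq)
  have h1 : ∀ᶠ ε : Eps in smallEps, δ ε < S.Q 0 q₀ / 2 :=
    hδ.eventually_lt_const (half_pos (h.Q_pos hq))
  filter_upwards [h1.prod_inl (𝓝 q₀), (h.tendsto_Q hDt).eventually_const_lt
    (half_lt_self (h.Q_pos hq)), (h.domain.open_Dt.eventually_mem hDt).prod_inr smallEps]
    with p h1 h2 h3
  exact ⟨h3, h1.trans h2⟩

theorem Hyp.contDiff_V (h : S.Hyp r) : ∀ᶠ ε : Eps in smallEps, ContDiff ℝ (r + 1) (S.V ε) :=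
  h.potential.smooth

/-- Boundary domination with the width `wid` reduces the derivatives near an interior point to those
on Q = `wid` within a compact part of N. There V is the Gaussian of Q, whose derivatives are O(ν).
-/
theorem Hyp.cBound_fderiv_V (h : S.Hyp r) {q₀ : Pos d} (hq : q₀ ∈ interior S.D) :
    CBound smallEps {q₀} (fun ε => nu r ε) r (fun (ε : Eps) q => fderiv ℝ (S.V ε) q) := by
  have hDt := h.domain.D_subset (h.interior_subset hq)
  obtain ⟨A, hA, B, hB, hAB⟩ := eventually_prod_iff.1 (h.eventually_lt_Q hq (tendsto_wid h.one_le))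
  obtain ⟨K, hKn, hKB, hK⟩ := LocallyCompactSpace.local_compact_nhds q₀ {q | B q ∧ q ∈ S.Dt}
    (hB.and (h.domain.open_Dt.mem_nhds hDt))
  obtain ⟨K', hK'N, hK', hdom⟩ := h.dominated (wid r) (admissibleWidth_wid h.one_le) K
    (fun q hq => (hKB hq).2) hK
  have hN : CBound smallEps K' (fun ε => nu r ε) r
      (fun (ε : Eps) q => gaussDer r ε (S.Q ε q) • fderiv ℝ (S.Q ε) q) := by
    refine CBound.of_singleton hK' fun q hq => ?_
    have hq' := h.domain.N_subset (hK'N hq)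
    exact (h.cBound_gaussDer_Q hq').smul_left
      ((h.cBound_fderiv_Q isCompact_singleton (singleton_subset_iff.2 hq')).of_le (by omega))
  have key : ∃ C, ∀ᶠ ε : Eps in smallEps, ∀ m ≤ r, ∀ q ∈ K', S.Q ε q = wid r ε →
      ‖iteratedFDeriv ℝ (m + 1) (S.V ε) q‖ ≤ C * nu r ε := by
    have h1 : ∀ m, ∃ C, m ≤ r → ∀ᶠ ε : Eps in smallEps, ∀ q ∈ K',
        ‖iteratedFDeriv ℝ m (fun q => gaussDer r ε (S.Q ε q) • fderiv ℝ (S.Q ε) q) q‖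
          ≤ C * ‖nu r ε‖ := by
      intro m
      by_cases hm : m ≤ r
      · obtain ⟨C, hC⟩ := (hN.iteratedFDeriv_isBigO hm).bound
        refine ⟨C, fun _ => ?_⟩
        obtain ⟨A, hA, B, hB, hAB⟩ := eventually_prod_iff.1 hC
        filter_upwards [hA] with ε hε q hq
        exact hAB hε (subset_of_mem_nhdsSet hB hq)
      · exact ⟨0, fun h => absurd h hm⟩
    choose C hC using h1
    have hCle : ∀ m ≤ r, C m ≤ ∑ i ∈ Finset.range (r + 1), |C i| := fun m hm =>
      (le_abs_self _).trans (Finset.single_le_sum (f := fun i => |C i|) (fun _ _ => abs_nonneg _)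
        (Finset.mem_range.2 (by omega)))
    refine ⟨∑ i ∈ Finset.range (r + 1), |C i|, ?_⟩
    have h2 : ∀ᶠ ε : Eps in smallEps, ∀ m ∈ Finset.range (r + 1), ∀ q ∈ K',
        ‖iteratedFDeriv ℝ m (fun q => gaussDer r ε (S.Q ε q) • fderiv ℝ (S.Q ε) q) q‖
          ≤ C m * ‖nu r ε‖ :=
      (Finset.eventually_all _).2 fun m hm => hC m (by simpa [Nat.lt_succ_iff] using hm)
    filter_upwards [h2, h.eventually_fderiv_V, eventually_smallEps_mem r one_pos,
      eventually_smallEps h.contDiffAt_Q] with ε h2 h3 h4 h5 m hm q hq hQ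
    have hw := wid_pos (r := r) h4.1
    -- To compare higher derivatives, equality is needed in a full neighbourhood of the level set.
    -- This is why the Gaussian is replaced only below half of `wid`.
    have h6 : fderiv ℝ (S.V ε) =ᶠ[𝓝 q] fun q => gaussDer r ε (S.Q ε q) • fderiv ℝ (S.Q ε) q := by
      filter_upwards [h.domain.open_N.mem_nhds (hK'N hq),
        (h5 q (h.domain.N_subset (hK'N hq))).continuousAt.eventually_const_lt
          (show wid r ε / 2 < S.Q ε q by linarith)] with y hy hy'
      rw [h3 y hy (by linarith), gaussDer_eq hy'.le]
    rw [← norm_iteratedFDeriv_fderiv, (h6.iteratedFDeriv ℝ m).eq_of_nhds]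
    refine (h2 m (Finset.mem_range.2 (by omega)) q hq).trans ?_
    rw [Real.norm_of_nonneg (nu_pos h4.1).le]
    exact mul_le_mul_of_nonneg_right (hCle m hm) (nu_pos h4.1).le
  obtain ⟨C, hC⟩ := key
  have hdom' : ∀ᶠ ε : Eps in smallEps, ∀ q ∈ K, wid r ε ≤ S.Q ε q → ∀ l ∈ Icc 1 (r + 1),
        ∃ q' ∈ K', S.Q ε q' = wid r ε ∧ ∃ l' ∈ Icc 1 (r + 1),
          ‖iteratedFDeriv ℝ l (S.V ε) q‖ ≤ ‖iteratedFDeriv ℝ l' (S.V ε) q'‖ := hdom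
  rw [← nhdsSet_singleton] at hKn
  refine CBound.of_contDiffAt ?_ fun m hm => ?_
  · filter_upwards [h.contDiff_V.prod_inl (𝓝ˢ {q₀})] with p hp
    exact (hp.fderiv_right (m := r) le_rfl).contDiffAt
  · refine IsBigO.of_bound C ?_
    filter_upwards [(((show ∀ᶠ ε in smallEps, A ε from hA).and hdom').and
      (hC.and (eventually_smallEps_mem r one_pos))).prod_inl (𝓝ˢ {q₀}),
      (show ∀ᶠ q in 𝓝ˢ {q₀}, q ∈ K from hKn).prod_inr smallEps] with p h1 h2
    obtain ⟨q', hq', hQ', l', hl', hle⟩ := h1.1.2 p.2 h2 (hAB h1.1.1 (hKB h2).1).2.le (m + 1)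
      ⟨by omega, by omega⟩
    rw [norm_iteratedFDeriv_fderiv, Real.norm_of_nonneg (nu_pos h1.2.2.1).le]
    refine hle.trans ?_
    have := h1.2.1 (l' - 1) (by have := hl'.2; omega) q' hq' hQ'
    rwa [Nat.sub_add_cancel hl'.1] at this

/-- Interior points eventually lie above the layer, where the force is the true one. At wall points
it is the extended Gaussian force. -/
theorem Hyp.cBound_force (h : S.Hyp r) {K : Set (Pos d)} (hK : IsCompact K)
    (hKD : K ⊆ S.D \ S.corner) : CBound smallEps K (fun ε => nu r ε) r (S.force r) := by
  refine CBound.of_singleton hK fun q hq => ?_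
  have hDt := h.domain.D_subset (hKD hq)
  rcases h.mem_cases (hKD hq) with hi | hw
  · refine (((h.cBound_fderiv_V hi).clm (gradL d)).neg).congr' ?_
    rw [nhdsSet_singleton]
    filter_upwards [h.force_eq.prod_inl (𝓝 q), h.eventually_lt_Q hi (tendsto_wid h.one_le),
      (eventually_smallEps_mem r one_pos).prod_inl (𝓝 q)] with p h1 h2 h3
    rw [h1 p.2 (by linarith [h2.2, wid_pos (r := r) h3.1]), gradL_fderiv]
  · have hN := h.domain.boundary_subset hw
    refine (((h.cBound_gaussDer_Q hDt).smul_left ((h.cBound_gradient_Q isCompact_singleton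
      (singleton_subset_iff.2 hDt)).of_le (show r ≤ r + 1 by omega))).neg).congr' ?_
    rw [nhdsSet_singleton]
    filter_upwards [(h.domain.open_N.eventually_mem hN).prod_inr smallEps] with p h1
    rw [force, if_pos h1]

end SteepSystem

/-! ### Implicit functions for close families -/

theorem fderiv_apply_zero_one {E : Type} [NormedAddCommGroup E] [NormedSpace ℝ E] {u : E × ℝ → ℝ}
    {x : E} {t D : ℝ} (hu : DifferentiableAt ℝ u (x, t)) (h : HasDerivAt (fun s => u (x, s)) D t) :
    fderiv ℝ u (x, t) (0, 1) = D :=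
  (hu.hasFDerivAt.comp_hasDerivAt t ((hasDerivAt_const t x).prodMk (hasDerivAt_id t))).unique h

section CNearImplicit

variable {ι E F : Type} [TopologicalSpace ι] [DiscreteTopology ι] [NormedAddCommGroup E]
  [NormedSpace ℝ E] [NormedAddCommGroup F] [NormedSpace ℝ F] {l : Filter ι} {μ : ι → ℝ} {n : ℕ}

theorem CNear.tendsto_fderiv {x₀ : E} {y₀ : F} {f g : ι → E → F}
    (h : CNear l μ (n + 1) x₀ y₀ f g) {v : E} {a : F}
    (ht : Tendsto (fun p : ι × E => fderiv ℝ (g p.1) p.2 v) (l ×ˢ 𝓝ˢ {x₀}) (𝓝 a)) :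
    Tendsto (fun p : ι × E => fderiv ℝ (f p.1) p.2 v) (l ×ˢ 𝓝ˢ {x₀}) (𝓝 a) := by
  have h1 := ((h.close.fderiv).clm (ContinuousLinearMap.apply ℝ F v)).tendsto_zero h.small
  have h2 := h1.add ht
  rw [zero_add] at h2
  refine h2.congr' ?_
  filter_upwards [h.left.differentiableAt, h.smooth.differentiableAt] with p hp hq
  simp [fderiv_fun_sub hp hq]

theorem CNear.exists_implicit [CompleteSpace E] {x₀ : E} {t₀ c : ℝ} {Γ Γ' : ι → E × ℝ → ℝ}
    (h : CNear l μ (n + 1) (x₀, t₀) 0 Γ Γ') (hc : 0 < c)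
    (hder : Tendsto (fun p : ι × (E × ℝ) => fderiv ℝ (Γ' p.1) p.2 (0, 1))
      (l ×ˢ 𝓝ˢ {(x₀, t₀)}) (𝓝 c)) :
    ∃ τ τ' : ι → E → ℝ, CNear l μ (n + 1) x₀ t₀ τ τ' ∧
      (∀ᶠ p in l ×ˢ 𝓝ˢ {x₀}, Γ p.1 (p.2, τ p.1 p.2) = 0) ∧
      ∀ᶠ p in l ×ˢ 𝓝ˢ {x₀}, Γ' p.1 (p.2, τ' p.1 p.2) = 0 := by
  have d1 := (h.tendsto_fderiv hder).eventually_const_le (half_lt_self hc)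
  have d2 := hder.eventually_const_le (half_lt_self hc)
  obtain ⟨τ, ht, hz, hτ⟩ := _root_.exists_implicit h.left (half_pos hc) d1 h.tendsto_left
  obtain ⟨τ', ht', hz', hτ'⟩ := _root_.exists_implicit (n := n + 1) h.smooth (half_pos hc) d2 h.tendsto
  exact ⟨τ, τ', ⟨hτ', implicit_sub_cBound h.left h.smooth h.close (half_pos hc) d1 d2 ht ht' hz hz',
    ht', h.small⟩, hz, hz'⟩

theorem CNear.const {a b : ι → F} {y₀ : F} (x₀ : E) (hab : (fun i => a i - b i) =O[l] μ)
    (hb : Tendsto b l (𝓝 y₀)) (hμ : Tendsto μ l (𝓝 0)) :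
    CNear l μ n x₀ y₀ (fun i _ => a i) fun i _ => b i :=
  ⟨CBound.const_family continuous_of_discreteTopology (hb.isBigO_one ℝ),
    CBound.const_family continuous_of_discreteTopology hab, hb.comp tendsto_fst, hμ⟩

theorem CNear.neg {x₀ : E} {y₀ : F} {f g : ι → E → F} (h : CNear l μ n x₀ y₀ f g) :
    CNear l μ n x₀ (-y₀) (fun i x => -f i x) fun i x => -g i x :=
  h.map contDiffAt_id.neg

end CNearImplicit

/-! ### Free motion between collisions -/

namespace SteepSystem

variable {d : ℕ} {S : SteepSystem d} {r : ℕ}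

theorem lt_of_fderiv_pos {f : Pos d → ℝ} {x : ℝ → Phase d} {τ s₁ s₂ : ℝ}
    (hx : ∀ s ∈ Icc 0 τ, HasDerivWithinAt (fun s => (x s).1) (x s).2 (Icc 0 τ) s)
    (h1 : 0 ≤ s₁) (h12 : s₁ < s₂) (h2 : s₂ ≤ τ)
    (hf : ∀ s ∈ Icc s₁ s₂, DifferentiableAt ℝ f (x s).1 ∧ 0 < fderiv ℝ f (x s).1 (x s).2) :
    f (x s₁).1 < f (x s₂).1 := by
  have hsub : Icc s₁ s₂ ⊆ Icc 0 τ := Icc_subset_Icc h1 h2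
  have hd : ∀ s ∈ Icc s₁ s₂, HasDerivWithinAt (fun s => f (x s).1)
      (fderiv ℝ f (x s).1 (x s).2) (Icc s₁ s₂) s := fun s hs =>
    (hf s hs).1.hasFDerivAt.comp_hasDerivWithinAt s ((hx s (hsub hs)).mono hsub)
  refine strictMonoOn_of_deriv_pos (convex_Icc s₁ s₂) (fun s hs => (hd s hs).continuousWithinAt)
    (fun s hs => ?_) (left_mem_Icc.2 h12.le) (right_mem_Icc.2 h12.le) h12
  rw [interior_Icc] at hs
  have := (hd s (Ioo_subset_Icc_self hs)).hasDerivAt (Icc_mem_nhds hs.1 hs.2)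
  rw [this.deriv]
  exact (hf s (Ioo_subset_Icc_self hs)).2

theorem lt_of_fderiv_neg {f : Pos d → ℝ} {x : ℝ → Phase d} {τ s₁ s₂ : ℝ}
    (hx : ∀ s ∈ Icc 0 τ, HasDerivWithinAt (fun s => (x s).1) (x s).2 (Icc 0 τ) s)
    (h1 : 0 ≤ s₁) (h12 : s₁ < s₂) (h2 : s₂ ≤ τ)
    (hf : ∀ s ∈ Icc s₁ s₂, DifferentiableAt ℝ f (x s).1 ∧ fderiv ℝ f (x s).1 (x s).2 < 0) :
    f (x s₂).1 < f (x s₁).1 := by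
  have := lt_of_fderiv_pos (f := fun q => -f q) hx h1 h12 h2 fun s hs => by
    refine ⟨(hf s hs).1.neg, ?_⟩
    rw [fderiv_fun_neg]
    simpa using (hf s hs).2
  linarith

/-- A straight flight inside `D`; each end point is either an interior point, or a regular boundary
point at which the flight is not tangent to the boundary. -/
structure RefLeg (S : SteepSystem d) (q p : Pos d) (τ : ℝ) : Prop where
  pos : 0 < τ
  inside : ∀ s ∈ Ioo 0 τ, q + s • p ∈ interior S.D
  start : q ∈ interior S.D ∨ (q ∈ frontier S.D \ S.corner ∧ 0 < inner ℝ (gradient (S.Q 0) q) p)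
  finish : q + τ • p ∈ interior S.D ∨
    (q + τ • p ∈ frontier S.D \ S.corner ∧ inner ℝ (gradient (S.Q 0) (q + τ • p)) p < 0)

theorem RefLeg.mem {q p : Pos d} {τ : ℝ} (h : S.Hyp r) (hl : S.RefLeg q p τ) {s : ℝ}
    (hs : s ∈ Icc 0 τ) : q + s • p ∈ S.D \ S.corner := by
  rcases hs.1.eq_or_lt with rfl | h0
  · rw [zero_smul, add_zero]
    exact hl.start.elim (fun h' => h.interior_subset h') fun h' => h.wall_subset h'.1
  rcases hs.2.eq_or_lt with rfl | h1
  · exact hl.finish.elim (fun h' => h.interior_subset h') fun h' => h.wall_subset h'.1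
  · exact h.interior_subset (hl.inside s ⟨h0, h1⟩)

/-- The directional derivative of `Q` has a limit. -/
theorem Hyp.tendsto_inner (h : S.Hyp r) {q₀ p₀ : Pos d} (hq : q₀ ∈ S.Dt) :
    Tendsto (fun w : Eps × Phase d => fderiv ℝ (S.Q w.1) w.2.1 w.2.2) (smallEps ×ˢ 𝓝 (q₀, p₀))
      (𝓝 (inner ℝ (gradient (S.Q 0) q₀) p₀)) := by
  rw [inner_gradient]
  have h1 : Tendsto (fun w : Eps × Phase d => (w.1, w.2.1)) (smallEps ×ˢ 𝓝 (q₀, p₀))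
      (smallEps ×ˢ 𝓝 q₀) := tendsto_fst.prodMk ((continuous_fst.tendsto _).comp tendsto_snd)
  have h2 : Tendsto (fun w : Eps × Phase d => w.2.2) (smallEps ×ˢ 𝓝 (q₀, p₀)) (𝓝 p₀) :=
    (continuous_snd.tendsto _).comp tendsto_snd
  have h3 : Tendsto (fun w : Eps × Phase d => fderiv ℝ (S.Q w.1) w.2.1) (smallEps ×ˢ 𝓝 (q₀, p₀))
      (𝓝 (fderiv ℝ (S.Q 0) q₀)) := (h.tendsto_fderiv_Q hq).comp h1
  exact (isBoundedBilinearMap_apply.continuous.tendsto (fderiv ℝ (S.Q 0) q₀, p₀)).comp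
    (h3.prodMk_nhds h2)

theorem Hyp.eventually_differentiableAt_Q (h : S.Hyp r) :
    ∀ᶠ ε : Eps in smallEps, ∀ q ∈ S.Dt, DifferentiableAt ℝ (S.Q ε) q := by
  filter_upwards [eventually_smallEps h.contDiffAt_Q] with ε hε q hq
  exact (hε q hq).differentiableAt (by simp)

/-- Near a wall end point the flight is transversal, so Q is strictly monotone along the motion and
the level inequality at the end point propagates. Near interior points and along the compact middle
part Q has a positive limit while δ tends to zero. Only the equation for the position enters, so the
argument serves the smooth motion and the free flight alike. -/
theorem Hyp.leg_above (h : S.Hyp r) {q p : Pos d} {τ₀ : ℝ} (hl : S.RefLeg q p τ₀)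
    {φ : Eps → ℝ × Phase d → Phase d}
    (hφ : ∀ s ∈ Icc 0 τ₀, Tendsto (fun w : Eps × (ℝ × Phase d) => φ w.1 w.2)
      (smallEps ×ˢ 𝓝 (s, (q, p))) (𝓝 (q + s • p, p)))
    {δ : ℝ → ℝ} (hδ : Tendsto δ (𝓝[>] (0 : ℝ)) (𝓝 0)) :
    ∀ᶠ w : Eps × (ℝ × Phase d) in smallEps ×ˢ 𝓝 (τ₀, (q, p)),
      (∀ σ ∈ Icc 0 w.2.1, HasDerivWithinAt (fun σ => (φ w.1 (σ, w.2.2)).1)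
        (φ w.1 (σ, w.2.2)).2 (Icc 0 w.2.1) σ) →
      δ w.1 ≤ S.Q w.1 (φ w.1 (0, w.2.2)).1 → δ w.1 ≤ S.Q w.1 (φ w.1 w.2).1 →
      ∀ σ ∈ Ioo 0 w.2.1, (φ w.1 (σ, w.2.2)).1 ∈ S.Dt ∧ δ w.1 < S.Q w.1 (φ w.1 (σ, w.2.2)).1 := by
  have hDt : ∀ s ∈ Icc 0 τ₀, q + s • p ∈ S.Dt := fun s hs => h.domain.D_subset (hl.mem h hs)
  -- the three kinds of points
  have hin : ∀ s ∈ Icc 0 τ₀, q + s • p ∈ interior S.D →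
      ∀ᶠ w : Eps × (ℝ × Phase d) in smallEps ×ˢ 𝓝ˢ {(s, (q, p))},
        (φ w.1 w.2).1 ∈ S.Dt ∧ δ w.1 < S.Q w.1 (φ w.1 w.2).1 := by
    intro s hs hi
    rw [nhdsSet_singleton]
    have h1 : Tendsto (fun w : Eps × (ℝ × Phase d) => (w.1, (φ w.1 w.2).1))
      (smallEps ×ˢ 𝓝 (s, (q, p))) (smallEps ×ˢ 𝓝 (q + s • p)) :=
      tendsto_fst.prodMk ((continuous_fst.tendsto _).comp (hφ s hs))
    exact h1.eventually (h.eventually_lt_Q hi hδ)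
  have hwall : ∀ s ∈ Icc 0 τ₀, ∀ A ∈ 𝓝 (inner ℝ (gradient (S.Q 0) (q + s • p)) p),
      ∀ᶠ w : Eps × (ℝ × Phase d) in smallEps ×ˢ 𝓝ˢ {(s, (q, p))},
        (φ w.1 w.2).1 ∈ S.Dt ∧ fderiv ℝ (S.Q w.1) (φ w.1 w.2).1 (φ w.1 w.2).2 ∈ A := by
    intro s hs A hA
    rw [nhdsSet_singleton]
    have h1 : Tendsto (fun w : Eps × (ℝ × Phase d) => (w.1, φ w.1 w.2))
      (smallEps ×ˢ 𝓝 (s, (q, p))) (smallEps ×ˢ 𝓝 (q + s • p, p)) :=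
      tendsto_fst.prodMk (hφ s hs)
    have h2 := ((continuous_fst.tendsto _).comp (hφ s hs)).eventually
      (h.domain.open_Dt.eventually_mem (hDt s hs))
    exact h2.and ((h.tendsto_inner (hDt s hs)).comp h1 hA)
  have h0m : (0 : ℝ) ∈ Icc 0 τ₀ := left_mem_Icc.2 hl.pos.le
  have h1m : τ₀ ∈ Icc 0 τ₀ := right_mem_Icc.2 hl.pos.le
  have mem_ball : ∀ {s σ a : ℝ} {ρ : Phase d}, dist σ s < a → dist ρ (q, p) < a →
      (σ, ρ) ∈ Metric.ball (s, (q, p)) a := fun h1 h2 => by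
    rw [Metric.mem_ball, Prod.dist_eq]; exact max_lt h1 h2
  -- the start
  have hstart : ∃ a > 0, ∀ᶠ ε : Eps in smallEps, ∀ τ, ∀ ρ ∈ Metric.ball (q, p) a,
      (∀ σ ∈ Icc 0 τ, HasDerivWithinAt (fun σ => (φ ε (σ, ρ)).1) (φ ε (σ, ρ)).2 (Icc 0 τ) σ) →
      δ ε ≤ S.Q ε (φ ε (0, ρ)).1 → ∀ σ ∈ Ioo 0 τ, σ < a →
      (φ ε (σ, ρ)).1 ∈ S.Dt ∧ δ ε < S.Q ε (φ ε (σ, ρ)).1 := by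
    rcases hl.start with hi | ⟨hw, hY⟩
    · obtain ⟨a, ha, ha'⟩ := exists_ball_of_eventually (hin 0 h0m (by simpa using hi))
      refine ⟨a, ha, ?_⟩
      filter_upwards [ha'] with ε hε τ ρ hρ _ _ σ hσ hσa
      exact hε _ (mem_ball (by simpa [abs_of_pos hσ.1] using hσa) hρ)
    · obtain ⟨a, ha, ha'⟩ := exists_ball_of_eventually (hwall 0 h0m (Ioi 0) (by
        rw [zero_smul, add_zero]; exact Ioi_mem_nhds hY))
      refine ⟨a, ha, ?_⟩
      filter_upwards [ha', h.eventually_differentiableAt_Q] with ε hε hdf τ ρ hρ hx h0 σ hσ hσa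
      have key : ∀ s ∈ Icc 0 σ, (s, ρ) ∈ Metric.ball ((0 : ℝ), (q, p)) a := fun s hs =>
        mem_ball (by rw [Real.dist_eq, sub_zero, abs_of_nonneg hs.1]; exact hs.2.trans_lt hσa) hρ
      refine ⟨(hε _ (key σ ⟨hσ.1.le, le_rfl⟩)).1, h0.trans_lt ?_⟩
      exact lt_of_fderiv_pos (x := fun σ => φ ε (σ, ρ)) hx le_rfl hσ.1 hσ.2.le fun s hs =>
        ⟨hdf _ (hε _ (key s hs)).1, (hε _ (key s hs)).2⟩
  -- the end
  have hball : ∃ b > 0, ∀ᶠ ε : Eps in smallEps, ∀ τ, τ < τ₀ + b → ∀ ρ ∈ Metric.ball (q, p) b,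
      (∀ σ ∈ Icc 0 τ, HasDerivWithinAt (fun σ => (φ ε (σ, ρ)).1) (φ ε (σ, ρ)).2 (Icc 0 τ) σ) →
      δ ε ≤ S.Q ε (φ ε (τ, ρ)).1 → ∀ σ ∈ Ioo 0 τ, τ₀ - b < σ →
      (φ ε (σ, ρ)).1 ∈ S.Dt ∧ δ ε < S.Q ε (φ ε (σ, ρ)).1 := by
    rcases hl.finish with hi | ⟨hw, hY⟩
    · obtain ⟨a, ha, ha'⟩ := exists_ball_of_eventually (hin τ₀ h1m hi)
      refine ⟨a, ha, ?_⟩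
      filter_upwards [ha'] with ε hε τ hτ ρ hρ _ _ σ hσ hσa
      refine hε _ (mem_ball ?_ hρ)
      rw [Real.dist_eq, abs_lt]
      constructor <;> linarith [hσ.2]
    · obtain ⟨a, ha, ha'⟩ := exists_ball_of_eventually (hwall τ₀ h1m (Iio 0) (Iio_mem_nhds hY))
      refine ⟨a, ha, ?_⟩
      filter_upwards [ha', h.eventually_differentiableAt_Q] with ε hε hdf τ hτ ρ hρ hx h0 σ hσ hσa
      have key : ∀ s ∈ Icc σ τ, (s, ρ) ∈ Metric.ball (τ₀, (q, p)) a := fun s hs => by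
        refine mem_ball ?_ hρ
        rw [Real.dist_eq, abs_lt]
        constructor <;> linarith [hs.1, hs.2]
      refine ⟨(hε _ (key σ ⟨le_rfl, hσ.2.le⟩)).1, h0.trans_lt ?_⟩
      exact lt_of_fderiv_neg (x := fun σ => φ ε (σ, ρ)) hx hσ.1.le hσ.2 le_rfl fun s hs =>
        ⟨hdf _ (hε _ (key s hs)).1, (hε _ (key s hs)).2⟩
  obtain ⟨a, ha, hA⟩ := hstart
  obtain ⟨b, hb, hB⟩ := hball
  have hK : IsCompact (Icc (a / 2) (τ₀ - b / 2) ×ˢ {(q, p)} : Set (ℝ × Phase d)) :=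
    isCompact_Icc.prod isCompact_singleton
  have hmid := eventually_prod_nhdsSet (l := smallEps) hK
    (P := fun w : Eps × (ℝ × Phase d) => (φ w.1 w.2).1 ∈ S.Dt ∧ δ w.1 < S.Q w.1 (φ w.1 w.2).1) (by
      rintro ⟨s, ρ⟩ ⟨hs, hρ⟩
      obtain rfl : ρ = (q, p) := hρ
      have hs' : s ∈ Ioo 0 τ₀ := ⟨by linarith [hs.1], by linarith [hs.2]⟩
      exact hin s (Ioo_subset_Icc_self hs') (hl.inside s hs'))
  obtain ⟨c, hc, hC⟩ := exists_thickening_of_eventually hK hmid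
  set m := min a (min b c)
  have hm : 0 < m := lt_min ha (lt_min hb hc)
  rw [← nhdsSet_singleton]
  refine eventually_of_exists_ball hm ?_
  filter_upwards [hA, hB, hC] with ε hA hB hC
  rintro ⟨τ, ρ⟩ hw hx h0 h1 σ hσ
  rw [Metric.mem_ball, Prod.dist_eq, max_lt_iff] at hw
  dsimp only at hw hx h0 h1 hσ ⊢
  have hma : m ≤ a := min_le_left _ _
  have hmb : m ≤ b := (min_le_right _ _).trans (min_le_left _ _)
  have hmc : m ≤ c := (min_le_right _ _).trans (min_le_right _ _)
  by_cases h2 : σ < a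
  · exact hA τ ρ (Metric.mem_ball.2 (hw.2.trans_le hma)) hx h0 σ hσ h2
  by_cases h3 : τ₀ - b < σ
  · refine hB τ ?_ ρ (Metric.mem_ball.2 (hw.2.trans_le hmb)) hx h1 σ hσ h3
    have := (abs_lt.1 hw.1).2
    linarith
  · refine hC (σ, ρ) (Metric.mem_thickening_iff.2 ⟨(σ, (q, p)), ⟨⟨by linarith, by linarith⟩, rfl⟩, ?_⟩)
    rw [Prod.dist_eq, dist_self]
    exact max_lt hc (hw.2.trans_le hmc)

/-- The free flight stays in the auxiliary table. -/
theorem Hyp.leg_free (h : S.Hyp r) {q p : Pos d} {τ₀ : ℝ} (hl : S.RefLeg q p τ₀) :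
    ∀ᶠ w : Eps × (ℝ × Phase d) in smallEps ×ˢ 𝓝 (τ₀, (q, p)),
      eta r w.1 ≤ S.Q w.1 w.2.2.1 → eta r w.1 ≤ S.Q w.1 (freeFlight w.2).1 →
      ∀ σ ∈ Ioo 0 w.2.1, w.2.2.1 + σ • w.2.2.2 ∈ S.Dt ∧
        eta r w.1 < S.Q w.1 (w.2.2.1 + σ • w.2.2.2) := by
  have hφ : ∀ s ∈ Icc 0 τ₀, Tendsto (fun w : Eps × (ℝ × Phase d) => freeFlight w.2)
      (smallEps ×ˢ 𝓝 (s, (q, p))) (𝓝 (q + s • p, p)) := fun s _ =>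
    ((contDiff_freeFlight (n := 0)).continuous.tendsto (s, (q, p))).comp tendsto_snd
  filter_upwards [h.leg_above hl (φ := fun _ => freeFlight) hφ (tendsto_eta h.one_le)] with w hw h0 h1
  refine hw (fun σ _ => ?_) (by rwa [freeFlight_zero]) h1
  have := ((hasDerivAt_id σ).smul_const w.2.2.2).const_add w.2.2.1
  simpa [freeFlight] using this.hasDerivWithinAt

/-- The smooth motion outside the boundary layer. -/
theorem Hyp.exists_leg (h : S.Hyp r) {q p : Pos d} {τ₀ : ℝ} (hl : S.RefLeg q p τ₀) :
    ∃ φ : Eps → ℝ × Phase d → Phase d,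
      CBound smallEps (Icc 0 τ₀ ×ˢ {(q, p)}) (fun ε => nu r ε) r (fun ε z => φ ε z - freeFlight z) ∧
      ∀ᶠ w : Eps × (ℝ × Phase d) in smallEps ×ˢ 𝓝 (τ₀, (q, p)),
        wid r w.1 ≤ S.Q w.1 w.2.2.1 → wid r w.1 ≤ S.Q w.1 (φ w.1 w.2).1 →
        ∀ σ ∈ Icc 0 w.2.1, HamSeg (S.V w.1) (fun q => q ∈ S.Dt ∧ wid r w.1 < S.Q w.1 q)
          w.2.2 σ (φ w.1 (σ, w.2.2)) := by
  obtain ⟨n, rfl⟩ : ∃ n, r = n + 1 := ⟨r - 1, by have := h.one_le; omega⟩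
  have hμ : Tendsto (fun ε : Eps => nu (n + 1) ε) smallEps (𝓝 0) := tendsto_nu
  have hF : CBound smallEps ((fun s : ℝ => q + s • p) '' Icc 0 τ₀) (fun ε => nu (n + 1) ε) (n + 1)
      (S.force (n + 1)) := by
    refine h.cBound_force (isCompact_Icc.image (by fun_prop)) ?_
    rintro _ ⟨s, hs, rfl⟩
    exact hl.mem h hs
  obtain ⟨φ, hφ, hode⟩ := exists_nearFree n hμ hF
  have hlim : ∀ s ∈ Icc 0 τ₀, Tendsto (fun w : Eps × (ℝ × Phase d) => φ w.1 w.2)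
      (smallEps ×ˢ 𝓝 (s, (q, p))) (𝓝 (q + s • p, p)) := by
    intro s hs
    have h1 := (hφ.mono le_rfl (K' := {(s, (q, p))}) (by
      rintro _ rfl; exact ⟨hs, rfl⟩)).tendsto_zero hμ
    rw [nhdsSet_singleton] at h1
    have h2 := h1.add (((contDiff_freeFlight (n := 0)).continuous.tendsto (s, (q, p))).comp
      (tendsto_snd (f := (smallEps : Filter Eps))))
    simpa [freeFlight] using h2
  refine ⟨φ, hφ, ?_⟩
  have hode' : ∀ᶠ w in smallEps ×ˢ 𝓝 (τ₀, (q, p)), φ w.1 (0, w.2.2) = w.2.2 ∧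
        ∀ σ ∈ Icc 0 w.2.1, HasDerivWithinAt (fun σ => φ w.1 (σ, w.2.2))
          ((φ w.1 (σ, w.2.2)).2, S.force (n + 1) w.1 (φ w.1 (σ, w.2.2)).1) (Icc 0 w.2.1) σ :=
    hode.filter_mono (prod_mono le_rfl
      (nhds_le_nhdsSet (show (τ₀, (q, p)) ∈ Icc 0 τ₀ ×ˢ {(q, p)} from ⟨right_mem_Icc.2 hl.pos.le, rfl⟩)))
  filter_upwards [h.leg_above hl hlim (tendsto_wid h.one_le), hode',
    (h.force_eq.and (eventually_smallEps_mem (n + 1) one_pos)).prod_inl _] with w h1 h2 h3 hs he σ hσ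
  have hin := h1 (fun σ hσ => (h2.2 σ hσ).fst_comp) (by rwa [h2.1]) he
  have hw := wid_pos (r := n + 1) h3.2.1
  have hle : ∀ s ∈ Icc 0 w.2.1, wid (n + 1) w.1 ≤ S.Q w.1 (φ w.1 (s, w.2.2)).1 := by
    intro s hs'
    rcases hs'.1.eq_or_lt with rfl | h0
    · rwa [h2.1]
    rcases hs'.2.eq_or_lt with rfl | h1
    · exact he
    · exact (hin s ⟨h0, h1⟩).2.le
  refine ⟨hσ.1, fun s => φ w.1 (s, w.2.2), fun s hs' => ?_, h2.1, rfl, fun s hs' =>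
    hin s ⟨hs'.1, hs'.2.trans_le hσ.2⟩⟩
  have := (h2.2 s ⟨hs'.1, hs'.2.trans hσ.2⟩).mono (Icc_subset_Icc_right hσ.2)
  rwa [h3.1 _ (by linarith [hle s ⟨hs'.1, hs'.2.trans hσ.2⟩])] at this

theorem Hyp.cNear_Q (h : S.Hyp r) {q : Pos d} (hq : q ∈ S.Dt) :
    CNear smallEps (fun ε => nu r ε) r q (S.Q 0 q) (fun ε : Eps => S.Q ε) fun ε : Eps => S.Q ε :=
  CNear.self ((h.cBound_Q isCompact_singleton (singleton_subset_iff.2 hq)).of_le (by omega))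
    (by rw [nhdsSet_singleton]; exact h.tendsto_Q hq) tendsto_nu

/-- The hitting times of the boundary layer and of the auxiliary wall. -/
theorem Hyp.exists_hit (h : S.Hyp r) {q p : Pos d} {τ₀ : ℝ} (hτ : 0 ≤ τ₀)
    (hw : q + τ₀ • p ∈ frontier S.D \ S.corner)
    (hY : inner ℝ (gradient (S.Q 0) (q + τ₀ • p)) p < 0) {φ : Eps → ℝ × Phase d → Phase d}
    (hφ : CBound smallEps (Icc 0 τ₀ ×ˢ {(q, p)}) (fun ε => nu r ε) r
      (fun ε z => φ ε z - freeFlight z)) :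
    ∃ τ τ' : Eps → Phase d → ℝ, CNear smallEps (fun ε => nu r ε) r (q, p) τ₀ τ τ' ∧
      (∀ᶠ w : Eps × Phase d in smallEps ×ˢ 𝓝ˢ {(q, p)},
        S.Q w.1 (φ w.1 (τ w.1 w.2, w.2)).1 = wid r w.1) ∧
      ∀ᶠ w : Eps × Phase d in smallEps ×ˢ 𝓝ˢ {(q, p)},
        S.Q w.1 (freeFlight (τ' w.1 w.2, w.2)).1 = eta r w.1 := by
  obtain ⟨n, rfl⟩ : ∃ n, r = n + 1 := ⟨r - 1, by have := h.one_le; omega⟩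
  have hμ : Tendsto (fun ε : Eps => nu (n + 1) ε) smallEps (𝓝 0) := tendsto_nu
  have hDt := h.domain.D_subset (h.wall_subset hw)
  have hfree : CNear smallEps (fun ε => nu (n + 1) ε) (n + 1) (τ₀, (q, p)) (q + τ₀ • p, p) φ
      fun _ => freeFlight :=
    ⟨CBound.of_contDiffAt_const isCompact_singleton fun _ _ => contDiff_freeFlight.contDiffAt,
      hφ.mono le_rfl (by rintro _ rfl; exact ⟨right_mem_Icc.2 hτ, rfl⟩), by
        rw [nhdsSet_singleton]
        exact ((contDiff_freeFlight (n := 0)).continuous.tendsto (τ₀, (q, p))).comp tendsto_snd, hμ⟩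
  have hswap : CNear smallEps (fun ε => nu (n + 1) ε) (n + 1) ((q, p), τ₀) (τ₀, (q, p))
      (fun _ (z : Phase d × ℝ) => (z.2, z.1)) fun _ (z : Phase d × ℝ) => (z.2, z.1) :=
    CNear.of_contDiffAt (u := fun z : Phase d × ℝ => (z.2, z.1)) (by fun_prop) hμ
  have hc := CNear.const (l := smallEps) (n := n + 1) (a := fun ε : Eps => wid (n + 1) ε)
    (b := fun ε : Eps => eta (n + 1) ε) ((q, p), τ₀)
    ((wid_isBigO_nu h.one_le).sub (eta_isBigO_nu h.one_le)) (tendsto_eta h.one_le) hμ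
  -- The functions to be solved are `wid` - Q along the smooth motion and `eta` - Q along the free
  -- flight. They differ by O(ν), tend to zero at the limit hit, and have the sign for which the
  -- time derivative is positive.
  have hΓ := hc.add ((h.cNear_Q hDt).comp (hfree.comp hswap).fst).neg
  rw [h.Q_wall hw, neg_zero, add_zero] at hΓ
  have hder : Tendsto (fun w : Eps × (Phase d × ℝ) =>
      fderiv ℝ (fun z : Phase d × ℝ => eta (n + 1) w.1 + -S.Q w.1 (freeFlight (z.2, z.1)).1) w.2 (0, 1))
      (smallEps ×ˢ 𝓝ˢ {((q, p), τ₀)}) (𝓝 (-inner ℝ (gradient (S.Q 0) (q + τ₀ • p)) p)) := by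
    rw [nhdsSet_singleton]
    have h1 : Tendsto (fun w : Eps × (Phase d × ℝ) => (w.1, freeFlight (w.2.2, w.2.1)))
        (smallEps ×ˢ 𝓝 ((q, p), τ₀)) (smallEps ×ˢ 𝓝 (q + τ₀ • p, p)) := by
      have := (hfree.comp hswap).tendsto_graph
      rwa [nhdsSet_singleton, nhdsSet_singleton] at this
    have h2 : ∀ᶠ w : Eps × (Phase d × ℝ) in smallEps ×ˢ 𝓝 ((q, p), τ₀),
        (freeFlight (w.2.2, w.2.1)).1 ∈ S.Dt :=
      ((continuous_fst.tendsto _).comp (tendsto_snd.comp h1)).eventually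
        (h.domain.open_Dt.eventually_mem hDt)
    refine (((h.tendsto_inner hDt).comp h1).neg).congr' ?_
    filter_upwards [h2, h.eventually_differentiableAt_Q.prod_inl _] with w hw1 hw2
    obtain ⟨ε, ρ, t⟩ := w
    have hd := hw2 _ hw1
    refine (fderiv_apply_zero_one ?_ ?_).symm
    · refine (DifferentiableAt.const_add _ (DifferentiableAt.neg ?_))
      refine DifferentiableAt.comp (g := S.Q ε) (ρ, t) hd ?_
      simp only [freeFlight]
      fun_prop
    · refine (HasDerivAt.neg ?_).const_add _
      refine hd.hasFDerivAt.comp_hasDerivAt t ?_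
      simpa [freeFlight] using ((hasDerivAt_id t).smul_const ρ.2).const_add ρ.1
  obtain ⟨τ, τ', h1, h2, h3⟩ := hΓ.exists_implicit (neg_pos.2 hY) hder
  refine ⟨τ, τ', h1, ?_, ?_⟩
  · filter_upwards [h2] with w hw
    linarith
  · filter_upwards [h3] with w hw
    linarith

end SteepSystem

/-! ### Crossing the boundary layer -/

theorem eq_of_hasDerivWithinAt_eq_unit {f g f' : ℝ → ℝ}
    (hf : ∀ s ∈ Icc (0 : ℝ) 1, HasDerivWithinAt f (f' s) (Icc 0 1) s)
    (hg : ∀ s ∈ Icc (0 : ℝ) 1, HasDerivWithinAt g (f' s) (Icc 0 1) s) (h0 : f 0 = g 0) {s : ℝ}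
    (hs : s ∈ Icc (0 : ℝ) 1) : f s = g s := by
  have := (convex_Icc (0 : ℝ) 1).norm_image_sub_le_of_norm_hasDerivWithin_le
    (f := fun s => f s - g s) (f' := fun s => f' s - f' s) (C := 0)
    (fun t ht => (hf t ht).sub (hg t ht)) (fun t _ => by simp)
    (show (0 : ℝ) ∈ Icc (0 : ℝ) 1 by simp) hs
  rw [h0, sub_self, sub_zero, zero_mul] at this
  exact sub_eq_zero.1 (norm_le_zero_iff.1 this)

/-- Since the flow is close to the identity for all times in [0, 1], a property that holds near x₀
holds along the whole curve. -/
theorem smallFlow_mem {ι E : Type} [TopologicalSpace ι] [NormedAddCommGroup E] [NormedSpace ℝ E]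
    {l : Filter ι} {μ : ι → ℝ} {n : ℕ} {x₀ : E} {Φ : ι × unitInterval → E → E}
    (hΦ : CBound (l ×ˢ ⊤) {x₀} (fun j => μ j.1) n (fun j x => Φ j x - x)) (hμ : Tendsto μ l (𝓝 0))
    {P : (ι × unitInterval) × E → Prop} (hP : ∀ᶠ w in (l ×ˢ ⊤) ×ˢ 𝓝ˢ {x₀}, P w) :
    ∀ᶠ w in l ×ˢ 𝓝ˢ {x₀}, ∀ s, P ((w.1, s), Φ (w.1, s) w.2) := by
  refine (eventually_unit (P := fun w : (ι × unitInterval) × E => P (w.1, Φ w.1 w.2))).1 ?_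
  have h1 := hΦ.tendsto_zero (hμ.comp tendsto_fst)
  rw [nhdsSet_singleton] at h1 hP ⊢
  have h2 : Tendsto (fun w : (ι × unitInterval) × E => w.2) ((l ×ˢ ⊤) ×ˢ 𝓝 x₀) (𝓝 x₀) := tendsto_snd
  have h3 := h1.add h2
  simp only [sub_add_cancel, zero_add] at h3
  exact (tendsto_fst.prodMk h3).eventually hP

theorem eventually_unit_of_eventually {ι E : Type} [TopologicalSpace E] {l : Filter ι} {l' : Filter E}
    {P : ι × E → Prop} (hP : ∀ᶠ w in l ×ˢ l', P w) :
    ∀ᶠ w : (ι × unitInterval) × E in (l ×ˢ ⊤) ×ˢ l', P (w.1.1, w.2) :=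
  ((tendsto_fst.comp tendsto_fst).prodMk tendsto_snd).eventually hP

/-- The gauge `Q ↦ Q - W(Q)` (up to a constant) on `Q ≥ 0`, extended to a diffeomorphism. -/
noncomputable def barrierGauge (ε s : ℝ) : ℝ := s + ∫ x in (0 : ℝ)..s, |deriv (gaussBarrier ε) x|

theorem continuous_deriv_gaussBarrier (ε : ℝ) : Continuous (deriv (gaussBarrier ε)) :=
  (contDiff_gaussBarrier ε (n := 1)).continuous_deriv le_rfl

theorem hasDerivAt_barrierGauge (ε s : ℝ) :
    HasDerivAt (barrierGauge ε) (1 + |deriv (gaussBarrier ε) s|) s :=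
  (hasDerivAt_id s).add
    ((continuous_deriv_gaussBarrier ε).abs.integral_hasStrictDerivAt 0 s).hasDerivAt

theorem deriv_gaussBarrier_nonpos {ε : ℝ} (hε : 0 < ε) {s : ℝ} (hs : 0 ≤ s) :
    deriv (gaussBarrier ε) s ≤ 0 := by
  rw [(hasDerivAt_gaussBarrier ε s).deriv, neg_mul]
  exact neg_nonpos.2 (mul_nonneg (by positivity) (Real.exp_pos _).le)

theorem barrierGauge_eq {ε : ℝ} (hε : 0 < ε) {s : ℝ} (hs : 0 ≤ s) :
    barrierGauge ε s = s + (1 - gaussBarrier ε s) := by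
  rw [barrierGauge]
  congr 1
  have h1 : ∫ x in (0 : ℝ)..s, |deriv (gaussBarrier ε) x| =
      ∫ x in (0 : ℝ)..s, -deriv (gaussBarrier ε) x := by
    refine intervalIntegral.integral_congr fun x hx => ?_
    rw [uIcc_of_le hs] at hx
    exact abs_of_nonpos (deriv_gaussBarrier_nonpos hε hx.1)
  rw [h1, intervalIntegral.integral_neg, intervalIntegral.integral_eq_sub_of_hasDerivAt
    (fun x _ => (hasDerivAt_gaussBarrier ε x).differentiableAt.hasDerivAt)
    ((continuous_deriv_gaussBarrier ε).intervalIntegrable 0 s)]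
  simp [gaussBarrier]

theorem gaussBarrier_mem {r : ℕ} {ε : ℝ} (hε : ε ∈ Ioo 0 (Real.exp (-2))) {s : ℝ}
    (hs : eta r ε ≤ s) : gaussBarrier ε s ∈ Icc 0 (nu r ε) := by
  refine ⟨(Real.exp_pos _).le, ?_⟩
  rw [← gaussBarrier_invBarrier hε.1 ⟨nu_pos hε, nu_lt_one (r := r) hε⟩]
  refine Real.exp_le_exp.2 ?_
  have h1 := eta_pos (r := r) hε
  have h2 : invBarrier ε (nu r ε) ^ 2 ≤ s ^ 2 := pow_le_pow_left₀ h1.le hs 2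
  exact div_le_div_of_nonneg_right (by linarith) hε.1.le

theorem exists_barrierGauge_inv (ε : ℝ) : ∃ σ : ℝ → ℝ, (∀ t, barrierGauge ε (σ t) = t) ∧
    (∀ s, σ (barrierGauge ε s) = s) ∧ StrictMono σ ∧
    ∀ t, HasDerivAt σ (1 + |deriv (gaussBarrier ε) (σ t)|)⁻¹ t :=
  exists_inverse_of_deriv_pos one_pos (hasDerivAt_barrierGauge ε)
    (fun s => by linarith [abs_nonneg (deriv (gaussBarrier ε) s)])

namespace SteepSystem

variable {d : ℕ} {S : SteepSystem d} {r : ℕ}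

/-- The vector field which crosses the boundary layer in unit time, at the speed `A` in the
gauge and with the share `B` for the momentum; the last component is the time. -/
noncomputable def layerField (S : SteepSystem d) (A B : Eps × unitInterval → ℝ)
    (j : Eps × unitInterval) (z : Phase d × ℝ) : Phase d × ℝ :=
  ((A j • (fderiv ℝ (S.Q j.1) z.1.1 z.1.2)⁻¹ • z.1.2,
    B j • (fderiv ℝ (S.Q j.1) z.1.1 z.1.2)⁻¹ • gradient (S.Q j.1) z.1.1),
    A j • (fderiv ℝ (S.Q j.1) z.1.1 z.1.2)⁻¹)

/-- A and B are functions of the index alone, so no derivative ever falls on the barrier. The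
remaining factors involve only Q, its first derivatives, and the normal velocity, which stays away
from zero. -/
theorem Hyp.cBound_layerField (h : S.Hyp r) {q p : Pos d} (hq : q ∈ S.Dt)
    (hY : inner ℝ (gradient (S.Q 0) q) p ≠ 0) {A B : Eps × unitInterval → ℝ} (hA : Continuous A)
    (hB : Continuous B) (hA' : A =O[smallEps ×ˢ ⊤] fun j => nu r j.1)
    (hB' : B =O[smallEps ×ˢ ⊤] fun j => nu r j.1) :
    CBound (smallEps ×ˢ ⊤) {((q, p), (0 : ℝ))} (fun j => nu r j.1) (r + 1) (S.layerField A B) := by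
  set l : Filter (Eps × unitInterval) := smallEps ×ˢ ⊤
  set K : Set (Phase d × ℝ) := {((q, p), 0)}
  have hK : IsCompact K := isCompact_singleton
  have hp : CBound l K (fun _ => 1) (r + 1) fun _ z => z.1.2 := CBound.clm_id hK
    ((ContinuousLinearMap.snd ℝ (Pos d) (Pos d)).comp (ContinuousLinearMap.fst ℝ (Phase d) ℝ))
  have hq' : CBound l K (fun _ => 1) (r + 1) fun _ z => z.1.1 := CBound.clm_id hK
    ((ContinuousLinearMap.fst ℝ (Pos d) (Pos d)).comp (ContinuousLinearMap.fst ℝ (Phase d) ℝ))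
  have ht : Tendsto (fun w : (Eps × unitInterval) × (Phase d × ℝ) => (w.1.1, w.2.1.1)) (l ×ˢ 𝓝ˢ K)
      (smallEps ×ˢ 𝓝ˢ {q}) := by
    rw [nhdsSet_singleton, nhdsSet_singleton]
    exact (tendsto_fst.comp tendsto_fst).prodMk
      (((continuous_fst.comp continuous_fst).tendsto ((q, p), (0 : ℝ))).comp tendsto_snd)
  have ht' : Tendsto (fun w : (Eps × unitInterval) × (Phase d × ℝ) => (w.1.1, w.2.1)) (l ×ˢ 𝓝ˢ K)
      (smallEps ×ˢ 𝓝 (q, p)) := by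
    rw [nhdsSet_singleton]
    exact (tendsto_fst.comp tendsto_fst).prodMk
      ((continuous_fst.tendsto ((q, p), (0 : ℝ))).comp tendsto_snd)
  have hsub := singleton_subset_iff.2 hq
  have hdQ := (h.cBound_fderiv_Q isCompact_singleton hsub).comp hq' continuous_fst ht
  have hgQ := (h.cBound_gradient_Q isCompact_singleton hsub).comp hq' continuous_fst ht
  have hYc := hdQ.bilin_right (ContinuousLinearMap.id ℝ (Pos d →L[ℝ] ℝ)) hp
  have hYi := hYc.inv (c := |inner ℝ (gradient (S.Q 0) q) p| / 2) (by positivity) (by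
    have := ((h.tendsto_inner hq (p₀ := p)).comp ht').abs
    exact this.eventually_const_le (half_lt_self (abs_pos.2 hY)))
  have hAc : CBound l K (fun j => nu r j.1) (r + 1) fun j _ => A j := CBound.const_family hA hA'
  have hBc : CBound l K (fun j => nu r j.1) (r + 1) fun j _ => B j := CBound.const_family hB hB'
  exact ((hAc.smul_left (hYi.smul_right hp)).prodMk (hBc.smul_left (hYi.smul_right hgQ))).prodMk
    (hAc.smul_left hYi)

/-- The motion through the boundary layer between the levels `s₀` and `s₁` of `Q` is close to the
identity. -/
theorem Hyp.exists_layer (h : S.Hyp r) {q p : Pos d} (hw : q ∈ frontier S.D \ S.corner)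
    (hY : inner ℝ (gradient (S.Q 0) q) p ≠ 0) {s₀ s₁ : ℝ → ℝ}
    (hs : ∀ᶠ ε : Eps in smallEps, eta r ε ≤ s₀ ε ∧ eta r ε ≤ s₁ ε ∧
      0 < (s₁ ε - s₀ ε) * inner ℝ (gradient (S.Q 0) q) p)
    (hO₀ : s₀ =O[𝓝[>] (0 : ℝ)] nu r) (hO₁ : s₁ =O[𝓝[>] (0 : ℝ)] nu r) :
    ∃ L : Eps → Phase d → ℝ × Phase d,
      CNear smallEps (fun ε => nu r ε) r (q, p) (0, (q, p)) L (fun _ ρ => (0, ρ)) ∧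
      ∀ᶠ w : Eps × Phase d in smallEps ×ˢ 𝓝ˢ {(q, p)}, S.Q w.1 w.2.1 = s₀ w.1 →
        0 < (L w.1 w.2).1 ∧
        HamSeg (S.V w.1) (fun q => q ∈ S.Dt ∧ eta r w.1 < S.Q w.1 q) w.2 (L w.1 w.2).1 (L w.1 w.2).2 ∧
        (L w.1 w.2).2.1 ∈ S.Dt ∧ S.Q w.1 (L w.1 w.2).2.1 = s₁ w.1 := by
  have hμ : Tendsto (fun ε : Eps => nu r ε) smallEps (𝓝 0) := tendsto_nu
  have hDt := h.domain.D_subset (h.wall_subset hw)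
  choose σ hσ1 hσ2 hσ3 hσ4 using fun ε : Eps => exists_barrierGauge_inv ε
  set U : Eps → ℝ := fun ε => barrierGauge ε (s₁ ε) - barrierGauge ε (s₀ ε) with hU
  -- The value prescribed for Q at the parameter θ: the gauge interpolates linearly between the two
  -- levels. The shares α and α|W'| of position and momentum are then at most 1.
  set s : Eps × unitInterval → ℝ := fun j => σ j.1 (barrierGauge j.1 (s₀ j.1) + j.2 * U j.1) with hsdef
  set α : Eps × unitInterval → ℝ := fun j => (1 + |deriv (gaussBarrier j.1) (s j)|)⁻¹ with hα
  have hα0 : ∀ j, 0 < 1 + |deriv (gaussBarrier j.1) (s j)| := fun j => by positivity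
  have hcs : Continuous s := by
    rw [continuous_prod_of_discrete_left]
    intro ε
    have : Continuous (σ ε) := continuous_iff_continuousAt.2 fun t => (hσ4 ε t).continuousAt
    have h1 (c : ℝ) : Continuous fun θ : unitInterval => c + (θ : ℝ) * U ε := by fun_prop
    exact this.comp (h1 (barrierGauge ε (s₀ ε)))
  have hcW : Continuous fun j => |deriv (gaussBarrier j.1) (s j)| := by
    rw [continuous_prod_of_discrete_left]
    intro ε
    exact ((continuous_deriv_gaussBarrier ε).comp (hcs.comp (by fun_prop))).abs
  have hcα : Continuous α := (continuous_const.add hcW).inv₀ fun j => (hα0 j).ne'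
  have hcU : Continuous fun j : Eps × unitInterval => U j.1 :=
    (continuous_of_discreteTopology (f := U)).comp continuous_fst
  -- The gauge increment is (s₁ - s₀) + (W(s₀) - W(s₁)); both levels are O(ν), and above η the
  -- barrier is at most ν.
  have hUO : (fun j : Eps × unitInterval => U j.1) =O[smallEps ×ˢ ⊤] fun j => nu r j.1 := by
    have h1 : U =O[smallEps] fun ε => nu r ε := by
      have h2 : (fun ε : Eps => gaussBarrier ε (s₀ ε) - gaussBarrier ε (s₁ ε)) =O[smallEps]
          fun ε => nu r ε := by
        refine IsBigO.of_bound 1 ?_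
        filter_upwards [hs, eventually_smallEps_mem r one_pos] with ε h1 h2
        have h3 := gaussBarrier_mem h2.1 h1.1
        have h4 := gaussBarrier_mem h2.1 h1.2.1
        rw [one_mul, Real.norm_eq_abs, Real.norm_of_nonneg (h3.1.trans h3.2), abs_le]
        constructor <;> linarith [h3.1, h3.2, h4.1, h4.2]
      have h3 : (fun ε : Eps => s₁ ε - s₀ ε) =O[smallEps] fun ε => nu r ε := hO₁.sub hO₀
      refine (h3.add h2).congr' ?_ EventuallyEq.rfl
      filter_upwards [hs, eventually_smallEps_mem r one_pos] with ε h1 h2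
      have h3 := eta_pos (r := r) h2.1
      rw [hU]
      simp only
      rw [barrierGauge_eq h2.1.1 (h3.le.trans h1.1), barrierGauge_eq h2.1.1 (h3.le.trans h1.2.1)]
      ring
    exact h1.comp_tendsto tendsto_fst
  have hle : ∀ {c : Eps × unitInterval → ℝ}, (∀ j, |c j| ≤ 1) →
      (fun j : Eps × unitInterval => U j.1 * c j) =O[smallEps ×ˢ ⊤] fun j => nu r j.1 := by
    intro c hc
    have : c =O[smallEps ×ˢ ⊤] fun _ => (1 : ℝ) :=
      IsBigO.of_bound 1 (Eventually.of_forall fun j => by simpa using hc j)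
    simpa using hUO.mul this
  have hα1 : ∀ j, |α j| ≤ 1 := fun j => by
    rw [abs_of_pos (inv_pos.2 (hα0 j))]
    exact inv_le_one_of_one_le₀ (by linarith [abs_nonneg (deriv (gaussBarrier j.1) (s j))])
  have hβ1 : ∀ j, |(|deriv (gaussBarrier j.1) (s j)|) * α j| ≤ 1 := fun j => by
    rw [abs_mul, abs_abs, abs_of_pos (inv_pos.2 (hα0 j)), ← div_eq_mul_inv, div_le_one (hα0 j)]
    linarith
  have hg := h.cBound_layerField hDt hY (A := fun j => U j.1 * α j)
    (B := fun j => U j.1 * (|deriv (gaussBarrier j.1) (s j)| * α j)) (hcU.mul hcα)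
    (hcU.mul (hcW.mul hcα)) (hle hα1) (hle hβ1)
  obtain ⟨Φ, hΦ, hΦC⟩ := exists_smallFlow r isCompact_singleton hμ hg
  have hj : CBound (smallEps : Filter Eps) {(q, p)} (fun _ => 1) r
      (fun _ (ρ : Phase d) => (ρ, (0 : ℝ))) :=
    CBound.clm_id isCompact_singleton (ContinuousLinearMap.inl ℝ (Phase d) ℝ)
  have hjt : Tendsto (fun w : Eps × Phase d => (w.1, (w.2, (0 : ℝ)))) (smallEps ×ˢ 𝓝ˢ {(q, p)})
      (smallEps ×ˢ 𝓝ˢ {((q, p), (0 : ℝ))}) := by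
    rw [nhdsSet_singleton, nhdsSet_singleton]
    exact tendsto_fst.prodMk (((by fun_prop : Continuous fun ρ : Phase d => (ρ, (0 : ℝ))).tendsto
      (q, p)).comp tendsto_snd)
  have hΦ1 := ((hΦC.reindex (j := fun ε => (ε, (1 : unitInterval))) (by fun_prop)
    (tendsto_id.prodMk tendsto_top)).of_le (Nat.le_succ r)).comp hj continuous_id hjt
  refine ⟨fun ε ρ => ((Φ (ε, 1) (ρ, 0)).2, (Φ (ε, 1) (ρ, 0)).1), ⟨?_, ?_, ?_, hμ⟩, ?_⟩
  · exact CBound.clm_id isCompact_singleton (ContinuousLinearMap.inr ℝ ℝ (Phase d))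
  · have e : (fun (ε : Eps) (ρ : Phase d) => ((Φ (ε, 1) (ρ, 0)).2, (Φ (ε, 1) (ρ, 0)).1) - (0, ρ)) =
        fun ε ρ => ((Φ (ε, 1) (ρ, 0) - (ρ, 0)).2, (Φ (ε, 1) (ρ, 0) - (ρ, 0)).1) := rfl
    rw [e]
    exact hΦ1.snd.prodMk hΦ1.fst
  · rw [nhdsSet_singleton]
    exact ((by fun_prop : Continuous fun ρ : Phase d => ((0 : ℝ), ρ)).tendsto (q, p)).comp tendsto_snd
  -- the motion
  have hsign : ∀ᶠ w : Eps × (Phase d × ℝ) in smallEps ×ˢ 𝓝ˢ {((q, p), (0 : ℝ))}, w.2.1.1 ∈ S.N ∧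
      0 < fderiv ℝ (S.Q w.1) w.2.1.1 w.2.1.2 * inner ℝ (gradient (S.Q 0) q) p := by
    rw [nhdsSet_singleton]
    have h1 : Tendsto (fun w : Eps × (Phase d × ℝ) => (w.1, w.2.1)) (smallEps ×ˢ 𝓝 ((q, p), (0 : ℝ)))
        (smallEps ×ˢ 𝓝 (q, p)) :=
      tendsto_fst.prodMk ((continuous_fst.tendsto ((q, p), (0 : ℝ))).comp tendsto_snd)
    have h2 := (((h.tendsto_inner hDt (p₀ := p)).comp h1).mul_const
      (inner ℝ (gradient (S.Q 0) q) p)).eventually_const_lt (mul_self_pos.2 hY)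
    have h3 := ((continuous_fst.tendsto (q, p)).comp (tendsto_snd.comp h1)).eventually
      (h.domain.open_N.eventually_mem (h.domain.boundary_subset hw))
    exact h3.and h2
  have hcurve := hjt.eventually (hΦ.and (smallFlow_mem hΦC hμ (eventually_unit_of_eventually hsign)))
  filter_upwards [hcurve, (hs.and ((eventually_smallEps_mem r one_pos).and
    (h.eventually_gradient_V.and (eventually_smallEps h.contDiffAt_Q)))).prod_inl _] with w hc hi hstart
  obtain ⟨ε, ρ⟩ := w
  obtain ⟨hline, hmem⟩ := hc
  obtain ⟨⟨hs0, hs1, hss⟩, ⟨hε, -⟩, hgrad, hQd⟩ := hi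
  dsimp only at hline hmem hs0 hs1 hss hε hgrad hQd hstart ⊢
  set X : unitInterval → Phase d := fun θ => (Φ (ε, θ) (ρ, 0)).1
  set T : unitInterval → ℝ := fun θ => (Φ (ε, θ) (ρ, 0)).2
  set Y : unitInterval → ℝ := fun θ => fderiv ℝ (S.Q ε) (X θ).1 (X θ).2 with hYdef
  have hXN : ∀ θ, (X θ).1 ∈ S.N := fun θ => (hmem θ).1
  have hXD : ∀ θ, (X θ).1 ∈ S.Dt := fun θ => h.domain.N_subset (hXN θ)
  have hYs : ∀ θ, 0 < Y θ * inner ℝ (gradient (S.Q 0) q) p := fun θ => (hmem θ).2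
  have hη := eta_pos (r := r) hε
  have hmono : StrictMono (barrierGauge ε) := by
    intro a b hab
    by_contra hcon
    have := (hσ3 ε).monotone (not_lt.1 hcon)
    rw [hσ2, hσ2] at this
    linarith
  -- Upward crossings have positive normal velocity and downward ones negative, so the physical time
  -- increases with θ in both cases.
  have hUY : ∀ θ, 0 < U ε * (Y θ)⁻¹ := by
    intro θ
    have hYp := hYs θ
    rcases pos_and_pos_or_neg_and_neg_of_mul_pos hss with ⟨h1, h2⟩ | ⟨h1, h2⟩
    · have h3 : 0 < U ε := sub_pos.2 (hmono (by linarith))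
      exact mul_pos h3 (inv_pos.2 (pos_of_mul_pos_left hYp h2.le))
    · have h3 : U ε < 0 := sub_neg.2 (hmono (by linarith))
      refine mul_pos_of_neg_of_neg h3 (inv_lt_zero.2 ?_)
      nlinarith
  have hXc : Continuous X := continuous_fst.comp hline.continuous
  have hYc : Continuous Y := by
    refine continuous_iff_continuousAt.2 fun θ => ?_
    have h1 : ContinuousAt (fderiv ℝ (S.Q ε)) (X θ).1 :=
      ((hQd _ (hXD θ)).fderiv_right (m := r + 1)
        (by rw [add_assoc, one_add_one_eq_two])).continuousAt
    have h2 : ContinuousAt (fun θ => fderiv ℝ (S.Q ε) (X θ).1) θ :=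
      ContinuousAt.comp (g := fderiv ℝ (S.Q ε)) h1 (by fun_prop)
    exact h2.clm_apply (by fun_prop)
  have hYne : ∀ θ, Y θ ≠ 0 := fun θ h0 => by have := hYs θ; rw [h0, zero_mul] at this; exact this.false
  have hXd : ∀ t ∈ Icc (0 : ℝ) 1, HasDerivWithinAt (fun t => X (toUnit t))
      ((U ε * α (ε, toUnit t)) • (Y (toUnit t))⁻¹ • (X (toUnit t)).2,
        (U ε * (|deriv (gaussBarrier ε) (s (ε, toUnit t))| * α (ε, toUnit t))) • (Y (toUnit t))⁻¹ •
          gradient (S.Q ε) (X (toUnit t)).1) (Icc 0 1) t := fun t ht => (hline.deriv t ht).fst_comp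
  have hTd : ∀ t ∈ Icc (0 : ℝ) 1, HasDerivWithinAt (fun t => T (toUnit t))
      ((U ε * α (ε, toUnit t)) • (Y (toUnit t))⁻¹) (Icc 0 1) t := fun t ht =>
    (hline.deriv t ht).snd_comp
  have hX0 : X 0 = ρ := congrArg Prod.fst hline.init
  have hT0 : T 0 = 0 := congrArg Prod.snd hline.init
  -- Both sides have the derivative Uα and the same initial value. This is what makes the field with
  -- prescribed coefficients the true motion: the W' entering it is evaluated at the actual Q.
  have hQs : ∀ t ∈ Icc (0 : ℝ) 1, S.Q ε (X (toUnit t)).1 = s (ε, toUnit t) := by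
    refine fun t ht => eq_of_hasDerivWithinAt_eq_unit (f := fun t => S.Q ε (X (toUnit t)).1)
      (g := fun t => s (ε, toUnit t)) (f' := fun t => U ε * α (ε, toUnit t))
      (fun t ht => ?_) (fun t ht => ?_) ?_ ht
    · have h1 := ((hQd _ (hXD (toUnit t))).differentiableAt (by simp)).hasFDerivAt
      refine (h1.comp_hasDerivWithinAt t (hXd t ht).fst_comp).congr_deriv ?_
      simp only [map_smul, smul_eq_mul]
      rw [inv_mul_cancel₀ (hYne (toUnit t)), mul_one]
    · have h1 : HasDerivAt (fun t : ℝ => barrierGauge ε (s₀ ε) + t * U ε) (U ε) t := by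
        simpa using ((hasDerivAt_id t).mul_const (U ε)).const_add (barrierGauge ε (s₀ ε))
      have h2 := ((hσ4 ε _).comp t h1).hasDerivWithinAt (s := Icc 0 1)
      refine (h2.congr_deriv ?_).congr (fun y hy => ?_) ?_
      · simp only [hα, hsdef, coe_toUnit ht]; ring
      · simp only [hsdef, coe_toUnit hy, Function.comp_apply]
      · simp only [hsdef, coe_toUnit ht, Function.comp_apply]
    · simp only [toUnit_zero, hX0, hsdef, hstart]
      simp [hσ2]
  have hQs' : ∀ θ, S.Q ε (X θ).1 = s (ε, θ) := fun θ => by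
    have := hQs θ θ.2
    rwa [toUnit_coe] at this
  have hsge : ∀ θ : unitInterval, eta r ε ≤ s (ε, θ) := by
    intro θ
    rw [← hσ2 ε (eta r ε)]
    refine (hσ3 ε).monotone ?_
    have h1 := hmono.monotone hs0
    have h2 := hmono.monotone hs1
    have h3 := θ.2.1
    have h4 := θ.2.2
    simp only [hU]
    nlinarith
  have hsgt : ∀ θ : unitInterval, 0 < θ → θ < 1 → eta r ε < s (ε, θ) := by
    intro θ h0 h1
    rw [← hσ2 ε (eta r ε)]
    refine (hσ3 ε) ?_
    have h2 := hmono.monotone hs0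
    have h3 := hmono.monotone hs1
    have h4 : (0 : ℝ) < θ := h0
    have h5 : (θ : ℝ) < 1 := h1
    simp only [hU]
    rcases pos_and_pos_or_neg_and_neg_of_mul_pos hss with ⟨h6, -⟩ | ⟨h6, -⟩
    · have := hmono (show s₀ ε < s₁ ε by linarith)
      nlinarith
    · have := hmono (show s₁ ε < s₀ ε by linarith)
      nlinarith
  have hseg := hamSeg_of_gauge (V := S.V ε) (P := fun q => q ∈ S.Dt ∧ eta r ε < S.Q ε q) (X := X) (T := T)
    (m := fun θ => U ε * α (ε, θ) * (Y θ)⁻¹) ?_ ?_ ?_ ?_ hT0 ?_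
  · rw [hX0] at hseg
    refine ⟨hseg.1, hseg.2, hXD 1, ?_⟩
    change S.Q ε (X 1).1 = _
    rw [hQs' 1]
    simp [hsdef, hU, hσ2]
  · exact (continuous_const.mul (hcα.comp (by fun_prop))).mul (hYc.inv₀ hYne)
  · intro θ
    have := mul_pos (hUY θ) (inv_pos.2 (hα0 (ε, θ)))
    calc 0 < _ := this
      _ = _ := by ring
  · intro t ht
    have hpos : 0 < S.Q ε (X (toUnit t)).1 := by
      rw [hQs']; exact hη.trans_le (hsge _)
    refine (hXd t ht).congr_deriv ?_
    rw [hgrad _ (hXN _) hpos, hQs', abs_of_nonpos (deriv_gaussBarrier_nonpos hε.1 (hη.le.trans (hsge _)))]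
    simp only [Prod.smul_mk, smul_smul, ← neg_smul]
    congr 2
    ring
  · intro t ht
    exact hTd t ht
  · intro θ h0 h1
    refine ⟨hXD θ, ?_⟩
    rw [hQs']
    exact hsgt θ h0 h1

end SteepSystem

/-! ### Reflection at the barrier -/

theorem tendsto_unit_family {ι E F G : Type} [TopologicalSpace E] [TopologicalSpace F]
    [TopologicalSpace G] {l : Filter ι} {x₀ : E} {n₀ : F} {c : unitInterval × E × F → G}
    (hc : Continuous c) {B : Set G} (hB : ∀ θ, c (θ, x₀, n₀) ∈ B) {N : (ι × unitInterval) × E → F}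
    (hN : Tendsto N ((l ×ˢ ⊤) ×ˢ 𝓝 x₀) (𝓝 n₀)) :
    Tendsto (fun w : (ι × unitInterval) × E => c (w.1.2, w.2, N w)) ((l ×ˢ ⊤) ×ˢ 𝓝 x₀)
      (𝓝ˢ B) := by
  have h1 : Tendsto c (𝓝ˢ (univ ×ˢ {(x₀, n₀)})) (𝓝ˢ B) := by
    refine hc.tendsto_nhdsSet ?_
    rintro ⟨θ, y⟩ ⟨-, hy⟩
    obtain rfl : y = (x₀, n₀) := hy
    exact hB θ
  rw [isCompact_univ.nhdsSet_prod_eq isCompact_singleton, nhdsSet_univ, nhdsSet_singleton] at h1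
  exact h1.comp ((tendsto_snd.comp tendsto_fst).prodMk (tendsto_snd.prodMk_nhds hN))

namespace SteepSystem

variable {d : ℕ} {S : SteepSystem d} {r : ℕ}

/-- The gradient of `Q` divided by the square of its norm. -/
noncomputable def conormal (S : SteepSystem d) (ε : ℝ) (q : Pos d) : Pos d :=
  (inner ℝ (gradient (S.Q ε) q) (gradient (S.Q ε) q))⁻¹ • gradient (S.Q ε) q

theorem Hyp.gradient_ne_zero (h : S.Hyp r) {q : Pos d} (hw : q ∈ frontier S.D \ S.corner) :
    gradient (S.Q 0) q ≠ 0 :=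
  h.pattern.gradient_ne.self_of_nhdsWithin (by simp) q (h.domain.boundary_subset hw)

theorem Hyp.inner_self_pos (h : S.Hyp r) {q : Pos d} (hw : q ∈ frontier S.D \ S.corner) :
    0 < inner ℝ (gradient (S.Q 0) q) (gradient (S.Q 0) q) :=
  real_inner_self_pos.2 (h.gradient_ne_zero hw)

theorem Hyp.tendsto_inner_self (h : S.Hyp r) {q : Pos d} (hq : q ∈ S.Dt) :
    Tendsto (fun w : Eps × Pos d => inner ℝ (gradient (S.Q w.1) w.2) (gradient (S.Q w.1) w.2))
      (smallEps ×ˢ 𝓝 q) (𝓝 (inner ℝ (gradient (S.Q 0) q) (gradient (S.Q 0) q))) :=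
  (h.tendsto_gradient_Q hq).inner (h.tendsto_gradient_Q hq)

theorem Hyp.tendsto_conormal (h : S.Hyp r) {q : Pos d} (hw : q ∈ frontier S.D \ S.corner) :
    Tendsto (fun w : Eps × Pos d => S.conormal w.1 w.2) (smallEps ×ˢ 𝓝 q) (𝓝 (S.conormal 0 q)) := by
  have hDt := h.domain.D_subset (h.wall_subset hw)
  exact ((h.tendsto_inner_self hDt).inv₀ (h.inner_self_pos hw).ne').smul (h.tendsto_gradient_Q hDt)

theorem Hyp.cBound_inner_inv (h : S.Hyp r) {q : Pos d} (hw : q ∈ frontier S.D \ S.corner) :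
    CBound smallEps {q} (fun _ => 1) (r + 1) (fun (ε : Eps) q =>
      (inner ℝ (gradient (S.Q ε) q) (gradient (S.Q ε) q))⁻¹) := by
  have hDt := h.domain.D_subset (h.wall_subset hw)
  have hg := h.cBound_gradient_Q isCompact_singleton (singleton_subset_iff.2 hDt)
  refine (hg.bilin_right (innerSL ℝ) hg).inv (half_pos (h.inner_self_pos hw)) ?_
  rw [nhdsSet_singleton]
  filter_upwards [(h.tendsto_inner_self hDt).eventually_const_le (half_lt_self (h.inner_self_pos hw))]
    with w hw
  exact hw.trans (le_abs_self _)

theorem Hyp.cBound_conormal (h : S.Hyp r) {q : Pos d} (hw : q ∈ frontier S.D \ S.corner) :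
    CBound smallEps {q} (fun _ => 1) (r + 1) (fun (ε : Eps) q => S.conormal ε q) := by
  have hDt := h.domain.D_subset (h.wall_subset hw)
  exact (h.cBound_inner_inv hw).smul_right
    (h.cBound_gradient_Q isCompact_singleton (singleton_subset_iff.2 hDt))

theorem inner_conormal (S : SteepSystem d) (ε : ℝ) (q p : Pos d) :
    inner ℝ p (S.conormal ε q) =
      (inner ℝ (gradient (S.Q ε) q) (gradient (S.Q ε) q))⁻¹ * inner ℝ (gradient (S.Q ε) q) p := by
  rw [conormal, inner_smul_right, real_inner_comm p]

theorem inner_conormal_self (S : SteepSystem d) (ε : ℝ) (q : Pos d) :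
    inner ℝ (S.conormal ε q) (S.conormal ε q) =
      (inner ℝ (gradient (S.Q ε) q) (gradient (S.Q ε) q))⁻¹ := by
  rw [inner_conormal, conormal, inner_smul_right]
  set G := inner ℝ (gradient (S.Q ε) q) (gradient (S.Q ε) q)
  by_cases h : G = 0
  · simp [h]
  · field_simp

theorem reflect_normal (S : SteepSystem d) (ε : ℝ) (q p : Pos d) :
    reflect (S.normal ε q) p = p + (-2 * inner ℝ (gradient (S.Q ε) q) p) • S.conormal ε q := by
  rw [reflect, SteepSystem.normal, conormal, inner_smul_right, real_inner_self_eq_norm_sq,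
    real_inner_comm, smul_smul, smul_smul, sub_eq_add_neg, ← neg_smul]
  congr 2
  rw [← inv_pow]
  ring

/-- Phase points with a time, an energy and an impulse. -/
abbrev ReflState (d : ℕ) : Type := Phase d × ℝ × ℝ × ℝ

/-- The momentum during the reflection, when a fraction `j.2` of the impulse has been received. -/
noncomputable def reflMom (S : SteepSystem d) (j : Eps × unitInterval) (x : ReflState d) : Pos d :=
  x.1.2 + ((j.2 : ℝ) * x.2.2.2) • S.conormal j.1 x.1.1

/-- The potential energy during the reflection. -/
noncomputable def reflHeight (S : SteepSystem d) (j : Eps × unitInterval) (x : ReflState d) : ℝ :=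
  x.2.2.1 - 2⁻¹ * inner ℝ (S.reflMom j x) (S.reflMom j x)

/-- The time received per unit of the impulse. -/
noncomputable def reflSpeed (S : SteepSystem d) (r : ℕ) (j : Eps × unitInterval) (x : ReflState d) :
    ℝ :=
  kap r j.1 (S.reflHeight j x) *
    (x.2.2.2 * (inner ℝ (gradient (S.Q j.1) x.1.1) (gradient (S.Q j.1) x.1.1))⁻¹)

/-- The equations of motion with the received impulse as the independent variable. -/
noncomputable def reflField (S : SteepSystem d) (r : ℕ) (j : Eps × unitInterval) (x : ReflState d) :
    ReflState d :=
  ((S.reflSpeed r j x • S.reflMom j x,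
    -(S.reflSpeed r j x • ((j.2 : ℝ) * x.2.2.2) •
      fderiv ℝ (S.conormal j.1) x.1.1 (S.reflMom j x))), S.reflSpeed r j x, 0, 0)

/-- In the limit reflection at unit speed the potential energy, after the fraction θ of the impulse,
is 2θ(1 - θ) Y²/G. The Cauchy–Schwarz bound Y² ≤ G keeps it at most 1/2, within the range where
`kap` is controlled. -/
theorem height_mem {G Y θ : ℝ} (hG : 0 < G) (hYG : Y ^ 2 ≤ G) (hθ : θ ∈ Icc (0 : ℝ) 1) {m : ℝ}
    (hm : m = 1 + 2 * (θ * (-2 * Y)) * (G⁻¹ * Y) + (θ * (-2 * Y)) ^ 2 * G⁻¹) :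
    1 / 2 - 2⁻¹ * m ∈ Icc (0 : ℝ) (1 / 2) := by
  have e : 1 / 2 - 2⁻¹ * m = 2 * (θ * (1 - θ)) * (Y ^ 2 / G) := by
    rw [hm]; field_simp; ring
  have h1 : Y ^ 2 / G ≤ 1 := (div_le_one hG).2 hYG
  have h2 : 0 ≤ Y ^ 2 / G := by positivity
  have h3 : 0 ≤ θ * (1 - θ) := mul_nonneg hθ.1 (by linarith [hθ.2])
  have h4 : θ * (1 - θ) ≤ 1 / 4 := by nlinarith [sq_nonneg (θ - 1 / 2)]
  rw [e]
  constructor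
  · positivity
  · nlinarith

theorem inner_add_smul_self (p n : Pos d) (c : ℝ) :
    inner ℝ (p + c • n) (p + c • n) =
      inner ℝ p p + 2 * c * inner ℝ p n + c ^ 2 * inner ℝ n n := by
  simp only [inner_add_left, inner_add_right, inner_smul_left, inner_smul_right, conj_trivial,
    real_inner_comm p n]
  ring

section Base

variable {q p : Pos d}

/-- The state at the start of a reflection of the limit billiard. -/
noncomputable def reflBase (S : SteepSystem d) (q p : Pos d) : ReflState d :=
  ((q, p), 0, 1 / 2, -2 * inner ℝ (gradient (S.Q 0) q) p)

theorem tendsto_reflState_fst :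
    Tendsto (fun w : (Eps × unitInterval) × ReflState d => (w.1.1, w.2.1.1))
      ((smallEps ×ˢ ⊤) ×ˢ 𝓝 (S.reflBase q p)) (smallEps ×ˢ 𝓝 q) := by
  have hc : Continuous fun x : ReflState d => x.1.1 := by fun_prop
  have h0 := hc.tendsto (S.reflBase q p)
  have e : (S.reflBase q p).1.1 = q := rfl
  rw [e] at h0
  exact (tendsto_fst.comp tendsto_fst).prodMk (h0.comp tendsto_snd)

theorem Hyp.tendsto_conormal_reflState (h : S.Hyp r) (hw : q ∈ frontier S.D \ S.corner) :
    Tendsto (fun w : (Eps × unitInterval) × ReflState d => S.conormal w.1.1 w.2.1.1)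
      ((smallEps ×ˢ ⊤) ×ˢ 𝓝 (S.reflBase q p)) (𝓝 (S.conormal 0 q)) := by
  have h1 := (h.tendsto_conormal hw).comp (tendsto_reflState_fst (S := S) (q := q) (p := p))
  exact h1

/-- The potential energy as a function of the conormal. -/
noncomputable def heightAt (y : unitInterval × ReflState d × Pos d) : ℝ :=
  y.2.1.2.2.1 - 2⁻¹ * inner ℝ (y.2.1.1.2 + ((y.1 : ℝ) * y.2.1.2.2.2) • y.2.2)
    (y.2.1.1.2 + ((y.1 : ℝ) * y.2.1.2.2.2) • y.2.2)

theorem continuous_heightAt : Continuous (heightAt (d := d)) := by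
  unfold heightAt
  fun_prop

theorem Hyp.heightAt_mem (h : S.Hyp r) (hw : q ∈ frontier S.D \ S.corner) (hp : ‖p‖ = 1)
    (θ : unitInterval) : heightAt (θ, S.reflBase q p, S.conormal 0 q) ∈ Icc (0 : ℝ) (1 / 2) := by
  refine height_mem (h.inner_self_pos hw) (Y := inner ℝ (gradient (S.Q 0) q) p) ?_ θ.2 ?_
  · have := real_inner_mul_inner_self_le (gradient (S.Q 0) q) p
    rw [real_inner_self_eq_norm_sq p, hp] at this
    nlinarith
  · rw [inner_add_smul_self, inner_conormal, inner_conormal_self]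
    simp only [reflBase]
    rw [real_inner_self_eq_norm_sq p, hp]
    ring

theorem Hyp.tendsto_reflHeight (h : S.Hyp r) (hw : q ∈ frontier S.D \ S.corner) (hp : ‖p‖ = 1) :
    Tendsto (fun w : (Eps × unitInterval) × ReflState d => (w.1.1, S.reflHeight w.1 w.2))
      ((smallEps ×ˢ ⊤) ×ˢ 𝓝ˢ {S.reflBase q p}) (smallEps ×ˢ 𝓝ˢ (Icc 0 (1 / 2))) := by
  rw [nhdsSet_singleton]
  exact (tendsto_fst.comp tendsto_fst).prodMk
    (tendsto_unit_family continuous_heightAt (h.heightAt_mem hw hp)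
      (h.tendsto_conormal_reflState hw))

theorem Hyp.cBound_reflMom (h : S.Hyp r) (hw : q ∈ frontier S.D \ S.corner) :
    CBound (smallEps ×ˢ (⊤ : Filter unitInterval)) {S.reflBase q p} (fun _ => 1) (r + 1) S.reflMom ∧
    CBound (smallEps ×ˢ (⊤ : Filter unitInterval)) {S.reflBase q p} (fun _ => 1) (r + 1)
      (fun j x => S.conormal j.1 x.1.1) ∧
    CBound (smallEps ×ˢ (⊤ : Filter unitInterval)) {S.reflBase q p} (fun _ => 1) (r + 1)
      (fun j x => (inner ℝ (gradient (S.Q j.1) x.1.1) (gradient (S.Q j.1) x.1.1))⁻¹) ∧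
    CBound (smallEps ×ˢ (⊤ : Filter unitInterval)) {S.reflBase q p} (fun _ => 1) r
      (fun j x => fderiv ℝ (S.conormal j.1) x.1.1) ∧
    CBound (smallEps ×ˢ (⊤ : Filter unitInterval)) {S.reflBase q p} (fun _ => 1) (r + 1)
      (fun j x => (j.2 : ℝ) * x.2.2.2) := by
  set l : Filter (Eps × unitInterval) := smallEps ×ˢ ⊤
  set K : Set (ReflState d) := {S.reflBase q p}
  have hK : IsCompact K := isCompact_singleton
  have hb : CBound l K (fun _ => 1) (r + 1) fun _ x => x.1.2 := CBound.clm_id hK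
    ((ContinuousLinearMap.snd ℝ (Pos d) (Pos d)).comp (ContinuousLinearMap.fst ℝ (Phase d) _))
  have hq : CBound l K (fun _ => 1) (r + 1) fun _ x => x.1.1 := CBound.clm_id hK
    ((ContinuousLinearMap.fst ℝ (Pos d) (Pos d)).comp (ContinuousLinearMap.fst ℝ (Phase d) _))
  have hz : CBound l K (fun _ => 1) (r + 1) fun _ x => x.2.2.2 := CBound.clm_id hK
    ((ContinuousLinearMap.snd ℝ ℝ ℝ).comp ((ContinuousLinearMap.snd ℝ ℝ (ℝ × ℝ)).comp
      (ContinuousLinearMap.snd ℝ (Phase d) (ℝ × ℝ × ℝ))))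
  have hθ : CBound l K (fun _ => 1) (r + 1) fun j (_ : ReflState d) => (j.2 : ℝ) := by
    refine CBound.const_family (by fun_prop) (IsBigO.of_bound 1 (Eventually.of_forall fun j => ?_))
    simpa [abs_of_nonneg j.2.2.1] using j.2.2.2
  have ht : Tendsto (fun w : (Eps × unitInterval) × ReflState d => (w.1.1, w.2.1.1)) (l ×ˢ 𝓝ˢ K)
      (smallEps ×ˢ 𝓝ˢ {q}) := by
    rw [nhdsSet_singleton, nhdsSet_singleton]
    exact tendsto_reflState_fst
  have hN := (h.cBound_conormal hw).comp hq continuous_fst ht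
  have hθz := hθ.smul_right hz
  exact ⟨hb.add (hθz.smul_right hN), hN, (h.cBound_inner_inv hw).comp hq continuous_fst ht,
    (h.cBound_conormal hw).fderiv.comp hq.pred continuous_fst ht, hθz⟩

theorem Hyp.cBound_reflHeight (h : S.Hyp r) (hw : q ∈ frontier S.D \ S.corner) :
    CBound (smallEps ×ˢ (⊤ : Filter unitInterval)) {S.reflBase q p} (fun _ => 1) (r + 1)
      S.reflHeight := by
  have hm := (h.cBound_reflMom (p := p) hw).1
  have he : CBound (smallEps ×ˢ (⊤ : Filter unitInterval)) {S.reflBase q p} (fun _ => 1) (r + 1)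
      (fun _ x => x.2.2.1) := CBound.clm_id isCompact_singleton
    ((ContinuousLinearMap.fst ℝ ℝ ℝ).comp ((ContinuousLinearMap.snd ℝ ℝ (ℝ × ℝ)).comp
      (ContinuousLinearMap.snd ℝ (Phase d) (ℝ × ℝ × ℝ))))
  exact he.sub ((CBound.const (2⁻¹ : ℝ)).smul_right (hm.bilin_right (innerSL ℝ) hm))

theorem Hyp.cBound_reflSpeed (h : S.Hyp r) (hw : q ∈ frontier S.D \ S.corner) (hp : ‖p‖ = 1) :
    CBound (smallEps ×ˢ (⊤ : Filter unitInterval)) {S.reflBase q p} (fun j => nu r j.1) r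
      (S.reflSpeed r) := by
  have hk := (cBound_kap r (K := Icc 0 (1 / 2)) isCompact_Icc (fun x hx => by
    have := hx.2
    rw [mem_Iio]; linarith)).comp (h.cBound_reflHeight (p := p) hw).pred continuous_fst
      (h.tendsto_reflHeight hw hp)
  have hz : CBound (smallEps ×ˢ (⊤ : Filter unitInterval)) {S.reflBase q p} (fun _ => 1) r
      (fun _ x => x.2.2.2) := CBound.clm_id isCompact_singleton
    ((ContinuousLinearMap.snd ℝ ℝ ℝ).comp ((ContinuousLinearMap.snd ℝ ℝ (ℝ × ℝ)).comp
      (ContinuousLinearMap.snd ℝ (Phase d) (ℝ × ℝ × ℝ))))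
  exact hk.smul_left (hz.smul_right (h.cBound_reflMom (p := p) hw).2.2.1.pred)

/-- The state stores the momentum minus the impulse received so far, so the large momentum transfer
drops out of the equations. Every nonzero component that remains carries the factor `reflSpeed`,
which is O(ν). -/
theorem Hyp.cBound_reflField (h : S.Hyp r) (hw : q ∈ frontier S.D \ S.corner) (hp : ‖p‖ = 1) :
    CBound (smallEps ×ˢ (⊤ : Filter unitInterval)) {S.reflBase q p} (fun j => nu r j.1) r
      (S.reflField r) := by
  obtain ⟨h1, -, -, h4, h5⟩ := h.cBound_reflMom (p := p) hw
  have hs := h.cBound_reflSpeed hw hp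
  have h6 := h5.pred.smul_right
    (h4.bilin_right (ContinuousLinearMap.id ℝ (Pos d →L[ℝ] Pos d)) h1.pred)
  exact ((hs.smul_left h1.pred).prodMk (hs.smul_left h6).neg).prodMk
    (hs.prodMk (CBound.zero_fun.prodMk CBound.zero_fun))

end Base

end SteepSystem

/-! ### The motion during the reflection -/

/-- A strictly concave function with equal end values lies above them. -/
theorem lt_of_hasDerivWithinAt_strictAnti {f f' : ℝ → ℝ} {c : ℝ}
    (hf : ∀ t ∈ Icc (0 : ℝ) 1, HasDerivWithinAt f (f' t) (Icc 0 1) t)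
    (hf' : StrictAntiOn f' (Icc 0 1)) (h0 : f 0 = c) (h1 : f 1 = c) {t : ℝ} (ht : t ∈ Ioo (0 : ℝ) 1) :
    c < f t := by
  have hd : ∀ t ∈ Ioo (0 : ℝ) 1, deriv f t = f' t := fun t ht =>
    ((hf t (Ioo_subset_Icc_self ht)).hasDerivAt (Icc_mem_nhds ht.1 ht.2)).deriv
  have hs : StrictConcaveOn ℝ (Icc (0 : ℝ) 1) f := by
    refine StrictAntiOn.strictConcaveOn_of_deriv (convex_Icc 0 1)
      (fun t ht => (hf t ht).continuousWithinAt) ?_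
    rw [interior_Icc]
    intro a ha b hb hab
    rw [hd a ha, hd b hb]
    exact hf' (Ioo_subset_Icc_self ha) (Ioo_subset_Icc_self hb) hab
  have := hs.2 (left_mem_Icc.2 zero_le_one) (right_mem_Icc.2 zero_le_one) zero_ne_one
    (sub_pos.2 ht.2) ht.1 (by ring)
  simp only [smul_eq_mul, mul_zero, mul_one, zero_add, h0, h1] at this
  linarith

theorem invBarrier_lt {ε w w' : ℝ} (hε : 0 < ε) (hw : 0 < w) (hww : w < w') (hw' : w' < 1) :
    invBarrier ε w' < invBarrier ε w := by
  have h1 := Real.log_lt_log hw hww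
  have h2 := Real.log_neg (hw.trans hww) hw'
  refine Real.sqrt_lt_sqrt ?_ ?_ <;> nlinarith

theorem invBarrier_pos {ε w : ℝ} (hε : 0 < ε) (hw : 0 < w) (hw' : w < 1) : 0 < invBarrier ε w := by
  have h2 := Real.log_neg hw hw'
  exact Real.sqrt_pos.2 (by nlinarith)

theorem IsLine.eq_const {E F : Type} [NormedAddCommGroup E] [NormedSpace ℝ E]
    [NormedAddCommGroup F] [NormedSpace ℝ F] {f : unitInterval → E → E} {γ : unitInterval → E} {x : E}
    (h : IsLine f γ x) (L : E →L[ℝ] F) (hL : ∀ s y, L (f s y) = 0) (s : unitInterval) :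
    L (γ s) = L x := by
  have h1 := (convex_Icc (0 : ℝ) 1).norm_image_sub_le_of_norm_hasDerivWithin_le
    (f := fun s => L (γ (toUnit s))) (C := 0)
    (fun t ht => (L.hasFDerivAt.comp_hasDerivWithinAt t (h.deriv t ht)))
    (fun t _ => by rw [hL, norm_zero]) (show (0 : ℝ) ∈ Icc (0 : ℝ) 1 by simp) s.2
  rw [zero_mul] at h1
  have h2 := sub_eq_zero.1 (norm_le_zero_iff.1 h1)
  rwa [toUnit_coe, toUnit_zero, h.init] at h2

namespace SteepSystem

variable {d : ℕ} {S : SteepSystem d} {r : ℕ}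

section Motion

variable {ε : Eps} {X : unitInterval → ReflState d} {x : ReflState d}

theorem differentiableAt_conormal {q : Pos d}
    (hQ : ContDiffAt ℝ (r + 2) (S.Q ε) q)
    (hG : 0 < inner ℝ (gradient (S.Q ε) q) (gradient (S.Q ε) q)) :
    DifferentiableAt ℝ (S.conormal ε) q := by
  have h1 : DifferentiableAt ℝ (gradient (S.Q ε)) q := by
    have h2 : ContDiffAt ℝ (r + 1) (fderiv ℝ (S.Q ε)) q :=
      hQ.fderiv_right (by rw [add_assoc, one_add_one_eq_two])
    exact (gradL d).differentiableAt.comp q (h2.differentiableAt (by simp))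
  exact ((h1.inner ℝ h1).inv hG.ne').smul h1

/-- The motion during the reflection in physical time. -/
theorem reflection_motion (hε : (ε : ℝ) ∈ Ioo 0 (Real.exp (-2)))
    (hline : IsLine (fun θ => S.reflField r (ε, θ)) X x)
    (hQd : ∀ q ∈ S.Dt, ContDiffAt ℝ (r + 2) (S.Q ε) q)
    (hgrad : ∀ q ∈ S.N, 0 < S.Q ε q →
      gradient (S.V ε) q = deriv (gaussBarrier ε) (S.Q ε q) • gradient (S.Q ε) q)
    (hN : S.N ⊆ S.Dt) (hXN : ∀ θ, (X θ).1.1 ∈ S.N) (hz : 0 < x.2.2.2)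
    (hG : ∀ θ, 0 < inner ℝ (gradient (S.Q ε) (X θ).1.1) (gradient (S.Q ε) (X θ).1.1))
    (hmono : ∀ θ, 0 < (X θ).2.2.2 *
        (inner ℝ (gradient (S.Q ε) (X θ).1.1) (gradient (S.Q ε) (X θ).1.1))⁻¹ +
      S.reflSpeed r (ε, θ) (X θ) * inner ℝ (S.reflMom (ε, θ) (X θ))
        (fderiv ℝ (S.conormal ε) (X θ).1.1 (S.reflMom (ε, θ) (X θ))))
    (hw : ∀ θ, S.reflHeight (ε, θ) (X θ) < 1) (ht : x.2.1 = 0)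
    (h0 : S.reflHeight (ε, 0) x = nu r ε) (h1 : S.reflHeight (ε, 1) (X 1) = nu r ε)
    (hq : S.Q ε x.1.1 = eta r ε) :
    0 < (X 1).2.1 ∧ HamSeg (S.V ε) (fun q => q ∈ S.Dt ∧ S.Q ε q < eta r ε)
      (x.1.1, S.reflMom (ε, 0) x) (X 1).2.1 ((X 1).1.1, S.reflMom (ε, 1) (X 1)) ∧
      S.Q ε (X 1).1.1 = eta r ε := by
  have hν := nu_pos (r := r) hε
  have hν1 := nu_lt_one (r := r) hε
  have hX : Continuous X := hline.continuous
  set q : unitInterval → Pos d := fun θ => (X θ).1.1 with hqdef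
  set p : unitInterval → Pos d := fun θ => S.reflMom (ε, θ) (X θ) with hpdef
  set z : ℝ := x.2.2.2 with hzdef
  set e : ℝ := x.2.2.1 with hedef
  set w : unitInterval → ℝ := fun θ => S.reflHeight (ε, θ) (X θ) with hwdef
  set sp : unitInterval → ℝ := fun θ => S.reflSpeed r (ε, θ) (X θ) with hspdef
  set N : Pos d → Pos d := S.conormal ε with hNdef
  set G : unitInterval → ℝ := fun θ => inner ℝ (gradient (S.Q ε) (q θ)) (gradient (S.Q ε) (q θ))
    with hGdef
  have hze : ∀ θ, (X θ).2.2.2 = z := fun θ => hline.eq_const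
    ((ContinuousLinearMap.snd ℝ ℝ ℝ).comp ((ContinuousLinearMap.snd ℝ ℝ (ℝ × ℝ)).comp
      (ContinuousLinearMap.snd ℝ (Phase d) (ℝ × ℝ × ℝ)))) (fun _ _ => rfl) θ
  have hee : ∀ θ, (X θ).2.2.1 = e := fun θ => hline.eq_const
    ((ContinuousLinearMap.fst ℝ ℝ ℝ).comp ((ContinuousLinearMap.snd ℝ ℝ (ℝ × ℝ)).comp
      (ContinuousLinearMap.snd ℝ (Phase d) (ℝ × ℝ × ℝ)))) (fun _ _ => rfl) θ
  have hqD : ∀ θ, q θ ∈ S.Dt := fun θ => hN (hXN θ)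
  have hND : ∀ θ, DifferentiableAt ℝ N (q θ) := fun θ =>
    differentiableAt_conormal (hQd _ (hqD θ)) (hG θ)
  have hqd : ∀ t ∈ Icc (0 : ℝ) 1, HasDerivWithinAt (fun t => q (toUnit t))
      (sp (toUnit t) • p (toUnit t)) (Icc 0 1) t := fun t ht => (hline.deriv t ht).fst_comp.fst_comp
  have hTd : ∀ t ∈ Icc (0 : ℝ) 1, HasDerivWithinAt (fun t => (X (toUnit t)).2.1)
      (sp (toUnit t)) (Icc 0 1) t := fun t ht => (hline.deriv t ht).snd_comp.fst_comp
  have hNd : ∀ t ∈ Icc (0 : ℝ) 1, HasDerivWithinAt (fun t => N (q (toUnit t)))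
      (sp (toUnit t) • fderiv ℝ N (q (toUnit t)) (p (toUnit t))) (Icc 0 1) t := fun t ht => by
    have := (hND (toUnit t)).hasFDerivAt.comp_hasDerivWithinAt t (hqd t ht)
    rwa [map_smul] at this
  -- The product rule for t z N(q) produces a term with the derivative of N, which the second
  -- component of the field cancels. The momentum changes exactly by the impulse z N.
  have hpd : ∀ t ∈ Icc (0 : ℝ) 1, HasDerivWithinAt (fun t => p (toUnit t))
      (z • N (q (toUnit t))) (Icc 0 1) t := fun t ht => by
    have h2 : HasDerivWithinAt (fun t => (X (toUnit t)).1.2)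
        (-(sp (toUnit t) • ((toUnit t : ℝ) * (X (toUnit t)).2.2.2) •
          fderiv ℝ N (q (toUnit t)) (p (toUnit t)))) (Icc 0 1) t := (hline.deriv t ht).fst_comp.snd_comp
    have h3 : HasDerivWithinAt (fun t : ℝ => t * z) z (Icc 0 1) t := by
      simpa using ((hasDerivAt_id t).mul_const z).hasDerivWithinAt (s := Icc 0 1)
    have h4 := h2.add (h3.smul (hNd t ht))
    refine (h4.congr_deriv ?_).congr (fun y hy => ?_) ?_
    · rw [hze, coe_toUnit ht, smul_comm (t * z)]
      abel
    · simp only [hpdef, reflMom, hze, coe_toUnit hy, Pi.add_apply]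
      rfl
    · simp only [hpdef, reflMom, hze, coe_toUnit ht, Pi.add_apply]
      rfl
  have hww : ∀ θ, w θ = e - 2⁻¹ * inner ℝ (p θ) (p θ) := fun θ => by
    simp only [hwdef, reflHeight, hee, hpdef]
  have hwd : ∀ t ∈ Icc (0 : ℝ) 1, HasDerivWithinAt (fun t => w (toUnit t))
      (-(z * inner ℝ (p (toUnit t)) (N (q (toUnit t))))) (Icc 0 1) t := fun t ht => by
    have h2 := ((((hpd t ht).inner ℝ (hpd t ht)).const_mul (2⁻¹ : ℝ)).const_sub e)
    simp only [hww]
    refine h2.congr_deriv ?_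
    rw [inner_smul_left, inner_smul_right, conj_trivial, real_inner_comm (p (toUnit t))]
    ring
  have hNN : ∀ θ, inner ℝ (N (q θ)) (N (q θ)) = (G θ)⁻¹ := fun θ => S.inner_conormal_self ε _
  have hNp : ∀ θ, inner ℝ (p θ) (N (q θ)) = (G θ)⁻¹ * inner ℝ (gradient (S.Q ε) (q θ)) (p θ) :=
    fun θ => S.inner_conormal ε _ _
  have hyd : ∀ t ∈ Icc (0 : ℝ) 1, HasDerivWithinAt
      (fun t => inner ℝ (p (toUnit t)) (N (q (toUnit t))))
      (z * (G (toUnit t))⁻¹ + sp (toUnit t) *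
        inner ℝ (p (toUnit t)) (fderiv ℝ N (q (toUnit t)) (p (toUnit t)))) (Icc 0 1) t := fun t ht => by
    refine ((hpd t ht).inner ℝ (hNd t ht)).congr_deriv ?_
    rw [inner_smul_left, inner_smul_right, conj_trivial, hNN]
    ring
  have hymono : StrictMonoOn (fun t => inner ℝ (p (toUnit t)) (N (q (toUnit t)))) (Icc (0 : ℝ) 1) := by
    refine strictMonoOn_of_deriv_pos (convex_Icc 0 1) (fun t ht => (hyd t ht).continuousWithinAt)
      fun t ht => ?_
    rw [interior_Icc] at ht
    rw [((hyd t (Ioo_subset_Icc_self ht)).hasDerivAt (Icc_mem_nhds ht.1 ht.2)).deriv]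
    have := hmono (toUnit t)
    rwa [hze] at this
  have hw0 : w 0 = nu r ε := by simp only [hwdef, hline.init]; exact h0
  -- The derivative of the potential energy is -z⟨p, N⟩, and ⟨p, N⟩ is strictly increasing by
  -- `hmono`. The energy is thus strictly concave and stays above its common end value ν, the range
  -- in which `kap` has not been altered.
  have hwgt : ∀ t ∈ Ioo (0 : ℝ) 1, nu r ε < w (toUnit t) := fun t ht =>
    lt_of_hasDerivWithinAt_strictAnti hwd
      (fun a ha b hb hab => neg_lt_neg (mul_lt_mul_of_pos_left (hymono ha hb hab) hz))
      (by rw [toUnit_zero, hw0]) (by rw [toUnit_one]; exact h1) ht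
  have hwgt' : ∀ θ : unitInterval, 0 < θ → θ < 1 → nu r ε < w θ := fun θ a b => by
    have := hwgt θ ⟨a, b⟩
    rwa [toUnit_coe] at this
  have hwge : ∀ θ, nu r ε ≤ w θ := fun θ => by
    rcases eq_or_ne θ 0 with rfl | h0'
    · exact hw0.ge
    rcases eq_or_ne θ 1 with rfl | h1'
    · exact h1.ge
    exact (hwgt' θ (unitInterval.pos_iff_ne_zero.2 h0') (unitInterval.lt_one_iff_ne_one.2 h1')).le
  have hwm : ∀ θ, w θ ∈ Ioo (0 : ℝ) 1 := fun θ => ⟨hν.trans_le (hwge θ), hw θ⟩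
  have hkap : ∀ θ, kap r ε (w θ) = invBarrierSeq ε 0 (w θ) := fun θ => kap_eq (hwge θ)
  have hspeq : ∀ θ, sp θ = invBarrierSeq ε 0 (w θ) * (z * (G θ)⁻¹) := fun θ => by
    have h2 : sp θ = kap r ε (w θ) * ((X θ).2.2.2 * (G θ)⁻¹) := rfl
    rw [h2, hkap, hze]
  have hsppos : ∀ θ, 0 < sp θ := fun θ => by
    rw [hspeq]
    exact mul_pos (invBarrierSeq_zero_pos hε.1 (hwm θ)) (mul_pos hz (inv_pos.2 (hG θ)))
  -- Both sides have the same derivative and the same initial value. Hence the bookkeeping variable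
  -- w is the true potential energy at the current position.
  have hQ : ∀ t ∈ Icc (0 : ℝ) 1, S.Q ε (q (toUnit t)) = invBarrier ε (w (toUnit t)) := by
    refine fun t ht => eq_of_hasDerivWithinAt_eq_unit (f := fun t => S.Q ε (q (toUnit t)))
      (g := fun t => invBarrier ε (w (toUnit t)))
      (f' := fun t => -invBarrierSeq ε 0 (w (toUnit t)) *
        -(z * inner ℝ (p (toUnit t)) (N (q (toUnit t)))))
      (fun t ht => ?_) (fun t ht => ?_) ?_ ht
    · have h2 := ((hQd _ (hqD (toUnit t))).differentiableAt (by simp)).hasFDerivAt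
      refine (h2.comp_hasDerivWithinAt t (hqd t ht)).congr_deriv ?_
      rw [map_smul, smul_eq_mul, ← inner_gradient, hspeq, hNp]
      ring
    · exact HasDerivAt.comp_hasDerivWithinAt (h₂ := invBarrier ε) (h := fun t => w (toUnit t)) t
        (hasDerivAt_invBarrier hε.1 (hwm (toUnit t))) (hwd t ht)
    · simp only [toUnit_zero, hw0]
      rw [hqdef]
      simp only [hline.init, hq]
      rfl
  have hQ' : ∀ θ, S.Q ε (q θ) = invBarrier ε (w θ) := fun θ => by
    have := hQ θ θ.2
    rwa [toUnit_coe] at this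
  have hspc : Continuous sp := by
    have hpc : Continuous w := by
      refine continuous_iff_continuousAt.2 fun θ => ?_
      have h2 : ContinuousAt (fun θ => N (q θ)) θ :=
        ContinuousAt.comp (g := N) (hND θ).continuousAt (by fun_prop)
      have h4 : ContinuousAt (fun θ : unitInterval => (θ : ℝ) * (X θ).2.2.2) θ :=
        (continuous_subtype_val.mul (by fun_prop)).continuousAt
      have h5 : ContinuousAt (fun θ => (X θ).1.2) θ := by fun_prop
      have h3 : ContinuousAt p θ := h5.add (h4.smul h2)
      have : ContinuousAt (fun θ => (X θ).2.2.1 - 2⁻¹ * inner ℝ (p θ) (p θ)) θ := by fun_prop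
      exact this
    have hGc : Continuous G := by
      refine continuous_iff_continuousAt.2 fun θ => ?_
      have h2 : ContinuousAt (gradient (S.Q ε)) (q θ) :=
        (gradL d).continuous.continuousAt.comp
          ((hQd _ (hqD θ)).fderiv_right (m := r + 1)
            (by rw [add_assoc, one_add_one_eq_two])).continuousAt
      have h3 : ContinuousAt (fun θ => gradient (S.Q ε) (q θ)) θ :=
        ContinuousAt.comp (g := gradient (S.Q ε)) h2 (by fun_prop)
      exact h3.inner h3
    have hkc : Continuous fun θ => invBarrierSeq ε 0 (w θ) :=
      continuous_iff_continuousAt.2 fun θ =>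
        ContinuousAt.comp (g := invBarrierSeq ε 0) (hasDerivAt_invBarrierSeq ε 0 (hwm θ)).continuousAt
          hpc.continuousAt
    have : sp = fun θ => invBarrierSeq ε 0 (w θ) * (z * (G θ)⁻¹) := funext hspeq
    rw [this]
    exact hkc.mul (continuous_const.mul (hGc.inv₀ fun θ => (hG θ).ne'))
  have hseg := hamSeg_of_gauge (V := S.V ε) (P := fun q => q ∈ S.Dt ∧ S.Q ε q < eta r ε)
    (X := fun θ => (q θ, p θ)) (T := fun θ => (X θ).2.1) (m := sp) hspc hsppos ?_ hTd ?_ ?_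
  · refine ⟨hseg.1, ?_, ?_⟩
    · have h2 := hseg.2
      simp only [hqdef, hpdef, hline.init] at h2
      exact h2
    · rw [show (X 1).1.1 = q 1 from rfl, hQ' 1]
      exact congrArg (invBarrier ε) h1
  · intro t ht
    -- The barrier slope at Q is minus the reciprocal of `invBarrierSeq ε 0`, so the force times the
    -- elapsed time per unit θ is exactly z N.
    refine ((hqd t ht).prodMk (hpd t ht)).congr_deriv ?_
    rw [Prod.smul_mk]
    congr 1
    have hpos : 0 < S.Q ε (q (toUnit t)) := by
      rw [hQ']; exact invBarrier_pos hε.1 (hwm _).1 (hwm _).2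
    have hne := (invBarrierSeq_zero_pos hε.1 (hwm (toUnit t))).ne'
    rw [hgrad _ (hXN _) hpos, hQ', deriv_gaussBarrier_invBarrier hε.1 (hwm _), neg_smul, neg_neg,
      hspeq, smul_smul]
    have h2 : N (q (toUnit t)) = (G (toUnit t))⁻¹ • gradient (S.Q ε) (q (toUnit t)) := rfl
    rw [h2, smul_smul]
    congr 1
    field_simp
  · simp only [hline.init, ht]
  · intro θ a b
    refine ⟨hqD θ, ?_⟩
    simp only [hQ']
    exact invBarrier_lt hε.1 hν (hwgt' θ a b) (hw θ)

end Motion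

end SteepSystem

/-! ### The reflection map -/

theorem CNear.congr_right {ι E F : Type} [TopologicalSpace ι] [DiscreteTopology ι]
    [NormedAddCommGroup E] [NormedSpace ℝ E] [NormedAddCommGroup F] [NormedSpace ℝ F] {l : Filter ι}
    {μ : ι → ℝ} {n : ℕ} {x₀ : E} {y₀ : F} {f g g' : ι → E → F} (h : CNear l μ n x₀ y₀ f g)
    (hg : ∀ᶠ p in l ×ˢ 𝓝ˢ {x₀}, g p.1 p.2 = g' p.1 p.2) : CNear l μ n x₀ y₀ f g' :=
  ⟨h.smooth.congr' hg, h.close.congr' (hg.mono fun p hp => by simp only [hp]), h.tendsto.congr' hg,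
    h.small⟩

namespace SteepSystem

variable {d : ℕ} {S : SteepSystem d} {r : ℕ} {q p : Pos d}

/-- The initial state for a reflection which receives the impulse `z.2`. -/
noncomputable def reflInput (r : ℕ) (ε : Eps) (z : Phase d × ℝ) : ReflState d :=
  (z.1, 0, nu r ε + 2⁻¹ * inner ℝ z.1.2 z.1.2, z.2)

/-- The time and the phase point at the end of a reflection. -/
noncomputable def reflOutput (S : SteepSystem d) (ε : Eps) (x : ReflState d) : ℝ × Phase d :=
  (x.2.1, x.1.1, x.1.2 + x.2.2.2 • S.conormal ε x.1.1)

theorem cNear_reflInput (hp : ‖p‖ = 1) :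
    CNear smallEps (fun ε => nu r ε) r ((q, p), -2 * inner ℝ (gradient (S.Q 0) q) p) (S.reflBase q p)
      (reflInput r) (reflInput r) := by
  have hμ : Tendsto (fun ε : Eps => nu r ε) smallEps (𝓝 0) := tendsto_nu
  set z₀ := -2 * inner ℝ (gradient (S.Q 0) q) p
  have h1 : CNear smallEps (fun ε => nu r ε) r ((q, p), z₀) ((q, p), (0 : ℝ), z₀)
      (fun _ (z : Phase d × ℝ) => (z.1, (0 : ℝ), z.2)) fun _ (z : Phase d × ℝ) => (z.1, (0 : ℝ), z.2) :=
    CNear.of_contDiffAt (u := fun z : Phase d × ℝ => (z.1, (0 : ℝ), z.2)) (by fun_prop) hμ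
  have h2 : CNear smallEps (fun ε => nu r ε) r ((q, p), z₀) (2⁻¹ * inner ℝ p p)
      (fun _ (z : Phase d × ℝ) => 2⁻¹ * inner ℝ z.1.2 z.1.2)
      fun _ (z : Phase d × ℝ) => 2⁻¹ * inner ℝ z.1.2 z.1.2 :=
    CNear.of_contDiffAt (u := fun z : Phase d × ℝ => 2⁻¹ * inner ℝ z.1.2 z.1.2) (by
      refine contDiffAt_const.mul ?_
      exact (contDiffAt_fst.snd).inner ℝ (contDiffAt_fst.snd)) hμ
  have h3 := (CNear.const (l := smallEps) (n := r) (a := fun ε : Eps => nu r ε)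
    (b := fun ε : Eps => nu r ε) ((q, p), z₀) (by simpa using isBigO_zero _ _) hμ hμ).add h2
  have h4 := (h1.prodMk h3).map
    (u := fun y : (Phase d × ℝ × ℝ) × ℝ => (y.1.1, y.1.2.1, y.2, y.1.2.2)) (by fun_prop)
  have e₂ : (0 : ℝ) + 2⁻¹ * inner ℝ p p = 1 / 2 := by
    rw [real_inner_self_eq_norm_sq, hp]
    norm_num
  have e : S.reflBase q p = ((q, p), 0, 0 + 2⁻¹ * inner ℝ p p, z₀) := by
    rw [e₂]
    rfl
  rw [e]
  exact h4

theorem Hyp.cNear_reflOutput (h : S.Hyp r) (hw : q ∈ frontier S.D \ S.corner) :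
    CNear smallEps (fun ε => nu r ε) r (S.reflBase q p)
      (0, q, p + (-2 * inner ℝ (gradient (S.Q 0) q) p) • S.conormal 0 q)
      S.reflOutput S.reflOutput := by
  have hμ : Tendsto (fun ε : Eps => nu r ε) smallEps (𝓝 0) := tendsto_nu
  have h1 : CNear smallEps (fun ε => nu r ε) r (S.reflBase q p) (S.reflBase q p)
      (fun _ (x : ReflState d) => x) fun _ (x : ReflState d) => x :=
    CNear.of_contDiffAt (u := fun x : ReflState d => x) (by fun_prop) hμ
  have h0 : CNear smallEps (fun ε => nu r ε) r q (S.conormal 0 q)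
      (fun (ε : Eps) q => S.conormal ε q) fun (ε : Eps) q => S.conormal ε q :=
    CNear.self (h.cBound_conormal hw) (by
      rw [nhdsSet_singleton]
      exact h.tendsto_conormal hw) hμ
  have h2 := h0.comp (h1.fst).fst
  exact (h1.prodMk h2).map (u := fun y : ReflState d × Pos d =>
    (y.1.2.1, y.1.1.1, y.1.1.2 + y.1.2.2.2 • y.2)) (by fun_prop)

/-- The conditions under which the reflection is a motion hold near the limit reflection. -/
theorem Hyp.eventually_reflState (h : S.Hyp r) (hw : q ∈ frontier S.D \ S.corner) (hp : ‖p‖ = 1)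
    (hY : inner ℝ (gradient (S.Q 0) q) p < 0) :
    ∀ᶠ w : (Eps × unitInterval) × ReflState d in (smallEps ×ˢ ⊤) ×ˢ 𝓝ˢ {S.reflBase q p},
      w.2.1.1 ∈ S.N ∧ 0 < inner ℝ (gradient (S.Q w.1.1) w.2.1.1) (gradient (S.Q w.1.1) w.2.1.1) ∧
      0 < w.2.2.2.2 *
          (inner ℝ (gradient (S.Q w.1.1) w.2.1.1) (gradient (S.Q w.1.1) w.2.1.1))⁻¹ +
        S.reflSpeed r w.1 w.2 * inner ℝ (S.reflMom w.1 w.2)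
          (fderiv ℝ (S.conormal w.1.1) w.2.1.1 (S.reflMom w.1 w.2)) ∧
      S.reflHeight w.1 w.2 < 1 := by
  have hDt := h.domain.D_subset (h.wall_subset hw)
  have hG₀ := h.inner_self_pos hw
  have hg := (h.tendsto_inner_self hDt).comp (tendsto_reflState_fst (S := S) (q := q) (p := p))
  have h1 := ((tendsto_snd.comp (tendsto_reflState_fst (S := S) (q := q) (p := p)))).eventually
    (h.domain.open_N.eventually_mem (h.domain.boundary_subset hw))
  have h2 := hg.eventually_const_lt hG₀
  have h3 : ∀ᶠ w : (Eps × unitInterval) × ReflState d in (smallEps ×ˢ ⊤) ×ˢ 𝓝ˢ {S.reflBase q p},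
      S.reflHeight w.1 w.2 < 1 := by
    have := (tendsto_snd.comp (h.tendsto_reflHeight hw hp)).eventually
      (isOpen_Iio.mem_nhdsSet.2 (fun x (hx : x ∈ Icc (0 : ℝ) (1 / 2)) => by
        have := hx.2
        rw [mem_Iio]; linarith : Icc (0 : ℝ) (1 / 2) ⊆ Iio 1))
    exact this
  have hz : Tendsto (fun w : (Eps × unitInterval) × ReflState d => w.2.2.2.2)
      ((smallEps ×ˢ ⊤) ×ˢ 𝓝 (S.reflBase q p)) (𝓝 (-2 * inner ℝ (gradient (S.Q 0) q) p)) := by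
    have hc : Continuous fun x : ReflState d => x.2.2.2 := by fun_prop
    have h0 := hc.tendsto (S.reflBase q p)
    exact h0.comp tendsto_snd
  have hm := h.cBound_reflMom (p := p) hw
  have hs := (h.cBound_reflSpeed hw hp).smul_left (hm.1.pred.bilin_right (innerSL ℝ)
    (hm.2.2.2.1.bilin_right (ContinuousLinearMap.id ℝ (Pos d →L[ℝ] Pos d)) hm.1.pred))
  have hs0 := hs.tendsto_zero (tendsto_nu.comp tendsto_fst)
  rw [nhdsSet_singleton] at hs0
  -- The impulse term tends to the positive number -2Y/G, while the curvature term carries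
  -- `reflSpeed` and tends to zero.
  have h4 := ((hz.mul (hg.inv₀ hG₀.ne')).add hs0).eventually_const_lt (u := 0) (by
    rw [add_zero]
    exact mul_pos (by linarith) (inv_pos.2 hG₀))
  rw [nhdsSet_singleton] at h3 ⊢
  filter_upwards [h1, h2, h3, h4] with w a1 a2 a3 a4
  exact ⟨a1, a2, a4, a3⟩

/-- The change of the square of the momentum by the impulse `z.2` of a hard wall. -/
noncomputable def reflBalance (S : SteepSystem d) (ε : Eps) (z : Phase d × ℝ) : ℝ :=
  inner ℝ (z.1.2 + z.2 • S.conormal ε z.1.1) (z.1.2 + z.2 • S.conormal ε z.1.1) + -inner ℝ z.1.2 z.1.2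

/-- As a function of the impulse t the balance is 2t⟨p, N⟩ + t²|N|². The elastic impulse -2Y is a
root with derivative -2Y/G, hence a simple one exactly when the collision is not tangent. -/
theorem Hyp.tendsto_fderiv_balance (h : S.Hyp r) (hw : q ∈ frontier S.D \ S.corner)
    (hd : ∀ᶠ w in smallEps ×ˢ 𝓝ˢ {((q, p), -2 * inner ℝ (gradient (S.Q 0) q) p)},
      DifferentiableAt ℝ (S.reflBalance w.1) w.2) :
    Tendsto (fun w : Eps × (Phase d × ℝ) => fderiv ℝ (S.reflBalance w.1) w.2 (0, 1))
      (smallEps ×ˢ 𝓝ˢ {((q, p), -2 * inner ℝ (gradient (S.Q 0) q) p)})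
      (𝓝 ((inner ℝ (gradient (S.Q 0) q) (gradient (S.Q 0) q))⁻¹ *
        (-2 * inner ℝ (gradient (S.Q 0) q) p))) := by
  set z₀ := -2 * inner ℝ (gradient (S.Q 0) q) p with hz₀
  rw [nhdsSet_singleton] at hd ⊢
  have hq : Tendsto (fun w : Eps × (Phase d × ℝ) => (w.1, w.2.1.1)) (smallEps ×ˢ 𝓝 ((q, p), z₀))
      (smallEps ×ˢ 𝓝 q) := by
    have hc : Continuous fun x : Phase d × ℝ => x.1.1 := by fun_prop
    exact tendsto_fst.prodMk ((hc.tendsto ((q, p), z₀)).comp tendsto_snd)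
  have hp : Tendsto (fun w : Eps × (Phase d × ℝ) => w.2.1.2) (smallEps ×ˢ 𝓝 ((q, p), z₀)) (𝓝 p) := by
    have hc : Continuous fun x : Phase d × ℝ => x.1.2 := by fun_prop
    exact (hc.tendsto ((q, p), z₀)).comp tendsto_snd
  have ht : Tendsto (fun w : Eps × (Phase d × ℝ) => w.2.2) (smallEps ×ˢ 𝓝 ((q, p), z₀)) (𝓝 z₀) := by
    have hc : Continuous fun x : Phase d × ℝ => x.2 := by fun_prop
    exact (hc.tendsto ((q, p), z₀)).comp tendsto_snd
  have hN := (h.tendsto_conormal hw).comp hq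
  have hlim := (((hp.inner hN).const_mul 2).add ((ht.mul (hN.inner hN)).const_mul 2))
  have e : 2 * inner ℝ p (S.conormal 0 q) + 2 * (z₀ * inner ℝ (S.conormal 0 q) (S.conormal 0 q)) =
      (inner ℝ (gradient (S.Q 0) q) (gradient (S.Q 0) q))⁻¹ * z₀ := by
    rw [inner_conormal, inner_conormal_self, hz₀]
    ring
  rw [e] at hlim
  refine hlim.congr' ?_
  filter_upwards [hd] with w hw
  obtain ⟨ε, ρ, t⟩ := w
  refine (fderiv_apply_zero_one hw ?_).symm
  have h1 : (fun s => S.reflBalance ε (ρ, s)) = fun s => (inner ℝ ρ.2 ρ.2 + 2 * s * inner ℝ ρ.2 (S.conormal ε ρ.1) +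
      s ^ 2 * inner ℝ (S.conormal ε ρ.1) (S.conormal ε ρ.1)) + -inner ℝ ρ.2 ρ.2 := by
    funext s
    rw [reflBalance, inner_add_smul_self]
  rw [h1]
  have h2 : HasDerivAt (fun s : ℝ => inner ℝ ρ.2 ρ.2 + 2 * s * inner ℝ ρ.2 (S.conormal ε ρ.1) +
      s ^ 2 * inner ℝ (S.conormal ε ρ.1) (S.conormal ε ρ.1)) (2 * inner ℝ ρ.2 (S.conormal ε ρ.1) +
      2 * t * inner ℝ (S.conormal ε ρ.1) (S.conormal ε ρ.1)) t := by
    have h3 := (((hasDerivAt_id t).const_mul 2).mul_const (inner ℝ ρ.2 (S.conormal ε ρ.1))).const_add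
      (inner ℝ ρ.2 ρ.2)
    have h4 := (hasDerivAt_pow 2 t).mul_const (inner ℝ (S.conormal ε ρ.1) (S.conormal ε ρ.1))
    refine (h3.add h4).congr_deriv ?_
    simp
  refine (h2.add_const _).congr_deriv ?_
  simp only [Function.comp_apply]
  ring

/-- The balance is quadratic in the impulse, with roots 0 and the elastic one; positivity excludes
0. -/
theorem reflect_of_balance {ε t : ℝ} {q p : Pos d}
    (hG : 0 < inner ℝ (gradient (S.Q ε) q) (gradient (S.Q ε) q)) (ht : 0 < t)
    (hb : inner ℝ (p + t • S.conormal ε q) (p + t • S.conormal ε q) + -inner ℝ p p = (0 : ℝ)) :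
    p + t • S.conormal ε q = reflect (S.normal ε q) p := by
  rw [inner_add_smul_self, inner_conormal, inner_conormal_self] at hb
  have h1 : (t * (inner ℝ (gradient (S.Q ε) q) (gradient (S.Q ε) q))⁻¹) *
      (t + 2 * inner ℝ (gradient (S.Q ε) q) p) = 0 := by linear_combination hb
  have h2 := (mul_eq_zero.1 h1).resolve_left (mul_pos ht (inv_pos.2 hG)).ne'
  rw [reflect_normal, show t = -2 * inner ℝ (gradient (S.Q ε) q) p by linarith]

/-- The reflection at the barrier is close to the elastic reflection. -/
theorem Hyp.exists_reflection (h : S.Hyp r) (hw : q ∈ frontier S.D \ S.corner) (hp : ‖p‖ = 1)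
    (hY : inner ℝ (gradient (S.Q 0) q) p < 0) :
    ∃ R : Eps → Phase d → ℝ × Phase d,
      CNear smallEps (fun ε => nu r ε) r (q, p) (0, (q, reflect (S.normal 0 q) p)) R
        (fun ε ρ => (0, (ρ.1, reflect (S.normal ε ρ.1) ρ.2))) ∧
      ∀ᶠ w : Eps × Phase d in smallEps ×ˢ 𝓝ˢ {(q, p)}, S.Q w.1 w.2.1 = eta r w.1 →
        0 < (R w.1 w.2).1 ∧
        HamSeg (S.V w.1) (fun q => q ∈ S.Dt ∧ S.Q w.1 q < eta r w.1) w.2 (R w.1 w.2).1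
          (R w.1 w.2).2 ∧
        (R w.1 w.2).2.1 ∈ S.Dt ∧ S.Q w.1 (R w.1 w.2).2.1 = eta r w.1 := by
  obtain ⟨n, rfl⟩ : ∃ n, r = n + 1 := ⟨r - 1, by have := h.one_le; omega⟩
  have hμ : Tendsto (fun ε : Eps => nu (n + 1) ε) smallEps (𝓝 0) := tendsto_nu
  have hDt := h.domain.D_subset (h.wall_subset hw)
  set Y₀ := inner ℝ (gradient (S.Q 0) q) p with hY₀
  have hG₀ := h.inner_self_pos hw
  obtain ⟨Φ, hΦ, hΦC⟩ := exists_smallFlow n isCompact_singleton hμ (h.cBound_reflField hw hp)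
  have hΦ1 : CNear smallEps (fun ε => nu (n + 1) ε) (n + 1) (S.reflBase q p) (S.reflBase q p)
      (fun ε => Φ (ε, 1)) fun _ x => x := by
    refine ⟨CBound.id isCompact_singleton, hΦC.reindex (j := fun ε => (ε, (1 : unitInterval)))
      (by fun_prop) (tendsto_id.prodMk tendsto_top), ?_, hμ⟩
    rw [nhdsSet_singleton]
    exact tendsto_snd
  have hin := cNear_reflInput (S := S) (r := n + 1) (q := q) hp
  have hEnd := (h.cNear_reflOutput (p := p) hw).comp (hΦ1.comp hin)
  have hbase : inner ℝ (p + (-2 * Y₀) • S.conormal 0 q) (p + (-2 * Y₀) • S.conormal 0 q) +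
      -inner ℝ p p = (0 : ℝ) := by
    rw [inner_add_smul_self, inner_conormal, inner_conormal_self]
    ring
  have hmomI : CNear smallEps (fun ε => nu (n + 1) ε) (n + 1) ((q, p), -2 * Y₀) (-inner ℝ p p)
      (fun _ (z : Phase d × ℝ) => -inner ℝ z.1.2 z.1.2) fun _ (z : Phase d × ℝ) =>
        -inner ℝ z.1.2 z.1.2 :=
    CNear.of_contDiffAt (u := fun z : Phase d × ℝ => -inner ℝ z.1.2 z.1.2)
      ((contDiffAt_fst.snd).inner ℝ (contDiffAt_fst.snd)).neg hμ
  -- The unknown is the impulse. The state is started with total energy ν + |p|²/2, so equal squared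
  -- momenta at both ends mean that the potential energy is back at ν, that is, at the level η.
  have hΓ := (hEnd.snd.snd.map (u := fun v : Pos d => inner ℝ v v)
    (contDiffAt_id.inner ℝ contDiffAt_id)).add hmomI
  simp only [] at hΓ
  rw [hbase] at hΓ
  have hΓ' := hΓ.congr_right (g' := S.reflBalance) (Eventually.of_forall fun _ => rfl)
  obtain ⟨τ, τ', hτ, hz, hz'⟩ := hΓ'.exists_implicit
    (mul_pos (inv_pos.2 hG₀) (by linarith : 0 < -2 * Y₀))
    (h.tendsto_fderiv_balance hw hΓ'.smooth.differentiableAt)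
  have hid : CNear smallEps (fun ε => nu (n + 1) ε) (n + 1) (q, p) (q, p)
      (fun _ (ρ : Phase d) => ρ) fun _ (ρ : Phase d) => ρ :=
    CNear.of_contDiffAt (u := fun ρ : Phase d => ρ) (by fun_prop) hμ
  have hg := hid.prodMk hτ
  refine ⟨fun ε ρ => S.reflOutput ε (Φ (ε, 1) (reflInput (n + 1) ε (ρ, τ ε ρ))), ?_, ?_⟩
  · rw [reflect_normal]
    refine (hEnd.comp hg).congr_right ?_
    have h1 : ∀ᶠ w : Eps × Phase d in smallEps ×ˢ 𝓝ˢ {(q, p)},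
        0 < inner ℝ (gradient (S.Q w.1) w.2.1) (gradient (S.Q w.1) w.2.1) := by
      rw [nhdsSet_singleton]
      exact ((h.tendsto_inner_self hDt).comp (tendsto_fst.prodMk
        ((continuous_fst.tendsto (q, p)).comp tendsto_snd))).eventually_const_lt hG₀
    filter_upwards [h1, hz', hτ.tendsto.eventually_const_lt (by linarith : 0 < -2 * Y₀)] with w g1 g2 g3
    obtain ⟨ε, ρ⟩ := w
    dsimp only at g1 g2 g3 ⊢
    exact congrArg (fun v => ((0 : ℝ), ρ.1, v)) (reflect_of_balance g1 g3 g2)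
  · have hx := (hin.comp hg).tendsto_graph_left
    filter_upwards [hx.eventually (hΦ.and (smallFlow_mem hΦC hμ (h.eventually_reflState hw hp hY))),
      hz, hτ.tendsto_left.eventually_const_lt (by linarith : 0 < -2 * Y₀),
      ((eventually_smallEps_mem (n + 1) one_pos).and
        (h.eventually_gradient_V.and (eventually_smallEps h.contDiffAt_Q))).prod_inl _]
      with w hc hz hpos hi hstart
    obtain ⟨ε, ρ⟩ := w
    obtain ⟨hline, hmem⟩ := hc
    obtain ⟨⟨hε, -⟩, hgrad, hQd⟩ := hi
    dsimp only at hline hmem hε hgrad hQd hz hpos hstart ⊢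
    set x := reflInput (n + 1) ε (ρ, τ ε ρ) with hxdef
    have he : (Φ (ε, 1) x).2.2.1 = x.2.2.1 := hline.eq_const
      ((ContinuousLinearMap.fst ℝ ℝ ℝ).comp ((ContinuousLinearMap.snd ℝ ℝ (ℝ × ℝ)).comp
        (ContinuousLinearMap.snd ℝ (Phase d) (ℝ × ℝ × ℝ)))) (fun _ _ => rfl) 1
    have hm0 : S.reflMom (ε, 0) x = ρ.2 := by
      simp [reflMom, hxdef, reflInput]
    have hm1 : S.reflMom (ε, 1) (Φ (ε, 1) x) = (S.reflOutput ε (Φ (ε, 1) x)).2.2 := by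
      simp [reflMom, reflOutput]
    have hmot := reflection_motion hε hline hQd hgrad h.domain.N_subset (fun θ => (hmem θ).1) hpos
      (fun θ => (hmem θ).2.1) (fun θ => (hmem θ).2.2.1) (fun θ => (hmem θ).2.2.2) rfl ?_ ?_ hstart
    · rw [hm0, hm1] at hmot
      exact ⟨hmot.1, hmot.2.1, h.domain.N_subset (hmem 1).1, hmot.2.2⟩
    · rw [reflHeight, hm0]
      simp [hxdef, reflInput]
    · rw [reflHeight, hm1, he]
      have : inner ℝ (S.reflOutput ε (Φ (ε, 1) x)).2.2 (S.reflOutput ε (Φ (ε, 1) x)).2.2 +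
        -inner ℝ ρ.2 ρ.2 = (0 : ℝ) := hz
      have h2 : x.2.2.1 = nu (n + 1) ε + 2⁻¹ * inner ℝ ρ.2 ρ.2 := rfl
      rw [h2]
      linarith

end SteepSystem

/-! ### Composition of timed maps -/

section Timed

variable {ι E F G : Type} [TopologicalSpace ι] [NormedAddCommGroup E] [NormedSpace ℝ E]
  [NormedAddCommGroup F] [NormedSpace ℝ F] [NormedAddCommGroup G] [NormedSpace ℝ G]
  {l : Filter ι} {μ : ι → ℝ} {n : ℕ}

/-- The motion `A` followed by the motion `B`, with the total duration. -/
def timeComp (A : E → ℝ × F) (B : F → ℝ × G) (x : E) : ℝ × G :=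
  ((A x).1 + (B (A x).2).1, (B (A x).2).2)

theorem CNear.timeComp {x₀ : E} {y₀ : F} {z₀ : G} {a b : ℝ} {A A' : ι → E → ℝ × F}
    {B B' : ι → F → ℝ × G} (hA : CNear l μ n x₀ (a, y₀) A A') (hB : CNear l μ n y₀ (b, z₀) B B') :
    CNear l μ n x₀ (a + b, z₀) (fun i => timeComp (A i) (B i)) fun i => timeComp (A' i) (B' i) :=
  (hA.fst.add (hB.comp hA.snd).fst).prodMk (hB.comp hA.snd).snd

theorem CNear.id (x₀ : E) (hμ : Tendsto μ l (𝓝 0)) :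
    CNear l μ n x₀ x₀ (fun _ x => x) fun _ x => x :=
  CNear.of_contDiffAt (u := fun x : E => x) (by fun_prop) hμ

end Timed

namespace SteepSystem

variable {d : ℕ} {S : SteepSystem d} {r : ℕ}

theorem inner_normal (S : SteepSystem d) (ε : ℝ) (q p : Pos d) :
    inner ℝ p (S.normal ε q) = ‖gradient (S.Q ε) q‖⁻¹ * fderiv ℝ (S.Q ε) q p := by
  rw [SteepSystem.normal, inner_smul_right, real_inner_comm, inner_gradient]

theorem norm_gradient_pos {ε : ℝ} {q p : Pos d} (h : fderiv ℝ (S.Q ε) q p ≠ 0) :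
    0 < ‖gradient (S.Q ε) q‖ := by
  refine norm_pos_iff.2 fun h0 => h ?_
  rw [← inner_gradient, h0, inner_zero_left]

theorem inner_normal_pos {ε : ℝ} {q p : Pos d} :
    0 < inner ℝ p (S.normal ε q) ↔ 0 < fderiv ℝ (S.Q ε) q p := by
  rw [inner_normal]
  refine ⟨fun h => ?_, fun h => mul_pos (inv_pos.2 (norm_gradient_pos h.ne')) h⟩
  exact pos_of_mul_pos_right h (inv_nonneg.2 (norm_nonneg _))

theorem inner_normal_neg {ε : ℝ} {q p : Pos d} :
    inner ℝ p (S.normal ε q) < 0 ↔ fderiv ℝ (S.Q ε) q p < 0 := by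
  have := inner_normal_pos (S := S) (ε := ε) (q := q) (p := -p)
  simpa using this

theorem Hyp.fderiv_reflect (h : S.Hyp r) {q p : Pos d} (hw : q ∈ frontier S.D \ S.corner) :
    inner ℝ (gradient (S.Q 0) q) (reflect (S.normal 0 q) p) = -inner ℝ (gradient (S.Q 0) q) p := by
  have hG := (h.inner_self_pos hw).ne'
  rw [reflect_normal, inner_add_right, inner_smul_right, conormal, inner_smul_right,
    inv_mul_cancel₀ hG]
  ring

theorem norm_reflect_normal (S : SteepSystem d) (ε : ℝ) (q p : Pos d) :
    ‖reflect (S.normal ε q) p‖ = ‖p‖ := by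
  have h1 : inner ℝ (reflect (S.normal ε q) p) (reflect (S.normal ε q) p) = inner ℝ p p := by
    rw [reflect_normal, inner_add_smul_self, inner_conormal, inner_conormal_self]
    ring
  rw [real_inner_self_eq_norm_sq, real_inner_self_eq_norm_sq] at h1
  exact (pow_left_inj₀ (norm_nonneg _) (norm_nonneg _) two_ne_zero).1 h1

/-- The sign of the normal velocity near the limit. -/
theorem Hyp.eventually_fderiv_pos (h : S.Hyp r) {E : Type} [NormedAddCommGroup E] [NormedSpace ℝ E]
    {x₀ : E} {q p : Pos d} (hq : q ∈ S.Dt) (hY : 0 < inner ℝ (gradient (S.Q 0) q) p)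
    {A : Eps → E → Phase d}
    (hA : Tendsto (fun w : Eps × E => A w.1 w.2) (smallEps ×ˢ 𝓝ˢ {x₀}) (𝓝 (q, p))) :
    ∀ᶠ w : Eps × E in smallEps ×ˢ 𝓝ˢ {x₀},
      0 < fderiv ℝ (S.Q w.1) (A w.1 w.2).1 (A w.1 w.2).2 :=
  ((h.tendsto_inner hq).comp (tendsto_fst.prodMk hA)).eventually_const_lt hY

theorem Hyp.eventually_fderiv_neg (h : S.Hyp r) {E : Type} [NormedAddCommGroup E] [NormedSpace ℝ E]
    {x₀ : E} {q p : Pos d} (hq : q ∈ S.Dt) (hY : inner ℝ (gradient (S.Q 0) q) p < 0)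
    {A : Eps → E → Phase d}
    (hA : Tendsto (fun w : Eps × E => A w.1 w.2) (smallEps ×ˢ 𝓝ˢ {x₀}) (𝓝 (q, p))) :
    ∀ᶠ w : Eps × E in smallEps ×ˢ 𝓝ˢ {x₀},
      fderiv ℝ (S.Q w.1) (A w.1 w.2).1 (A w.1 w.2).2 < 0 :=
  ((h.tendsto_inner hq).comp (tendsto_fst.prodMk hA)).eventually_lt_const hY

theorem cNear_leg {q p : Pos d} {τ₀ : ℝ} {φ : Eps → ℝ × Phase d → Phase d} {s : ℝ}
    (hs : s ∈ Icc 0 τ₀)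
    (hφ : CBound smallEps (Icc 0 τ₀ ×ˢ {(q, p)}) (fun ε => nu r ε) r
      (fun ε z => φ ε z - freeFlight z)) :
    CNear smallEps (fun ε => nu r ε) r (s, (q, p)) (q + s • p, p) φ fun _ => freeFlight :=
  ⟨CBound.of_contDiffAt_const isCompact_singleton fun _ _ => contDiff_freeFlight.contDiffAt,
    hφ.mono le_rfl (by rintro _ rfl; exact ⟨hs, rfl⟩), by
      rw [nhdsSet_singleton]
      exact ((contDiff_freeFlight (n := 0)).continuous.tendsto (s, (q, p))).comp tendsto_snd,
    tendsto_nu⟩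

/-- A flight up to the boundary layer, and up to the auxiliary wall. -/
theorem Hyp.exists_flight (h : S.Hyp r) {q p : Pos d} {τ₀ : ℝ} (hl : S.RefLeg q p τ₀)
    (hw : q + τ₀ • p ∈ frontier S.D \ S.corner)
    (hY : inner ℝ (gradient (S.Q 0) (q + τ₀ • p)) p < 0) :
    ∃ (φ : Eps → ℝ × Phase d → Phase d) (τ τ' : Eps → Phase d → ℝ),
      CBound smallEps (Icc 0 τ₀ ×ˢ {(q, p)}) (fun ε => nu r ε) r (fun ε z => φ ε z - freeFlight z) ∧
      CNear smallEps (fun ε => nu r ε) r (q, p) (τ₀, (q + τ₀ • p, p))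
        (fun ε ρ => (τ ε ρ, φ ε (τ ε ρ, ρ))) (fun ε ρ => (τ' ε ρ, freeFlight (τ' ε ρ, ρ))) ∧
      (∀ᶠ w : Eps × Phase d in smallEps ×ˢ 𝓝ˢ {(q, p)}, wid r w.1 ≤ S.Q w.1 w.2.1 →
        0 < τ w.1 w.2 ∧
        (∀ σ ∈ Icc 0 (τ w.1 w.2), HamSeg (S.V w.1) (fun q => q ∈ S.Dt ∧ wid r w.1 < S.Q w.1 q)
          w.2 σ (φ w.1 (σ, w.2))) ∧
        (φ w.1 (τ w.1 w.2, w.2)).1 ∈ S.Dt ∧ S.Q w.1 (φ w.1 (τ w.1 w.2, w.2)).1 = wid r w.1) ∧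
      ∀ᶠ w : Eps × Phase d in smallEps ×ˢ 𝓝ˢ {(q, p)}, eta r w.1 ≤ S.Q w.1 w.2.1 →
        0 < τ' w.1 w.2 ∧
        (∀ σ ∈ Ioo 0 (τ' w.1 w.2), w.2.1 + σ • w.2.2 ∈ (S.auxTable w.1 (eta r w.1)).inside) ∧
        w.2.1 + τ' w.1 w.2 • w.2.2 ∈ (S.auxTable w.1 (eta r w.1)).wall ∧
        inner ℝ w.2.2 (S.normal w.1 (w.2.1 + τ' w.1 w.2 • w.2.2)) < 0 := by
  have hμ : Tendsto (fun ε : Eps => nu r ε) smallEps (𝓝 0) := tendsto_nu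
  have hDt := h.domain.D_subset (h.wall_subset hw)
  obtain ⟨φ, hφ, hleg⟩ := h.exists_leg hl
  obtain ⟨τ, τ', hτ, hQ, hQ'⟩ := h.exists_hit hl.pos.le hw hY hφ
  have hg := hτ.prodMk (CNear.id (n := r) (q, p) hμ)
  have hH := hτ.prodMk ((cNear_leg (right_mem_Icc.2 hl.pos.le) hφ).comp hg)
  refine ⟨φ, τ, τ', hφ, hH, ?_, ?_⟩
  · rw [← nhdsSet_singleton] at hleg
    have hD := (((continuous_fst.tendsto _).comp hH.snd.tendsto_left)).eventually
      (h.domain.open_Dt.eventually_mem hDt)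
    filter_upwards [hg.tendsto_graph_left.eventually hleg, hQ,
      hτ.tendsto_left.eventually_const_lt hl.pos, hD] with w h1 h2 h3 h4 hs
    exact ⟨h3, h1 hs h2.ge, h4, h2⟩
  · have hleg' := h.leg_free hl
    rw [← nhdsSet_singleton] at hleg'
    have hD := (((continuous_fst.tendsto _).comp hH.snd.tendsto)).eventually
      (h.domain.open_Dt.eventually_mem hDt)
    filter_upwards [hg.tendsto_graph.eventually hleg', hQ',
      hτ.tendsto.eventually_const_lt hl.pos, hD,
      h.eventually_fderiv_neg hDt hY (A := fun ε ρ => freeFlight (τ' ε ρ, ρ)) hH.snd.tendsto] with w h1 h2 h3 h4 h5 hs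
    exact ⟨h3, h1 hs h2.ge, ⟨h4, h2⟩, inner_normal_neg.2 h5⟩

theorem Hyp.exists_layer_out (h : S.Hyp r) {q p : Pos d} (hw : q ∈ frontier S.D \ S.corner)
    (hY : 0 < inner ℝ (gradient (S.Q 0) q) p) :
    ∃ L : Eps → Phase d → ℝ × Phase d,
      CNear smallEps (fun ε => nu r ε) r (q, p) (0, (q, p)) L (fun _ ρ => (0, ρ)) ∧
      ∀ᶠ w : Eps × Phase d in smallEps ×ˢ 𝓝ˢ {(q, p)}, S.Q w.1 w.2.1 = eta r w.1 →
        0 < (L w.1 w.2).1 ∧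
        HamSeg (S.V w.1) (fun q => q ∈ S.Dt ∧ eta r w.1 < S.Q w.1 q) w.2 (L w.1 w.2).1 (L w.1 w.2).2 ∧
        (L w.1 w.2).2.1 ∈ S.Dt ∧ S.Q w.1 (L w.1 w.2).2.1 = wid r w.1 := by
  refine h.exists_layer hw hY.ne' ?_ (eta_isBigO_nu h.one_le) (wid_isBigO_nu h.one_le)
  filter_upwards [eventually_smallEps_mem r one_pos] with ε hε
  have h1 := eta_lt_wid (r := r) hε.1
  have h2 := eta_pos (r := r) hε.1
  exact ⟨le_rfl, by linarith, mul_pos (by linarith) hY⟩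

theorem Hyp.exists_layer_in (h : S.Hyp r) {q p : Pos d} (hw : q ∈ frontier S.D \ S.corner)
    (hY : inner ℝ (gradient (S.Q 0) q) p < 0) :
    ∃ L : Eps → Phase d → ℝ × Phase d,
      CNear smallEps (fun ε => nu r ε) r (q, p) (0, (q, p)) L (fun _ ρ => (0, ρ)) ∧
      ∀ᶠ w : Eps × Phase d in smallEps ×ˢ 𝓝ˢ {(q, p)}, S.Q w.1 w.2.1 = wid r w.1 →
        0 < (L w.1 w.2).1 ∧
        HamSeg (S.V w.1) (fun q => q ∈ S.Dt ∧ eta r w.1 < S.Q w.1 q) w.2 (L w.1 w.2).1 (L w.1 w.2).2 ∧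
        (L w.1 w.2).2.1 ∈ S.Dt ∧ S.Q w.1 (L w.1 w.2).2.1 = eta r w.1 := by
  refine h.exists_layer hw hY.ne ?_ (wid_isBigO_nu h.one_le) (eta_isBigO_nu h.one_le)
  filter_upwards [eventually_smallEps_mem r one_pos] with ε hε
  have h1 := eta_lt_wid (r := r) hε.1
  have h2 := eta_pos (r := r) hε.1
  exact ⟨by linarith, le_rfl, mul_pos_of_neg_of_neg (by linarith) hY⟩

end SteepSystem

/-! ### The Poincaré map -/

theorem CBound.exists_bound {ι E F : Type} [TopologicalSpace ι] [NormedAddCommGroup E]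
    [NormedSpace ℝ E] [NormedAddCommGroup F] [NormedSpace ℝ F] {l : Filter ι} {K : Set E}
    {μ : ι → ℝ} {n : ℕ} {f : ι → E → F} (h : CBound l K μ n f) (hμ : ∀ᶠ i in l, 0 ≤ μ i) :
    ∃ C, ∀ᶠ p in l ×ˢ 𝓝ˢ K, ∀ m ≤ n, ‖iteratedFDeriv ℝ m (f p.1) p.2‖ ≤ C * μ p.1 := by
  choose! c hc using fun m (hm : m ≤ n) => (h.iteratedFDeriv_isBigO hm).bound
  refine ⟨∑ m ∈ Finset.range (n + 1), |c m|, ?_⟩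
  have h1 : ∀ᶠ p in l ×ˢ 𝓝ˢ K, ∀ m ∈ Finset.range (n + 1),
      ‖iteratedFDeriv ℝ m (f p.1) p.2‖ ≤ c m * ‖μ p.1‖ :=
    (Filter.eventually_all_finset _).2 fun m hm => hc m (by
      have := Finset.mem_range.1 hm
      omega)
  filter_upwards [h1, hμ.prod_inl _] with p hp hμ m hm
  have hm' : m ∈ Finset.range (n + 1) := Finset.mem_range.2 (by omega)
  refine (hp m hm').trans ?_
  rw [Real.norm_of_nonneg hμ]
  refine mul_le_mul_of_nonneg_right ((le_abs_self _).trans ?_) hμ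
  exact Finset.single_le_sum (f := fun m => |c m|) (fun _ _ => abs_nonneg _) hm'

theorem eventually_nu_nonneg (r : ℕ) : ∀ᶠ ε : Eps in smallEps, 0 ≤ nu r ε := by
  filter_upwards [SteepSystem.eventually_smallEps_mem r one_pos] with ε hε
  exact (nu_pos hε.1).le

namespace SteepSystem

variable {d : ℕ} {S : SteepSystem d} {r : ℕ}

/-- The smooth return map is layer, flight, layer, reflection. In the comparison the two layers are
replaced by identities, the flight by the free flight up to Q = η, and the last part by the elastic
law. The signs of the normal velocity at both crossings come from those of the limit. -/
theorem Hyp.poincare_close (h : S.Hyp r) {ρ₀ ρ₁ : Phase d} (hp : ‖ρ₀.2‖ = 1)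
    (hρ : IsBilliardImage S.table ρ₀ ρ₁) :
    ∃ (U : Set (Phase d)) (C : ℝ) (Φ B : ℝ → Phase d → Phase d),
      IsOpen U ∧ ρ₀ ∈ U ∧
      ∀ᶠ ε in 𝓝[>] (0 : ℝ),
        (∀ ρ ∈ U ∩ crossSection (S.auxTable ε (eta r ε)),
          S.IsPoincareImage ε (eta r ε) ρ (Φ ε ρ) ∧
          IsBilliardImage (S.auxTable ε (eta r ε)) ρ (B ε ρ)) ∧
        ContDiffOn ℝ r (Φ ε) U ∧ ContDiffOn ℝ r (B ε) U ∧
        ∀ l ≤ r, ∀ ρ ∈ U,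
          ‖iteratedFDeriv ℝ l (fun ρ' => Φ ε ρ' - B ε ρ') ρ‖ ≤ C * nu r ε := by
  obtain ⟨q, p⟩ := ρ₀
  obtain ⟨⟨hw₀, hY₀⟩, τ₀, hτ₀, hin, hend, hw₁, hY₁, -⟩ := hρ
  rw [hend] at hw₁ hY₁
  have hY₀' : 0 < inner ℝ (gradient (S.Q 0) q) p := by
    rw [inner_gradient]; exact inner_normal_pos.1 hY₀
  have hY₁' : inner ℝ (gradient (S.Q 0) (q + τ₀ • p)) p < 0 := by
    rw [inner_gradient]; exact inner_normal_neg.1 hY₁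
  have hl : S.RefLeg q p τ₀ := ⟨hτ₀, hin, Or.inr ⟨hw₀, hY₀'⟩, Or.inr ⟨hw₁, hY₁'⟩⟩
  have hD₁ := h.domain.D_subset (h.wall_subset hw₁)
  obtain ⟨L₀, hL₀, mL₀⟩ := h.exists_layer_out hw₀ hY₀'
  obtain ⟨φ, τ, τ', -, hF, mF, mF'⟩ := h.exists_flight hl hw₁ hY₁'
  obtain ⟨L₁, hL₁, mL₁⟩ := h.exists_layer_in hw₁ hY₁'
  obtain ⟨R, hR, mR⟩ := h.exists_reflection hw₁ hp hY₁'
  set F : Eps → Phase d → ℝ × Phase d := fun ε ρ => (τ ε ρ, φ ε (τ ε ρ, ρ)) with hFdef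
  set F' : Eps → Phase d → ℝ × Phase d := fun ε ρ => (τ' ε ρ, freeFlight (τ' ε ρ, ρ)) with hFdef'
  have hA := hL₀.timeComp hF
  have hA₂ := hA.timeComp hL₁
  have hΦ := (hR.comp hA₂.snd).snd
  set A : Eps → Phase d → ℝ × Phase d := fun ε => timeComp (L₀ ε) (F ε) with hAdef
  set A₂ : Eps → Phase d → ℝ × Phase d := fun ε => timeComp (A ε) (L₁ ε) with hA₂def
  set Φ : Eps → Phase d → Phase d := fun ε ρ => (R ε (A₂ ε ρ).2).2 with hΦdef
  set B : Eps → Phase d → Phase d := fun ε ρ =>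
    ((F' ε ρ).2.1, reflect (S.normal ε (F' ε ρ).2.1) (F' ε ρ).2.2) with hBdef
  have hΦB : CNear smallEps (fun ε => nu r ε) r (q, p) _ Φ B := hΦ
  obtain ⟨C, hC⟩ := hΦB.close.exists_bound (eventually_nu_nonneg r)
  have hY₂ : 0 < inner ℝ (gradient (S.Q 0) (q + τ₀ • p)) (reflect (S.normal 0 (q + τ₀ • p)) p) := by
    rw [h.fderiv_reflect hw₁]; linarith
  have hall : ∀ᶠ w : Eps × Phase d in smallEps ×ˢ 𝓝ˢ {(q, p)},
      (w.2 ∈ crossSection (S.auxTable w.1 (eta r w.1)) →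
        S.IsPoincareImage w.1 (eta r w.1) w.2 (Φ w.1 w.2) ∧
        IsBilliardImage (S.auxTable w.1 (eta r w.1)) w.2 (B w.1 w.2)) ∧
      ContDiffAt ℝ r (Φ w.1) w.2 ∧ ContDiffAt ℝ r (B w.1) w.2 ∧
      ∀ l ≤ r, ‖iteratedFDeriv ℝ l (fun ρ' => Φ w.1 ρ' - B w.1 ρ') w.2‖ ≤ C * nu r w.1 := by
    filter_upwards [hC, hΦB.left.contDiffAt, hΦB.smooth.pred.contDiffAt, mL₀,
      hL₀.snd.tendsto_graph_left.eventually mF, mF', hA.snd.tendsto_graph_left.eventually mL₁,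
      hA₂.snd.tendsto_graph_left.eventually mR,
      h.eventually_fderiv_neg hD₁ hY₁' (A := fun ε ρ => (A₂ ε ρ).2) hA₂.snd.tendsto_left,
      h.eventually_fderiv_pos hD₁ hY₂ (A := Φ) hΦB.tendsto_left,
      (eventually_smallEps_mem r one_pos).prod_inl _]
      with w c1 c2 c3 m1 m2 m2' m3 m4 s1 s2 hε
    obtain ⟨ε, ρ⟩ := w
    refine ⟨fun hρ => ?_, c2, c3, c1⟩
    have hlt := eta_lt_wid (r := r) hε.1
    have hpos := eta_pos (r := r) hε.1
    have hlt' : eta r ε < wid r ε := by dsimp only at hlt hpos; linarith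
    obtain ⟨t1, g1, d1, e1⟩ := m1 hρ.1.2
    obtain ⟨t2, g2, d2, e2⟩ := m2 e1.ge
    have g2' := (g2 _ ⟨t2.le, le_rfl⟩).mono
      (P' := fun q => q ∈ S.Dt ∧ eta r ε < S.Q ε q) fun q hq => ⟨hq.1, hlt'.trans hq.2⟩
    obtain ⟨t3, g3, d3, e3⟩ := m3 e2
    obtain ⟨t4, g4, d4, e4⟩ := m4 e3
    have hseg := (g1.trans ⟨d1, by rw [e1]; exact hlt'⟩ g2').trans
      ⟨d2, by rw [e2]; exact hlt'⟩ g3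
    refine ⟨⟨hρ, (A₂ ε ρ).1, (A₂ ε ρ).1 + (R ε (A₂ ε ρ).2).1, ?_⟩, ?_⟩
    · obtain ⟨n1, x, hx, x0, x1, x2⟩ := hseg
      obtain ⟨n2, y, hy, y0, y1, y2⟩ := g4
      have hAt : (A₂ ε ρ).1 = (L₀ ε ρ).1 + τ ε (L₀ ε ρ).2 + (L₁ ε (A ε ρ).2).1 := rfl
      have hApos : 0 < (A₂ ε ρ).1 := by
        rw [hAt]
        exact add_pos (add_pos t1 t2) t3
      refine ⟨_, hApos, by linarith, IsHamOrbit.concat (τ := (A₂ ε ρ).1) hx hy n1 n2 (y0.trans x1.symm),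
        ?_, ?_, ?_, ?_, ?_, ?_⟩
      · rw [if_pos hApos.le, x0]
      · intro s hs
        rw [if_pos hs.2.le]
        exact x2 s hs
      · rw [if_pos le_rfl]
        have hx1 : x (A₂ ε ρ).1 = (A₂ ε ρ).2 := x1
        rw [hx1]
        exact ⟨⟨d3, e3⟩, inner_normal_neg.2 s1⟩
      · intro s hs
        rw [if_neg (not_le.2 hs.1)]
        exact y2 _ ⟨by linarith [hs.1], by linarith [hs.2]⟩
      · rw [if_neg (by linarith), add_sub_cancel_left, y1]
        exact ⟨⟨d4, e4⟩, inner_normal_pos.2 s2⟩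
      · rw [if_neg (by linarith), add_sub_cancel_left, y1]
    · obtain ⟨b1, b2, b3, b4⟩ := m2' hρ.1.2.ge
      exact ⟨hρ, τ' ε ρ, b1, b2, rfl, b3, b4, rfl⟩
  obtain ⟨δ, hδ, hball⟩ := exists_ball_of_eventually hall
  refine ⟨Metric.ball (q, p) δ, C, Φ, B, Metric.isOpen_ball, Metric.mem_ball_self hδ, ?_⟩
  have hball' : ∀ᶠ ε in 𝓝[>] (0 : ℝ), _ := hball
  filter_upwards [hball'] with ε hε
  exact ⟨fun ρ hρ => (hε ρ hρ.1).1 hρ.2, fun ρ hρ => (hε ρ hρ).2.1.contDiffWithinAt,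
    fun ρ hρ => (hε ρ hρ).2.2.1.contDiffWithinAt, fun l hl ρ hρ => (hε ρ hρ).2.2.2 l hl⟩

end SteepSystem

/-! ### Concatenation of orbits -/

theorem forall_append {k m : ℕ} {α : Type} {t : Fin k → α} {u : Fin m → α} {P : α → Prop} :
    (∀ j, P (Fin.append t u j)) ↔ (∀ i, P (t i)) ∧ ∀ i, P (u i) := by
  constructor
  · intro h
    exact ⟨fun i => by simpa using h (Fin.castAdd m i), fun i => by simpa using h (Fin.natAdd k i)⟩
  · rintro ⟨h1, h2⟩ j
    refine Fin.addCases (fun i => ?_) (fun i => ?_) j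
    · simpa using h1 i
    · simpa using h2 i

/-- Collision times lie in open intervals, so the junction is a moment of free motion. Any flight
across it is glued from one flight on each side. -/
theorem IsRegularOrbit.concat {d : ℕ} {B : Table d} {T₁ T₂ : ℝ} {k m : ℕ} {t : Fin k → ℝ}
    {u : Fin m → ℝ} {x y : ℝ → Phase d} (hx : IsRegularOrbit B T₁ t x) (hy : IsRegularOrbit B T₂ u y)
    (h₁ : 0 < T₁) (h₂ : 0 < T₂) (hxy : y 0 = x T₁) :
    IsRegularOrbit B (T₁ + T₂) (Fin.append t fun j => T₁ + u j)
      fun s => if s ≤ T₁ then x s else y (s - T₁) where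
  times_mono := by
    intro i j hij
    induction i using Fin.addCases with
    | left i =>
      induction j using Fin.addCases with
      | left j =>
        simp only [Fin.append_left]
        exact hx.times_mono (Fin.lt_def.2 (Fin.lt_def.1 hij))
      | right j =>
        simp only [Fin.append_left, Fin.append_right]
        linarith [(hx.times_mem i).2, (hy.times_mem j).1]
    | right i =>
      induction j using Fin.addCases with
      | left j =>
        have := i.2
        have := j.2
        simp only [Fin.lt_def, Fin.val_natAdd, Fin.val_castAdd] at hij
        omega
      | right j =>
        simp only [Fin.append_right]
        have := hy.times_mono (show i < j by simpa using hij)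
        linarith
  times_mem := by
    refine forall_append.2 ⟨fun i => ?_, fun i => ?_⟩
    · exact ⟨(hx.times_mem i).1, by linarith [(hx.times_mem i).2]⟩
    · exact ⟨by linarith [(hy.times_mem i).1], by linarith [(hy.times_mem i).2]⟩
  inside := by
    intro s hs hj
    obtain ⟨hj1, hj2⟩ := (forall_append (P := fun a => s ≠ a)).1 hj
    by_cases hsT : s ≤ T₁
    · rw [if_pos hsT]
      exact hx.inside s ⟨hs.1, hsT⟩ hj1
    · rw [if_neg hsT]
      exact hy.inside _ ⟨by linarith, by linarith [hs.2]⟩ fun j h => hj2 j (by linarith)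
  free := by
    intro s s' h0 hss hs' hj
    obtain ⟨hj1, hj2⟩ := (forall_append (P := fun a => a ∉ Ioc s s')).1 hj
    by_cases hsT' : s' ≤ T₁
    · rw [if_pos hsT', if_pos (hss.trans hsT')]
      exact hx.free s s' h0 hss hsT' hj1
    · rw [if_neg hsT']
      have hT := not_le.1 hsT'
      by_cases hsT : s ≤ T₁
      · rw [if_pos hsT]
        have e1 := hx.free s T₁ h0 hsT le_rfl fun j hj => hj1 j ⟨hj.1, hj.2.trans hT.le⟩
        have e2 := hy.free 0 (s' - T₁) le_rfl (by linarith) (by linarith)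
          fun j hj => hj2 j ⟨by linarith [hj.1], by linarith [hj.2]⟩
        rw [e2, hxy, e1]
        ext1
        · simp only
          module
        · rfl
      · rw [if_neg hsT]
        have e2 := hy.free (s - T₁) (s' - T₁) (by linarith) (by linarith) (by linarith)
          fun j hj => hj2 j ⟨by linarith [hj.1], by linarith [hj.2]⟩
        rw [e2, sub_sub_sub_cancel_right]
  hit := by
    intro j s h0 hs hj
    obtain ⟨hj1, hj2⟩ := (forall_append (P := fun a => a ∉ Ioo s _)).1 hj
    induction j using Fin.addCases with
    | left j =>
      simp only [Fin.append_left] at hs hj1 ⊢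
      have hjT := (hx.times_mem j).2.le
      rw [if_pos hjT, if_pos (hs.le.trans hjT)]
      exact hx.hit j s h0 hs hj1
    | right j =>
      simp only [Fin.append_right] at hs hj1 hj2 ⊢
      have hju := (hy.times_mem j).1
      rw [if_neg (show ¬ T₁ + u j ≤ T₁ by linarith), add_sub_cancel_left]
      by_cases hsT : s ≤ T₁
      · rw [if_pos hsT]
        have e1 := hx.free s T₁ h0 hsT le_rfl fun i hi => hj1 i ⟨hi.1, by linarith [hi.2]⟩
        have e2 := hy.hit j 0 le_rfl hju fun i hi => hj2 i ⟨by linarith [hi.1], by linarith [hi.2]⟩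
        rw [hxy, e1] at e2
        refine ⟨?_, e2.2⟩
        rw [e2.1]
        simp only
        module
      · rw [if_neg hsT]
        have e2 := hy.hit j (s - T₁) (by linarith) (by linarith) fun i hi =>
          hj2 i ⟨by linarith [hi.1], by linarith [hi.2]⟩
        refine ⟨?_, e2.2⟩
        rw [e2.1, show u j - (s - T₁) = T₁ + u j - s by ring]

theorem IsRegularOrbit.restrict {d : ℕ} {B : Table d} {T m : ℝ} {k : ℕ} {t : Fin (k + 1) → ℝ}
    {x : ℝ → Phase d} (hx : IsRegularOrbit B T t x) (h1 : ∀ j : Fin k, t j.castSucc < m)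
    (h2 : m < t (Fin.last k)) : IsRegularOrbit B m (fun j : Fin k => t j.castSucc) x where
  times_mono := fun i j hij => hx.times_mono (Fin.castSucc_lt_castSucc_iff.2 hij)
  times_mem := fun j => ⟨(hx.times_mem _).1, h1 j⟩
  inside := fun s hs hj => hx.inside s ⟨hs.1, hs.2.trans (h2.trans (hx.times_mem _).2).le⟩ fun i => by
    induction i using Fin.lastCases with
    | last => linarith [hs.2]
    | cast i => exact hj i
  free := fun s s' h0 hss hs' hj => hx.free s s' h0 hss (hs'.trans (h2.trans (hx.times_mem _).2).le)
    fun i hi => by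
      induction i using Fin.lastCases with
      | last => linarith [hi.2]
      | cast i => exact hj i hi
  hit := fun j s h0 hs hj => hx.hit j.castSucc s h0 hs fun i hi => by
      induction i using Fin.lastCases with
      | last => linarith [hi.2, h1 j]
      | cast i => exact hj i hi

theorem exists_between_collisions {T : ℝ} {k : ℕ} {t : Fin (k + 1) → ℝ} (hm : StrictMono t)
    (ht : ∀ j, t j ∈ Ioo 0 T) :
    ∃ m, 0 < m ∧ m < t (Fin.last k) ∧ ∀ j : Fin k, t j.castSucc < m := by
  have h1 : ∀ᶠ m in 𝓝[<] t (Fin.last k), ∀ j : Fin k, t j.castSucc < m :=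
    eventually_all.2 fun j =>
      nhdsWithin_le_nhds (lt_mem_nhds (hm (Fin.castSucc_lt_last j)))
  have h2 : ∀ᶠ m in 𝓝[<] t (Fin.last k), 0 < m := nhdsWithin_le_nhds (lt_mem_nhds (ht _).1)
  obtain ⟨m, ⟨a, b⟩, c⟩ := ((h1.and h2).and (eventually_mem_nhdsWithin)).exists
  exact ⟨m, b, c, a⟩

/-! ### Closeness of flows -/

/-- The maps `u` and `v` are close at `ρ`. -/
def CloseAt {d : ℕ} (r : ℕ) (c : ℝ) (u v : Phase d → Phase d) (ρ : Phase d) : Prop :=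
  ContDiffAt ℝ r u ρ ∧ ContDiffAt ℝ r v ρ ∧
    ∀ l ≤ r, ‖iteratedFDeriv ℝ l (fun ρ' => u ρ' - v ρ') ρ‖ ≤ c

section CloseAt

variable {d r : ℕ} {c c' : ℝ} {u v u' v' : Phase d → Phase d} {ρ : Phase d}

theorem CloseAt.mono (h : CloseAt r c u v ρ) (hc : c ≤ c') : CloseAt r c' u v ρ :=
  ⟨h.1, h.2.1, fun l hl => (h.2.2 l hl).trans hc⟩

theorem CloseAt.congr (h : CloseAt r c u v ρ) (hu : u' =ᶠ[𝓝 ρ] u) (hv : v' =ᶠ[𝓝 ρ] v) :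
    CloseAt r c u' v' ρ := by
  refine ⟨h.1.congr_of_eventuallyEq hu, h.2.1.congr_of_eventuallyEq hv, fun l hl => ?_⟩
  have e : (fun ρ' => u' ρ' - v' ρ') =ᶠ[𝓝 ρ] fun ρ' => u ρ' - v ρ' := hu.sub hv
  rw [(e.iteratedFDeriv ℝ l).self_of_nhds]
  exact h.2.2 l hl

end CloseAt

namespace SteepSystem

variable {d : ℕ} {S : SteepSystem d} {r : ℕ}

/-- The impact intervals of radius `c`. -/
def impact {k : ℕ} (t : Fin k → ℝ) (c : ℝ) : Set ℝ := ⋃ j, Icc (t j - c) (t j + c)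

theorem impact_mono {k : ℕ} {t : Fin k → ℝ} {c c' : ℝ} (h : c ≤ c') : impact t c ⊆ impact t c' :=
  iUnion_mono fun _ => Icc_subset_Icc (by linarith) (by linarith)

theorem impact_append {k m : ℕ} {t : Fin k → ℝ} {u : Fin m → ℝ} {T c s : ℝ}
    (hs : s ∉ impact (Fin.append t fun j => T + u j) c) : s ∉ impact t c ∧ s - T ∉ impact u c := by
  simp only [impact, mem_iUnion, not_exists] at hs ⊢
  obtain ⟨h1, h2⟩ := (forall_append (P := fun a => s ∉ Icc (a - c) (a + c))).1 hs
  exact ⟨h1, fun j hj => h2 j ⟨by linarith [hj.1], by linarith [hj.2]⟩⟩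

/-- Along the billiard orbit from `ρ₀` to `ρ₁`, of duration `T` and with `k` collisions, the smooth
flow `h` and the flow `b` of the auxiliary billiard, with the collision times `tc`, are close outside
the impact intervals, for all pairs of close initial conditions. -/
structure FlowClose (S : SteepSystem d) (r : ℕ) (T : ℝ) (k : ℕ) (ρ₀ ρ₁ : Phase d)
    (h b : Eps → ℝ → Phase d → Phase d) (tc : Eps → Phase d → Fin k → ℝ) : Prop where
  near : CNear smallEps (fun ε => nu r ε) r ρ₀ ρ₁ (fun ε => h ε T) fun ε => b ε T
  orbit : ∀ᶠ w : Eps × Phase d in smallEps ×ˢ 𝓝ˢ {ρ₀},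
    h w.1 0 w.2 = w.2 ∧ IsHamOrbit (S.V w.1) T (fun s => h w.1 s w.2) ∧ b w.1 0 w.2 = w.2 ∧
      IsRegularOrbit (S.auxTable w.1 (eta r w.1)) T (tc w.1 w.2) (fun s => b w.1 s w.2)
  bound : ∀ (x₀ : Phase d) (f g : Eps → Phase d → Phase d),
    CNear smallEps (fun ε => nu r ε) r x₀ ρ₀ f g →
    ∃ C, ∀ᶠ w : Eps × Phase d in smallEps ×ˢ 𝓝ˢ {x₀}, ∀ s ∈ Icc 0 T,
      s ∉ impact (tc w.1 (g w.1 w.2)) (C * nu r w.1) →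
      CloseAt r (C * nu r w.1) (fun ρ => h w.1 s (f w.1 ρ)) (fun ρ => b w.1 s (g w.1 ρ)) w.2

/-- The motion `u` up to the time `T`, followed by the motion `v`. -/
noncomputable def flowConcat (T : ℝ) (u v : Eps → ℝ → Phase d → Phase d) (ε : Eps) (s : ℝ)
    (ρ : Phase d) : Phase d :=
  if s ≤ T then u ε s ρ else v ε (s - T) (u ε T ρ)

/-- The second piece is entered from two different points, the smooth and the billiard image of the
first. That is why the field `bound` is stated for arbitrary close pairs f, g, with the impact
intervals attached to g, the billiard side. -/
theorem FlowClose.concat {T₁ T₂ : ℝ} {k m : ℕ} {ρ₀ ρ₁ ρ₂ : Phase d}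
    {h₁ b₁ h₂ b₂ : Eps → ℝ → Phase d → Phase d} {tc₁ : Eps → Phase d → Fin k → ℝ}
    {tc₂ : Eps → Phase d → Fin m → ℝ} (H₁ : S.FlowClose r T₁ k ρ₀ ρ₁ h₁ b₁ tc₁)
    (H₂ : S.FlowClose r T₂ m ρ₁ ρ₂ h₂ b₂ tc₂) (hT₁ : 0 < T₁) (hT₂ : 0 < T₂) :
    S.FlowClose r (T₁ + T₂) (k + m) ρ₀ ρ₂ (flowConcat T₁ h₁ h₂) (flowConcat T₁ b₁ b₂)
      fun ε ρ => Fin.append (tc₁ ε ρ) fun j => T₁ + tc₂ ε (b₁ ε T₁ ρ) j where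
  near := by
    have e : ∀ u v : Eps → ℝ → Phase d → Phase d,
        (fun ε => flowConcat T₁ u v ε (T₁ + T₂)) = fun ε ρ => v ε T₂ (u ε T₁ ρ) := by
      intro u v
      funext ε ρ
      rw [flowConcat, if_neg (by linarith), add_sub_cancel_left]
    rw [e, e]
    exact H₂.near.comp H₁.near
  orbit := by
    filter_upwards [H₁.orbit, H₁.near.tendsto_graph_left.eventually H₂.orbit,
      H₁.near.tendsto_graph.eventually H₂.orbit] with w a1 a2 a3
    refine ⟨by rw [flowConcat, if_pos hT₁.le, a1.1], ?_, by rw [flowConcat, if_pos hT₁.le, a1.2.2.1], ?_⟩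
    · exact a1.2.1.concat a2.2.1 hT₁.le hT₂.le a2.1
    · exact a1.2.2.2.concat a3.2.2.2 hT₁ hT₂ a3.2.2.1
  bound := by
    intro x₀ f g hfg
    obtain ⟨C₁, hC₁⟩ := H₁.bound x₀ f g hfg
    obtain ⟨C₂, hC₂⟩ := H₂.bound x₀ _ _ (H₁.near.comp hfg)
    refine ⟨max C₁ C₂, ?_⟩
    filter_upwards [hC₁, hC₂, (eventually_nu_nonneg r).prod_inl _] with w h1 h2 hν s hs hj
    have m1 : C₁ * nu r w.1 ≤ max C₁ C₂ * nu r w.1 := mul_le_mul_of_nonneg_right (le_max_left _ _) hν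
    have m2 : C₂ * nu r w.1 ≤ max C₁ C₂ * nu r w.1 := mul_le_mul_of_nonneg_right (le_max_right _ _) hν
    obtain ⟨j1, j2⟩ := impact_append hj
    by_cases hsT : s ≤ T₁
    · simp only [flowConcat, if_pos hsT]
      exact (h1 s ⟨hs.1, hsT⟩ fun h => j1 (impact_mono m1 h)).mono m1
    · simp only [flowConcat, if_neg hsT]
      exact (h2 (s - T₁) ⟨by linarith, by linarith [hs.2]⟩ fun h => j2 (impact_mono m2 h)).mono m2

end SteepSystem

/-! ### Flights which start at variable times -/

theorem CNear.congr_left {ι E F : Type} [TopologicalSpace ι] [DiscreteTopology ι]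
    [NormedAddCommGroup E] [NormedSpace ℝ E] [NormedAddCommGroup F] [NormedSpace ℝ F] {l : Filter ι}
    {μ : ι → ℝ} {n : ℕ} {x₀ : E} {y₀ : F} {f f' g : ι → E → F} (h : CNear l μ n x₀ y₀ f g)
    (hf : ∀ᶠ p in l ×ˢ 𝓝ˢ {x₀}, f p.1 p.2 = f' p.1 p.2) : CNear l μ n x₀ y₀ f' g :=
  ⟨h.smooth, h.close.congr' (hf.mono fun p hp => by simp only [hp]), h.tendsto, h.small⟩

theorem CNear.exists_norm_le {ι E F : Type} [TopologicalSpace ι]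
    [NormedAddCommGroup E] [NormedSpace ℝ E] [NormedAddCommGroup F] [NormedSpace ℝ F] {l : Filter ι}
    {μ : ι → ℝ} {n : ℕ} {x₀ : E} {y₀ : F} {f g : ι → E → F} (h : CNear l μ n x₀ y₀ f g)
    (hμ : ∀ᶠ i in l, 0 ≤ μ i) :
    ∃ C, ∀ᶠ p in l ×ˢ 𝓝ˢ {x₀}, ‖f p.1 p.2 - g p.1 p.2‖ ≤ C * μ p.1 := by
  obtain ⟨C, hC⟩ := h.close.isBigO.bound
  refine ⟨C, ?_⟩
  filter_upwards [hC, hμ.prod_inl _] with p h1 h2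
  rwa [Real.norm_of_nonneg h2] at h1

theorem tendsto_sub_nhdsSet {α : Type} {𝓕 : Filter α} {a τ : ℝ} {u v : α → ℝ}
    (hu : Tendsto u 𝓕 (𝓝ˢ (Icc a (a + τ)))) (hv : Tendsto v 𝓕 (𝓝 a)) :
    Tendsto (fun x => u x - v x) 𝓕 (𝓝ˢ (Icc 0 τ)) := by
  have h1 : Tendsto (fun z : ℝ × ℝ => z.1 - z.2) (𝓝ˢ (Icc a (a + τ) ×ˢ {a})) (𝓝ˢ (Icc 0 τ)) := by
    refine Continuous.tendsto_nhdsSet (by fun_prop) ?_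
    rintro ⟨s, t⟩ ⟨hs, ht⟩
    obtain rfl : t = a := ht
    exact ⟨by linarith [hs.1], by linarith [hs.2]⟩
  rw [isCompact_Icc.nhdsSet_prod_eq isCompact_singleton, nhdsSet_singleton] at h1
  exact h1.comp (hu.prodMk hv)

/-- The real number which is given by a point of the discrete line. -/
def Eps.val (s : Eps) : ℝ := s

/-- The neighbourhoods of a compact time interval, as a filter on the discrete line. -/
def nearTimes (a b : ℝ) : Filter Eps := (𝓝ˢ (Icc a b) : Filter ℝ)

theorem nearTimes_isBigO (a b : ℝ) : Eps.val =O[nearTimes a b] fun _ => (1 : ℝ) := by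
  refine IsBigO.of_bound (|a| + |b| + 1) ?_
  have h1 : Icc a b ⊆ Ioo (a - 1) (b + 1) := fun x hx => ⟨by linarith [hx.1], by linarith [hx.2]⟩
  have h2 : ∀ᶠ s : ℝ in 𝓝ˢ (Icc a b), s ∈ Ioo (a - 1) (b + 1) := isOpen_Ioo.mem_nhdsSet.2 h1
  refine Filter.Eventually.mono h2 fun s hs => ?_
  have hs1 : a - 1 < s.val := hs.1
  have hs2 : s.val < b + 1 := hs.2
  rw [norm_one, mul_one, Real.norm_eq_abs, abs_le]
  constructor <;> linarith [neg_abs_le a, le_abs_self b, abs_nonneg a, abs_nonneg b]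

namespace SteepSystem

variable {d : ℕ} {S : SteepSystem d} {r : ℕ}

section LegClose

variable {x₀ y₀ : Phase d} {τ₀ a : ℝ} {A B : Eps → Phase d → ℝ × Phase d}

theorem cBound_shift (hA : CBound smallEps {x₀} (fun _ => 1) r A) :
    CBound (smallEps ×ˢ nearTimes a (a + τ₀)) {x₀} (fun _ => 1) r
      (fun i ρ => (i.2.val - (A i.1 ρ).1, (A i.1 ρ).2)) := by
  have h1 : CBound (smallEps ×ˢ nearTimes a (a + τ₀)) {x₀} (fun _ => 1) r
      (fun i (_ : Phase d) => i.2.val) :=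
    CBound.const_family (c := fun i : Eps × Eps => i.2.val) continuous_of_discreteTopology
      ((nearTimes_isBigO a (a + τ₀)).comp_tendsto tendsto_snd)
  have h2 : CBound (smallEps ×ˢ nearTimes a (a + τ₀)) {x₀} (fun _ => 1) r (fun i => A i.1) :=
    hA.reindex continuous_fst tendsto_fst
  exact (h1.sub h2.fst).prodMk h2.snd

theorem tendsto_shift (hA : Tendsto (fun w : Eps × Phase d => A w.1 w.2) (smallEps ×ˢ 𝓝ˢ {x₀})
      (𝓝 (a, y₀))) :
    Tendsto (fun w : (Eps × Eps) × Phase d =>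
        (w.1.1, ((w.1.2.val - (A w.1.1 w.2).1, (A w.1.1 w.2).2) : ℝ × Phase d)))
      ((smallEps ×ˢ nearTimes a (a + τ₀)) ×ˢ 𝓝ˢ {x₀}) (smallEps ×ˢ 𝓝ˢ (Icc 0 τ₀ ×ˢ {y₀})) := by
  rw [isCompact_Icc.nhdsSet_prod_eq isCompact_singleton, nhdsSet_singleton (x := y₀)]
  have h1 : Tendsto (fun w : (Eps × Eps) × Phase d => A w.1.1 w.2)
      ((smallEps ×ˢ nearTimes a (a + τ₀)) ×ˢ 𝓝ˢ {x₀}) (𝓝 (a, y₀)) :=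
    hA.comp ((tendsto_fst.comp tendsto_fst).prodMk tendsto_snd)
  have h2 : Tendsto (fun w : (Eps × Eps) × Phase d => w.1.2.val)
      ((smallEps ×ˢ nearTimes a (a + τ₀)) ×ˢ 𝓝ˢ {x₀}) (𝓝ˢ (Icc a (a + τ₀)) : Filter ℝ) :=
    tendsto_snd.comp tendsto_fst
  exact (tendsto_fst.comp tendsto_fst).prodMk
    ((tendsto_sub_nhdsSet h2 ((continuous_fst.tendsto _).comp h1)).prodMk
      ((continuous_snd.tendsto _).comp h1))

/-- The observation time s is added to the index instead of the variables, so the bounds are uniform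
in s while only initial conditions are differentiated. The open set around the closed time interval
leaves room for collision times that move with ρ and ε. -/
theorem leg_closeAt {φ : Eps → ℝ × Phase d → Phase d}
    (hφ : CBound smallEps (Icc 0 τ₀ ×ˢ {y₀}) (fun ε => nu r ε) r (fun ε z => φ ε z - freeFlight z))
    (hAB : CNear smallEps (fun ε => nu r ε) r x₀ (a, y₀) A B) :
    ∃ (C : ℝ) (O : Set ℝ), IsOpen O ∧ Icc a (a + τ₀) ⊆ O ∧
      ∀ᶠ w : Eps × Phase d in smallEps ×ˢ 𝓝ˢ {x₀}, ∀ s ∈ O,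
        CloseAt r (C * nu r w.1) (fun ρ => φ w.1 (s - (A w.1 ρ).1, (A w.1 ρ).2))
          (fun ρ => freeFlight (s - (B w.1 ρ).1, (B w.1 ρ).2)) w.2 := by
  set l : Filter (Eps × Eps) := smallEps ×ˢ nearTimes a (a + τ₀) with hl
  have hK : IsCompact (Icc 0 τ₀ ×ˢ {y₀}) := isCompact_Icc.prod isCompact_singleton
  have hu : CBound (smallEps : Filter Eps) (Icc 0 τ₀ ×ˢ {y₀}) (fun _ => 1) (r + 1)
      (fun _ => freeFlight (E := Pos d)) :=
    CBound.of_contDiffAt_const hK fun _ _ => contDiff_freeFlight.contDiffAt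
  have iA := cBound_shift (a := a) (τ₀ := τ₀) hAB.left
  have iB := cBound_shift (a := a) (τ₀ := τ₀) hAB.smooth.pred
  have tA := tendsto_shift (τ₀ := τ₀) hAB.tendsto_left
  have tB := tendsto_shift (τ₀ := τ₀) hAB.tendsto
  have c1 := hφ.comp iA continuous_fst tA
  have hd : CBound l {x₀} (fun i => nu r i.1) r (fun i ρ =>
      ((i.2.val - (A i.1 ρ).1, (A i.1 ρ).2) : ℝ × Phase d) - (i.2.val - (B i.1 ρ).1, (B i.1 ρ).2)) := by
    have h1 : CBound l {x₀} (fun i => nu r i.1) r (fun i ρ => A i.1 ρ - B i.1 ρ) :=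
      hAB.close.reindex (j := Prod.fst) continuous_fst tendsto_fst
    have h2 := h1.fst.neg.prodMk h1.snd
    refine h2.congr' (Eventually.of_forall fun p => ?_)
    ext1
    · simp
    · simp
  have c2 := hu.comp_sub_comp iA iB hd continuous_fst
    (eventually_segment hK ((convex_Icc 0 τ₀).prod (convex_singleton y₀)) tA tB)
  have c3 : CBound l {x₀} (fun i => nu r i.1) r (fun i ρ =>
      φ i.1 (i.2.val - (A i.1 ρ).1, (A i.1 ρ).2) -
        freeFlight (i.2.val - (B i.1 ρ).1, (B i.1 ρ).2)) :=
    (c1.add c2).congr' (Eventually.of_forall fun p => sub_add_sub_cancel _ _ _)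
  have c4 := hu.pred.comp iB continuous_fst tB
  have hν : ∀ᶠ i : Eps × Eps in l, 0 ≤ nu r i.1 := (eventually_nu_nonneg r).prod_inl _
  obtain ⟨C, hC⟩ := c3.exists_bound hν
  obtain ⟨P, hP, P', hP', hPP⟩ := eventually_prod_iff.1 (hC.and (c3.contDiffAt.and c4.contDiffAt))
  obtain ⟨P₁, hP₁, P₂, hP₂, hP₁₂⟩ := eventually_prod_iff.1 hP
  have hP₂' : ∀ᶠ s : ℝ in 𝓝ˢ (Icc a (a + τ₀)), P₂ s := hP₂
  obtain ⟨O, hO, hsub, hOP⟩ := mem_nhdsSet_iff_exists.1 hP₂'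
  refine ⟨C, O, hO, hsub, ?_⟩
  filter_upwards [hP₁.prod_inl _, hP'.prod_inr _] with w h1 h2 s hs
  obtain ⟨k1, k2, k3⟩ := hPP (hP₁₂ h1 (hOP hs)) h2
  refine ⟨?_, k3, k1⟩
  have := k2.add k3
  refine this.congr_of_eventuallyEq (Eventually.of_forall fun y => ?_)
  simp only [sub_add_cancel]
  rfl

end LegClose

end SteepSystem

/-! ### Orbits with at most one collision -/

section Orbits

variable {d : ℕ}

open Classical in
/-- The flow of `p² / 2 + V` on `[0, T]`, where it is defined. -/
noncomputable def hamFlow (V : Pos d → ℝ) (T s : ℝ) (ρ : Phase d) : Phase d :=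
  if h : ∃ x, IsHamOrbit V T x ∧ x 0 = ρ then h.choose s else ρ

theorem hamFlow_spec {V : Pos d → ℝ} {P : Pos d → Prop} {T : ℝ} {ρ ρ' : Phase d}
    (h : HamSeg V P ρ T ρ') : IsHamOrbit V T (fun s => hamFlow V T s ρ) ∧ hamFlow V T 0 ρ = ρ := by
  obtain ⟨-, x, hx, x0, -⟩ := h
  have hex : ∃ x, IsHamOrbit V T x ∧ x 0 = ρ := ⟨x, hx, x0⟩
  simp only [hamFlow, dif_pos hex]
  exact hex.choose_spec

/-- `hamFlow` is an arbitrary choice of solution; uniqueness identifies it with whatever piece of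
motion has been constructed. -/
theorem hamFlow_eq {V : Pos d → ℝ} {P P' : Pos d → Prop} {T s : ℝ} {ρ ρ' ρ'' : Phase d}
    (hV : ContDiff ℝ 2 V) (h : HamSeg V P ρ T ρ'') (hs : s ≤ T) (h' : HamSeg V P' ρ s ρ') :
    hamFlow V T s ρ = ρ' := by
  obtain ⟨h1, h2⟩ := hamFlow_spec h
  have : HamSeg V (fun _ => True) ρ s (hamFlow V T s ρ) :=
    ⟨h'.1, _, h1.mono hs, h2, rfl, fun _ _ => trivial⟩
  exact this.unique hV h'

theorem isRegularOrbit_zero {B : Table d} {T : ℝ} {t : Fin 0 → ℝ} {ρ : Phase d}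
    (h : ∀ s ∈ Icc 0 T, ρ.1 + s • ρ.2 ∈ B.inside) :
    IsRegularOrbit B T t fun s => freeFlight (s, ρ) where
  times_mono := fun i => i.elim0
  times_mem := fun i => i.elim0
  inside := fun s hs _ => h s hs
  free := by
    intro s s' _ _ _ _
    ext1
    · simp only [freeFlight]
      module
    · rfl
  hit := fun i => i.elim0

/-- A flight, a collision at the time `τ`, and a flight starting from `ρ'`. -/
noncomputable def bounceFlow (τ : ℝ) (ρ ρ' : Phase d) (s : ℝ) : Phase d :=
  if s < τ then freeFlight (s, ρ) else freeFlight (s - τ, ρ')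

theorem isRegularOrbit_one {B : Table d} {T τ : ℝ} {ρ ρ' : Phase d} (hτ : τ ∈ Ioo 0 T)
    (h : ∀ s ∈ Ico 0 τ, ρ.1 + s • ρ.2 ∈ B.inside) (hw : ρ.1 + τ • ρ.2 ∈ B.wall)
    (hn : inner ℝ ρ.2 (B.normal (ρ.1 + τ • ρ.2)) < 0)
    (hρ : ρ' = (ρ.1 + τ • ρ.2, reflect (B.normal (ρ.1 + τ • ρ.2)) ρ.2))
    (h' : ∀ s ∈ Ioc 0 (T - τ), ρ'.1 + s • ρ'.2 ∈ B.inside) :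
    IsRegularOrbit B T (fun _ : Fin 1 => τ) (bounceFlow τ ρ ρ') where
  times_mono := Subsingleton.strictMono _
  times_mem := fun _ => hτ
  inside := by
    intro s hs hj
    rcases lt_or_gt_of_ne (hj 0) with h1 | h1
    · rw [bounceFlow, if_pos h1]
      exact h s ⟨hs.1, h1⟩
    · rw [bounceFlow, if_neg h1.not_gt]
      exact h' _ ⟨by linarith, by linarith [hs.2]⟩
  free := by
    intro s s' h0 hss hs' hj
    have hj0 := hj 0
    rcases lt_or_ge s τ with h1 | h1
    · have h2 : s' < τ := by
        by_contra hcon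
        exact hj0 ⟨h1, not_lt.1 hcon⟩
      rw [bounceFlow, bounceFlow, if_pos h1, if_pos h2]
      ext1
      · simp only [freeFlight]
        module
      · rfl
    · rw [bounceFlow, bounceFlow, if_neg h1.not_gt, if_neg (h1.trans hss).not_gt]
      ext1
      · simp only [freeFlight]
        module
      · rfl
  hit := by
    intro j s h0 hs hj
    have e : bounceFlow τ ρ ρ' τ = ρ' := by
      rw [bounceFlow, if_neg (lt_irrefl _), sub_self, freeFlight_zero]
    have e' : bounceFlow τ ρ ρ' s = freeFlight (s, ρ) := by rw [bounceFlow, if_pos hs]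
    rw [e, e', hρ]
    refine ⟨?_, hw, hn, rfl⟩
    simp only [freeFlight]
    module

end Orbits

namespace SteepSystem

variable {d : ℕ} {S : SteepSystem d} {r : ℕ}

theorem Hyp.contDiff_two_V (h : S.Hyp r) : ∀ᶠ ε : Eps in smallEps, ContDiff ℝ 2 (S.V ε) := by
  filter_upwards [h.contDiff_V] with ε hε
  refine hε.of_le ?_
  have : (2 : WithTop ℕ∞) = ((1 : ℕ) : WithTop ℕ∞) + 1 := by norm_num
  rw [this]
  gcongr
  exact_mod_cast h.one_le

theorem Hyp.exists_flowClose_zero (h : S.Hyp r) {q p : Pos d} {T : ℝ} (hl : S.RefLeg q p T)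
    (hq : q ∈ interior S.D) (hq' : q + T • p ∈ interior S.D) :
    ∃ hf b tc, S.FlowClose r T 0 (q, p) (q + T • p, p) hf b tc := by
  have hμ : Tendsto (fun ε : Eps => nu r ε) smallEps (𝓝 0) := tendsto_nu
  obtain ⟨φ, hφ, hleg⟩ := h.exists_leg hl
  have hA : CNear smallEps (fun ε => nu r ε) r (q, p) (T, (q, p)) (fun _ ρ => (T, ρ)) fun _ ρ => (T, ρ) :=
    CNear.of_contDiffAt (u := fun ρ : Phase d => (T, ρ)) (by fun_prop) hμ
  have hφT := (cNear_leg (right_mem_Icc.2 hl.pos.le) hφ).comp hA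
  have hfst : Tendsto (fun w : Eps × Phase d => (w.1, w.2.1)) (smallEps ×ˢ 𝓝ˢ {(q, p)})
      (smallEps ×ˢ 𝓝 q) := by
    rw [nhdsSet_singleton]
    exact tendsto_fst.prodMk ((continuous_fst.tendsto (q, p)).comp tendsto_snd)
  have hseg : ∀ᶠ w : Eps × Phase d in smallEps ×ˢ 𝓝ˢ {(q, p)}, ∀ σ ∈ Icc 0 T,
      HamSeg (S.V w.1) (fun q => q ∈ S.Dt ∧ wid r w.1 < S.Q w.1 q) w.2 σ (φ w.1 (σ, w.2)) := by
    rw [← nhdsSet_singleton] at hleg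
    filter_upwards [hA.tendsto_graph.eventually hleg,
      hfst.eventually (h.eventually_lt_Q hq (tendsto_wid h.one_le)),
      (tendsto_fst.prodMk ((continuous_fst.tendsto _).comp hφT.tendsto_left)).eventually
        (h.eventually_lt_Q hq' (tendsto_wid h.one_le))] with w h1 h2 h3
    exact h1 h2.2.le h3.2.le
  have hflow : ∀ᶠ w : Eps × Phase d in smallEps ×ˢ 𝓝ˢ {(q, p)},
      IsHamOrbit (S.V w.1) T (fun s => hamFlow (S.V w.1) T s w.2) ∧ hamFlow (S.V w.1) T 0 w.2 = w.2 ∧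
      ∀ s ∈ Icc 0 T, hamFlow (S.V w.1) T s w.2 = φ w.1 (s, w.2) := by
    filter_upwards [hseg, h.contDiff_two_V.prod_inl _] with w h1 h2
    have hT := h1 T (right_mem_Icc.2 hl.pos.le)
    exact ⟨(hamFlow_spec hT).1, (hamFlow_spec hT).2, fun s hs => hamFlow_eq h2 hT hs.2 (h1 s hs)⟩
  refine ⟨fun ε => hamFlow (S.V ε) T, fun ε s ρ => freeFlight (s, ρ), fun _ _ i => i.elim0, ?_, ?_, ?_⟩
  · refine hφT.congr_left ?_
    filter_upwards [hflow] with w hw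
    exact (hw.2.2 T (right_mem_Icc.2 hl.pos.le)).symm
  · have hfree := h.leg_free hl
    rw [← nhdsSet_singleton] at hfree
    filter_upwards [hflow, hA.tendsto_graph.eventually hfree,
      hfst.eventually (h.eventually_lt_Q hq (tendsto_eta h.one_le)),
      (tendsto_fst.prodMk ((continuous_fst.tendsto _).comp hφT.tendsto)).eventually
        (h.eventually_lt_Q hq' (tendsto_eta h.one_le))] with w h1 h2 h3 h4
    refine ⟨h1.2.1, h1.1, freeFlight_zero _, isRegularOrbit_zero fun s hs => ?_⟩
    rcases hs.1.eq_or_lt with rfl | hs0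
    · rw [zero_smul, add_zero]
      exact h3
    rcases hs.2.eq_or_lt with rfl | hs1
    · exact h4
    · exact h2 h3.2.le h4.2.le s ⟨hs0, hs1⟩
  · intro x₀ f g hfg
    have hAB := (CNear.const (l := smallEps) (n := r) (a := fun _ : Eps => (0 : ℝ))
      (b := fun _ : Eps => (0 : ℝ)) x₀ (by simpa using isBigO_zero _ _) tendsto_const_nhds hμ).prodMk hfg
    obtain ⟨C, O, hO, hsub, hC⟩ := leg_closeAt hφ hAB
    refine ⟨C, ?_⟩
    filter_upwards [hC, eventually_eventually_nhds_snd (hfg.tendsto_graph_left.eventually hflow)]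
      with w h1 h2 s hs _
    refine (h1 s (hsub (by rwa [zero_add]))).congr ?_ ?_
    · filter_upwards [h2] with ρ hρ
      simp only [sub_zero]
      exact hρ.2.2 s hs
    · simp only [sub_zero]
      exact EventuallyEq.rfl

end SteepSystem

/-! ### One collision -/

namespace SteepSystem

variable {d : ℕ} {S : SteepSystem d} {r : ℕ}

/-- The smooth and the auxiliary motion along a billiard orbit with one collision, in terms of the
flights before and after the collision: `τ` is the time at which the smooth motion arrives at the
boundary layer, `E` the time and the phase point at which it leaves the layer, and `E'` the time and
the phase point of the collision of the auxiliary billiard. -/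
theorem Hyp.exists_bounce (h : S.Hyp r) {q p : Pos d} {τ₁ τ₂ : ℝ} (hp : ‖p‖ = 1)
    (hl₁ : S.RefLeg q p τ₁) (hq : q ∈ interior S.D) (hw : q + τ₁ • p ∈ frontier S.D \ S.corner)
    (hY : inner ℝ (gradient (S.Q 0) (q + τ₁ • p)) p < 0) {q₁ p₁ : Pos d} (hq₁ : q₁ = q + τ₁ • p)
    (hp₁ : p₁ = reflect (S.normal 0 q₁) p) (hl₂ : S.RefLeg q₁ p₁ τ₂)
    (hq₂ : q₁ + τ₂ • p₁ ∈ interior S.D) :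
    ∃ (φ₁ φ₂ : Eps → ℝ × Phase d → Phase d) (τ : Eps → Phase d → ℝ)
      (E E' : Eps → Phase d → ℝ × Phase d),
      CBound smallEps (Icc 0 τ₁ ×ˢ {(q, p)}) (fun ε => nu r ε) r
        (fun ε z => φ₁ ε z - freeFlight z) ∧
      CBound smallEps (Icc 0 τ₂ ×ˢ {(q₁, p₁)}) (fun ε => nu r ε) r
        (fun ε z => φ₂ ε z - freeFlight z) ∧
      CNear smallEps (fun ε => nu r ε) r (q, p) τ₁ τ (fun ε ρ => (E' ε ρ).1) ∧
      CNear smallEps (fun ε => nu r ε) r (q, p) (τ₁, (q₁, p₁)) E E' ∧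
      (∀ᶠ w : Eps × Phase d in smallEps ×ˢ 𝓝ˢ {(q, p)},
        IsHamOrbit (S.V w.1) (τ₁ + τ₂) (fun s => hamFlow (S.V w.1) (τ₁ + τ₂) s w.2) ∧
        hamFlow (S.V w.1) (τ₁ + τ₂) 0 w.2 = w.2 ∧
        (∀ s ∈ Icc 0 (τ w.1 w.2), hamFlow (S.V w.1) (τ₁ + τ₂) s w.2 = φ₁ w.1 (s, w.2)) ∧
        ∀ s ∈ Icc (E w.1 w.2).1 (τ₁ + τ₂), hamFlow (S.V w.1) (τ₁ + τ₂) s w.2 =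
          φ₂ w.1 (s - (E w.1 w.2).1, (E w.1 w.2).2)) ∧
      ∀ᶠ w : Eps × Phase d in smallEps ×ˢ 𝓝ˢ {(q, p)}, (E' w.1 w.2).1 ∈ Ioo 0 (τ₁ + τ₂) ∧
        IsRegularOrbit (S.auxTable w.1 (eta r w.1)) (τ₁ + τ₂) (fun _ : Fin 1 => (E' w.1 w.2).1)
          (bounceFlow (E' w.1 w.2).1 w.2 (E' w.1 w.2).2) := by
  have hμ : Tendsto (fun ε : Eps => nu r ε) smallEps (𝓝 0) := tendsto_nu
  have hY₂ : 0 < inner ℝ (gradient (S.Q 0) q₁) p₁ := by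
    rw [hp₁, hq₁, h.fderiv_reflect hw]; linarith
  obtain ⟨φ₁, τ, τ', hφ₁, hF, mF, mF'⟩ := h.exists_flight hl₁ hw hY
  rw [← hq₁] at hw hY hF
  obtain ⟨L₁, hL₁, mL₁⟩ := h.exists_layer_in hw hY
  obtain ⟨R, hR, mR⟩ := h.exists_reflection hw hp hY
  rw [← hp₁] at hR
  obtain ⟨L₂, hL₂, mL₂⟩ := h.exists_layer_out hw hY₂
  obtain ⟨φ₂, hφ₂, mleg⟩ := h.exists_leg hl₂
  set F : Eps → Phase d → ℝ × Phase d := fun ε ρ => (τ ε ρ, φ₁ ε (τ ε ρ, ρ)) with hFdef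
  set E' : Eps → Phase d → ℝ × Phase d := fun ε ρ => (τ' ε ρ,
    ((freeFlight (τ' ε ρ, ρ)).1, reflect (S.normal ε (freeFlight (τ' ε ρ, ρ)).1) ρ.2)) with hEdef'
  have hE₁ := hF.timeComp hL₁
  have hE₂ := hE₁.timeComp hR
  have hE₃ := hE₂.timeComp hL₂
  set E₁ : Eps → Phase d → ℝ × Phase d := fun ε => timeComp (F ε) (L₁ ε) with hE₁def
  set E₂ : Eps → Phase d → ℝ × Phase d := fun ε => timeComp (E₁ ε) (R ε) with hE₂def
  set E : Eps → Phase d → ℝ × Phase d := fun ε => timeComp (E₂ ε) (L₂ ε) with hEdef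
  have hE : CNear smallEps (fun ε => nu r ε) r (q, p) (τ₁, (q₁, p₁)) E E' := by
    have h1 := hE₃.congr_right (g' := E') (Eventually.of_forall fun w => by
      ext1
      · simp [timeComp, hEdef']
      · rfl)
    simpa only [add_zero] using h1
  have hτ : CNear smallEps (fun ε => nu r ε) r (q, p) τ₁ τ fun ε ρ => (E' ε ρ).1 := hF.fst
  have hdur : CNear smallEps (fun ε => nu r ε) r (q, p) (τ₂, (q₁, p₁))
      (fun ε ρ => (τ₁ + τ₂ - (E ε ρ).1, (E ε ρ).2)) fun ε ρ => (τ₁ + τ₂ - (E' ε ρ).1, (E' ε ρ).2) := by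
    have := hE.map (u := fun z : ℝ × Phase d => (τ₁ + τ₂ - z.1, z.2)) (by fun_prop)
    simpa only [add_sub_cancel_left] using this
  have hend := (cNear_leg (right_mem_Icc.2 hl₂.pos.le) hφ₂).comp hdur
  have hfst : Tendsto (fun w : Eps × Phase d => (w.1, w.2.1)) (smallEps ×ˢ 𝓝ˢ {(q, p)})
      (smallEps ×ˢ 𝓝 q) := by
    rw [nhdsSet_singleton]
    exact tendsto_fst.prodMk ((continuous_fst.tendsto (q, p)).comp tendsto_snd)
  refine ⟨φ₁, φ₂, τ, E, E', hφ₁, hφ₂, hτ, hE, ?_, ?_⟩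
  · rw [← nhdsSet_singleton] at mleg
    filter_upwards [hfst.eventually (h.eventually_lt_Q hq (tendsto_wid h.one_le)), mF,
      hF.snd.tendsto_graph_left.eventually mL₁, hE₁.snd.tendsto_graph_left.eventually mR,
      hE₂.snd.tendsto_graph_left.eventually mL₂, hdur.tendsto_graph_left.eventually mleg,
      (tendsto_fst.prodMk ((continuous_fst.tendsto _).comp hend.tendsto_left)).eventually
        (h.eventually_lt_Q hq₂ (tendsto_wid h.one_le)), h.contDiff_two_V.prod_inl _,
      hdur.fst.tendsto_left.eventually_const_lt hl₂.pos] with w i0 i1 i2 i3 i4 i5 i6 i7 i8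
    obtain ⟨ε, ρ⟩ := w
    obtain ⟨a1, a2, a3, a4⟩ := i1 i0.2.le
    obtain ⟨b1, b2, b3, b4⟩ := i2 a4
    obtain ⟨c1, c2, c3, c4⟩ := i3 b4
    obtain ⟨d1, d2, d3, d4⟩ := i4 c4
    have e1 := i5 d4.ge i6.2.le
    have hF1 := (a2 _ (right_mem_Icc.2 a1.le)).mono (P' := fun _ => True) fun _ _ => trivial
    have hseg : HamSeg (S.V ε) (fun _ => True) ρ (E ε ρ).1 (E ε ρ).2 :=
      ((hF1.trans trivial (b2.mono fun _ _ => trivial)).trans trivial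
        (c2.mono fun _ _ => trivial)).trans trivial (d2.mono fun _ _ => trivial)
    have hseg' : ∀ s ∈ Icc (E ε ρ).1 (τ₁ + τ₂),
        HamSeg (S.V ε) (fun _ => True) ρ s (φ₂ ε (s - (E ε ρ).1, (E ε ρ).2)) := by
      intro s hs
      have h1 := hseg.trans trivial ((e1 (s - (E ε ρ).1) ⟨by linarith [hs.1], by
        have := hs.2
        dsimp only
        linarith⟩).mono (P' := fun _ => True) fun _ _ => trivial)
      rwa [add_sub_cancel] at h1
    have hle : (E ε ρ).1 ≤ τ₁ + τ₂ := by dsimp only at i8; linarith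
    have hT := hseg' _ (right_mem_Icc.2 hle)
    have hτE : τ ε ρ ≤ (E ε ρ).1 := by
      have : (E ε ρ).1 = τ ε ρ + (L₁ ε (F ε ρ).2).1 + (R ε (E₁ ε ρ).2).1 + (L₂ ε (E₂ ε ρ).2).1 := rfl
      rw [this]
      dsimp only at b1 c1 d1
      linarith
    exact ⟨(hamFlow_spec hT).1, (hamFlow_spec hT).2,
      fun s hs => hamFlow_eq i7 hT (hs.2.trans (hτE.trans hle)) (a2 s hs),
      fun s hs => hamFlow_eq i7 hT hs.2 (hseg' s hs)⟩
  · have hfree := h.leg_free hl₂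
    rw [← nhdsSet_singleton] at hfree
    filter_upwards [hfst.eventually (h.eventually_lt_Q hq (tendsto_eta h.one_le)), mF',
      hdur.tendsto_graph.eventually hfree,
      (tendsto_fst.prodMk ((continuous_fst.tendsto _).comp hend.tendsto)).eventually
        (h.eventually_lt_Q hq₂ (tendsto_eta h.one_le)),
      hdur.fst.tendsto.eventually_const_lt hl₂.pos] with w i0 i1 i2 i3 i4
    obtain ⟨ε, ρ⟩ := w
    obtain ⟨a1, a2, a3, a4⟩ := i1 i0.2.le
    have hin : (E' ε ρ).1 ∈ Ioo 0 (τ₁ + τ₂) := ⟨a1, by dsimp only at i4; linarith⟩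
    refine ⟨hin, isRegularOrbit_one hin (fun s hs => ?_) a3 a4 rfl fun s hs => ?_⟩
    · rcases hs.1.eq_or_lt with rfl | hs0
      · rw [zero_smul, add_zero]
        exact i0
      · exact a2 s ⟨hs0, hs.2⟩
    · rcases hs.2.eq_or_lt with rfl | hs1
      · exact i3
      · exact i2 a3.2.ge i3.2.le s ⟨hs.1, hs1⟩

theorem eventually_Icc_subset {α : Type} {𝓕 : Filter α} {O : Set ℝ} (hO : IsOpen O) {a b : ℝ}
    (hab : a ≤ b) (hI : Icc a b ⊆ O) {u v : α → ℝ} (hu : Tendsto u 𝓕 (𝓝 a)) (hv : Tendsto v 𝓕 (𝓝 b)) :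
    ∀ᶠ x in 𝓕, Icc (u x) (v x) ⊆ O := by
  obtain ⟨δ, hδ, hδO⟩ := (isCompact_Icc (a := a) (b := b)).exists_thickening_subset_open hO hI
  filter_upwards [hu.eventually_const_lt (sub_lt_self a hδ),
    hv.eventually_lt_const (lt_add_of_pos_right b hδ)] with x h1 h2 s hs
  refine hδO (Metric.mem_thickening_iff.2 ?_)
  rcases lt_or_ge s a with h3 | h3
  · refine ⟨a, left_mem_Icc.2 hab, ?_⟩
    rw [Real.dist_eq, abs_lt]
    constructor <;> linarith [hs.1]
  rcases lt_or_ge b s with h4 | h4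
  · refine ⟨b, right_mem_Icc.2 hab, ?_⟩
    rw [Real.dist_eq, abs_lt]
    constructor <;> linarith [hs.2]
  · exact ⟨s, ⟨h3, h4⟩, by simpa using hδ⟩

end SteepSystem

/-! ### Closeness of the flows along orbits with finitely many collisions. -/

namespace SteepSystem

variable {d : ℕ} {S : SteepSystem d} {r : ℕ}

/-- Before the impact both motions are flights from nearby initial points. After it they are flights
started at the nearby times and phase points E and E'. Between arrival and departure nothing is
claimed. -/
theorem Hyp.exists_flowClose_one (h : S.Hyp r) {q p : Pos d} {τ₁ τ₂ : ℝ} (hp : ‖p‖ = 1)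
    (hl₁ : S.RefLeg q p τ₁) (hq : q ∈ interior S.D) (hw : q + τ₁ • p ∈ frontier S.D \ S.corner)
    (hY : inner ℝ (gradient (S.Q 0) (q + τ₁ • p)) p < 0) {q₁ p₁ : Pos d} (hq₁ : q₁ = q + τ₁ • p)
    (hp₁ : p₁ = reflect (S.normal 0 q₁) p) (hl₂ : S.RefLeg q₁ p₁ τ₂)
    (hq₂ : q₁ + τ₂ • p₁ ∈ interior S.D) :
    ∃ hf b tc, S.FlowClose r (τ₁ + τ₂) 1 (q, p) (q₁ + τ₂ • p₁, p₁) hf b tc := by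
  have hμ : Tendsto (fun ε : Eps => nu r ε) smallEps (𝓝 0) := tendsto_nu
  obtain ⟨φ₁, φ₂, τ, E, E', hφ₁, hφ₂, hτ, hE, hflow, hbill⟩ :=
    h.exists_bounce hp hl₁ hq hw hY hq₁ hp₁ hl₂ hq₂
  refine ⟨fun ε => hamFlow (S.V ε) (τ₁ + τ₂), fun ε s ρ => bounceFlow (E' ε ρ).1 ρ (E' ε ρ).2 s,
    fun ε ρ _ => (E' ε ρ).1, ?_, ?_, ?_⟩
  · have hdur : CNear smallEps (fun ε => nu r ε) r (q, p) (τ₂, (q₁, p₁))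
        (fun ε ρ => (τ₁ + τ₂ - (E ε ρ).1, (E ε ρ).2)) fun ε ρ => (τ₁ + τ₂ - (E' ε ρ).1, (E' ε ρ).2) := by
      have := hE.map (u := fun z : ℝ × Phase d => (τ₁ + τ₂ - z.1, z.2)) (by fun_prop)
      simpa only [add_sub_cancel_left] using this
    refine (((cNear_leg (right_mem_Icc.2 hl₂.pos.le) hφ₂).comp hdur).congr_left ?_).congr_right ?_
    · filter_upwards [hflow, hdur.fst.tendsto_left.eventually_const_lt hl₂.pos] with w h1 h2
      exact (h1.2.2.2 _ (right_mem_Icc.2 (by linarith))).symm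
    · filter_upwards [hbill] with w h1
      rw [bounceFlow, if_neg h1.1.2.not_gt]
  · filter_upwards [hflow, hbill] with w h1 h2
    refine ⟨h1.2.1, h1.1, ?_, h2.2⟩
    rw [bounceFlow, if_pos h2.1.1, freeFlight_zero]
  · intro x₀ f g hfg
    have hA := (CNear.const (l := smallEps) (n := r) (a := fun _ : Eps => (0 : ℝ))
      (b := fun _ : Eps => (0 : ℝ)) x₀ (by simpa using isBigO_zero _ _) tendsto_const_nhds hμ).prodMk hfg
    have hB := hE.comp hfg
    have hT := hτ.comp hfg
    obtain ⟨C₁, O₁, hO₁, hI₁, hC₁⟩ := leg_closeAt hφ₁ hA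
    obtain ⟨C₂, O₂, hO₂, hI₂, hC₂⟩ := leg_closeAt hφ₂ hB
    obtain ⟨C₃, hC₃⟩ := hT.exists_norm_le (eventually_nu_nonneg r)
    obtain ⟨C₄, hC₄⟩ := hB.fst.exists_norm_le (eventually_nu_nonneg r)
    rw [zero_add] at hI₁
    -- C₁ and C₂ bound the two flights. C₃ and C₄ bound the distances, in units of ν, of arrival and
    -- departure from the auxiliary collision. The added 1 makes the last two comparisons strict, so
    -- a time outside the impact interval remains outside the reflection for all nearby initial
    -- conditions.
    refine ⟨|C₁| + |C₂| + |C₃| + |C₄| + 1, ?_⟩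
    set C := |C₁| + |C₂| + |C₃| + |C₄| + 1
    have hCle : C₁ ≤ C ∧ C₂ ≤ C ∧ C₃ < C ∧ C₄ < C := by
      have h1 := le_abs_self C₁
      have h2 := le_abs_self C₂
      have h3 := le_abs_self C₃
      have h4 := le_abs_self C₄
      refine ⟨?_, ?_, ?_, ?_⟩ <;>
        linarith [abs_nonneg C₁, abs_nonneg C₂, abs_nonneg C₃, abs_nonneg C₄]
    filter_upwards [hC₁, hC₂, hC₃, hC₄, (eventually_smallEps_mem r one_pos).prod_inl _,
      eventually_eventually_nhds_snd (hfg.tendsto_graph_left.eventually hflow),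
      hT.left.contDiffAt, hB.fst.left.contDiffAt, hB.fst.smooth.contDiffAt,
      eventually_Icc_subset hO₁ hl₁.pos.le hI₁ tendsto_const_nhds hB.fst.tendsto,
      eventually_Icc_subset hO₂ (by linarith [hl₂.pos]) hI₂ hB.fst.tendsto tendsto_const_nhds]
      with w c1 c2 c3 c4 hε hloc k1 k2 k3 s1 s2 s hs himp
    obtain ⟨ε, ρ⟩ := w
    dsimp only at c1 c2 c3 c4 hε hloc k1 k2 k3 s1 s2 himp ⊢
    have hν := nu_pos (r := r) hε.1
    have b1 : C₁ * nu r ε ≤ C * nu r ε := mul_le_mul_of_nonneg_right hCle.1 hν.le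
    have b2 : C₂ * nu r ε ≤ C * nu r ε := mul_le_mul_of_nonneg_right hCle.2.1 hν.le
    have b3 : C₃ * nu r ε < C * nu r ε := mul_lt_mul_of_pos_right hCle.2.2.1 hν
    have b4 : C₄ * nu r ε < C * nu r ε := mul_lt_mul_of_pos_right hCle.2.2.2 hν
    have hCν : 0 < C * nu r ε := lt_of_le_of_lt ((norm_nonneg _).trans c3) b3
    rw [Real.norm_eq_abs, abs_le] at c3 c4
    have hcase : s < (E' ε (g ε ρ)).1 - C * nu r ε ∨ (E' ε (g ε ρ)).1 + C * nu r ε < s := by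
      simp only [impact, mem_iUnion, mem_Icc, not_exists, not_and_or, not_le] at himp
      exact himp 0
    rcases hcase with hlt | hgt
    · have hsτ : s < τ ε (f ε ρ) := by linarith [c3.1]
      have hsE : s < (E' ε (g ε ρ)).1 := by linarith
      refine ((c1 s (s1 ⟨hs.1, hsE.le⟩)).mono b1).congr ?_ ?_
      · filter_upwards [hloc, k1.continuousAt.eventually (eventually_gt_nhds hsτ)] with y hy hy'
        simp only [sub_zero]
        exact hy.2.2.1 s ⟨hs.1, hy'.le⟩
      · filter_upwards [k3.continuousAt.eventually (eventually_gt_nhds hsE)] with y hy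
        simp only [sub_zero]
        rw [bounceFlow, if_pos hy]
    · have hsτ : (E ε (f ε ρ)).1 < s := by linarith [c4.2]
      have hsE : (E' ε (g ε ρ)).1 < s := by linarith
      refine ((c2 s (s2 ⟨hsE.le, hs.2⟩)).mono b2).congr ?_ ?_
      · filter_upwards [hloc, k2.continuousAt.eventually (eventually_lt_nhds hsτ)] with y hy hy'
        exact hy.2.2.2 s ⟨hy'.le, hs.2⟩
      · filter_upwards [k3.continuousAt.eventually (eventually_lt_nhds hsE)] with y hy
        rw [bounceFlow, if_neg hy.not_gt]

/-- Induction on the number of collisions, cutting at a time between the last two, or before the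
only one. The unit speed at the cut is part of the induction because the reflection estimate is made
at the energy 1/2. -/
theorem Hyp.exists_flowClose (h : S.Hyp r) {k : ℕ} {T : ℝ} (hT : 0 < T) {t : Fin k → ℝ}
    {x : ℝ → Phase d} (hx0 : ‖(x 0).2‖ = 1) (hx : IsRegularOrbit S.table T t x) :
    ‖(x T).2‖ = 1 ∧ ∃ hf b tc, S.FlowClose r T k (x 0) (x T) hf b tc := by
  induction k generalizing T with
  | zero =>
    have hfree : ∀ s ∈ Icc 0 T, x s = ((x 0).1 + s • (x 0).2, (x 0).2) := fun s hs => by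
      have := hx.free 0 s le_rfl hs.1 hs.2 fun j => j.elim0
      rwa [sub_zero] at this
    have hin : ∀ s ∈ Icc 0 T, (x 0).1 + s • (x 0).2 ∈ interior S.D := fun s hs => by
      have := hx.inside s hs fun j => j.elim0
      rwa [hfree s hs] at this
    have h0 : (x 0).1 ∈ interior S.D := by simpa using hin 0 ⟨le_rfl, hT.le⟩
    have h1 := hin T (right_mem_Icc.2 hT.le)
    rw [hfree T (right_mem_Icc.2 hT.le)]
    exact ⟨hx0, h.exists_flowClose_zero
      ⟨hT, fun s hs => hin s (Ioo_subset_Icc_self hs), Or.inl h0, Or.inl h1⟩ h0 h1⟩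
  | succ k ih =>
    obtain ⟨m, hm0, hm1, hm2⟩ := exists_between_collisions hx.times_mono hx.times_mem
    obtain ⟨hn, hf₁, b₁, tc₁, H₁⟩ := ih hm0 (hx.restrict hm2 hm1)
    set t₁ := t (Fin.last k)
    have ht₁T : t₁ < T := (hx.times_mem _).2
    have hne : ∀ s, m ≤ s → s ≠ t₁ → ∀ j, s ≠ t j := fun s hs hst j => by
      induction j using Fin.lastCases with
      | last => exact hst
      | cast j => exact ((hm2 j).trans_le hs).ne'
    have hnot : ∀ s s', m ≤ s → (t₁ ≤ s ∨ s' < t₁) → ∀ j, t j ∉ Ioc s s' := fun s s' hs hst j hj => by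
      induction j using Fin.lastCases with
      | last => exact hst.elim (fun h => (h.trans_lt hj.1).false) fun h => (hj.2.trans_lt h).false
      | cast j => linarith [hm2 j, hj.1]
    have hfree₁ : ∀ s ∈ Ico 0 (t₁ - m), x (m + s) = ((x m).1 + s • (x m).2, (x m).2) := fun s hs => by
      have := hx.free m (m + s) hm0.le (by linarith [hs.1]) (by linarith [hs.2])
        (hnot _ _ le_rfl (Or.inr (by linarith [hs.2])))
      rwa [add_sub_cancel_left] at this
    have hfree₂ : ∀ s ∈ Icc 0 (T - t₁), x (t₁ + s) = ((x t₁).1 + s • (x t₁).2, (x t₁).2) :=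
      fun s hs => by
        have := hx.free t₁ (t₁ + s) (by linarith) (by linarith [hs.1]) (by linarith [hs.2])
          (hnot _ _ hm1.le (Or.inl le_rfl))
        rwa [add_sub_cancel_left] at this
    have hin₁ : ∀ s ∈ Ico 0 (t₁ - m), (x m).1 + s • (x m).2 ∈ interior S.D := fun s hs => by
      have := hx.inside (m + s) ⟨by linarith [hs.1], by linarith [hs.2]⟩
        (hne _ (by linarith [hs.1]) (by linarith [hs.2]))
      rwa [hfree₁ s hs] at this
    have hin₂ : ∀ s ∈ Ioc 0 (T - t₁), (x t₁).1 + s • (x t₁).2 ∈ interior S.D := fun s hs => by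
      have := hx.inside (t₁ + s) ⟨by linarith [hs.1], by linarith [hs.2]⟩
        (hne _ (by linarith [hs.1]) (by linarith [hs.1]))
      rwa [hfree₂ s (Ioc_subset_Icc_self hs)] at this
    obtain ⟨e1, e2, e3, e4⟩ := hx.hit (Fin.last k) m hm0.le hm1 fun i hi =>
      hnot m (t i) le_rfl (Or.inr hi.2) i ⟨hi.1, le_rfl⟩
    have hw : (x t₁).1 ∈ frontier S.D \ S.corner := e2
    have hY : inner ℝ (gradient (S.Q 0) (x t₁).1) (x m).2 < 0 := by
      rw [inner_gradient]
      exact inner_normal_neg.1 e3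
    have hY' : 0 < inner ℝ (gradient (S.Q 0) (x t₁).1) (x t₁).2 := by
      rw [e4]
      have := h.fderiv_reflect (p := (x m).2) hw
      change 0 < inner ℝ (gradient (S.Q 0) (x t₁).1) (reflect (S.normal 0 (x t₁).1) (x m).2)
      linarith
    have hm : (x m).1 ∈ interior S.D := by simpa using hin₁ 0 ⟨le_rfl, by linarith⟩
    have hTT : T - t₁ ∈ Ioc 0 (T - t₁) := right_mem_Ioc.2 (by linarith)
    have hxT : x T = ((x t₁).1 + (T - t₁) • (x t₁).2, (x t₁).2) := by
      have := hfree₂ (T - t₁) (Ioc_subset_Icc_self hTT)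
      rwa [add_sub_cancel] at this
    have hl₁ : S.RefLeg (x m).1 (x m).2 (t₁ - m) :=
      ⟨by linarith, fun s hs => hin₁ s ⟨hs.1.le, hs.2⟩, Or.inl hm, Or.inr (by rw [← e1]; exact ⟨hw, hY⟩)⟩
    have hl₂ : S.RefLeg (x t₁).1 (x t₁).2 (T - t₁) :=
      ⟨by linarith, fun s hs => hin₂ s ⟨hs.1, hs.2.le⟩, Or.inr ⟨hw, hY'⟩, Or.inl (hin₂ _ hTT)⟩
    obtain ⟨hf₂, b₂, tc₂, H₂⟩ := h.exists_flowClose_one hn hl₁ hm (by rw [← e1]; exact hw)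
      (by rw [← e1]; exact hY) e1 e4 hl₂ (hin₂ _ hTT)
    rw [← hxT] at H₂
    have H := H₁.concat H₂ hm0 (by linarith)
    rw [show m + (t₁ - m + (T - t₁)) = T by ring] at H
    refine ⟨?_, _, _, _, H⟩
    rw [hxT]
    change ‖(x t₁).2‖ = 1
    rw [e4]
    exact (S.norm_reflect_normal 0 _ _).trans hn

end SteepSystem

/-- `O(ν)`-closeness in `C^r` of the smooth Hamiltonian flow `h` and of its Poincaré map `Φ` to the
flow `b` and the map `B` of the auxiliary billiard bounded by `Q(q; ε) = η(ε)`.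

First part: the size of `η`.  Second part: near an orbit of the original billiard with finitely
many collisions, all regular, on `[0, T]`; the impact intervals are the intervals of radius `C ν(ε)`
around the collision times `tc` of the auxiliary orbit.  Third part: near a regular flight of the
original billiard; `Φ ε` and `B ε` are `C^r` functions on an open set `U` of phase space which
coincide with the two maps on the part of the cross-section that lies in `U`. -/
theorem mainTheorem9 (d r : ℕ) (hr : 1 ≤ r) (S : SteepSystem d) (hD : S.IsDomain)
    (hQ : S.PatternCondition r) (hV : S.ConditionI r) (hW : S.GaussianBarrier)
    (hB : S.BoundaryDominated r) :
    (eta r =O[𝓝[>] (0 : ℝ)] fun ε => Real.sqrt (ε * |Real.log ε|)) ∧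
    (∀ (T : ℝ) (_ : 0 < T) (k : ℕ) (t : Fin k → ℝ) (x : ℝ → Phase d),
      ‖(x 0).2‖ = 1 → IsRegularOrbit S.table T t x →
      ∃ (U : Set (Phase d)) (C : ℝ) (h b : ℝ → ℝ → Phase d → Phase d)
        (tc : ℝ → Phase d → Fin k → ℝ),
        IsOpen U ∧ x 0 ∈ U ∧
        ∀ᶠ ε in 𝓝[>] (0 : ℝ), ∀ ρ ∈ U,
          h ε 0 ρ = ρ ∧ IsHamOrbit (S.V ε) T (fun s => h ε s ρ) ∧
          b ε 0 ρ = ρ ∧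
          IsRegularOrbit (S.auxTable ε (eta r ε)) T (tc ε ρ) (fun s => b ε s ρ) ∧
          ∀ s ∈ Set.Icc 0 T,
            s ∉ ⋃ j, Set.Icc (tc ε ρ j - C * nu r ε) (tc ε ρ j + C * nu r ε) →
            ContDiffAt ℝ r (h ε s) ρ ∧ ContDiffAt ℝ r (b ε s) ρ ∧
            ∀ l ≤ r, ‖iteratedFDeriv ℝ l (fun ρ' => h ε s ρ' - b ε s ρ') ρ‖ ≤ C * nu r ε) ∧
    (∀ ρ₀ ρ₁ : Phase d, ‖ρ₀.2‖ = 1 → IsBilliardImage S.table ρ₀ ρ₁ →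
      ∃ (U : Set (Phase d)) (C : ℝ) (Φ B : ℝ → Phase d → Phase d),
        IsOpen U ∧ ρ₀ ∈ U ∧
        ∀ᶠ ε in 𝓝[>] (0 : ℝ),
          (∀ ρ ∈ U ∩ crossSection (S.auxTable ε (eta r ε)),
            S.IsPoincareImage ε (eta r ε) ρ (Φ ε ρ) ∧
            IsBilliardImage (S.auxTable ε (eta r ε)) ρ (B ε ρ)) ∧
          ContDiffOn ℝ r (Φ ε) U ∧ ContDiffOn ℝ r (B ε) U ∧
          ∀ l ≤ r, ∀ ρ ∈ U,
            ‖iteratedFDeriv ℝ l (fun ρ' => Φ ε ρ' - B ε ρ') ρ‖ ≤ C * nu r ε) := by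
  have h : S.Hyp r := ⟨hr, hD, hQ, hV, hW, hB⟩
  refine ⟨eta_isBigO, fun T hT k t x hx0 hx => ?_, fun ρ₀ ρ₁ hp hρ => h.poincare_close hp hρ⟩
  obtain ⟨-, hf, b, tc, H⟩ := h.exists_flowClose hT hx0 hx
  -- The whole orbit is entered from one common initial point, so both maps of the pair are the
  -- identity.
  obtain ⟨C, hC⟩ := H.bound (x 0) _ _ (CNear.id (x 0) tendsto_nu)
  obtain ⟨δ, hδ, hball⟩ := exists_ball_of_eventually (hC.and H.orbit)
  refine ⟨Metric.ball (x 0) δ, C, hf, b, tc, Metric.isOpen_ball, Metric.mem_ball_self hδ, ?_⟩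
  have hball' : ∀ᶠ ε in 𝓝[>] (0 : ℝ), _ := hball
  filter_upwards [hball'] with ε hε ρ hρ
  obtain ⟨h1, h2, h3, h4, h5⟩ := hε ρ hρ
  exact ⟨h2, h3, h4, h5, fun s hs himp => h1 s hs himp⟩
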